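/- **Conventions.** Algorithms are programs for a random access machine with integer cells (all zero outside the input; arithmetic $+,-,\cdot$ and integer division), and time is measured by the logarithmic cost criterion. SETH is the statement: for every $\delta>0$ there is a $k$ such that no algorithm decides satisfiability of $k$-CNF formulas with $n$ variables and $m$ clauses in time $2^{(1-\delta)n}\cdot\mathrm{poly}(n+m)$. For $Q\in\mathbb R^{n\times d_q}$ with rows $Q_1,\dots,Q_n$, for $V\in\mathbb R^{n\times d_v}$ and for $C>0$, the $\ell_2$ (RBF-kernel) self-attention is $Y=h(S)\,V\in\mathbb R^{n\times d_v}$, where $S_{ij}=e^{-C\|Q_i-Q_j\|_2^2}$ and $h(M)=M$. Outputs are matrices $\hat Y$ of floating-point numbers $a\cdot 2^{b}$ with integers $a,b$ of any size. **Theorem.** Assume SETH. Let $C>0$ be any fixed real constant. Let $d_q=d_q(n)$ and $d_v=d_v(n)\ge 1$ be polynomially bounded and computable in time polynomial in $n$, and let $d_q=\omega(\log n)$. Let $\varepsilon>0$. Then no algorithm that is given $Q\in\mathbb R^{n\times d_q(n)}$ and $V\in\mathbb R^{n\times d_v(n)}$, for all $n\ge 1$, outputs within time $O(n^{2-\varepsilon})$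 a matrix $\hat Y\in\mathbb R^{n\times d_v(n)}$ that satisfies either of the following conditions: 1. (exact computation) $\hat Y=Y$. Moreover, no algorithm that is given in addition a precision $p\in\mathbb N$ outputs a $\hat Y$ with $|\hat Y_{ij}-Y_{ij}|\le 2^{-p}$ for all $i\in[n]$, $j\in[d_v]$ in time $O(n^{2-\varepsilon}\cdot\mathrm{poly}(p))$. 2. (multiplicative approximation) $|\hat Y_{ij}-Y_{ij}|\le\mu|Y_{ij}|$ for all $i\in[n]$, $j\in[d_v]$, where $\mu$ is any fixed constant with $0\le\mu<1$. This holds even if the algorithm only has to be correct and fast on those inputs in which the entries of $Q$ are integers of absolute value at most $n$ and the entries of $V$ are $0$ or $1$. -/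

import Mathlib

open Filter Asymptotics

/-! ## Machine model

A random access machine with integer cells, given by its programs in structured form. It has registers
`reg 0, reg 1, …` and memory segments `mem 0, mem 1, …`, each of which is an array of
integer cells with random access. (A program names finitely many registers and segments; programs with
jumps are simulated with constant overhead by one loop over a program counter.) Time is measured by
the logarithmic cost criterion: a step costs at least the bit lengths of the numbers it handles,
addresses included. All cells outside the input are initially `0`. -/

/-- A configuration of the memory: registers, and memory segments with random access. -/
structure RAMState where
  reg : ℕ → ℤ
  mem : ℕ → ℤ → ℤ

/-- The bit length of an integer. -/
def bitLen (z : ℤ) : ℕ := Nat.size z.natAbs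

/-- Arithmetic operations of the machine. -/
inductive ArithOp where
  | add
  | sub
  | mul
  | div

def ArithOp.eval : ArithOp → ℤ → ℤ → ℤ
  | .add, y, z => y + z
  | .sub, y, z => y - z
  | .mul, y, z => y * z
  | .div, y, z => y / z

/-- Logarithmic cost of an arithmetic operation (schoolbook cost for `mul` and `div`). -/
def ArithOp.cost : ArithOp → ℤ → ℤ → ℕ
  | .add, y, z => 1 + bitLen y + bitLen z
  | .sub, y, z => 1 + bitLen y + bitLen z
  | .mul, y, z => (1 + bitLen y) * (1 + bitLen z)
  | .div, y, z => (1 + bitLen y) * (1 + bitLen z)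

/-- Programs of the random access machine. -/
inductive Prog where
  /-- `reg x := c` -/
  | const (x : ℕ) (c : ℤ)
  /-- `reg x := reg y o reg z` -/
  | arith (o : ArithOp) (x y z : ℕ)
  /-- `reg x := mem a [reg i]` -/
  | load (x a i : ℕ)
  /-- `mem a [reg i] := reg x` -/
  | store (a i x : ℕ)
  /-- run `p`, then `q` -/
  | seq (p q : Prog)
  /-- if `reg x > 0` then run `p` else run `q` -/
  | ifPos (x : ℕ) (p q : Prog)
  /-- while `reg x > 0` run `p` -/
  | whilePos (x : ℕ) (p : Prog)

def RAMState.setReg (s : RAMState) (x : ℕ) (v : ℤ) : RAMState :=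
  { s with reg := Function.update s.reg x v }

def RAMState.setMem (s : RAMState) (a : ℕ) (i v : ℤ) : RAMState :=
  { s with mem := Function.update s.mem a (Function.update (s.mem a) i v) }

/-- `Prog.Exec p s t s'`: started in `s`, the program `p` halts in `s'` after time exactly `t`. -/
inductive Prog.Exec : Prog → RAMState → ℕ → RAMState → Prop
  | const (s : RAMState) (x : ℕ) (c : ℤ) :
      Prog.Exec (.const x c) s (1 + bitLen c) (s.setReg x c)
  | arith (s : RAMState) (o : ArithOp) (x y z : ℕ) :
      Prog.Exec (.arith o x y z) s (o.cost (s.reg y) (s.reg z))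
        (s.setReg x (o.eval (s.reg y) (s.reg z)))
  | load (s : RAMState) (x a i : ℕ) :
      Prog.Exec (.load x a i) s (1 + bitLen (s.reg i) + bitLen (s.mem a (s.reg i)))
        (s.setReg x (s.mem a (s.reg i)))
  | store (s : RAMState) (a i x : ℕ) :
      Prog.Exec (.store a i x) s (1 + bitLen (s.reg i) + bitLen (s.reg x))
        (s.setMem a (s.reg i) (s.reg x))
  | seq {p q : Prog} {s s' s'' : RAMState} {t t' : ℕ}
      (hp : Prog.Exec p s t s') (hq : Prog.Exec q s' t' s'') :
      Prog.Exec (.seq p q) s (t + t') s''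
  | if_true {x : ℕ} {p q : Prog} {s s' : RAMState} {t : ℕ}
      (hx : 0 < s.reg x) (hp : Prog.Exec p s t s') :
      Prog.Exec (.ifPos x p q) s (1 + bitLen (s.reg x) + t) s'
  | if_false {x : ℕ} {p q : Prog} {s s' : RAMState} {t : ℕ}
      (hx : ¬ 0 < s.reg x) (hq : Prog.Exec q s t s') :
      Prog.Exec (.ifPos x p q) s (1 + bitLen (s.reg x) + t) s'
  | while_true {x : ℕ} {p : Prog} {s s' s'' : RAMState} {t t' : ℕ}
      (hx : 0 < s.reg x) (hp : Prog.Exec p s t s') (hw : Prog.Exec (.whilePos x p) s' t' s'') :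
      Prog.Exec (.whilePos x p) s (1 + bitLen (s.reg x) + t + t') s''
  | while_false {x : ℕ} {p : Prog} {s : RAMState}
      (hx : ¬ 0 < s.reg x) :
      Prog.Exec (.whilePos x p) s (1 + bitLen (s.reg x)) s

/-- Initial register contents: the listed numbers, then zeros. -/
def initRegs (l : List ℤ) : ℕ → ℤ := fun r => l.getD r 0

/-- `f` is polynomially bounded, and `n ↦ f n` is computable in time polynomial in `n`. -/
def PolyTimeFun (f : ℕ → ℕ) : Prop :=
  ∃ (P : Prog) (K : ℕ), ∀ n : ℕ, f n ≤ K * (n + 1) ^ K ∧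
    ∃ (t : ℕ) (s : RAMState), P.Exec ⟨initRegs [(n : ℤ)], fun _ _ => 0⟩ t s ∧
      t ≤ K * (n + 1) ^ K ∧ s.reg 0 = (f n : ℤ)

/-! ## The Strong Exponential Time Hypothesis -/

/-- A CNF formula in the variables `0, …, n - 1` whose clauses have at most `k` literals. The literal
`(v, true)` is the variable `v`, and `(v, false)` is its negation. -/
structure KCNF (n k : ℕ) where
  clauses : List (List (Fin n × Bool))
  width_le : ∀ c ∈ clauses, c.length ≤ k

def KCNF.Satisfiable {n k : ℕ} (φ : KCNF n k) : Prop :=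
  ∃ a : Fin n → Bool, ∀ c ∈ φ.clauses, ∃ l ∈ c, a l.1 = l.2

/-- The literals `v` and `¬ v` are encoded by `v + 1` and `-(v + 1)`. -/
def litCode {n : ℕ} (l : Fin n × Bool) : ℤ :=
  if l.2 then (l.1 : ℤ) + 1 else -((l.1 : ℤ) + 1)

/-- The formula as an input: `reg 0 = n`, `reg 1` is the number of clauses, and the cell `k * j + l` of
`mem 0` holds the `l`-th literal of the `j`-th clause, or `0` if there is none. -/
def KCNF.input {n k : ℕ} (φ : KCNF n k) : RAMState where
  reg := initRegs [(n : ℤ), (φ.clauses.length : ℤ)]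
  mem := fun a z =>
    if a = 0 ∧ 0 ≤ z then
      ((φ.clauses.getD (z.toNat / k) []).map litCode).getD (z.toNat % k) 0
    else 0

/-- `P` decides satisfiability of `k`-CNF formulas with `n` variables and `m` clauses in time
`O(2 ^ ((1 - δ) n) · poly(n + m))`. -/
def SolvesKSAT (P : Prog) (k : ℕ) (δ : ℝ) : Prop :=
  ∃ K : ℕ, ∀ (n : ℕ) (φ : KCNF n k), ∃ (t : ℕ) (s : RAMState), P.Exec φ.input t s ∧
    (t : ℝ) ≤ K * ((n : ℝ) + φ.clauses.length + 1) ^ K * (2 : ℝ) ^ ((1 - δ) * (n : ℝ)) ∧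
    (φ.Satisfiable → s.reg 0 = 1) ∧ (¬ φ.Satisfiable → s.reg 0 = 0)

/-- The Strong Exponential Time Hypothesis: for every `δ > 0` there is a `k` such that `k`-SAT cannot
be solved in time `O(2 ^ ((1 - δ) n))`, up to polynomial factors. -/
def SETH : Prop :=
  ∀ δ : ℝ, 0 < δ → ∃ k : ℕ, ¬ ∃ P : Prog, SolvesKSAT P k δ

/-! ## Self-attention -/

/-- Generalized self-attention `h(S) V`, with score matrix `S i j = f (Q i) (K j)`. -/
noncomputable def attention {n d dv : ℕ} (f : (Fin d → ℝ) → (Fin d → ℝ) → ℝ)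
    (h : Matrix (Fin n) (Fin n) ℝ → Matrix (Fin n) (Fin n) ℝ)
    (Q K : Matrix (Fin n) (Fin d) ℝ) (V : Matrix (Fin n) (Fin dv) ℝ) :
    Matrix (Fin n) (Fin dv) ℝ :=
  h (Matrix.of fun i j => f (Q i) (K j)) * V

/-- The RBF kernel `exp (-C ‖x - y‖₂²)`. -/
noncomputable def rbfKernel {d : ℕ} (C : ℝ) (x y : Fin d → ℝ) : ℝ :=
  Real.exp (-C * ‖WithLp.toLp 2 x - WithLp.toLp 2 y‖ ^ 2)

/-- `ℓ₂`-self-attention: RBF scores of the rows of `Q`, and `h` the identity. -/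
noncomputable def rbfSelfAttention {n d dv : ℕ} (C : ℝ)
    (Q : Matrix (Fin n) (Fin d) ℝ) (V : Matrix (Fin n) (Fin dv) ℝ) :
    Matrix (Fin n) (Fin dv) ℝ :=
  attention (rbfKernel C) id Q Q V

/-- An integer matrix stored row by row: the cell `i * d + j` holds the entry `(i, j)`, and all other
cells hold `0`. -/
def rowMajor {n d : ℕ} (M : Matrix (Fin n) (Fin d) ℤ) : ℤ → ℤ := fun z =>
  ∑ i : Fin n, ∑ j : Fin d, if z = (i : ℤ) * d + j then M i j else 0

/-- The input of an attention algorithm: `reg 0, reg 1, reg 2` hold `n`, `d_q`, `d_v`, `reg 3` holds a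
precision parameter `p`, `mem 0` holds `Q` and `mem 1` holds `V`. -/
def attentionInput {n d dv : ℕ} (Q : Matrix (Fin n) (Fin d) ℤ) (V : Matrix (Fin n) (Fin dv) ℤ)
    (p : ℕ) : RAMState where
  reg := initRegs [(n : ℤ), (d : ℤ), (dv : ℤ), (p : ℤ)]
  mem := fun a => if a = 0 then rowMajor Q else if a = 1 then rowMajor V else fun _ => 0

/-- The real number that a final state represents at the entry `(i, l)` of the `n × dv` output matrix,
in floating-point form: mantissa (any integer) in `mem 0`, binary exponent (any integer) in `mem 1`. -/
noncomputable def outputEntry (s : RAMState) (dv i l : ℕ) : ℝ :=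
  (s.mem 0 ((i : ℤ) * dv + l) : ℝ) * (2 : ℝ) ^ (s.mem 1 ((i : ℤ) * dv + l))

/-- With `Y` the `ℓ₂`-self-attention of `Q` and `V`, the program `P` with parameter `p` outputs in time
at most `T n` a matrix whose every entry `y'` satisfies `ok y y'` against the corresponding entry `y`
of `Y`. Only the following inputs have to be served (which makes the task of `P` easier): `n ≥ 1`,
dimensions exactly `d n` and `dv n`, integer entries of `Q` of absolute value at most `n`, and entries
`0` and `1` of `V`. -/
def SolvesAttention (P : Prog) (C : ℝ) (d dv : ℕ → ℕ) (p : ℕ) (T : ℕ → ℝ)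
    (ok : ℝ → ℝ → Prop) : Prop :=
  ∀ n : ℕ, 1 ≤ n →
    ∀ (Q : Matrix (Fin n) (Fin (d n)) ℤ) (V : Matrix (Fin n) (Fin (dv n)) ℤ),
      (∀ i j, |Q i j| ≤ (n : ℤ)) → (∀ i l, V i l = 0 ∨ V i l = 1) →
      ∃ (t : ℕ) (s : RAMState), P.Exec (attentionInput Q V p) t s ∧ (t : ℝ) ≤ T n ∧
        ∀ (i : Fin n) (l : Fin (dv n)),
          ok (rbfSelfAttention C (Q.map (Int.cast : ℤ → ℝ)) (V.map (Int.cast : ℤ → ℝ)) i l)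
            (outputEntry s (dv n) i l)

/-! ## Bit lengths -/

/-! Satisfiability of a k-CNF formula in n variables is reduced to attention on N = c₀ · 2^g rows
with g = ⌊n/q⌋, by guessing, splitting and listing. The values of all but 2g variables are guessed
(the outer assignment), and for each half of the remaining ones all 2^g partial assignments are
listed. A left row has the entry 2B in the column of a clause that it leaves violated and 0
otherwise; a right row has -B or B in these cases. For J clauses the squared distance of a left and
a right row is B²(J + 8v), where v counts the clauses violated on both sides (`Gadget.sum_sq_left`).
A reference row has distance B²(J + 4) to every right row (`Gadget.sum_sq_ref`). If B is a suitable
multiple of g + 1, the factor exp(4CB²) dominates the number 2^g of summands, so the output of a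
left row lies far above the reference output if some right row completes it to a satisfying
assignment, and far below it if not. The gap survives a relative error μ < 1 together with an
absolute error 2^(-p), with p polynomial in n (`Gadget.decides`). Hence one lower bound,
`not_solvesAttention`, yields all claims.

The rows have only d_q = ω(log N) = ω(g) columns, so the formula must first have O(n) clauses. This
is achieved by sparsification. While many minimal clauses share a nonempty part, the heart, the
process branches: either the heart is satisfied and is added as a clause, or all the petals are and
they are added. With thresholds θ i = A · β i only O(n) sets are ever added, and few steps choose
the petals (`Sparsify.Inv.card_add_le`, `Sparsify.Inv.mul_ones_le`). A satisfying assignment thus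
selects a path whose choice bits form a string of length O(n) with few ones, and arithmetic coding
gives it a code of n/(q q') + O(1) bits (`Sparsify.exists_code`, `Sparsify.exists_params`). An
iteration r consists of a code and an outer assignment, and φ is satisfiable if and only if some
iteration succeeds (`Setup.satisfiable_iff`).

Up to polynomial factors each iteration takes time 2^(g(2 - ε/2)), and there are about 2^(n/(qq') +
n - 2g) of them. With q' ≥ 4/ε the product is at most 2^((1 - ε/(4q)) n), against SETH
(`Setup.rounds_mul_le`). Since q is fixed before k, the saving does not depend on k.

The reduction has to be a program of the machine, which raises three points. First, every call needs
zeroed memory. Calls are relocated to distinct residue classes of addresses, so nothing is ever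
cleared (`Prog.Exec.relocate`). Second, the output numbers may be long. By a potential argument,
time t produces only O(b + √t) bits from b bits (`Prog.Exec.bitsLE`), so reading 2^g outputs stays
below the quadratic barrier. Third, exponents of floating-point outputs may be too large to expand.
Comparisons therefore use bit lengths and differences of exponents only (`Setup.Witness.good_iff`).
-/

theorem bitLen_le_iff {z : ℤ} {b : ℕ} : bitLen z ≤ b ↔ z.natAbs < 2 ^ b := Nat.size_le

theorem natAbs_lt_two_pow_bitLen (z : ℤ) : z.natAbs < 2 ^ bitLen z := bitLen_le_iff.1 le_rfl

@[simp] theorem bitLen_zero : bitLen 0 = 0 := by simp [bitLen]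

@[simp] theorem bitLen_one : bitLen 1 = 1 := by simp [bitLen]

theorem bitLen_mono {y z : ℤ} (h : y.natAbs ≤ z.natAbs) : bitLen y ≤ bitLen z :=
  Nat.size_le_size h

theorem bitLen_le_natAbs (z : ℤ) : bitLen z ≤ z.natAbs :=
  bitLen_le_iff.2 Nat.lt_two_pow_self

@[simp] theorem bitLen_neg (z : ℤ) : bitLen (-z) = bitLen z := by simp [bitLen]

theorem bitLen_two_pow (k : ℕ) : bitLen (2 ^ k) = k + 1 := by
  have : ((2 : ℤ) ^ k).natAbs = 2 ^ k := by simp [Int.natAbs_pow]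
  rw [bitLen, this, Nat.size_pow]

theorem bitLen_add_le (y z : ℤ) : bitLen (y + z) ≤ max (bitLen y) (bitLen z) + 1 := by
  rw [bitLen_le_iff]
  have h1 := natAbs_lt_two_pow_bitLen y
  have h2 := natAbs_lt_two_pow_bitLen z
  have h3 : 2 ^ bitLen y ≤ 2 ^ max (bitLen y) (bitLen z) :=
    Nat.pow_le_pow_right (by norm_num) (le_max_left _ _)
  have h4 : 2 ^ bitLen z ≤ 2 ^ max (bitLen y) (bitLen z) :=
    Nat.pow_le_pow_right (by norm_num) (le_max_right _ _)
  have := Int.natAbs_add_le y z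
  rw [pow_succ]
  omega

theorem bitLen_sub_le (y z : ℤ) : bitLen (y - z) ≤ max (bitLen y) (bitLen z) + 1 := by
  have := bitLen_add_le y (-z)
  rwa [bitLen_neg, ← sub_eq_add_neg] at this

theorem bitLen_mul_le (y z : ℤ) : bitLen (y * z) ≤ bitLen y + bitLen z := by
  rw [bitLen_le_iff, Int.natAbs_mul, pow_add]
  exact Nat.mul_lt_mul'' (natAbs_lt_two_pow_bitLen y) (natAbs_lt_two_pow_bitLen z)

theorem bitLen_div_le (y z : ℤ) : bitLen (y / z) ≤ bitLen y :=
  bitLen_mono (Int.natAbs_ediv_le_natAbs y z)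

theorem bitLen_sum_range_le {f : ℕ → ℤ} {N b : ℕ} (h : ∀ i < N, bitLen (f i) ≤ b) :
    bitLen (∑ i ∈ Finset.range N, f i) ≤ bitLen N + b := by
  rw [bitLen_le_iff]
  have h1 : (∑ i ∈ Finset.range N, f i).natAbs ≤ N * (2 ^ b) := by
    have h2 : (∑ i ∈ Finset.range N, f i).natAbs ≤ ∑ i ∈ Finset.range N, (f i).natAbs :=
      Finset.induction_on (Finset.range N) (by simp) fun a s ha ih => by
        rw [Finset.sum_insert ha, Finset.sum_insert ha]
        exact (Int.natAbs_add_le _ _).trans (by omega)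
    refine h2.trans ((Finset.sum_le_card_nsmul _ _ (2 ^ b) fun i hi => ?_).trans (by simp))
    exact (bitLen_le_iff.1 (h i (Finset.mem_range.1 hi))).le
  have h3 : N < 2 ^ bitLen (N : ℤ) := by simpa using natAbs_lt_two_pow_bitLen (N : ℤ)
  rw [pow_add]
  exact h1.trans_lt (Nat.mul_lt_mul_of_pos_right h3 (by positivity))

theorem ArithOp.bitLen_eval_le (o : ArithOp) (y z : ℤ) :
    bitLen (o.eval y z) ≤ bitLen y + bitLen z + 1 := by
  cases o
  · have := bitLen_add_le y z; simp only [ArithOp.eval]; omega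
  · have := bitLen_sub_le y z; simp only [ArithOp.eval]; omega
  · have := bitLen_mul_le y z; simp only [ArithOp.eval]; omega
  · have := bitLen_div_le y z; simp only [ArithOp.eval]; omega

theorem ArithOp.cost_le (o : ArithOp) (y z : ℤ) :
    o.cost y z ≤ (1 + bitLen y) * (1 + bitLen z) := by
  cases o <;> simp only [ArithOp.cost] <;> nlinarith [Nat.zero_le (bitLen y * bitLen z)]

/-! ## Polynomially bounded quantities -/

/-- `f` is bounded by a polynomial in `z`. -/
def PolyBdd {ι : Type*} (z f : ι → ℕ) : Prop := ∃ c : ℕ, ∀ i, f i ≤ c * (z i + 1) ^ c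

namespace PolyBdd

variable {ι : Type*} {z f g : ι → ℕ}

theorem const_mul_pow_mono (x : ℕ) {c d : ℕ} (h : c ≤ d) :
    c * (x + 1) ^ c ≤ d * (x + 1) ^ d :=
  Nat.mul_le_mul h (Nat.pow_le_pow_right (by omega) h)

theorem mono (hg : PolyBdd z g) (h : ∀ i, f i ≤ g i) : PolyBdd z f := by
  obtain ⟨c, hc⟩ := hg
  exact ⟨c, fun i => (h i).trans (hc i)⟩

theorem const (a : ℕ) : PolyBdd z fun _ => a :=
  ⟨a, fun i => Nat.le_mul_of_pos_right _ (by positivity)⟩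

theorem self : PolyBdd z z := ⟨1, fun i => by simp⟩

theorem add (hf : PolyBdd z f) (hg : PolyBdd z g) : PolyBdd z fun i => f i + g i := by
  obtain ⟨c, hc⟩ := hf
  obtain ⟨d, hd⟩ := hg
  refine ⟨c + d, fun i => (Nat.add_le_add (hc i) (hd i)).trans ?_⟩
  rw [add_mul]
  exact Nat.add_le_add (Nat.mul_le_mul_left _ (Nat.pow_le_pow_right (by omega) (by omega)))
    (Nat.mul_le_mul_left _ (Nat.pow_le_pow_right (by omega) (by omega)))

theorem mul (hf : PolyBdd z f) (hg : PolyBdd z g) : PolyBdd z fun i => f i * g i := by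
  obtain ⟨c, hc⟩ := hf
  obtain ⟨d, hd⟩ := hg
  refine ⟨c * d + c + d, fun i => (Nat.mul_le_mul (hc i) (hd i)).trans ?_⟩
  calc c * (z i + 1) ^ c * (d * (z i + 1) ^ d) = c * d * (z i + 1) ^ (c + d) := by ring
    _ ≤ _ := Nat.mul_le_mul (by omega) (Nat.pow_le_pow_right (by omega) (by omega))

theorem pow (hf : PolyBdd z f) (k : ℕ) : PolyBdd z fun i => f i ^ k := by
  induction k with
  | zero => simpa using const 1
  | succ k ih => simpa only [pow_succ] using ih.mul hf

theorem const_mul (c : ℕ) (hf : PolyBdd z f) : PolyBdd z fun i => c * f i := (const c).mul hf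

theorem comp {κ : Type*} (hf : PolyBdd z f) (e : κ → ι) :
    PolyBdd (fun k => z (e k)) fun k => f (e k) := by
  obtain ⟨c, hc⟩ := hf
  exact ⟨c, fun k => hc _⟩

end PolyBdd

/-! ## Executions -/

/-- Started in `s`, the program `p` halts within time `T` in a state that satisfies `Q`. -/
def RunsTo (p : Prog) (s : RAMState) (T : ℕ) (Q : RAMState → Prop) : Prop :=
  ∃ (t : ℕ) (s' : RAMState), p.Exec s t s' ∧ t ≤ T ∧ Q s'

namespace RunsTo

variable {p q : Prog} {s : RAMState} {T T₁ T₂ : ℕ} {Q R : RAMState → Prop}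

theorem mono (h : RunsTo p s T Q) (hT : T ≤ T₁) (hQ : ∀ s', Q s' → R s') : RunsTo p s T₁ R := by
  obtain ⟨t, s', h1, h2, h3⟩ := h
  exact ⟨t, s', h1, h2.trans hT, hQ _ h3⟩

theorem le (h : RunsTo p s T Q) (hT : T ≤ T₁) : RunsTo p s T₁ Q := h.mono hT fun _ h => h

theorem seq (hp : RunsTo p s T₁ Q) (hq : ∀ s', Q s' → RunsTo q s' T₂ R) :
    RunsTo (.seq p q) s (T₁ + T₂) R := by
  obtain ⟨t, s', h1, h2, h3⟩ := hp
  obtain ⟨t', s'', h4, h5, h6⟩ := hq _ h3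
  exact ⟨_, _, .seq h1 h4, by omega, h6⟩

theorem step {s₁ : RAMState} {t : ℕ} (hp : p.Exec s t s₁) (hq : RunsTo q s₁ T R) :
    RunsTo (.seq p q) s (t + T) R := by
  obtain ⟨t', s'', h4, h5, h6⟩ := hq
  exact ⟨_, _, .seq hp h4, by omega, h6⟩

theorem const (x : ℕ) (c : ℤ) (hQ : Q (s.setReg x c)) : RunsTo (.const x c) s (1 + bitLen c) Q :=
  ⟨_, _, .const _ _ _, le_rfl, hQ⟩

theorem arith (o : ArithOp) (x y z : ℕ) (hQ : Q (s.setReg x (o.eval (s.reg y) (s.reg z)))) :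
    RunsTo (.arith o x y z) s (o.cost (s.reg y) (s.reg z)) Q :=
  ⟨_, _, .arith _ _ _ _ _, le_rfl, hQ⟩

theorem load (x a i : ℕ) (hQ : Q (s.setReg x (s.mem a (s.reg i)))) :
    RunsTo (.load x a i) s (1 + bitLen (s.reg i) + bitLen (s.mem a (s.reg i))) Q :=
  ⟨_, _, .load _ _ _ _, le_rfl, hQ⟩

theorem store (a i x : ℕ) (hQ : Q (s.setMem a (s.reg i) (s.reg x))) :
    RunsTo (.store a i x) s (1 + bitLen (s.reg i) + bitLen (s.reg x)) Q :=
  ⟨_, _, .store _ _ _ _, le_rfl, hQ⟩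

theorem ifPos {x : ℕ} (hp : 0 < s.reg x → RunsTo p s T Q) (hq : ¬ 0 < s.reg x → RunsTo q s T Q) :
    RunsTo (.ifPos x p q) s (1 + bitLen (s.reg x) + T) Q := by
  by_cases hx : 0 < s.reg x
  · obtain ⟨t, s', h1, h2, h3⟩ := hp hx
    exact ⟨_, _, .if_true hx h1, by omega, h3⟩
  · obtain ⟨t, s', h1, h2, h3⟩ := hq hx
    exact ⟨_, _, .if_false hx h1, by omega, h3⟩

/-- A loop that runs exactly `N` times. -/
theorem whilePos {x N c : ℕ} (I : ℕ → RAMState → Prop)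
    (hpos : ∀ j < N, ∀ s, I j s → 0 < s.reg x ∧ bitLen (s.reg x) ≤ c)
    (hstep : ∀ j < N, ∀ s, I j s → RunsTo p s T (I (j + 1)))
    (hend : ∀ s, I N s → ¬ 0 < s.reg x ∧ bitLen (s.reg x) ≤ c) (h0 : I 0 s) :
    RunsTo (.whilePos x p) s (N * (T + c + 1) + c + 1) (I N) := by
  have key : ∀ k j, j + k = N → ∀ s, I j s →
      RunsTo (.whilePos x p) s (k * (T + c + 1) + c + 1) (I N) := by
    intro k
    induction k with
    | zero =>
      intro j hj s hs
      obtain rfl : j = N := by omega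
      exact ⟨_, _, .while_false (hend s hs).1, by have := (hend s hs).2; omega, hs⟩
    | succ k ih =>
      intro j hj s hs
      obtain ⟨t, s', h1, h2, h3⟩ := hstep j (by omega) s hs
      obtain ⟨t', s'', h4, h5, h6⟩ := ih (j + 1) (by omega) s' h3
      have := hpos j (by omega) s hs
      refine ⟨_, _, .while_true this.1 h1 h4, ?_, h6⟩
      rw [Nat.succ_mul]
      omega
  exact key N 0 (by omega) s h0

end RunsTo

/-! ## Expressions with bounded sums -/

/-- Integer expressions over registers and memory segments. The expression `sum x b e` is the sum of
`e` over all values `0 ≤ reg x < reg b`. -/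
inductive Expr where
  | var (r : ℕ)
  | lit (c : ℤ)
  | op (o : ArithOp) (a b : Expr)
  | get (seg : ℕ) (a : Expr)
  | ite (c a b : Expr)
  | sum (x b : ℕ) (e : Expr)

namespace Expr

def eval : Expr → (ℕ → ℤ) → (ℕ → ℤ → ℤ) → ℤ
  | var r, ρ, _ => ρ r
  | lit c, _, _ => c
  | op o a b, ρ, μ => o.eval (a.eval ρ μ) (b.eval ρ μ)
  | get seg a, ρ, μ => μ seg (a.eval ρ μ)
  | ite c a b, ρ, μ => if 0 < c.eval ρ μ then a.eval ρ μ else b.eval ρ μ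
  | sum x b e, ρ, μ => ∑ i ∈ Finset.range (ρ b).toNat, e.eval (Function.update ρ x (i : ℤ)) μ

/-- Registers `< 16` serve as bounds of sums, registers `< 64` as variables, segments `< 8` can be
read. -/
def WF : Expr → Prop
  | var r => r < 64
  | lit _ => True
  | op _ a b => a.WF ∧ b.WF
  | get seg a => seg < 8 ∧ a.WF
  | ite c a b => c.WF ∧ a.WF ∧ b.WF
  | sum x b e => 16 ≤ x ∧ x < 64 ∧ b < 16 ∧ e.WF

/-- The program that computes the value of an expression in register `dst`. -/
def compile : Expr → ℕ → Prog
  | var r, dst => .seq (.const dst 0) (.arith .add dst r dst)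
  | lit c, dst => .const dst c
  | op o a b, dst => .seq (a.compile dst) (.seq (b.compile (dst + 1)) (.arith o dst dst (dst + 1)))
  | get seg a, dst => .seq (a.compile dst) (.load dst seg dst)
  | ite c a b, dst => .seq (c.compile dst) (.ifPos dst (a.compile dst) (b.compile dst))
  | sum x b e, dst =>
    .seq (.const dst 0) <| .seq (.const (dst + 1) 0) <| .seq (.arith .add (dst + 1) x (dst + 1)) <|
    .seq (.const x 0) <| .seq (.arith .sub (dst + 2) b x) <|
    .seq (.whilePos (dst + 2) <|
      .seq (e.compile (dst + 3)) <| .seq (.arith .add dst dst (dst + 3)) <|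
      .seq (.const (dst + 3) 1) <| .seq (.arith .add x x (dst + 3)) <|
      .arith .sub (dst + 2) b x) <|
    .seq (.const (dst + 2) 0) (.arith .add x (dst + 1) (dst + 2))

/-- All values that an expression can access directly have at most `M` bits, and sums have at most `B`
terms. -/
structure Small (ρ : ℕ → ℤ) (μ : ℕ → ℤ → ℤ) (M B : ℕ) : Prop where
  reg : ∀ x < 64, bitLen (ρ x) ≤ M
  bound : ∀ b < 16, ρ b ≤ B
  mem : ∀ a < 8, ∀ z, bitLen (μ a z) ≤ M
  bits : bitLen (B : ℤ) ≤ M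

/-- For a fixed expression this is linear in `M`. A sum gains `M` bits because the number of its
terms has at most `M` bits. -/
def bits (M : ℕ) : Expr → ℕ
  | var _ => M
  | lit c => bitLen c
  | op _ a b => a.bits M + b.bits M + 1
  | get _ _ => M
  | ite _ a b => a.bits M + b.bits M
  | sum _ _ e => M + e.bits M

/-- The constants leave slack for the bookkeeping instructions of the loop that a sum compiles to.
Each nested sum contributes a factor `B + 1`, so for a fixed expression the time is polynomial in
`M` and `B`. -/
def time (M B : ℕ) : Expr → ℕ
  | var _ => 2 + M
  | lit c => 1 + bitLen c
  | op _ a b => a.time M B + b.time M B + (1 + a.bits M) * (1 + b.bits M)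
  | get _ a => a.time M B + 1 + a.bits M + M
  | ite c a b => c.time M B + 1 + c.bits M + a.time M B + b.time M B
  | sum _ _ e => (B + 1) * (e.time M B + 2 * e.bits M + 6 * M + 10) + 10 + 6 * M

theorem bits_polyBdd (e : Expr) {ι : Type*} {z M : ι → ℕ} (hM : PolyBdd z M) :
    PolyBdd z fun i => e.bits (M i) := by
  induction e with
  | var | get => exact hM
  | lit => exact .const _
  | op _ _ _ ha hb => exact (ha.add hb).add (.const 1)
  | ite _ _ _ _ ha hb => exact ha.add hb
  | sum _ _ _ ih => exact hM.add ih

theorem time_polyBdd (e : Expr) {ι : Type*} {z M B : ι → ℕ} (hM : PolyBdd z M)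
    (hB : PolyBdd z B) : PolyBdd z fun i => e.time (M i) (B i) := by
  induction e with
  | var => exact (PolyBdd.const 2).add hM
  | lit => exact .const _
  | op _ a b ha hb =>
    exact (ha.add hb).add (((PolyBdd.const 1).add (a.bits_polyBdd hM)).mul
      ((PolyBdd.const 1).add (b.bits_polyBdd hM)))
  | get _ a ha => exact ((ha.add (.const 1)).add (a.bits_polyBdd hM)).add hM
  | ite c _ _ hc ha hb => exact (((hc.add (.const 1)).add (c.bits_polyBdd hM)).add ha).add hb
  | sum _ _ e ih =>
    exact (((hB.add (.const 1)).mul (((ih.add ((PolyBdd.const 2).mul (e.bits_polyBdd hM))).add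
      ((PolyBdd.const 6).mul hM)).add (.const 10))).add (.const 10)).add ((PolyBdd.const 6).mul hM)

theorem Small.update {ρ : ℕ → ℤ} {μ : ℕ → ℤ → ℤ} {M B : ℕ} (h : Small ρ μ M B) {x : ℕ}
    (hx : 16 ≤ x) {v : ℤ} (hv : bitLen v ≤ M) : Small (Function.update ρ x v) μ M B where
  reg y hy := by
    by_cases hyx : y = x
    · subst hyx; simpa using hv
    · simpa [hyx] using h.reg y hy
  bound b hb := by
    rw [Function.update_of_ne (by omega)]
    exact h.bound b hb
  mem := h.mem
  bits := h.bits

theorem Small.congr {ρ ρ' : ℕ → ℤ} {μ : ℕ → ℤ → ℤ} {M B : ℕ} (h : Small ρ μ M B)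
    (hρ : ∀ x < 64, ρ' x = ρ x) : Small ρ' μ M B where
  reg y hy := by rw [hρ y hy]; exact h.reg y hy
  bound b hb := by rw [hρ b (by omega)]; exact h.bound b hb
  mem := h.mem
  bits := h.bits

theorem Small.bitLen_index {ρ : ℕ → ℤ} {μ : ℕ → ℤ → ℤ} {M B : ℕ} (h : Small ρ μ M B) {b i : ℕ}
    (hb : b < 16) (hi : i ≤ (ρ b).toNat) : bitLen (i : ℤ) ≤ M := by
  have := h.bound b hb
  exact (bitLen_mono (by simp; omega)).trans h.bits

theorem eval_congr (e : Expr) (he : e.WF) {ρ ρ' : ℕ → ℤ} (μ : ℕ → ℤ → ℤ)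
    (h : ∀ x < 64, ρ x = ρ' x) : e.eval ρ μ = e.eval ρ' μ := by
  induction e generalizing ρ ρ' with
  | var r => exact h r he
  | lit => rfl
  | op o a b iha ihb => simp only [eval, iha he.1 h, ihb he.2 h]
  | get seg a iha => simp only [eval, iha he.2 h]
  | ite c a b ihc iha ihb => simp only [eval, ihc he.1 h, iha he.2.1 h, ihb he.2.2 h]
  | sum x b e ih =>
    simp only [eval, h b (by have := he.2.2.1; omega)]
    refine Finset.sum_congr rfl fun i _ => ih he.2.2.2 fun y hy => ?_
    by_cases hyx : y = x
    · subst hyx; simp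
    · simp [hyx, h y hy]

theorem bitLen_eval_le (e : Expr) (he : e.WF) {ρ : ℕ → ℤ} {μ : ℕ → ℤ → ℤ} {M B : ℕ}
    (h : Small ρ μ M B) : bitLen (e.eval ρ μ) ≤ e.bits M := by
  induction e generalizing ρ with
  | var r => exact h.reg r he
  | lit => exact le_rfl
  | op o a b iha ihb =>
    have := o.bitLen_eval_le (a.eval ρ μ) (b.eval ρ μ)
    have := iha he.1 h
    have := ihb he.2 h
    simp only [eval, bits]
    omega
  | get seg a iha => exact h.mem _ he.1 _
  | ite c a b ihc iha ihb =>
    have := iha he.2.1 h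
    have := ihb he.2.2 h
    simp only [eval, bits]
    split_ifs <;> omega
  | sum x b e ih =>
    refine (bitLen_sum_range_le fun i hi => ih he.2.2.2
      (h.update he.1 (h.bitLen_index he.2.2.1 hi.le))).trans ?_
    exact Nat.add_le_add_right (h.bitLen_index he.2.2.1 le_rfl) _

end Expr

/-! ### Compiled expressions: correctness and running time -/

@[simp] theorem RAMState.setReg_reg (s : RAMState) (x : ℕ) (v : ℤ) (y : ℕ) :
    (s.setReg x v).reg y = if y = x then v else s.reg y := by
  simp [RAMState.setReg, Function.update_apply]

@[simp] theorem RAMState.setReg_mem (s : RAMState) (x : ℕ) (v : ℤ) :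
    (s.setReg x v).mem = s.mem := rfl

@[simp] theorem RAMState.setMem_reg (s : RAMState) (a : ℕ) (i v : ℤ) :
    (s.setMem a i v).reg = s.reg := rfl

@[simp] theorem RAMState.setMem_mem (s : RAMState) (a : ℕ) (i v : ℤ) :
    (s.setMem a i v).mem = Function.update s.mem a (Function.update (s.mem a) i v) := rfl

theorem bitLen_sub_natCast_le {N j b : ℕ} (hN : bitLen (N : ℤ) ≤ b) (hj : j ≤ N) :
    bitLen ((N : ℤ) - j) ≤ b :=
  (bitLen_mono (by omega)).trans hN

theorem bitLen_natCast_mono {i j : ℕ} (h : i ≤ j) : bitLen (i : ℤ) ≤ bitLen (j : ℤ) :=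
  bitLen_mono (by simpa using h)

/-- Induction on the expression with a stack discipline: code compiled for `dst` leaves its result
in `dst` and keeps its temporaries above. A sum does use its variable `x < 64` as a loop counter,
but saves the old content in `dst + 1` and restores it at the end, so that all registers below `dst`
are unchanged. -/
theorem Expr.runsTo_compile (e : Expr) (he : e.WF) {dst : ℕ} (hdst : 64 ≤ dst) {s : RAMState}
    {M B : ℕ} (h : Expr.Small s.reg s.mem M B) :
    RunsTo (e.compile dst) s (e.time M B) fun s' =>
      s'.mem = s.mem ∧ s'.reg dst = e.eval s.reg s.mem ∧ ∀ x < dst, s'.reg x = s.reg x := by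
  induction e generalizing dst s with
  | var r =>
    have hr : r < 64 := he
    refine (RunsTo.seq (.const _ _ rfl) fun s' hs' => ?_).le (T := 1 + bitLen 0 + (1 + M + 0))
      (by simp [time]; omega)
    subst hs'
    refine (RunsTo.arith _ _ _ _ ?_).le ?_
    · simp +contextual [ArithOp.eval, eval, show r ≠ dst by omega, Nat.ne_of_lt]
    · have := h.reg r hr
      simp [ArithOp.cost, show r ≠ dst by omega, this]
  | lit c =>
    exact RunsTo.const _ _ (by simp +contextual [eval, Nat.ne_of_lt])
  | op o a b iha ihb =>
    refine (RunsTo.seq (iha he.1 hdst h) fun s₁ h₁ => RunsTo.seq (ihb he.2 (by omega)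
      (s := s₁) (by rw [h₁.1]; exact h.congr fun x hx => h₁.2.2 x (by omega))) fun s₂ h₂ =>
      ((RunsTo.arith _ _ _ _ ?_).mono ((o.cost_le _ _).trans ?_) fun _ h => h)).mono
      (T := _ + (_ + (1 + a.bits M) * (1 + b.bits M))) (by simp only [time]; omega) fun _ h => h
    · have e1 : b.eval s₁.reg s₁.mem = b.eval s.reg s.mem := by
        rw [h₁.1]; exact b.eval_congr he.2 _ fun x hx => h₁.2.2 x (by omega)
      simp +contextual only [RAMState.setReg_mem, RAMState.setReg_reg, if_true, h₂.2.1, eval,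
        h₂.2.2 dst (by omega), h₁.2.1, h₂.1]
      rw [e1]
      refine ⟨h₁.1, rfl, fun x hx => ?_⟩
      rw [if_neg (by omega), h₂.2.2 x (by omega), h₁.2.2 x hx]
    · rw [h₂.2.1, h₂.2.2 dst (by omega), h₁.2.1, h₁.1,
        b.eval_congr he.2 _ fun x hx => h₁.2.2 x (by omega)]
      exact Nat.mul_le_mul (Nat.add_le_add_left (a.bitLen_eval_le he.1 h) _)
        (Nat.add_le_add_left (b.bitLen_eval_le he.2 h) _)
  | get seg a iha =>
    refine (RunsTo.seq (iha he.2 hdst h) fun s₁ h₁ =>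
      ((RunsTo.load _ _ _ ?_).mono ?_ fun _ h => h)).mono
      (T := _ + (1 + a.bits M + M)) (by simp only [time]; omega) fun _ h => h
    · simp +contextual [h₁.1, h₁.2.1, eval, Nat.ne_of_lt, h₁.2.2]
    · have := a.bitLen_eval_le he.2 h
      have := h.mem seg he.1 (a.eval s.reg s.mem)
      rw [h₁.2.1, h₁.1]
      omega
  | ite c a b ihc iha ihb =>
    refine (RunsTo.seq (ihc he.1 hdst h) fun s₁ h₁ => ((RunsTo.ifPos
      (T := a.time M B + b.time M B) (fun hp => ?_) (fun hp => ?_)).mono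
      (T₁ := 1 + c.bits M + (a.time M B + b.time M B)) ?_ fun _ h => h)).le (by simp only [time]; omega)
    · have hs : Small s₁.reg s₁.mem M B := by
        rw [h₁.1]; exact h.congr fun x hx => h₁.2.2 x (by omega)
      refine (iha he.2.1 hdst hs).mono (by omega) fun s₂ h₂ => ⟨h₂.1.trans h₁.1, ?_, fun x hx =>
        (h₂.2.2 x hx).trans (h₁.2.2 x hx)⟩
      rw [h₂.2.1, h₁.1, a.eval_congr he.2.1 _ fun x hx => h₁.2.2 x (by omega)]
      rw [h₁.2.1] at hp
      simp [eval, hp]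
    · have hs : Small s₁.reg s₁.mem M B := by
        rw [h₁.1]; exact h.congr fun x hx => h₁.2.2 x (by omega)
      refine (ihb he.2.2 hdst hs).mono (by omega) fun s₂ h₂ => ⟨h₂.1.trans h₁.1, ?_, fun x hx =>
        (h₂.2.2 x hx).trans (h₁.2.2 x hx)⟩
      rw [h₂.2.1, h₁.1, b.eval_congr he.2.2 _ fun x hx => h₁.2.2 x (by omega)]
      rw [h₁.2.1] at hp
      simp only [eval, hp, if_false]
    · have := c.bitLen_eval_le he.1 h
      rw [h₁.2.1]
      omega
  | sum x b e ih =>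
    obtain ⟨hx1, hx2, hb, he'⟩ := he
    have hMb := h.reg b (by omega)
    have hMx := h.reg x hx2
    set N := (s.reg b).toNat with hN
    have hNB : N ≤ B := by have := h.bound b hb; omega
    have hNM : bitLen (N : ℤ) ≤ M := h.bitLen_index hb le_rfl
    let f : ℕ → ℤ := fun i => e.eval (Function.update s.reg x (i : ℤ)) s.mem
    let I : ℕ → RAMState → Prop := fun j s' => s'.mem = s.mem ∧
      (∀ y < dst, s'.reg y = Function.update s.reg x (j : ℤ) y) ∧
      s'.reg dst = ∑ i ∈ Finset.range j, f i ∧ s'.reg (dst + 1) = s.reg x ∧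
      s'.reg (dst + 2) = s.reg b - j
    have hf : ∀ i ≤ N, bitLen (f i) ≤ e.bits M := fun i hi =>
      e.bitLen_eval_le he' (h.update hx1 (h.bitLen_index hb hi))
    have hS : ∀ j ≤ N, bitLen (∑ i ∈ Finset.range j, f i) ≤ M + e.bits M := fun j hj =>
      (bitLen_sum_range_le fun i hi => hf i (by omega)).trans
        (Nat.add_le_add_right ((bitLen_natCast_mono hj).trans hNM) _)
    -- The loop condition is the number of remaining terms. If the bound register is negative, the
    -- sum is empty and only its own content is tested; otherwise the difference lies between `0`
    -- and `N`.
    have hcond : ∀ j ≤ N, bitLen (s.reg b - j) ≤ M := by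
      intro j hj
      by_cases h0 : 0 ≤ s.reg b
      · exact (bitLen_mono (by omega)).trans hNM
      · obtain rfl : j = 0 := by omega
        simpa using hMb
    have loop : ∀ s₁, I 0 s₁ → RunsTo (.whilePos (dst + 2) (.seq (e.compile (dst + 3)) <|
        .seq (.arith .add dst dst (dst + 3)) <| .seq (.const (dst + 3) 1) <|
        .seq (.arith .add x x (dst + 3)) <| .arith .sub (dst + 2) b x)) s₁
        (N * (e.time M B + (1 + M + 2 * e.bits M) + 2 + (2 + M) + (1 + 2 * M) + M + 1) + M + 1)
        (I N) := by
      intro s₁ hs₁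
      refine RunsTo.whilePos I ?_ ?_ ?_ hs₁
      · rintro j hj s' ⟨h1, h2, h3, h4, h5⟩
        rw [h5]
        exact ⟨by omega, hcond j hj.le⟩
      · rintro j hj s' ⟨h1, h2, h3, h4, h5⟩
        have hsm : Small s'.reg s'.mem M B := by
          rw [h1]
          exact (h.update hx1 (h.bitLen_index hb hj.le)).congr fun y hy => h2 y (by omega)
        have ev : e.eval s'.reg s'.mem = f j := by
          rw [h1]; exact e.eval_congr he' _ fun y hy => h2 y (by omega)
        have hbx : b ≠ x := by omega
        refine (RunsTo.seq (T₂ := (1 + M + 2 * e.bits M) + 2 + (2 + M) + (1 + 2 * M))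
          (ih he' (by omega) hsm) fun s₂ h₂ => RunsTo.le (.step (.arith _ _ _ _ _) <|
          .step (.const _ _ _) <| .step (.arith _ _ _ _ _) <|
          .arith (Q := I (j + 1)) _ _ _ _ ?_) ?_).le (by omega)
        · refine ⟨by simp [h₂.1, h1], ?_, ?_, ?_, ?_⟩
          · intro y hy
            by_cases hyx : y = x
            · subst hyx
              simp [ArithOp.eval, h₂.2.2 y (by omega), h2 y hy, show y ≠ dst + 3 by omega,
                show y ≠ dst by omega, show y ≠ dst + 2 by omega]
            · simp [hyx, h₂.2.2 y (by omega), h2 y hy, show y ≠ dst + 3 by omega,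
                show y ≠ dst by omega, show y ≠ dst + 2 by omega]
          · simp [ArithOp.eval, h₂.2.2 dst (by omega), h3, h₂.2.1, ev, show dst ≠ x by omega,
              Finset.sum_range_succ]
          · simp [h₂.2.2 (dst + 1) (by omega), h4, show dst + 1 ≠ x by omega]
          · simp [ArithOp.eval, h₂.2.2 x (by omega), h2 x (by omega), show x ≠ dst + 3 by omega,
              show x ≠ dst by omega, hbx, h₂.2.2 b (by omega), h2 b (by omega),
              show b ≠ dst by omega, show b ≠ dst + 3 by omega]
        · have a0 := h.bitLen_index hb (show j + 1 ≤ N by omega)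
          have a1 := hf j hj.le
          have a2 := hS j hj.le
          have a3 := h.bitLen_index hb hj.le
          push_cast at a0
          simp [ArithOp.eval, ArithOp.cost, h₂.2.2 x (by omega), h2 x (by omega), hbx,
            show x ≠ dst + 3 by omega, show x ≠ dst by omega, h₂.2.2 b (by omega),
            h2 b (by omega), show b ≠ dst by omega, show b ≠ dst + 3 by omega,
            h₂.2.2 dst (by omega), h3, h₂.2.1, ev]
          omega
      · rintro s' ⟨h1, h2, h3, h4, h5⟩
        rw [h5]
        exact ⟨by omega, hcond N le_rfl⟩
    refine RunsTo.le (.step (.const _ _ _) <| .step (.const _ _ _) <| .step (.arith _ _ _ _ _) <|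
      .step (.const _ _ _) <| .step (.arith _ _ _ _ _) <| .seq (T₂ := 2 + M) (loop _ ?_)
      fun s₆ h₆ => RunsTo.le (.step (.const _ _ _) <| .arith _ _ _ _ ?_) ?_) ?_
    · refine ⟨by simp, ?_, ?_, ?_, ?_⟩
      · intro y hy
        by_cases hyx : y = x
        · subst hyx
          simp [show y ≠ dst + 2 by omega]
        · simp [hyx, show y ≠ dst + 2 by omega, show y ≠ dst + 1 by omega, show y ≠ dst by omega]
      · simp [show dst ≠ x by omega]
      · simp [ArithOp.eval, show x ≠ dst + 1 by omega, show x ≠ dst by omega,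
          show dst + 1 ≠ x by omega]
      · simp [ArithOp.eval, show b ≠ x by omega, show b ≠ dst + 1 by omega,
          show b ≠ dst by omega]
    · obtain ⟨g1, g2, g3, g4, g5⟩ := h₆
      refine ⟨by simp [g1], ?_, ?_⟩
      · simp [show dst ≠ x by omega, g3, eval, f, hN]
      · intro y hy
        by_cases hyx : y = x
        · subst hyx
          simp [ArithOp.eval, g4]
        · simp [hyx, show y ≠ dst + 2 by omega, g2 y hy]
    · obtain ⟨g1, g2, g3, g4, g5⟩ := h₆
      simp [ArithOp.cost, g4]
      omega
    · simp [ArithOp.cost, time, show x ≠ dst + 1 by omega, show x ≠ dst by omega,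
        show b ≠ x by omega, show b ≠ dst + 1 by omega, show b ≠ dst by omega]
      have h2 : N * (e.time M B + (1 + M + 2 * e.bits M) + 2 + (2 + M) + (1 + 2 * M) + M + 1) ≤
          B * (e.time M B + 2 * e.bits M + 6 * M + 10) :=
        Nat.mul_le_mul hNB (by omega)
      rw [add_mul]
      omega

/-! ## Hoare triples

Registers `≥ 80` are scratch registers, which a triple does not describe. -/

/-- Started with registers `ρ` (below `80`) and memory `μ`, the program `p` halts within time `T`, with
registers (below `80`) and memory that satisfy `Post`. -/
def Ht (p : Prog) (ρ : ℕ → ℤ) (μ : ℕ → ℤ → ℤ) (T : ℕ)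
    (Post : (ℕ → ℤ) → (ℕ → ℤ → ℤ) → Prop) : Prop :=
  ∀ s : RAMState, (∀ x < 80, s.reg x = ρ x) → s.mem = μ →
    RunsTo p s T fun s' => ∃ ρ', (∀ x < 80, s'.reg x = ρ' x) ∧ Post ρ' s'.mem

namespace Ht

variable {p q : Prog} {ρ : ℕ → ℤ} {μ : ℕ → ℤ → ℤ} {T T₁ T₂ : ℕ}
  {Q R : (ℕ → ℤ) → (ℕ → ℤ → ℤ) → Prop}

theorem mono (h : Ht p ρ μ T Q) (hT : T ≤ T₁) (hQ : ∀ ρ' μ', Q ρ' μ' → R ρ' μ') :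
    Ht p ρ μ T₁ R := fun s h1 h2 =>
  (h s h1 h2).mono hT fun _ ⟨ρ', h3, h4⟩ => ⟨ρ', h3, hQ _ _ h4⟩

theorem le (h : Ht p ρ μ T Q) (hT : T ≤ T₁) : Ht p ρ μ T₁ Q := h.mono hT fun _ _ h => h

theorem seq (hp : Ht p ρ μ T₁ Q) (hq : ∀ ρ' μ', Q ρ' μ' → Ht q ρ' μ' T₂ R) :
    Ht (.seq p q) ρ μ (T₁ + T₂) R := fun s h1 h2 =>
  (hp s h1 h2).seq fun s' ⟨ρ', h3, h4⟩ => hq ρ' s'.mem h4 s' h3 rfl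

theorem const (x : ℕ) (c : ℤ) (hQ : Q (Function.update ρ x c) μ) :
    Ht (.const x c) ρ μ (1 + bitLen c) Q := by
  intro s h1 h2
  refine .const _ _ ⟨_, fun y hy => ?_, by simpa [h2] using hQ⟩
  simp [Function.update_apply, h1 y hy]

theorem arith (o : ArithOp) {x y z : ℕ} (hy : y < 80) (hz : z < 80)
    (hQ : Q (Function.update ρ x (o.eval (ρ y) (ρ z))) μ) :
    Ht (.arith o x y z) ρ μ (o.cost (ρ y) (ρ z)) Q := by
  intro s h1 h2
  have := RunsTo.arith (Q := fun s' => ∃ ρ', (∀ x < 80, s'.reg x = ρ' x) ∧ Q ρ' s'.mem) (s := s)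
    o x y z ⟨_, fun w hw => ?_, by simpa [h2] using hQ⟩
  · rwa [h1 y hy, h1 z hz] at this
  · simp [Function.update_apply, h1 y hy, h1 z hz, h1 w hw]

theorem load {x a i : ℕ} (hi : i < 80) (hQ : Q (Function.update ρ x (μ a (ρ i))) μ) :
    Ht (.load x a i) ρ μ (1 + bitLen (ρ i) + bitLen (μ a (ρ i))) Q := by
  intro s h1 h2
  have := RunsTo.load (Q := fun s' => ∃ ρ', (∀ x < 80, s'.reg x = ρ' x) ∧ Q ρ' s'.mem) (s := s)
    x a i ⟨_, fun w hw => ?_, by simpa [h2] using hQ⟩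
  · rwa [h1 i hi, h2] at this
  · simp [Function.update_apply, h1 i hi, h2, h1 w hw]

theorem store {a i x : ℕ} (hi : i < 80) (hx : x < 80)
    (hQ : Q ρ (Function.update μ a (Function.update (μ a) (ρ i) (ρ x)))) :
    Ht (.store a i x) ρ μ (1 + bitLen (ρ i) + bitLen (ρ x)) Q := by
  intro s h1 h2
  have := RunsTo.store (Q := fun s' => ∃ ρ', (∀ x < 80, s'.reg x = ρ' x) ∧ Q ρ' s'.mem) (s := s)
    a i x ⟨ρ, by simpa using h1, by simpa [h2, h1 i hi, h1 x hx] using hQ⟩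
  rwa [h1 i hi, h1 x hx] at this

theorem ifPos {x : ℕ} (hx : x < 80) (hp : 0 < ρ x → Ht p ρ μ T Q) (hq : ¬ 0 < ρ x → Ht q ρ μ T Q) :
    Ht (.ifPos x p q) ρ μ (1 + bitLen (ρ x) + T) Q := by
  intro s h1 h2
  have := RunsTo.ifPos (x := x) (p := p) (q := q) (s := s) (T := T)
    (Q := fun s' => ∃ ρ', (∀ x < 80, s'.reg x = ρ' x) ∧ Q ρ' s'.mem)
    (fun h => hp (by rwa [← h1 x hx]) s h1 h2) (fun h => hq (by rwa [← h1 x hx]) s h1 h2)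
  rwa [h1 x hx] at this

/-- A loop that runs exactly `N` times. -/
theorem whilePos {x N c : ℕ} (hx : x < 80) (I : ℕ → (ℕ → ℤ) → (ℕ → ℤ → ℤ) → Prop)
    (hpos : ∀ j < N, ∀ ρ μ, I j ρ μ → 0 < ρ x ∧ bitLen (ρ x) ≤ c)
    (hstep : ∀ j < N, ∀ ρ μ, I j ρ μ → Ht p ρ μ T (I (j + 1)))
    (hend : ∀ ρ μ, I N ρ μ → ¬ 0 < ρ x ∧ bitLen (ρ x) ≤ c) (h0 : I 0 ρ μ) :
    Ht (.whilePos x p) ρ μ (N * (T + c + 1) + c + 1) (I N) := by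
  intro s h1 h2
  refine RunsTo.whilePos (fun j s' => ∃ ρ', (∀ x < 80, s'.reg x = ρ' x) ∧ I j ρ' s'.mem)
    ?_ ?_ ?_ ⟨ρ, h1, by rwa [h2]⟩
  · rintro j hj s' ⟨ρ', h3, h4⟩
    rw [h3 x hx]
    exact hpos j hj _ _ h4
  · rintro j hj s' ⟨ρ', h3, h4⟩
    exact hstep j hj _ _ h4 s' h3 rfl
  · rintro s' ⟨ρ', h3, h4⟩
    rw [h3 x hx]
    exact hend _ _ h4

end Ht

namespace Expr

/-- Time for evaluating an expression and storing its value. -/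
def cost (M B : ℕ) (e : Expr) : ℕ := e.time M B + e.bits M + 2

theorem cost_polyBdd (e : Expr) {ι : Type*} {z M B : ι → ℕ} (hM : PolyBdd z M)
    (hB : PolyBdd z B) : PolyBdd z fun i => e.cost (M i) (B i) :=
  ((e.time_polyBdd hM hB).add (e.bits_polyBdd hM)).add (.const 2)

end Expr

namespace Prog

/-- `reg x := e` -/
def assign (x : ℕ) (e : Expr) : Prog :=
  .seq (e.compile 80) (.seq (.const 81 0) (.arith .add x 80 81))

/-- `mem a [e₁] := e₂` -/
def storeExpr (a : ℕ) (e₁ e₂ : Expr) : Prog :=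
  .seq (e₁.compile 80) (.seq (e₂.compile 81) (.store a 80 81))

/-- Run `body` for `reg x = 0, …, reg b - 1`. -/
def forLoop (x b : ℕ) (body : Prog) : Prog :=
  .seq (.const x 0) <| .seq (.arith .sub 80 b x) <| .whilePos 80 <|
    .seq body <| .seq (.const 80 1) <| .seq (.arith .add x x 80) <| .arith .sub 80 b x

/-- `mem a [e₁] := e₂` for `reg x = 0, …, reg b - 1`. -/
def fill (x b a : ℕ) (e₁ e₂ : Expr) : Prog := .forLoop x b (.storeExpr a e₁ e₂)

end Prog

theorem Ht.assign {ρ : ℕ → ℤ} {μ : ℕ → ℤ → ℤ} {M B : ℕ} {Q} {e : Expr} (x : ℕ)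
    (h : Expr.Small ρ μ M B) (he : e.WF) (hQ : Q (Function.update ρ x (e.eval ρ μ)) μ) :
    Ht (.assign x e) ρ μ (e.cost M B) Q := by
  intro s h1 h2
  have hs : Expr.Small s.reg s.mem M B := by rw [h2]; exact h.congr fun y hy => h1 y (by omega)
  have hev : e.eval s.reg s.mem = e.eval ρ μ := by
    rw [h2]; exact e.eval_congr he _ fun y hy => h1 y (by omega)
  have hb := e.bitLen_eval_le he h
  refine RunsTo.le (.seq (T₂ := 2 + e.bits M) (e.runsTo_compile he (by norm_num) hs)
    fun s₁ h₁ => RunsTo.le (.step (.const _ _ _) <| .arith _ _ _ _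
      ⟨Function.update ρ x (e.eval ρ μ), ?_, ?_⟩) ?_) (by rw [Expr.cost]; omega)
  · intro y hy
    simp only [RAMState.setReg_reg, Function.update_apply, ArithOp.eval]
    simp [h₁.2.1, hev, h₁.2.2 y hy, h1 y hy, show y ≠ 81 by omega]
  · simpa [h₁.1, h2] using hQ
  · simp [ArithOp.cost, h₁.2.1, hev]
    omega

theorem Ht.storeExpr {ρ : ℕ → ℤ} {μ : ℕ → ℤ → ℤ} {M B : ℕ} {Q} {e₁ e₂ : Expr} (a : ℕ)
    (h : Expr.Small ρ μ M B) (he₁ : e₁.WF) (he₂ : e₂.WF)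
    (hQ : Q ρ (Function.update μ a (Function.update (μ a) (e₁.eval ρ μ) (e₂.eval ρ μ)))) :
    Ht (.storeExpr a e₁ e₂) ρ μ (e₁.cost M B + e₂.cost M B) Q := by
  intro s h1 h2
  have hs : Expr.Small s.reg s.mem M B := by rw [h2]; exact h.congr fun y hy => h1 y (by omega)
  have hev : e₁.eval s.reg s.mem = e₁.eval ρ μ := by
    rw [h2]; exact e₁.eval_congr he₁ _ fun y hy => h1 y (by omega)
  have hb := e₁.bitLen_eval_le he₁ h
  have hb' := e₂.bitLen_eval_le he₂ h
  refine RunsTo.le (.seq (T₂ := e₂.time M B + (1 + e₁.bits M + e₂.bits M))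
    (e₁.runsTo_compile he₁ (by norm_num) hs) fun s₁ h₁ =>
    .seq (e₂.runsTo_compile he₂ (by norm_num) (s := s₁)
      (by rw [h₁.1]; exact hs.congr fun y hy => h₁.2.2 y (by omega))) fun s₂ h₂ =>
      RunsTo.le (.store _ _ _ ⟨ρ, ?_, ?_⟩) ?_) (by simp only [Expr.cost]; omega)
  · intro y hy
    simp [h₂.2.2 y (by omega), h₁.2.2 y (by omega), h1 y hy]
  · have hev2 : e₂.eval s₁.reg s₁.mem = e₂.eval ρ μ := by
      rw [h₁.1, h2]
      exact e₂.eval_congr he₂ _ fun y hy => (h₁.2.2 y (by omega)).trans (h1 y (by omega))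
    rwa [RAMState.setMem_mem, h₂.2.1, hev2, h₂.2.2 80 (by norm_num), h₁.2.1, hev, h₂.1, h₁.1, h2]
  · have hev2 : e₂.eval s₁.reg s₁.mem = e₂.eval ρ μ := by
      rw [h₁.1, h2]
      exact e₂.eval_congr he₂ _ fun y hy => (h₁.2.2 y (by omega)).trans (h1 y (by omega))
    rw [h₂.2.1, hev2, h₂.2.2 80 (by norm_num), h₁.2.1, hev]
    omega

/-- The loop condition lives in the scratch register 80 and is recomputed from `b` and `x` after
each pass. The body may therefore destroy all scratch registers and has to preserve only `x` and
`b`. -/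
theorem Ht.forLoop {ρ : ℕ → ℤ} {μ : ℕ → ℤ → ℤ} {x b N T : ℕ} {body : Prog} (hx : x < 80)
    (hb : b < 80) (hxb : x ≠ b) (I : ℕ → (ℕ → ℤ) → (ℕ → ℤ → ℤ) → Prop)
    (hbody : ∀ j < N, ∀ ρ μ, I j ρ μ → Ht body ρ μ T fun ρ' μ' =>
      ρ' x = j ∧ ρ' b = N ∧ I (j + 1) (Function.update ρ' x ((j + 1 : ℕ) : ℤ)) μ')
    (hρ : ρ b = N) (h0 : I 0 (Function.update ρ x 0) μ) :
    Ht (.forLoop x b body) ρ μ ((N + 1) * (T + 5 * (bitLen (N : ℤ)) + 10)) (I N) := by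
  intro s h1 h2
  set c := bitLen (N : ℤ) with hc
  let J : ℕ → RAMState → Prop := fun j s' =>
    s'.reg 80 = N - j ∧ ∃ ρ', (∀ x < 80, s'.reg x = ρ' x) ∧ I j ρ' s'.mem
  have loop : ∀ s₁, J 0 s₁ → RunsTo (.whilePos 80 (.seq body <| .seq (.const 80 1) <|
      .seq (.arith .add x x 80) <| .arith .sub 80 b x)) s₁
      (N * (T + (6 + 3 * c) + c + 1) + c + 1) (J N) := by
    intro s₁ hs₁
    refine RunsTo.whilePos J ?_ ?_ ?_ hs₁
    · rintro j hj s' ⟨h3, -⟩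
      rw [h3]
      exact ⟨by omega, bitLen_sub_natCast_le le_rfl hj.le⟩
    · rintro j hj s' ⟨h3, ρ', h4, h5⟩
      refine RunsTo.seq (hbody j hj ρ' _ h5 s' h4 rfl) fun s₂ ⟨ρ₂, h6, h7, h8, h9⟩ =>
        RunsTo.le (.step (.const _ _ _) <| .step (.arith _ _ _ _ _) <| .arith _ _ _ _ ?_) ?_
      · refine ⟨?_, Function.update ρ₂ x ((j + 1 : ℕ) : ℤ), fun y hy => ?_, ?_⟩
        · simp [ArithOp.eval, hxb.symm, h6 x hx, h6 b hb, h7, h8, show b ≠ 80 by omega,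
            show x ≠ 80 by omega]
        · simp [ArithOp.eval, h6 x hx, h6 y hy, h7, show y ≠ 80 by omega,
            show x ≠ 80 by omega, Function.update_apply]
        · simpa using h9
      · have a1 := bitLen_natCast_mono (show j + 1 ≤ N by omega)
        have a2 := bitLen_natCast_mono (show j ≤ N by omega)
        push_cast at a1
        simp [ArithOp.eval, ArithOp.cost, hxb.symm, h6 x hx, h6 b hb, h7, h8,
          show b ≠ 80 by omega, show x ≠ 80 by omega]
        omega
    · rintro s' ⟨h3, -⟩
      simp [h3]
  refine RunsTo.le (.step (.const _ _ _) <| .step (.arith _ _ _ _ _) <|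
    RunsTo.mono (loop _ ?_) le_rfl fun s' h => h.2) ?_
  · refine ⟨?_, Function.update ρ x 0, fun y hy => ?_, by simpa [h2] using h0⟩
    · simp [ArithOp.eval, hxb.symm, h1 b hb, hρ]
    · simp [Function.update_apply, show y ≠ 80 by omega, h1 y hy]
  · have : N * (T + (6 + 3 * c) + c + 1) ≤ N * (T + 5 * c + 10) := Nat.mul_le_mul_left _ (by omega)
    rw [add_mul]
    simp [ArithOp.cost, hxb.symm, h1 b hb, hρ, ← hc]
    omega

/-- The evaluation hypotheses hold for every content `ν` of the segment being filled, which
expresses that addresses and values do not depend on what was written so far. Only the segments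
below 8 are subject to the bound on bit lengths, hence the premise in `hval`. Injectivity of the
addresses keeps later writes from destroying earlier ones. -/
theorem Ht.fill {ρ : ℕ → ℤ} {μ : ℕ → ℤ → ℤ} {M B x b a N : ℕ} {e₁ e₂ : Expr} (hx : 16 ≤ x)
    (hx' : x < 64) (hb : b < 64) (hxb : x ≠ b) (h : Expr.Small ρ μ M B) (he₁ : e₁.WF)
    (he₂ : e₂.WF) (hρ : ρ b = N) (addr val : ℕ → ℤ)
    (h₁ : ∀ j < N, ∀ ν, e₁.eval (Function.update ρ x (j : ℤ)) (Function.update μ a ν) = addr j)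
    (h₂ : ∀ j < N, ∀ ν, Expr.Small (Function.update ρ x (j : ℤ)) (Function.update μ a ν) M B →
      e₂.eval (Function.update ρ x (j : ℤ)) (Function.update μ a ν) = val j)
    (hval : a < 8 → ∀ j < N, bitLen (val j) ≤ M)
    (hinj : ∀ i < N, ∀ j < N, addr i = addr j → i = j) :
    Ht (.fill x b a e₁ e₂) ρ μ ((N + 1) * (e₁.cost M B + e₂.cost M B + 5 * M + 10)) fun ρ' μ' =>
      ρ' = Function.update ρ x (N : ℤ) ∧ ∃ ν, μ' = Function.update μ a ν ∧
        (∀ j < N, ν (addr j) = val j) ∧ ∀ z, (∀ j < N, addr j ≠ z) → ν z = μ a z := by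
  have hNM : bitLen (N : ℤ) ≤ M := by rw [← hρ]; exact h.reg b hb
  let I : ℕ → (ℕ → ℤ) → (ℕ → ℤ → ℤ) → Prop := fun n ρ' μ' =>
      ρ' = Function.update ρ x (n : ℤ) ∧ n ≤ N ∧ ∃ ν, μ' = Function.update μ a ν ∧
        (∀ j < n, ν (addr j) = val j) ∧ ∀ z, (∀ j < n, addr j ≠ z) → ν z = μ a z
  refine (Ht.forLoop (T := e₁.cost M B + e₂.cost M B) (by omega) (by omega) hxb I ?_ hρ ?_).mono
    (Nat.mul_le_mul_left _ (by omega)) fun ρ' μ' h => ⟨h.1, h.2.2⟩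
  · rintro j hj ρ' μ' ⟨rfl, hjN, ν, rfl, h3, h4⟩
    have hsm : Expr.Small (Function.update ρ x (j : ℤ)) (Function.update μ a ν) M B := by
      have h0 := h.update hx ((bitLen_natCast_mono hj.le).trans hNM)
      refine ⟨h0.reg, h0.bound, fun a' ha' z => ?_, h0.bits⟩
      by_cases haa : a' = a
      · subst haa
        simp only [Function.update_self]
        by_cases hz : ∃ i < j, addr i = z
        · obtain ⟨i, hi, rfl⟩ := hz
          rw [h3 i hi]
          exact hval ha' i (by omega)
        · push Not at hz
          rw [h4 z hz]
          exact h.mem a' ha' z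
      · simpa [haa] using h.mem a' ha' z
    refine Ht.storeExpr a hsm he₁ he₂ ?_
    rw [h₁ j hj, h₂ j hj _ hsm]
    refine ⟨by simp, by simp [hxb.symm, hρ], by simp, by omega,
      Function.update ν (addr j) (val j), by simp, fun i hi => ?_, fun z hz => ?_⟩
    · by_cases hij : i = j
      · subst hij; simp
      · rw [Function.update_of_ne fun hh => hij (hinj i (by omega) j hj hh), h3 i (by omega)]
    · rw [Function.update_of_ne (hz j (by omega)).symm, h4 z fun i hi => hz i (by omega)]
  · exact ⟨by simp, by simp, μ a, by simp, by simp, by simp⟩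

/-! ## Growth of the numbers in an execution -/

/-- The maximal bit length of the constants of a program. -/
def Prog.constBits : Prog → ℕ
  | .const _ c => bitLen c
  | .arith .. | .load .. | .store .. => 0
  | .seq p q | .ifPos _ p q => max p.constBits q.constBits
  | .whilePos _ p => p.constBits

/-- All numbers in the state have at most `b` bits. -/
def RAMState.BitsLE (s : RAMState) (b : ℕ) : Prop :=
  (∀ x, bitLen (s.reg x) ≤ b) ∧ ∀ a z, bitLen (s.mem a z) ≤ b

theorem RAMState.BitsLE.mono {s : RAMState} {b c : ℕ} (h : s.BitsLE b) (hbc : b ≤ c) :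
    s.BitsLE c :=
  ⟨fun x => (h.1 x).trans hbc, fun a z => (h.2 a z).trans hbc⟩

theorem RAMState.BitsLE.setReg {s : RAMState} {b x : ℕ} {v : ℤ} (h : s.BitsLE b)
    (hv : bitLen v ≤ b) : (s.setReg x v).BitsLE b := by
  refine ⟨fun y => ?_, h.2⟩
  rw [setReg_reg]
  split_ifs
  exacts [hv, h.1 y]

/-- The square of the maximal bit length is a potential that is paid for by the time. An addition
can exceed `b` bits only by one, and only if an operand has `b` bits, which costs more than `b`. A
product of numbers with `u` and `v` bits raises the square by at most `3uv`, which the schoolbook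
cost covers. -/
theorem ArithOp.bitLen_eval_sq_le (o : ArithOp) {y z : ℤ} {b : ℕ} (hy : bitLen y ≤ b)
    (hz : bitLen z ≤ b) : (max b (bitLen (o.eval y z))) ^ 2 ≤ b ^ 2 + 9 * o.cost y z := by
  rcases le_total (bitLen (o.eval y z)) b with h | h
  · rw [max_eq_left h]; omega
  rw [max_eq_right h]
  cases o
  · have := bitLen_add_le y z
    simp only [ArithOp.eval, ArithOp.cost] at *
    have h2 : bitLen (y + z) ≤ max (bitLen y) (bitLen z) + 1 := this
    rcases le_total (bitLen y) (bitLen z) with h3 | h3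
    · rw [max_eq_right h3] at h2; nlinarith
    · rw [max_eq_left h3] at h2; nlinarith
  · have := bitLen_sub_le y z
    simp only [ArithOp.eval, ArithOp.cost] at *
    have h2 : bitLen (y - z) ≤ max (bitLen y) (bitLen z) + 1 := this
    rcases le_total (bitLen y) (bitLen z) with h3 | h3
    · rw [max_eq_right h3] at h2; nlinarith
    · rw [max_eq_left h3] at h2; nlinarith
  · have := bitLen_mul_le y z
    simp only [ArithOp.eval, ArithOp.cost] at *
    rcases le_total (bitLen y) (bitLen z) with h3 | h3 <;> nlinarith
  · have := bitLen_div_le y z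
    simp only [ArithOp.eval, ArithOp.cost] at *
    have : bitLen (y / z) = b := by omega
    rw [this]
    omega

/-- The potential telescopes along the execution, so time `t` creates numbers of only about `√t`
bits. With linear cost for products they could have about `t` bits, and merely reading all outputs
could be too expensive. -/
theorem Prog.Exec.bitsLE {P : Prog} {s s' : RAMState} {t b : ℕ} (h : P.Exec s t s')
    (hP : P.constBits ≤ b) (hs : s.BitsLE b) : ∃ b', s'.BitsLE b' ∧ b ≤ b' ∧ b' ^ 2 ≤ b ^ 2 + 9 * t := by
  induction h generalizing b with
  | const s x c => exact ⟨b, hs.setReg hP, le_rfl, by omega⟩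
  | arith s o x y z =>
    exact ⟨_, (hs.mono (le_max_left _ _)).setReg (le_max_right _ _), le_max_left _ _,
      o.bitLen_eval_sq_le (hs.1 y) (hs.1 z)⟩
  | load s x a i => exact ⟨b, hs.setReg (hs.2 _ _), le_rfl, by omega⟩
  | store s a i x =>
    refine ⟨b, ⟨hs.1, fun a' z => ?_⟩, le_rfl, by omega⟩
    simp only [RAMState.setMem_mem, Function.update_apply]
    split_ifs
    · rw [Function.update_apply]; split_ifs
      exacts [hs.1 x, hs.2 _ _]
    · exact hs.2 _ _
  | seq _ _ ih1 ih2 =>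
    simp only [constBits, max_le_iff] at hP
    obtain ⟨b1, h1, h2, h3⟩ := ih1 hP.1 hs
    obtain ⟨b2, h4, h5, h6⟩ := ih2 (hP.2.trans h2) h1
    exact ⟨b2, h4, h2.trans h5, by omega⟩
  | if_true _ _ ih =>
    simp only [constBits, max_le_iff] at hP
    obtain ⟨b1, h1, h2, h3⟩ := ih hP.1 hs
    exact ⟨b1, h1, h2, by omega⟩
  | if_false _ _ ih =>
    simp only [constBits, max_le_iff] at hP
    obtain ⟨b1, h1, h2, h3⟩ := ih hP.2 hs
    exact ⟨b1, h1, h2, by omega⟩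
  | while_true _ _ _ ih1 ih2 =>
    obtain ⟨b1, h1, h2, h3⟩ := ih1 hP hs
    obtain ⟨b2, h4, h5, h6⟩ := ih2 (le_trans hP h2) h1
    exact ⟨b2, h4, h2.trans h5, by omega⟩
  | while_false _ => exact ⟨b, hs, le_rfl, by omega⟩

/-! ## Relocation of programs

A relocated program uses the registers from `80` on, and its memory cell `mem a [i]` is the cell
`mem (σ + a) [i * R + r]`, where `R` and `r` are the contents of registers `62` and `63`. -/

namespace Prog

def relocate (σ : ℕ) : Prog → Prog
  | .const x c => .const (80 + x) c
  | .arith o x y z => .arith o (80 + x) (80 + y) (80 + z)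
  | .load x a i => .seq (.arith .mul 79 (80 + i) 62) <| .seq (.arith .add 79 79 63) <|
      .load (80 + x) (σ + a) 79
  | .store a i x => .seq (.arith .mul 79 (80 + i) 62) <| .seq (.arith .add 79 79 63) <|
      .store (σ + a) 79 (80 + x)
  | .seq p q => .seq (p.relocate σ) (q.relocate σ)
  | .ifPos x p q => .ifPos (80 + x) (p.relocate σ) (q.relocate σ)
  | .whilePos x p => .whilePos (80 + x) (p.relocate σ)

/-- A bound for the registers of a program. -/
def regBound : Prog → ℕ
  | .const x _ => x + 1
  | .arith _ x y z => x + y + z + 1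
  | .load x _ i => x + i + 1
  | .store _ i x => x + i + 1
  | .seq p q => max p.regBound q.regBound
  | .ifPos x p q => max (x + 1) (max p.regBound q.regBound)
  | .whilePos x p => max (x + 1) p.regBound

end Prog

/-- The state `u` holds the relocated state `s`. -/
structure Relocated (σ nb : ℕ) (R r : ℤ) (s u : RAMState) : Prop where
  reg : ∀ x < nb, u.reg (80 + x) = s.reg x
  mem : ∀ a z, u.mem (σ + a) (z * R + r) = s.mem a z
  modulus : u.reg 62 = R
  residue : u.reg 63 = r

/-- Parts of the state that relocated programs do not change. -/
structure RelocFrame (σ : ℕ) (R r : ℤ) (u u' : RAMState) : Prop where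
  reg : ∀ x < 79, u'.reg x = u.reg x
  mem : ∀ a z, (a < σ ∨ z % R ≠ r) → u'.mem a z = u.mem a z

theorem RelocFrame.trans {σ : ℕ} {R r : ℤ} {u u' u'' : RAMState} (h : RelocFrame σ R r u u')
    (h' : RelocFrame σ R r u' u'') : RelocFrame σ R r u u'' :=
  ⟨fun x hx => (h'.reg x hx).trans (h.reg x hx), fun a z hz => (h'.mem a z hz).trans (h.mem a z hz)⟩

theorem bitLen_address_le {i R r : ℤ} (hr : 0 ≤ r) (hrR : r < R) :
    bitLen (i * R + r) ≤ bitLen i + bitLen R + 1 := by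
  have h1 := bitLen_add_le (i * R) r
  have h2 := bitLen_mul_le i R
  have h3 : bitLen r ≤ bitLen R := bitLen_mono (by omega)
  omega

/-- The simulation is instruction by instruction. Only memory accesses become longer, by the
computation of `i * R + r`, which costs a factor linear in the bit length of `R`. All addresses used
in the relocated segments are congruent to `r` modulo `R`, so runs with different residues never see
each other's data and memory need not be cleared between them. -/
theorem Prog.Exec.relocate {P : Prog} {s s' u : RAMState} {t σ nb : ℕ} {R r : ℤ}
    (h : P.Exec s t s') (hP : P.regBound ≤ nb) (hr : 0 ≤ r) (hrR : r < R)
    (hu : Relocated σ nb R r s u) :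
    RunsTo (P.relocate σ) u (t * (4 * bitLen R + 6))
      fun u' => Relocated σ nb R r s' u' ∧ RelocFrame σ R r u u' := by
  have hle : ∀ t', t' ≤ t' * (4 * bitLen R + 6) := fun t' =>
    Nat.le_mul_of_pos_right _ (by omega)
  have hrb : bitLen r ≤ bitLen R := bitLen_mono (by omega)
  have hR : R ≠ 0 := by omega
  have hmod : ∀ z, (z * R + r) % R = r := fun z => by
    rw [Int.add_comm, Int.add_mul_emod_self_right]
    exact Int.emod_eq_of_lt hr hrR
  induction h generalizing u with
  | const s x c =>
    simp only [regBound] at hP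
    refine (RunsTo.const _ _ ⟨⟨fun y hy => ?_, hu.mem, ?_, ?_⟩, fun y hy => ?_,
      fun _ _ _ => rfl⟩).le (hle _)
    · simp [hu.reg y hy]
    · simp [hu.modulus, show 62 ≠ 80 + x by omega]
    · simp [hu.residue, show 63 ≠ 80 + x by omega]
    · simp [show y ≠ 80 + x by omega]
  | arith s o x y z =>
    simp only [regBound] at hP
    have e1 := hu.reg y (by omega)
    have e2 := hu.reg z (by omega)
    refine (RunsTo.arith _ _ _ _ ⟨⟨fun y hy => ?_, hu.mem, ?_, ?_⟩, fun y hy => ?_,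
      fun _ _ _ => rfl⟩).le (by rw [e1, e2]; exact hle _)
    · simp [hu.reg y hy, e1, e2]
    · simp [hu.modulus, show 62 ≠ 80 + x by omega]
    · simp [hu.residue, show 63 ≠ 80 + x by omega]
    · simp [show y ≠ 80 + x by omega]
  | load s x a i =>
    simp only [regBound] at hP
    have e1 := hu.reg i (by omega)
    have e2 := hu.mem a (s.reg i)
    refine RunsTo.le (.step (.arith _ _ _ _ _) <| .step (.arith _ _ _ _ _) <|
      .load _ _ _ ⟨⟨fun y hy => ?_, hu.mem, ?_, ?_⟩, fun y hy => ?_, fun _ _ _ => rfl⟩) ?_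
    · simp [ArithOp.eval, hu.reg y hy, e1, e2, hu.modulus, hu.residue, show 80 + y ≠ 79 by omega]
    · simp [hu.modulus, show 62 ≠ 80 + x by omega]
    · simp [hu.residue, show 63 ≠ 80 + x by omega]
    · simp [show y ≠ 80 + x by omega, show y ≠ 79 by omega]
    · have h1 := bitLen_mul_le (s.reg i) R
      have h2 := bitLen_address_le (i := s.reg i) hr hrR
      simp [ArithOp.eval, ArithOp.cost, hu.modulus, hu.residue, e1, e2]
      nlinarith
  | store s a i x =>
    simp only [regBound] at hP
    have e1 := hu.reg i (by omega)
    have e2 := hu.reg x (by omega)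
    refine RunsTo.le (.step (.arith _ _ _ _ _) <| .step (.arith _ _ _ _ _) <|
      .store _ _ _ ⟨⟨fun y hy => ?_, fun a' z => ?_, ?_, ?_⟩, fun y hy => ?_,
      fun a' z hz => ?_⟩) ?_
    · simp [hu.reg y hy, show 80 + y ≠ 79 by omega]
    · by_cases ha : a' = a
      · subst ha
        simp [ArithOp.eval, e1, e2, hu.modulus, hu.residue, Function.update_apply, hR, hu.mem,
          show 80 + x ≠ 79 by omega]
      · simp [ha, hu.mem]
    · simp [hu.modulus]
    · simp [hu.residue]
    · simp [show y ≠ 79 by omega]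
    · by_cases ha : a' = σ + a
      · have hz' : z ≠ s.reg i * R + r := by
          rintro rfl
          rcases hz with hz | hz
          · omega
          · exact hz (hmod _)
        subst ha
        simp [ArithOp.eval, e1, hu.modulus, hu.residue, hz']
      · simp [ha]
    · have h1 := bitLen_mul_le (s.reg i) R
      have h2 := bitLen_address_le (i := s.reg i) hr hrR
      simp [ArithOp.eval, ArithOp.cost, hu.modulus, hu.residue, e1, e2,
        show 80 + x ≠ 79 by omega]
      nlinarith
  | seq _ _ ih1 ih2 =>
    simp only [regBound, max_le_iff] at hP
    refine RunsTo.le (.seq (ih1 hP.1 hu) fun u₁ h₁ => RunsTo.mono (ih2 hP.2 h₁.1) le_rfl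
      fun u₂ h₂ => ⟨h₂.1, h₁.2.trans h₂.2⟩) (by rw [add_mul])
  | @if_true x p q s s' t hx _ ih =>
    simp only [regBound, max_le_iff] at hP
    have e1 := hu.reg x (by omega)
    obtain ⟨t', u', h1, h2, h3⟩ := ih hP.2.1 hu
    refine ⟨_, _, .if_true (by rwa [e1]) h1, ?_, h3⟩
    rw [e1, add_mul]
    have := hle (1 + bitLen (s.reg x))
    omega
  | @if_false x p q s s' t hx _ ih =>
    simp only [regBound, max_le_iff] at hP
    have e1 := hu.reg x (by omega)
    obtain ⟨t', u', h1, h2, h3⟩ := ih hP.2.2 hu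
    refine ⟨_, _, .if_false (by rwa [e1]) h1, ?_, h3⟩
    rw [e1, add_mul]
    have := hle (1 + bitLen (s.reg x))
    omega
  | @while_true x p s s' s'' t t' hx _ _ ih1 ih2 =>
    have hP' := hP
    simp only [regBound, max_le_iff] at hP
    have e1 := hu.reg x (by omega)
    obtain ⟨t1, u1, h1, h2, h3⟩ := ih1 hP.2 hu
    obtain ⟨t2, u2, h4, h5, h6⟩ := ih2 hP' h3.1
    refine ⟨_, _, .while_true (by rwa [e1]) h1 h4, ?_, h6.1, h3.2.trans h6.2⟩
    rw [e1, add_mul, add_mul]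
    have := hle (1 + bitLen (s.reg x))
    omega
  | @while_false x p s hx =>
    simp only [regBound, max_le_iff] at hP
    have e1 := hu.reg x (by omega)
    exact ⟨_, _, .while_false (by rwa [e1]), by rw [e1]; exact hle _, hu,
      fun _ _ => rfl, fun _ _ _ => rfl⟩

/-! ## Subroutine calls -/

namespace Prog

/-- Set the registers `80, …, 80 + nb - 1` to zero. -/
def zeroRegs : ℕ → Prog
  | 0 => .const 80 0
  | nb + 1 => .seq (zeroRegs nb) (.const (80 + nb) 0)

/-- Add the listed registers to the registers from `80 + k` on. -/
def copyRegs (k : ℕ) : List ℕ → Prog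
  | [] => .const 79 0
  | x :: l => .seq (.arith .add (80 + k) x (80 + k)) (copyRegs (k + 1) l)

/-- Number of registers that have to be cleared for calling `P` with the arguments `l`. -/
def callRegs (P : Prog) (l : List ℕ) : ℕ := P.regBound + l.length + 1

/-- Run the relocated program `P` with the listed registers as its input. -/
def call (σ : ℕ) (P : Prog) (l : List ℕ) : Prog :=
  .seq (zeroRegs (P.callRegs l)) (.seq (copyRegs 0 l) (P.relocate σ))

/-- Run the relocated program `P` and copy its register `0` to register `x`. -/
def callResult (σ : ℕ) (P : Prog) (l : List ℕ) (x : ℕ) : Prog :=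
  .seq (P.call σ l) (.seq (.const 79 0) (.arith .add x 80 79))

end Prog

theorem RunsTo.zeroRegs (nb : ℕ) (s : RAMState) :
    RunsTo (.zeroRegs nb) s (nb + 1) fun s' => s'.mem = s.mem ∧ (∀ x < 80, s'.reg x = s.reg x) ∧
      ∀ x < nb, s'.reg (80 + x) = 0 := by
  induction nb with
  | zero => exact RunsTo.const _ _ (by simp +contextual [Nat.ne_of_lt])
  | succ nb ih =>
    refine RunsTo.le (.seq ih fun s₁ h₁ => .const _ _ ⟨h₁.1, fun x hx => ?_, fun x hx => ?_⟩)
      (by simp)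
    · simp [show x ≠ 80 + nb by omega, h₁.2.1 x hx]
    · rw [RAMState.setReg_reg]
      split_ifs with h
      · rfl
      · exact h₁.2.2 x (by omega)

theorem RunsTo.copyRegs (k nb c : ℕ) (l : List ℕ) (s : RAMState) (hl : ∀ x ∈ l, x < 79)
    (hk : k + l.length ≤ nb) (hz : ∀ x < nb, k ≤ x → s.reg (80 + x) = 0)
    (hc : ∀ x ∈ l, bitLen (s.reg x) ≤ c) :
    RunsTo (.copyRegs k l) s (l.length * (c + 1) + 1) fun s' => s'.mem = s.mem ∧
      (∀ x < 79, s'.reg x = s.reg x) ∧ (∀ x < nb, s'.reg (80 + x) =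
        if x < k then s.reg (80 + x) else (l.map s.reg).getD (x - k) 0) := by
  induction l generalizing k s with
  | nil =>
    refine RunsTo.le (.const _ _ ⟨rfl, fun x hx => ?_, fun x hx => ?_⟩) (by simp)
    · simp [show x ≠ 79 by omega]
    · simp only [RAMState.setReg_reg, show 80 + x ≠ 79 by omega, if_false]
      split_ifs with h
      · rfl
      · simpa using hz x hx (by omega)
  | cons y l ih =>
    have hy := hl y (by simp)
    simp only [List.length_cons] at hk
    have hst := Prog.Exec.arith s .add (80 + k) y (80 + k)
    rw [hz k (by omega) le_rfl, show ArithOp.add.eval (s.reg y) 0 = s.reg y by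
      simp [ArithOp.eval]] at hst
    refine RunsTo.le (.step hst <| (ih (k + 1)
      (s.setReg (80 + k) (s.reg y)) (fun x hx => hl x (by simp [hx])) (by omega) ?_ ?_).mono
      le_rfl fun s' h => ⟨h.1, ?_, ?_⟩) ?_
    · intro x hx hkx
      simp [show x ≠ k by omega, hz x hx (by omega)]
    · intro x hx
      have := hl x (by simp [hx])
      simpa [show x ≠ 80 + k by omega] using hc x (by simp [hx])
    · intro x hx
      rw [h.2.1 x hx]
      simp [show x ≠ 80 + k by omega]
    · intro x hx
      have hmap : l.map (s.setReg (80 + k) (s.reg y)).reg = l.map s.reg := by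
        refine List.map_congr_left fun x hx => ?_
        have := hl x (by simp [hx])
        simp [show x ≠ 80 + k by omega]
      rw [h.2.2 x hx, hmap]
      rcases lt_trichotomy x k with h1 | h1 | h1
      · simp [h1, show x < k + 1 by omega, show x ≠ k by omega]
      · subst h1; simp
      · obtain ⟨d, rfl⟩ : ∃ d, x = k + 1 + d := ⟨x - (k + 1), by omega⟩
        simp [show k + 1 + d - k = d + 1 by omega, show ¬ k + 1 + d < k + 1 by omega,
          show ¬ k + 1 + d < k by omega]
    · have := hc y (by simp)
      simp [ArithOp.cost, add_mul]
      omega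

theorem RunsTo.call {P : Prog} {σ c t : ℕ} {l : List ℕ} {R r : ℤ} {s' u : RAMState}
    {m : ℕ → ℤ → ℤ} (hl : ∀ x ∈ l, x < 79) (hc : ∀ x ∈ l, bitLen (u.reg x) ≤ c)
    (hr : 0 ≤ r) (hrR : r < R) (hR' : u.reg 62 = R) (hr' : u.reg 63 = r)
    (hm : ∀ a z, u.mem (σ + a) (z * R + r) = m a z)
    (hP : P.Exec ⟨initRegs (l.map u.reg), m⟩ t s') :
    RunsTo (P.call σ l) u (P.callRegs l * (c + 2) + 2 + t * (4 * bitLen R + 6)) fun u' =>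
      Relocated σ (P.callRegs l) R r s' u' ∧ RelocFrame σ R r u u' := by
  refine RunsTo.le (.seq (.zeroRegs _ u) fun u₁ h₁ => .seq (T₁ := l.length * (c + 1) + 1)
    (T₂ := t * (4 * bitLen R + 6)) (.copyRegs 0 (P.callRegs l) c l u₁ hl ?_ ?_ ?_) fun u₂ h₂ => ?_) ?_
  · rw [Prog.callRegs]; omega
  · exact fun x hx _ => h₁.2.2 x hx
  · intro x hx
    have := hl x hx
    rw [h₁.2.1 x (by omega)]
    exact hc x hx
  · have hfr : ∀ x < 79, u₂.reg x = u.reg x := fun x hx =>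
      (h₂.2.1 x hx).trans (h₁.2.1 x (by omega))
    have hmem : u₂.mem = u.mem := h₂.1.trans h₁.1
    refine (hP.relocate (σ := σ) (nb := P.callRegs l) (u := u₂) ?_ hr hrR ⟨?_, ?_, ?_, ?_⟩).mono
      le_rfl fun u' h => ⟨h.1, fun x hx => (h.2.reg x hx).trans (hfr x hx), fun a z hz => ?_⟩
    · rw [Prog.callRegs]; omega
    · intro x hx
      rw [h₂.2.2 x hx]
      have : l.map u₁.reg = l.map u.reg := List.map_congr_left fun x hx => by
        have := hl x hx
        exact h₁.2.1 x (by omega)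
      simp [this, initRegs]
    · intro a z; rw [hmem]; exact hm a z
    · rw [hfr _ (by norm_num), hR']
    · rw [hfr _ (by norm_num), hr']
    · rw [h.2.mem a z hz, hmem]
  · have : l.length ≤ P.callRegs l := by rw [Prog.callRegs]; omega
    nlinarith

theorem Ht.call {P : Prog} {σ c t : ℕ} {l : List ℕ} {R r : ℤ} {s' : RAMState} {ρ : ℕ → ℤ}
    {μ m : ℕ → ℤ → ℤ} (hl : ∀ x ∈ l, x < 79) (hc : ∀ x ∈ l, bitLen (ρ x) ≤ c)
    (hr : 0 ≤ r) (hrR : r < R) (hR' : ρ 62 = R) (hr' : ρ 63 = r)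
    (hm : ∀ a z, μ (σ + a) (z * R + r) = m a z)
    (hP : P.Exec ⟨initRegs (l.map ρ), m⟩ t s') :
    Ht (P.call σ l) ρ μ (P.callRegs l * (c + 2) + 2 + t * (4 * bitLen R + 6)) fun ρ' μ' =>
      (∀ x ≠ 79, ρ' x = ρ x) ∧ (∀ a z, μ' (σ + a) (z * R + r) = s'.mem a z) ∧
        ∀ a z, (a < σ ∨ z % R ≠ r) → μ' a z = μ a z := by
  rintro u h1 rfl
  have hmap : l.map u.reg = l.map ρ := List.map_congr_left fun x hx => h1 x (by
    have := hl x hx; omega)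
  refine (RunsTo.call hl (fun x hx => ?_) hr hrR (by rw [h1 62 (by norm_num), hR'])
    (by rw [h1 63 (by norm_num), hr']) hm (by rwa [hmap])).mono le_rfl fun u' h =>
      ⟨Function.update ρ 79 (u'.reg 79), fun x hx => ?_, fun x hx => ?_, h.1.mem, h.2.mem⟩
  · rw [h1 x (by have := hl x hx; omega)]; exact hc x hx
  · by_cases hx' : x = 79
    · subst hx'; simp
    · simp [hx', h.2.reg x (by omega), h1 x hx]
  · simp [hx]

theorem Ht.callResult {P : Prog} {σ c t x : ℕ} {l : List ℕ} {R r : ℤ} {s' : RAMState}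
    {ρ : ℕ → ℤ} {μ m : ℕ → ℤ → ℤ} (hl : ∀ x ∈ l, x < 79) (hc : ∀ x ∈ l, bitLen (ρ x) ≤ c)
    (hr : 0 ≤ r) (hrR : r < R) (hR' : ρ 62 = R) (hr' : ρ 63 = r)
    (hm : ∀ a z, μ (σ + a) (z * R + r) = m a z)
    (hP : P.Exec ⟨initRegs (l.map ρ), m⟩ t s') :
    Ht (P.callResult σ l x) ρ μ
      (P.callRegs l * (c + 2) + 4 + t * (4 * bitLen R + 6) + bitLen (s'.reg 0)) fun ρ' μ' =>
      ρ' = Function.update (Function.update ρ 79 0) x (s'.reg 0) ∧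
        ∀ a z, (a < σ ∨ z % R ≠ r) → μ' a z = μ a z := by
  rintro u h1 rfl
  have hmap : l.map u.reg = l.map ρ := List.map_congr_left fun x hx => h1 x (by
    have := hl x hx; omega)
  refine RunsTo.le (.seq (T₂ := 2 + bitLen (s'.reg 0)) (RunsTo.call (c := c) hl (fun x hx => ?_) hr hrR
    (by rw [h1 62 (by norm_num), hR'])
    (by rw [h1 63 (by norm_num), hr']) hm (by rwa [hmap])) fun u' h =>
      RunsTo.le (.step (.const _ _ _) <| .arith _ _ _ _ ⟨_, fun y hy => ?_, rfl, h.2.mem⟩) ?_) ?_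
  · rw [h1 x (by have := hl x hx; omega)]; exact hc x hx
  · have h80 := h.1.reg 0 (by rw [Prog.callRegs]; omega)
    by_cases hy' : y = 79
    · subst hy'; simp [ArithOp.eval, Function.update_apply, h80]
    · have := h.2.reg y (by omega)
      simp [ArithOp.eval, Function.update_apply, h80, hy', this, h1 y hy]
  · have h80 := h.1.reg 0 (by rw [Prog.callRegs]; omega)
    simp [ArithOp.cost, h80]
    omega
  · omega

/-! ## Sparsification of set families -/

namespace Sparsify

variable {α : Type*} [DecidableEq α]

/-- The set `a` meets all members of `F`. -/
def Hits (a : Set α) (F : Finset (Finset α)) : Prop := ∀ C ∈ F, ∃ l ∈ C, l ∈ a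

/-- The inclusion-minimal members of `F`. -/
def minSets (F : Finset (Finset α)) : Finset (Finset α) :=
  F.filter fun C => ∀ D ∈ F, D ⊆ C → D = C

/-- The minimal members of size `c` that contain `H`. -/
def flower (F : Finset (Finset α)) (c : ℕ) (H : Finset α) : Finset (Finset α) :=
  (minSets F).filter fun C => C.card = c ∧ H ⊆ C

/-- There is no sunflower with petals of size `i` and at least `θ i` members of size `≤ k`. -/
def Saturated (k : ℕ) (θ : ℕ → ℕ) (F : Finset (Finset α)) : Prop :=
  ∀ c i : ℕ, ∀ H : Finset α, 1 ≤ i → i < c → c ≤ k → H.card + i = c → (flower F c H).card < θ i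

/-- A sunflower with heart `H`, members of size `c` and petals of size `i`, where `(c, i)` is
lexicographically minimal. The family `G` consists of `θ i` of its members. -/
structure Sunflower (k : ℕ) (θ : ℕ → ℕ) (F : Finset (Finset α)) (c i : ℕ) (H : Finset α)
    (G : Finset (Finset α)) : Prop where
  one_le : 1 ≤ i
  lt : i < c
  le : c ≤ k
  card_heart : H.card + i = c
  sub : G ⊆ flower F c H
  card : G.card = θ i
  min : ∀ c' i' : ℕ, ∀ H' : Finset α, 1 ≤ i' → i' < c' → H'.card + i' = c' →
    (c' < c ∨ c' = c ∧ i' < i) → (flower F c' H').card < θ i'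

variable {k : ℕ} {θ : ℕ → ℕ} {F N Add : Finset (Finset α)} {U : Finset α}

theorem mem_minSets {C : Finset α} : C ∈ minSets F ↔ C ∈ F ∧ ∀ D ∈ F, D ⊆ C → D = C := by
  simp [minSets]

theorem mem_flower {c : ℕ} {H C : Finset α} :
    C ∈ flower F c H ↔ C ∈ minSets F ∧ C.card = c ∧ H ⊆ C := by
  simp [flower]

/-- The bookkeeping of the sparsification process: `Add` are the sets that were added so far, and
`ones` counts the steps in which petals were added. -/
structure Inv (k : ℕ) (θ : ℕ → ℕ) (U : Finset α) (F Add : Finset (Finset α)) (ones : ℕ) :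
    Prop where
  sub_univ : ∀ C ∈ F, C ⊆ U
  add_sub : Add ⊆ F
  card_add : ∀ C ∈ Add, 1 ≤ C.card ∧ C.card < k
  degree : ∀ i j : ℕ, ∀ H : Finset α, 1 ≤ j → j < i → H.card + j = i →
    (flower F i H ∩ Add).card ≤ 2 * θ j
  killed : ∀ i, ((Add.filter fun C => C.card = i) \ minSets F).card ≤
    ∑ D ∈ Add.filter (fun D => D.card < i), 2 * θ (i - D.card)
  ones_le : (ones : ℚ) ≤ ∑ C ∈ Add, (1 / θ C.card : ℚ)

theorem Inv.init (hF : ∀ C ∈ F, C ⊆ U) : Inv k θ U F ∅ 0 where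
  sub_univ := hF
  add_sub := by simp
  card_add := by simp
  degree := by simp
  killed := by simp
  ones_le := by simp

/-- Since no new set contains an old one and all new sets have the same size, every new set is
minimal, and the degree count can grow only in size `i₀`. An added set that stops being minimal
contains some new `D`, so it belongs to the flower of `D`. The degree bound limits these sets by `2
* θ (i - D.card)`, which is what `D` contributes to the sum in `killed`. -/
theorem Inv.union {i₀ ones : ℕ} {b : Bool} (h : Inv k θ U F Add ones)
    (hcard : ∀ D ∈ N, D.card = i₀) (hi₀ : 1 ≤ i₀) (hi₀k : i₀ < k) (hU : ∀ D ∈ N, D ⊆ U)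
    (hnew : ∀ D ∈ N, ∀ E ∈ F, ¬ E ⊆ D)
    (hdeg : ∀ j : ℕ, ∀ H : Finset α, 1 ≤ j → j < i₀ → H.card + j = i₀ →
      (flower F i₀ H).card + (N.filter fun D => H ⊆ D).card ≤ 2 * θ j)
    (hθ : 0 < θ i₀) (hb : b = true → θ i₀ ≤ N.card) :
    Inv k θ U (F ∪ N) (Add ∪ N) (ones + b.toNat) := by
  have hdisj : Disjoint Add N := by
    rw [Finset.disjoint_left]
    exact fun C hC hN => hnew C hN C (h.add_sub hC) subset_rfl
  have hmin : ∀ C ∈ F, C ∈ minSets (F ∪ N) → C ∈ minSets F := fun C hC hm =>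
    mem_minSets.2 ⟨hC, fun D hD => (mem_minSets.1 hm).2 D (Finset.mem_union_left _ hD)⟩
  have hNmin : ∀ D ∈ N, D ∈ minSets (F ∪ N) := fun D hD => by
    refine mem_minSets.2 ⟨Finset.mem_union_right _ hD, fun E hE hED => ?_⟩
    rcases Finset.mem_union.1 hE with hE | hE
    · exact absurd hED (hnew D hD E hE)
    · exact Finset.eq_of_subset_of_card_le hED (by rw [hcard D hD, hcard E hE])
  refine ⟨?_, Finset.union_subset_union h.add_sub subset_rfl, ?_, ?_, ?_, ?_⟩
  · intro C hC
    rcases Finset.mem_union.1 hC with hC | hC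
    exacts [h.sub_univ C hC, hU C hC]
  · intro C hC
    rcases Finset.mem_union.1 hC with hC | hC
    · exact h.card_add C hC
    · rw [hcard C hC]; exact ⟨hi₀, hi₀k⟩
  · intro i j H hj hji hH
    have hsub : flower (F ∪ N) i H ∩ (Add ∪ N) ⊆
        (flower F i H ∩ Add) ∪ (N.filter fun D => D.card = i ∧ H ⊆ D) := by
      intro C hC
      simp only [Finset.mem_inter, Finset.mem_union, mem_flower, Finset.mem_filter] at hC ⊢
      obtain ⟨⟨h1, h2, h3⟩, h4 | h4⟩ := hC
      · exact Or.inl ⟨⟨hmin C (h.add_sub h4) h1, h2, h3⟩, h4⟩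
      · exact Or.inr ⟨h4, h2, h3⟩
    refine (Finset.card_le_card hsub).trans ((Finset.card_union_le _ _).trans ?_)
    by_cases hii : i = i₀
    · subst hii
      refine le_trans (Nat.add_le_add (Finset.card_le_card Finset.inter_subset_left)
        (Finset.card_le_card ?_)) (hdeg j H hj hji hH)
      intro C
      simp +contextual
    · have : (N.filter fun D => D.card = i ∧ H ⊆ D) = ∅ := by
        rw [Finset.filter_eq_empty_iff]
        rintro D hD ⟨h1, -⟩
        exact hii (h1.symm.trans (hcard D hD))
      rw [this, Finset.card_empty, add_zero]
      exact h.degree i j H hj hji hH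
  · intro i
    have hsub : ((Add ∪ N).filter fun C => C.card = i) \ minSets (F ∪ N) ⊆
        ((Add.filter fun C => C.card = i) \ minSets F) ∪
          (N.filter fun D => D.card < i).biUnion fun D => flower F i D ∩ Add := by
      intro C hC
      simp only [Finset.mem_sdiff, Finset.mem_union, Finset.mem_filter, Finset.mem_biUnion,
        Finset.mem_inter] at hC ⊢
      obtain ⟨⟨hCA | hCN, hi⟩, hnm⟩ := hC
      · by_cases hm : C ∈ minSets F
        · right
          rw [mem_minSets] at hnm
          push Not at hnm
          obtain ⟨E, hE, hEC, hne⟩ := hnm (Finset.mem_union_left _ (h.add_sub hCA))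
          rcases Finset.mem_union.1 hE with hE | hE
          · exact absurd ((mem_minSets.1 hm).2 E hE hEC) hne
          · refine ⟨E, ⟨hE, ?_⟩, mem_flower.2 ⟨hm, hi, hEC⟩, hCA⟩
            rw [← hi]
            exact Finset.card_lt_card (hEC.ssubset_of_ne hne)
        · exact Or.inl ⟨⟨hCA, hi⟩, hm⟩
      · exact absurd (hNmin C hCN) hnm
    refine (Finset.card_le_card hsub).trans ((Finset.card_union_le _ _).trans ?_)
    rw [Finset.filter_union, Finset.sum_union (Finset.disjoint_filter_filter hdisj)]
    refine Nat.add_le_add (h.killed i) (Finset.card_biUnion_le.trans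
      (Finset.sum_le_sum fun D hD => ?_))
    rw [Finset.mem_filter] at hD
    exact h.degree i (i - D.card) D (by omega) (by have := hcard D hD.1; omega) (by omega)
  · rw [Finset.sum_union hdisj]
    push_cast
    refine add_le_add h.ones_le ?_
    rw [Finset.sum_congr rfl fun D hD => by rw [hcard D hD], Finset.sum_const, nsmul_eq_mul]
    cases b with
    | false => simpa using by positivity
    | true =>
      have := hb rfl
      rw [mul_one_div, le_div_iff₀ (by exact_mod_cast hθ)]
      simpa using this

/-! ### The two branches of a sparsification step -/

theorem Sunflower.heart_props {c i : ℕ} {H : Finset α} {G : Finset (Finset α)}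
    (hs : Sunflower k θ F c i H G) (hθ : ∀ i, 0 < θ i) :
    ∃ C ∈ minSets F, C.card = c ∧ H ⊆ C := by
  have : 0 < G.card := by rw [hs.card]; exact hθ i
  obtain ⟨C, hC⟩ := Finset.card_pos.1 this
  exact ⟨C, mem_flower.1 (hs.sub hC)⟩

/-- The heart is smaller than `c`, so by lexicographic minimality all flowers of its size are below
the threshold, and one further set keeps the degrees below `2 * θ j`. The heart contains no member
of the family, since such a member would be a proper subset of a minimal set. -/
theorem Sunflower.inv_heart {c i ones : ℕ} {H : Finset α} {G : Finset (Finset α)}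
    (hs : Sunflower k θ F c i H G) (hθ : ∀ i, 0 < θ i) (h : Inv k θ U F Add ones) :
    Inv k θ U (insert H F) (Add ∪ {H}) ones ∧ H ∉ Add := by
  obtain ⟨C, hC, hCc, hHC⟩ := hs.heart_props hθ
  have h1 := hs.one_le
  have h2 := hs.lt
  have h3 := hs.le
  have h4 := hs.card_heart
  have hnew : ∀ E ∈ F, ¬ E ⊆ H := fun E hE hEH => by
    have := (mem_minSets.1 hC).2 E hE (hEH.trans hHC)
    subst this
    have := Finset.card_le_card hEH
    omega
  refine ⟨?_, fun hA => hnew H (h.add_sub hA) subset_rfl⟩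
  have := Inv.union (N := {H}) (i₀ := H.card) (b := false) h (by simp) (by omega) (by omega)
    (by simpa using hHC.trans (h.sub_univ C (mem_minSets.1 hC).1)) (by simpa using hnew) ?_
    (hθ _) (by simp)
  · simpa [Finset.union_comm] using this
  · intro j H' hj hjH hH'
    have a1 := hs.min H.card j H' hj hjH hH' (Or.inl (by omega))
    have a2 : (({H} : Finset (Finset α)).filter fun D => H' ⊆ D).card ≤ 1 :=
      (Finset.card_filter_le _ _).trans (by simp)
    omega

/-- The flowers of size `i < c` are below the threshold by minimality in `c`. The petals that
contain `H'` come from members containing `H ∪ H'`, which form a flower of the same size `c` with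
smaller petals, so there are at most `θ j` of them by minimality in `i`. Taking exactly `θ i` petals
pays for the increment of `ones`. -/
theorem Sunflower.inv_petals {c i ones : ℕ} {H : Finset α} {G : Finset (Finset α)}
    (hs : Sunflower k θ F c i H G) (hθ : ∀ i, 0 < θ i) (h : Inv k θ U F Add ones) :
    Inv k θ U (F ∪ G.image (· \ H)) (Add ∪ G.image (· \ H)) (ones + 1) ∧
      Add.card < (Add ∪ G.image (· \ H)).card := by
  have h1 := hs.one_le
  have h2 := hs.lt
  have h3 := hs.le
  have h4 := hs.card_heart
  have hG : ∀ C ∈ G, C ∈ minSets F ∧ C.card = c ∧ H ⊆ C := fun C hC => mem_flower.1 (hs.sub hC)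
  have hinj : Set.InjOn (· \ H) (G : Set (Finset α)) := by
    intro C hC D hD hCD
    have hCD' : C \ H = D \ H := hCD
    rw [← Finset.sdiff_union_of_subset (hG C hC).2.2, hCD',
      Finset.sdiff_union_of_subset (hG D hD).2.2]
  have hcardN : (G.image (· \ H)).card = θ i := by
    rw [Finset.card_image_of_injOn hinj, hs.card]
  have hnew : ∀ D ∈ G.image (· \ H), ∀ E ∈ F, ¬ E ⊆ D := by
    intro D hD E hE hED
    obtain ⟨C, hC, rfl⟩ := Finset.mem_image.1 hD
    -- A member contained in the petal would be the minimal set `C` itself, but `C` also contains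
    -- the nonempty heart, which the petal avoids.
    have hEC := (mem_minSets.1 (hG C hC).1).2 E hE (hED.trans Finset.sdiff_subset)
    subst hEC
    have hHne : H.Nonempty := Finset.card_pos.1 (by omega)
    obtain ⟨x, hx⟩ := hHne
    have := hED ((hG E hC).2.2 hx)
    simp [hx] at this
  refine ⟨?_, ?_⟩
  · refine Inv.union (i₀ := i) (b := true) h ?_ h1 (by omega) ?_ hnew ?_ (hθ _)
      (fun _ => hcardN.ge)
    · intro D hD
      obtain ⟨C, hC, rfl⟩ := Finset.mem_image.1 hD
      rw [Finset.card_sdiff_of_subset (hG C hC).2.2, (hG C hC).2.1]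
      omega
    · intro D hD
      obtain ⟨C, hC, rfl⟩ := Finset.mem_image.1 hD
      exact Finset.sdiff_subset.trans (h.sub_univ C (mem_minSets.1 (hG C hC).1).1)
    · intro j H' hj hji hH'
      have a1 := hs.min i j H' hj hji hH' (Or.inl (by omega))
      have a2 : ((G.image (· \ H)).filter fun D => H' ⊆ D).card ≤ θ j := by
        rcases ((G.image (· \ H)).filter fun D => H' ⊆ D).eq_empty_or_nonempty with he | ⟨D₀, hD₀⟩
        · rw [he]; simp
        · rw [Finset.mem_filter] at hD₀
          have hdis : Disjoint H H' := by
            obtain ⟨C, hC, rfl⟩ := Finset.mem_image.1 hD₀.1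
            exact (Finset.disjoint_of_subset_left hD₀.2 Finset.sdiff_disjoint).symm
          have a3 := hs.min c j (H ∪ H') hj (by omega)
            (by rw [Finset.card_union_of_disjoint hdis]; omega) (Or.inr ⟨rfl, hji⟩)
          refine le_trans ?_ a3.le
          refine Finset.card_le_card_of_injOn (fun D => D ∪ H) ?_ ?_
          · intro D hD
            simp only [Finset.coe_filter, Set.mem_ofPred_eq] at hD
            obtain ⟨C, hC, rfl⟩ := Finset.mem_image.1 hD.1
            simp only [Finset.sdiff_union_of_subset (hG C hC).2.2]
            exact mem_flower.2 ⟨(hG C hC).1, (hG C hC).2.1,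
              Finset.union_subset (hG C hC).2.2 (hD.2.trans Finset.sdiff_subset)⟩
          · intro D hD E hE hDE
            simp only [Finset.coe_filter, Set.mem_ofPred_eq] at hD hE
            obtain ⟨C, hC, rfl⟩ := Finset.mem_image.1 hD.1
            obtain ⟨C', hC', rfl⟩ := Finset.mem_image.1 hE.1
            simp only [Finset.sdiff_union_of_subset (hG C hC).2.2,
              Finset.sdiff_union_of_subset (hG C' hC').2.2] at hDE
            rw [hDE]
      omega
  · have hdisj : Disjoint Add (G.image (· \ H)) := by
      rw [Finset.disjoint_left]
      exact fun C hC hN => hnew C hN C (h.add_sub hC) subset_rfl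
    rw [Finset.card_union_of_disjoint hdisj, hcardN]
    have := hθ i
    omega

section Bounds

variable {β : ℕ → ℕ} {A ones : ℕ}

/-- Strong induction on the size. Those added sets that are still minimal are counted through one of
their elements, at most `2 * θ (i - 1)` for each. The others are charged to smaller added sets,
whose number is known by induction. The recursion for `β` sums up precisely these two contributions.
-/
theorem Inv.card_add_le (h : Inv k θ U F Add ones) (hβ1 : 1 ≤ β 1)
    (hβ : ∀ i, 2 ≤ i → 2 * θ (i - 1) + ∑ j ∈ Finset.Ico 1 i, β j * (2 * θ (i - j)) ≤ β i)
    (i : ℕ) (hi : 1 ≤ i) : (Add.filter fun C => C.card = i).card ≤ β i * U.card := by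
  induction i using Nat.strong_induction_on with
  | _ i ih =>
    rcases hi.lt_or_eq with hi2 | rfl
    · have hsplit : (Add.filter fun C => C.card = i).card ≤
          (U.biUnion fun l => flower F i {l} ∩ Add).card +
            ((Add.filter fun C => C.card = i) \ minSets F).card := by
        refine (Finset.card_le_card ?_).trans (Finset.card_union_le _ _)
        intro C hC
        rw [Finset.mem_filter] at hC
        by_cases hm : C ∈ minSets F
        · refine Finset.mem_union_left _ (Finset.mem_biUnion.2 ?_)
          obtain ⟨l, hl⟩ := Finset.card_pos.1 (show 0 < C.card by omega)
          exact ⟨l, h.sub_univ C (h.add_sub hC.1) hl, Finset.mem_inter.2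
            ⟨mem_flower.2 ⟨hm, hC.2, by simpa using hl⟩, hC.1⟩⟩
        · exact Finset.mem_union_right _ (Finset.mem_sdiff.2 ⟨Finset.mem_filter.2 hC, hm⟩)
      have h1 : (U.biUnion fun l => flower F i {l} ∩ Add).card ≤ 2 * θ (i - 1) * U.card := by
        refine Finset.card_biUnion_le.trans ((Finset.sum_le_card_nsmul _ _ (2 * θ (i - 1))
          fun l _ => h.degree i (i - 1) {l} (by omega) (by omega) (by simp; omega)).trans ?_)
        rw [smul_eq_mul, mul_comm]
      have h2 : ∑ D ∈ Add.filter (fun D => D.card < i), 2 * θ (i - D.card) ≤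
          (∑ j ∈ Finset.Ico 1 i, β j * (2 * θ (i - j))) * U.card := by
        have hmaps : ∀ D ∈ Add.filter (fun D => D.card < i), D.card ∈ Finset.Ico 1 i := by
          intro D hD
          rw [Finset.mem_filter] at hD
          exact Finset.mem_Ico.2 ⟨(h.card_add D hD.1).1, hD.2⟩
        rw [← Finset.sum_fiberwise_of_maps_to hmaps, Finset.sum_mul]
        refine Finset.sum_le_sum fun j hj => ?_
        rw [Finset.mem_Ico] at hj
        rw [Finset.sum_congr rfl (g := fun _ => 2 * θ (i - j)) fun D hD => by
          rw [(Finset.mem_filter.1 hD).2], Finset.sum_const, smul_eq_mul]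
        have h3 : ((Add.filter fun D => D.card < i).filter fun D => D.card = j).card ≤
            β j * U.card := (Finset.card_le_card (by
          intro D; simp only [Finset.mem_filter]; tauto)).trans (ih j hj.2 hj.1)
        nlinarith [Nat.mul_le_mul_right (2 * θ (i - j)) h3]
      have h3 := h.killed i
      have h4 := Nat.mul_le_mul_right U.card (hβ i hi2)
      rw [add_mul] at h4
      omega
    · have : (Add.filter fun C => C.card = 1) ⊆ U.image fun l => {l} := by
        intro C hC
        rw [Finset.mem_filter] at hC
        obtain ⟨l, rfl⟩ := Finset.card_eq_one.1 hC.2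
        exact Finset.mem_image.2 ⟨l, h.sub_univ _ (h.add_sub hC.1) (by simp), rfl⟩
      refine (Finset.card_le_card this).trans (Finset.card_image_le.trans ?_)
      exact Nat.le_mul_of_pos_left _ hβ1

/-- As long as the family is not saturated each step adds a set, so this bounds the length of the
process by a multiple of the number of literals. -/
theorem Inv.card_le (h : Inv k θ U F Add ones) (hβ1 : 1 ≤ β 1)
    (hβ : ∀ i, 2 ≤ i → 2 * θ (i - 1) + ∑ j ∈ Finset.Ico 1 i, β j * (2 * θ (i - j)) ≤ β i) :
    Add.card ≤ (∑ i ∈ Finset.Ico 1 k, β i) * U.card := by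
  have hmaps : ∀ D ∈ Add, D.card ∈ Finset.Ico 1 k := fun D hD => Finset.mem_Ico.2 (h.card_add D hD)
  rw [Finset.card_eq_sum_card_fiberwise hmaps, Finset.sum_mul]
  exact Finset.sum_le_sum fun i hi => h.card_add_le hβ1 hβ i (Finset.mem_Ico.1 hi).1

/-- A petal step with petals of size `i` adds `A * β i` sets, while at most `β i * U.card` sets of
this size are ever added. So there are at most `U.card / A` such steps for each size below `k`. -/
theorem Inv.mul_ones_le (h : Inv k θ U F Add ones) (hβ1 : 1 ≤ β 1)
    (hβ : ∀ i, 2 ≤ i → 2 * θ (i - 1) + ∑ j ∈ Finset.Ico 1 i, β j * (2 * θ (i - j)) ≤ β i)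
    (hA : 0 < A) (hθ : ∀ i, 1 ≤ i → θ i = A * β i) (hβ0 : ∀ i, 0 < β i) :
    A * ones ≤ k * U.card := by
  have hmaps : ∀ D ∈ Add, D.card ∈ Finset.Ico 1 k := fun D hD => Finset.mem_Ico.2 (h.card_add D hD)
  have h1 : ∑ C ∈ Add, (1 / θ C.card : ℚ) ≤ ∑ i ∈ Finset.Ico 1 k, ((U.card : ℚ) / A) := by
    rw [← Finset.sum_fiberwise_of_maps_to hmaps]
    refine Finset.sum_le_sum fun i hi => ?_
    rw [Finset.mem_Ico] at hi
    rw [Finset.sum_congr rfl (g := fun _ => (1 / θ i : ℚ)) fun D hD => by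
      rw [(Finset.mem_filter.1 hD).2], Finset.sum_const, nsmul_eq_mul, hθ i hi.1, mul_one_div]
    have h2 : ((Add.filter fun C => C.card = i).card : ℚ) ≤ β i * U.card := by
      exact_mod_cast h.card_add_le hβ1 hβ i hi.1
    have hβi : (0 : ℚ) < β i := by exact_mod_cast hβ0 i
    have hA' : (0 : ℚ) < A := by exact_mod_cast hA
    push_cast
    rw [div_le_div_iff₀ (by positivity) hA']
    nlinarith
  have h2 := h.ones_le.trans h1
  rw [Finset.sum_const, nsmul_eq_mul, Nat.card_Ico, mul_div_assoc', le_div_iff₀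
    (by exact_mod_cast hA)] at h2
  have h3 : ones * A ≤ (k - 1) * U.card := by exact_mod_cast h2
  calc A * ones = ones * A := mul_comm _ _
    _ ≤ (k - 1) * U.card := h3
    _ ≤ k * U.card := Nat.mul_le_mul_right _ (by omega)

/-- A minimal set with at least two elements belongs to the flower whose heart is any one of its
elements, and saturation bounds these flowers. The empty set and the singletons are counted
separately. -/
theorem Saturated.card_minSets_le (h : Saturated k θ F) (hU : ∀ C ∈ F, C ⊆ U)
    (hk : ∀ C ∈ minSets F, C.card ≤ k) :
    (minSets F).card ≤ 1 + U.card * (1 + ∑ i ∈ Finset.Ico 1 k, θ i) := by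
  have hsub : minSets F ⊆ {∅} ∪ (U.image (fun l => {l}) ∪
      U.biUnion fun l => (Finset.Ico 1 k).biUnion fun i => flower F (i + 1) {l}) := by
    intro C hC
    have hC' := mem_minSets.1 hC
    rcases Nat.lt_trichotomy C.card 1 with h1 | h1 | h1
    · refine Finset.mem_union_left _ ?_
      have : C.card = 0 := by omega
      simpa using this
    · obtain ⟨l, rfl⟩ := Finset.card_eq_one.1 h1
      refine Finset.mem_union_right _ (Finset.mem_union_left _ (Finset.mem_image.2 ⟨l, ?_, rfl⟩))
      exact hU _ hC'.1 (by simp)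
    · refine Finset.mem_union_right _ (Finset.mem_union_right _ (Finset.mem_biUnion.2 ?_))
      obtain ⟨l, hl⟩ := Finset.card_pos.1 (show 0 < C.card by omega)
      have := hk C hC
      exact ⟨l, hU C hC'.1 hl, Finset.mem_biUnion.2 ⟨C.card - 1, Finset.mem_Ico.2 (by omega),
        mem_flower.2 ⟨hC, by omega, by simpa using hl⟩⟩⟩
  refine (Finset.card_le_card hsub).trans ((Finset.card_union_le _ _).trans ?_)
  refine Nat.add_le_add (by simp) ((Finset.card_union_le _ _).trans ?_)
  rw [mul_add, mul_one]
  refine Nat.add_le_add Finset.card_image_le (Finset.card_biUnion_le.trans ?_)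
  rw [← smul_eq_mul]
  refine Finset.sum_le_card_nsmul _ _ _ fun l _ => Finset.card_biUnion_le.trans
    (Finset.sum_le_sum fun i hi => ?_)
  rw [Finset.mem_Ico] at hi
  exact (h (i + 1) i {l} hi.1 (by omega) (by omega) (by simp; omega)).le

end Bounds

/-- The state after `n` steps with choice bits `w`. -/
def runBits {σ : Type*} (next : ℕ → σ → Bool → σ) (x : σ) (w : ℕ → Bool) : ℕ → σ
  | 0 => x
  | n + 1 => next n (runBits next x w n) (w n)

theorem runBits_congr {σ : Type*} (next : ℕ → σ → Bool → σ) (x : σ) {w w' : ℕ → Bool} {n : ℕ}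
    (h : ∀ j < n, w j = w' j) : runBits next x w n = runBits next x w' n := by
  induction n with
  | zero => rfl
  | succ n ih => rw [runBits, runBits, ih fun j hj => h j (by omega), h n (by omega)]

/-- A hitting set guides the sparsification process to a saturated family that it hits. -/
theorem exists_guided_path {σ : Type*} {β : ℕ → ℕ} {A S : ℕ} (fam : σ → Finset (Finset α))
    (next : ℕ → σ → Bool → σ) (P : ℕ → σ → Prop)
    (hP : ∀ s < S, ∀ x b, P s x → P (s + 1) (next s x b))
    (hsat : ∀ s < S, ∀ x b, P s x → Saturated k θ (fam x) → fam (next s x b) = fam x)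
    (hsun : ∀ s < S, ∀ x, P s x → ¬ Saturated k θ (fam x) → ∃ c i H G,
      Sunflower k θ (fam x) c i H G ∧ fam (next s x false) = insert H (fam x) ∧
        fam (next s x true) = fam x ∪ G.image (· \ H))
    {x : σ} (hx : P 0 x) (hU : ∀ C ∈ fam x, C ⊆ U) {a : Set α} (ha : Hits a (fam x))
    (hA : 0 < A) (hθ : ∀ i, 1 ≤ i → θ i = A * β i) (hβ0 : ∀ i, 0 < β i) (hθ0 : ∀ i, 0 < θ i)
    (hβ : ∀ i, 2 ≤ i → 2 * θ (i - 1) + ∑ j ∈ Finset.Ico 1 i, β j * (2 * θ (i - j)) ≤ β i)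
    (hS : (∑ i ∈ Finset.Ico 1 k, β i) * U.card < S) :
    ∃ w : ℕ → Bool, Hits a (fam (runBits next x w S)) ∧ Saturated k θ (fam (runBits next x w S)) ∧
      A * ((Finset.range S).filter fun s => w s = true).card ≤ k * U.card := by
  -- Either the process is already saturated, after which nothing changes, or every step so far has
  -- added a new set. The second alternative contradicts the bound on the number of added sets at `n
  -- = S`.
  have key : ∀ n ≤ S, ∃ w : ℕ → Bool, P n (runBits next x w n) ∧
      Hits a (fam (runBits next x w n)) ∧ ∃ Add,
        Inv k θ U (fam (runBits next x w n)) Add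
          ((Finset.range n).filter fun s => w s = true).card ∧
        (Saturated k θ (fam (runBits next x w n)) ∨ n ≤ Add.card) := by
    intro n
    induction n with
    | zero => exact fun _ => ⟨fun _ => false, hx, ha, ∅, by simpa [runBits] using Inv.init hU, by simp⟩
    | succ n ih =>
      intro hn
      obtain ⟨w, hw, hwa, Add, hI, hor⟩ := ih (by omega)
      set y := runBits next x w n with hy
      have hext : ∀ b : Bool, runBits next x (Function.update w n b) (n + 1) = next n y b := by
        intro b
        rw [runBits, Function.update_self, hy]
        congr 1
        exact runBits_congr _ _ fun j hj => by rw [Function.update_of_ne (by omega)]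
      have hcount : ∀ b : Bool, ((Finset.range (n + 1)).filter fun s =>
          Function.update w n b s = true).card =
            ((Finset.range n).filter fun s => w s = true).card + b.toNat := by
        intro b
        have h0 : ((Finset.range n).filter fun s => Function.update w n b s = true) =
            ((Finset.range n).filter fun s => w s = true) := by
          refine Finset.filter_congr fun s hs => ?_
          rw [Function.update_of_ne (by have := Finset.mem_range.1 hs; omega)]
        rw [Finset.range_add_one, Finset.filter_insert, h0]
        cases b <;> simp
      have hPn : ∀ b, P (n + 1) (next n y b) := fun b => hP n (by omega) y b hw
      by_cases hs : Saturated k θ (fam y)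
      · have e := hsat n (by omega) y false hw hs
        refine ⟨Function.update w n false, ?_, ?_, Add, ?_, ?_⟩
        · rw [hext]; exact hPn _
        · rw [hext, e]; exact hwa
        · rw [hext, e, hcount]; simpa using hI
        · rw [hext, e]; exact Or.inl hs
      · obtain ⟨c, i, H, G, hsf, e0, e1⟩ := hsun n (by omega) y hw hs
        have hnA := hor.resolve_left hs
        -- The hitting set dictates the branch. If it misses the heart, it meets every member of the
        -- sunflower outside the heart and thus hits all petals.
        by_cases hH : ∃ l ∈ H, l ∈ a
        · obtain ⟨hI', hnot⟩ := hsf.inv_heart hθ0 hI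
          refine ⟨Function.update w n false, ?_, ?_, Add ∪ {H}, ?_, Or.inr ?_⟩
          · rw [hext]; exact hPn _
          · rw [hext, e0]
            intro C hC
            rcases Finset.mem_insert.1 hC with rfl | hC
            exacts [hH, hwa C hC]
          · rw [hext, e0, hcount]; simpa using hI'
          · rw [Finset.card_union_of_disjoint (by simpa using hnot), Finset.card_singleton]
            omega
        · obtain ⟨hI', hlt⟩ := hsf.inv_petals hθ0 hI
          refine ⟨Function.update w n true, ?_, ?_, _, ?_, Or.inr (hnA.trans_lt hlt)⟩
          · rw [hext]; exact hPn _
          · rw [hext, e1]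
            intro C hC
            rcases Finset.mem_union.1 hC with hC | hC
            · exact hwa C hC
            · obtain ⟨D, hD, rfl⟩ := Finset.mem_image.1 hC
              obtain ⟨l, hl, hla⟩ := hwa D (mem_minSets.1 (mem_flower.1 (hsf.sub hD)).1).1
              exact ⟨l, Finset.mem_sdiff.2 ⟨hl, fun hlH => hH ⟨l, hlH, hla⟩⟩, hla⟩
          · rw [hext, e1, hcount]; simpa using hI'
  obtain ⟨w, -, hwa, Add, hI, hor⟩ := key S le_rfl
  refine ⟨w, hwa, hor.resolve_right fun h => ?_, hI.mul_ones_le (hβ0 1) hβ hA hθ hβ0⟩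
  exact absurd (hI.card_le (hβ0 1) hβ) (by omega)

end Sparsify

/-! ## Coding of sparse bit strings

A number `r < M` is decoded to a bit string: the fraction `2 ^ (-b)` of the codes has first bit `1`. -/

namespace Sparsify

/-- The first bit that the code `x = (r, M)` stands for. -/
def codeBit (b : ℕ) (x : ℕ × ℕ) : Bool := decide (x.1 < x.2 / 2 ^ b)

/-- The code of the remaining bits. -/
def codeNext (b : ℕ) (x : ℕ × ℕ) : ℕ × ℕ :=
  if x.1 < x.2 / 2 ^ b then (x.1, x.2 / 2 ^ b) else (x.1 - x.2 / 2 ^ b, x.2 - x.2 / 2 ^ b)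

/-- Arithmetic coding with integer rounding. A bit `1` reduces the number of codes from `M` to `⌊M /
2 ^ b⌋`, which is at least `M / 2 ^ (b + 1)`. A bit `0` leaves at least `(1 - 2 ^ (-b)) * M`, and `1
- x ≥ exp (-2 * x)` for `x ≤ 1 / 2`. The leading factor `2 ^ b` guarantees `M ≥ 2 ^ b` throughout,
so the quotient never vanishes. -/
theorem exists_code_real {b : ℕ} (hb : 1 ≤ b) (S : ℕ) (w : ℕ → Bool) (M : ℕ)
    (hM : (2 : ℝ) ^ b * 2 ^ ((b + 1) * ((Finset.range S).filter fun s => w s = true).card) *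
      Real.exp (2 * S / 2 ^ b) ≤ M) :
    ∃ r < M, ∀ s < S, codeBit b ((codeNext b)^[s] (r, M)) = w s := by
  induction S generalizing w M with
  | zero =>
    refine ⟨0, ?_, by simp⟩
    have : (0 : ℝ) < M := lt_of_lt_of_le (by positivity) hM
    exact_mod_cast this
  | succ S ih =>
    set q := M / 2 ^ b with hq
    have hcount : ((Finset.range (S + 1)).filter fun s => w s = true).card =
        ((Finset.range S).filter fun s => w (s + 1) = true).card + (w 0).toNat := by
      rw [Finset.card_filter, Finset.sum_range_succ', Finset.card_filter]
      cases w 0 <;> simp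
    set o := ((Finset.range S).filter fun s => w (s + 1) = true).card with ho
    rw [hcount] at hM
    have hbpos : (0 : ℝ) < 2 ^ b := by positivity
    have hbig : (2 : ℝ) ^ b ≤ M := by
      refine le_trans ?_ hM
      rw [mul_assoc]
      refine le_mul_of_one_le_right hbpos.le (one_le_mul_of_one_le_of_one_le
        (one_le_pow₀ (by norm_num)) (Real.one_le_exp (by positivity)))
    have hbig' : 2 ^ b ≤ M := by exact_mod_cast hbig
    have hq1 : 1 ≤ q := Nat.div_pos hbig' (by positivity)
    have hqle : q * 2 ^ b ≤ M := Nat.div_mul_le_self _ _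
    have hqlt : M < (q + 1) * 2 ^ b := by
      rw [hq, mul_comm]; exact Nat.lt_mul_div_succ M (by positivity)
    have hexp : Real.exp (2 * S / 2 ^ b) ≤ Real.exp (2 * (S + 1 : ℕ) / 2 ^ b) := by
      refine Real.exp_le_exp.2 (div_le_div_of_nonneg_right ?_ hbpos.le)
      push_cast; linarith
    cases hw : w 0 with
    | true =>
      rw [hw] at hM
      have hM' : (2 : ℝ) ^ b * 2 ^ ((b + 1) * o) * Real.exp (2 * S / 2 ^ b) ≤ (q : ℕ) := by
        have h1 : (M : ℝ) ≤ q * 2 ^ (b + 1) := by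
          have : M ≤ q * 2 ^ (b + 1) := by rw [pow_succ]; nlinarith
          exact_mod_cast this
        have h2 : (2 : ℝ) ^ b * 2 ^ ((b + 1) * (o + true.toNat)) *
            Real.exp (2 * (S + 1 : ℕ) / 2 ^ b) =
            (2 ^ b * 2 ^ ((b + 1) * o) * Real.exp (2 * (S + 1 : ℕ) / 2 ^ b)) * 2 ^ (b + 1) := by
          simp only [Bool.toNat_true, mul_add, mul_one, pow_add]; ring
        rw [h2] at hM
        have h3 := le_of_mul_le_mul_right (hM.trans h1) (by positivity)
        exact le_trans (mul_le_mul_of_nonneg_left hexp (by positivity)) h3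
      obtain ⟨r, hr, hs⟩ := ih (fun s => w (s + 1)) q hM'
      refine ⟨r, by nlinarith [Nat.div_le_self M (2 ^ b)], fun s hsS => ?_⟩
      cases s with
      | zero => simp [codeBit, hw, ← hq, hr]
      | succ s =>
        have : codeNext b (r, M) = (r, q) := by simp [codeNext, ← hq, hr]
        rw [Function.iterate_succ_apply, this]
        exact hs s (by omega)
    | false =>
      rw [hw] at hM
      have hM' : (2 : ℝ) ^ b * 2 ^ ((b + 1) * o) * Real.exp (2 * S / 2 ^ b) ≤ (M - q : ℕ) := by
        have hqM : q ≤ M := Nat.div_le_self _ _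
        rw [Nat.cast_sub hqM]
        set x : ℝ := 1 / 2 ^ b with hx
        have hx0 : 0 < x := by positivity
        have hx1 : x ≤ 1 / 2 := by
          rw [hx]
          refine one_div_le_one_div_of_le (by norm_num) ?_
          calc (2 : ℝ) = 2 ^ 1 := by norm_num
            _ ≤ 2 ^ b := pow_le_pow_right₀ (by norm_num) hb
        have h1 : (q : ℝ) ≤ M * x := by
          rw [hx, mul_one_div, le_div_iff₀ hbpos]
          exact_mod_cast hqle
        have h2 : 1 ≤ (1 - x) * Real.exp (2 * x) := by
          have := Real.add_one_le_exp (2 * x)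
          nlinarith
        have h3 : Real.exp (2 * (S + 1 : ℕ) / 2 ^ b) =
            Real.exp (2 * S / 2 ^ b) * Real.exp (2 * x) := by
          rw [← Real.exp_add, hx]; congr 1; push_cast; ring
        rw [h3] at hM
        simp only [Bool.toNat_false, add_zero] at hM
        set K : ℝ := (2 : ℝ) ^ b * 2 ^ ((b + 1) * o) * Real.exp (2 * S / 2 ^ b) with hK
        have hK0 : 0 ≤ K := by positivity
        have h4 : K * Real.exp (2 * x) ≤ M := by rw [hK, mul_assoc _ (Real.exp _)]; exact hM
        have h5 : K ≤ (1 - x) * (K * Real.exp (2 * x)) := by nlinarith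
        nlinarith
      obtain ⟨r, hr, hs⟩ := ih (fun s => w (s + 1)) (M - q) hM'
      refine ⟨r + q, by omega, fun s hsS => ?_⟩
      cases s with
      | zero => simp [codeBit, hw, ← hq]
      | succ s =>
        have : codeNext b (r + q, M) = (r, M - q) := by simp [codeNext, ← hq]
        rw [Function.iterate_succ_apply, this]
        exact hs s (by omega)

/-- The exponential factor is replaced by a power of two, using that `exp 2 ≤ 8` and that `X` is at
least `S / 2 ^ b`. -/
theorem exists_code {b L S X : ℕ} (hb : 1 ≤ b) (w : ℕ → Bool) (hX : S ≤ 2 ^ b * X)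
    (hL : b + (b + 1) * ((Finset.range S).filter fun s => w s = true).card + 3 * X ≤ L) :
    ∃ r < 2 ^ L, ∀ s < S, codeBit b ((codeNext b)^[s] (r, 2 ^ L)) = w s := by
  refine exists_code_real hb S w (2 ^ L) ?_
  have h1 : Real.exp (2 * S / 2 ^ b) ≤ 2 ^ (3 * X) := by
    have h2 : (2 * S / 2 ^ b : ℝ) ≤ X * 2 := by
      rw [div_le_iff₀ (by positivity)]
      have : (S : ℝ) ≤ 2 ^ b * X := by exact_mod_cast hX
      linarith
    have h3 : Real.exp 2 ≤ 2 ^ 3 := by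
      have := Real.exp_one_lt_d9
      have h4 : Real.exp 2 = Real.exp 1 * Real.exp 1 := by rw [← Real.exp_add]; norm_num
      rw [h4]
      nlinarith [Real.exp_pos 1]
    calc Real.exp (2 * S / 2 ^ b) ≤ Real.exp (X * 2) := Real.exp_le_exp.2 h2
      _ = Real.exp 2 ^ X := by rw [Real.exp_nat_mul]
      _ ≤ (2 ^ 3) ^ X := pow_le_pow_left₀ (Real.exp_pos 2).le h3 X
      _ = 2 ^ (3 * X) := by rw [pow_mul]
  push_cast
  refine le_trans (mul_le_mul_of_nonneg_left h1 (by positivity)) ?_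
  rw [← pow_add, ← pow_add]
  exact pow_le_pow_right₀ (by norm_num) hL

/-- Parameters of the sparsification process for which the choices have short codes. -/
structure Params (k Q : ℕ) where
  θ : ℕ → ℕ
  β : ℕ → ℕ
  A : ℕ
  b : ℕ
  κ : ℕ
  A_pos : 0 < A
  θ_eq : ∀ i, 1 ≤ i → θ i = A * β i
  β_pos : ∀ i, 0 < β i
  θ_pos : ∀ i, 0 < θ i
  β_rec : ∀ i, 2 ≤ i → 2 * θ (i - 1) + ∑ j ∈ Finset.Ico 1 i, β j * (2 * θ (i - j)) ≤ β i
  b_pos : 1 ≤ b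
  code_le : ∀ n ones : ℕ, A * ones ≤ k * (2 * n + 1) →
    ∃ X, (∑ i ∈ Finset.Ico 1 k, β i) * (2 * n + 1) + 1 ≤ 2 ^ b * X ∧
      b + (b + 1) * ones + 3 * X ≤ n / Q + κ

/-- For `j + l = i` with both parts positive, `j² + l² ≤ (i - 1)² + 1`. So every term loses at least
`2 * (i - 1)` in the exponent of `4 * A`, which is enough to absorb the factor `2 * A` and the
number of terms. -/
theorem beta_recursion {A i : ℕ} (hA : 0 < A) (hi : 2 ≤ i) :
    2 * (A * (4 * A) ^ (i - 1) ^ 2) +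
      ∑ j ∈ Finset.Ico 1 i, (4 * A) ^ j ^ 2 * (2 * (A * (4 * A) ^ (i - j) ^ 2)) ≤
        (4 * A) ^ i ^ 2 := by
  obtain ⟨e, rfl⟩ : ∃ e, i = e + 2 := ⟨i - 2, by omega⟩
  have hx : 1 ≤ 4 * A := by omega
  have key : ∀ j ∈ Finset.Ico 1 (e + 2), (4 * A) ^ j ^ 2 * (2 * (A * (4 * A) ^ (e + 2 - j) ^ 2)) ≤
      2 * A * (4 * A) ^ (e ^ 2 + 2 * e + 2) := by
    intro j hj
    rw [Finset.mem_Ico] at hj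
    obtain ⟨l, hl⟩ : ∃ l, e + 2 = j + l := ⟨e + 2 - j, by omega⟩
    have h1 : e + 2 - j = l := by omega
    have h2 : j ^ 2 + l ^ 2 ≤ e ^ 2 + 2 * e + 2 := by
      have : (e + 2) ^ 2 = (j + l) ^ 2 := by rw [hl]
      have h3 : j + l ≤ j * l + 1 := by
        obtain ⟨j', rfl⟩ : ∃ j', j = j' + 1 := ⟨j - 1, by omega⟩
        obtain ⟨l', rfl⟩ : ∃ l', l = l' + 1 := ⟨l - 1, by omega⟩
        nlinarith [Nat.zero_le (j' * l')]
      nlinarith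
    rw [h1]
    calc (4 * A) ^ j ^ 2 * (2 * (A * (4 * A) ^ l ^ 2)) = 2 * A * (4 * A) ^ (j ^ 2 + l ^ 2) := by
          rw [pow_add]; ring
      _ ≤ _ := Nat.mul_le_mul_left _ (Nat.pow_le_pow_right hx h2)
  have h0 : 2 * (A * (4 * A) ^ (e + 2 - 1) ^ 2) ≤ 2 * A * (4 * A) ^ (e ^ 2 + 2 * e + 2) := by
    rw [← mul_assoc]
    refine Nat.mul_le_mul_left _ (Nat.pow_le_pow_right hx ?_)
    rw [show e + 2 - 1 = e + 1 by omega]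
    nlinarith
  have hsum := Finset.sum_le_card_nsmul _ _ _ key
  rw [Nat.card_Ico, smul_eq_mul] at hsum
  have h5 : (e + 2) * (2 * A) ≤ (4 * A) ^ (2 * e + 2) := by
    have h6 : e + 2 ≤ 4 ^ (e + 1) := (Nat.lt_pow_self (n := e + 1) (a := 4) (by norm_num))
    calc (e + 2) * (2 * A) ≤ 4 ^ (e + 1) * (4 * A) := Nat.mul_le_mul h6 (by omega)
      _ ≤ (4 * A) ^ (e + 1) * (4 * A) ^ (e + 1) := Nat.mul_le_mul
          (Nat.pow_le_pow_left (by omega) _) (Nat.le_self_pow (by omega) _)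
      _ = _ := by rw [← pow_add]; congr 1; omega
  have h7 : (4 * A) ^ (e + 2) ^ 2 = (4 * A) ^ (2 * e + 2) * (4 * A) ^ (e ^ 2 + 2 * e + 2) := by
    rw [← pow_add]; congr 1; ring
  rw [h7]
  have h8 := Nat.mul_le_mul_right ((4 * A) ^ (e ^ 2 + 2 * e + 2)) h5
  have h9 : (e + 2) * (2 * A) * (4 * A) ^ (e ^ 2 + 2 * e + 2) =
      2 * A * (4 * A) ^ (e ^ 2 + 2 * e + 2) +
        (e + 2 - 1) * (2 * A * (4 * A) ^ (e ^ 2 + 2 * e + 2)) := by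
    rw [show e + 2 - 1 = e + 1 by omega]; ring
  omega

theorem exists_polynomial_lt_two_pow (c₁ c₂ e : ℕ) : ∃ b ≥ 1, c₁ * (c₂ * (b + 1)) ^ e + c₁ ≤ 2 ^ b := by
  have h := (tendsto_pow_const_div_const_pow_of_one_lt e (show (1 : ℝ) < 2 by norm_num))
  have h2 := (h.comp (tendsto_add_atTop_nat 1)).eventually
    (gt_mem_nhds (show (0 : ℝ) < 1 / (2 * (c₁ * (c₂ ^ e + 1) + 1)) by positivity))
  obtain ⟨b, hb, hb1⟩ := (h2.and (eventually_ge_atTop 1)).exists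
  refine ⟨b, hb1, ?_⟩
  simp only [Function.comp_apply] at hb
  rw [div_lt_div_iff₀ (by positivity) (by positivity), pow_succ] at hb
  have h3 : ((b + 1 : ℕ) : ℝ) ^ e * (c₁ * (c₂ ^ e + 1) + 1) < 2 ^ b := by linarith
  have h4 : (b + 1) ^ e * (c₁ * (c₂ ^ e + 1) + 1) < 2 ^ b := by exact_mod_cast h3
  have h5 : 1 ≤ (b + 1) ^ e := Nat.one_le_pow _ _ (by omega)
  rw [mul_pow]
  nlinarith [Nat.zero_le (c₁ * c₂ ^ e), Nat.mul_le_mul_left c₁ h5]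

/-- A bit `1` costs `b + 1` bits of the code, so `A` is taken proportional to `Q * k * (b + 1)`. The
bits `0` cost about `n * ∑ β i / 2 ^ b` in total. As `β` is a power of `4 * A` whose exponent
depends on `k` only, this sum is polynomial in `b`, and a large `b` makes the quotient small. -/
theorem exists_params (k Q : ℕ) (hQ : 0 < Q) : Nonempty (Params k Q) := by
  obtain ⟨b, hb1, hb⟩ := exists_polynomial_lt_two_pow (24 * Q * (k + 1)) (4 * (8 * Q * k + 1)) (k ^ 2)
  set A := 8 * Q * k * (b + 1) + 1 with hA
  have hA0 : 0 < A := by omega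
  refine ⟨⟨fun i => A * (4 * A) ^ i ^ 2, fun i => (4 * A) ^ i ^ 2, A, b, b + 5, hA0, fun _ _ => rfl,
    fun _ => by positivity, fun _ => by positivity, fun i hi => beta_recursion hA0 hi, hb1, ?_⟩⟩
  intro n ones hones
  set Sβ := ∑ i ∈ Finset.Ico 1 k, (4 * A) ^ i ^ 2 with hS
  have hSβ : 24 * Q * (Sβ + 1) ≤ 2 ^ b := by
    have h1 : Sβ ≤ k * (4 * A) ^ k ^ 2 := by
      refine (Finset.sum_le_card_nsmul _ _ ((4 * A) ^ k ^ 2) fun i hi => ?_).trans ?_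
      · rw [Finset.mem_Ico] at hi
        exact Nat.pow_le_pow_right (by omega) (Nat.pow_le_pow_left hi.2.le 2)
      · rw [Nat.card_Ico, smul_eq_mul]
        exact Nat.mul_le_mul_right _ (by omega)
    have h2 : (4 * A) ^ k ^ 2 ≤ (4 * (8 * Q * k + 1) * (b + 1)) ^ k ^ 2 :=
      Nat.pow_le_pow_left (by rw [hA]; nlinarith) _
    refine le_trans ?_ hb
    calc 24 * Q * (Sβ + 1) ≤ 24 * Q * (k * (4 * (8 * Q * k + 1) * (b + 1)) ^ k ^ 2 + 1) :=
          Nat.mul_le_mul_left _ (Nat.add_le_add_right (h1.trans (Nat.mul_le_mul_left _ h2)) _)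
      _ ≤ _ := by
          set Z := (4 * (8 * Q * k + 1) * (b + 1)) ^ k ^ 2
          nlinarith [Nat.zero_le (24 * Q * Z), Nat.zero_le (24 * Q * k)]
  set W := 2 * n + 1 with hW
  refine ⟨(Sβ * W + 1) / 2 ^ b + 1, ?_, ?_⟩
  · have := Nat.lt_mul_div_succ (Sβ * W + 1) (show 0 < 2 ^ b by positivity)
    omega
  · have h1 : 8 * Q * ((b + 1) * ones) ≤ W := by
      rcases Nat.eq_zero_or_pos k with rfl | hk
      · have : ones = 0 := by
          rcases Nat.eq_zero_or_pos ones with h | h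
          · exact h
          · have := Nat.mul_pos hA0 h; omega
        subst this; simp
      · have h2 : k * (8 * Q * ((b + 1) * ones)) ≤ k * W := by
          refine le_trans ?_ hones
          rw [hA]; nlinarith [Nat.zero_le ones]
        exact Nat.le_of_mul_le_mul_left h2 hk
    have h3 : 24 * Q * ((Sβ * W + 1) / 2 ^ b) ≤ W := by
      have h4 : (Sβ * W + 1) / 2 ^ b * 2 ^ b ≤ Sβ * W + 1 := Nat.div_mul_le_self _ _
      have h5 : (Sβ * W + 1) / 2 ^ b * (24 * Q * (Sβ + 1)) ≤ (Sβ + 1) * W :=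
        (Nat.mul_le_mul_left _ hSβ).trans (h4.trans (by rw [add_mul]; omega))
      exact Nat.le_of_mul_le_mul_left (c := Sβ + 1) (by nlinarith) (by omega)
    set Y := (Sβ * W + 1) / 2 ^ b
    have h6 : 8 * Q * ((b + 1) * ones + 3 * Y) ≤ 2 * W := by nlinarith
    -- Ones and zeros each account for at most `W / (8 * Q)` with `W = 2 * n + 1`. The summand `b`
    -- of the code length and the rounding in `X = Y + 1` are covered by `κ = b + 5`.
    have h7 : Q * ((b + 1) * ones + 3 * Y) ≤ n := by
      have : 4 * (Q * ((b + 1) * ones + 3 * Y)) ≤ 2 * n + 1 := by rw [← hW]; nlinarith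
      omega
    have h8 : (b + 1) * ones + 3 * Y ≤ n / Q := by
      rw [Nat.le_div_iff_mul_le hQ, mul_comm]; exact h7
    omega

end Sparsify

/-! ## Self-attention on the gadget matrix -/

theorem rbfSelfAttention_intCast {n d dv : ℕ} (C : ℝ) (Q : Matrix (Fin n) (Fin d) ℤ)
    (V : Matrix (Fin n) (Fin dv) ℤ) (i : Fin n) (l : Fin dv) :
    rbfSelfAttention C (Q.map (Int.cast : ℤ → ℝ)) (V.map (Int.cast : ℤ → ℝ)) i l =
      ∑ j, Real.exp (-C * ((∑ c, (Q i c - Q j c) ^ 2 : ℤ) : ℝ)) * (V j l : ℝ) := by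
  simp only [rbfSelfAttention, attention, id, Matrix.mul_apply, Matrix.of_apply, rbfKernel,
    Matrix.map_apply]
  refine Finset.sum_congr rfl fun j _ => ?_
  rw [EuclideanSpace.norm_sq_eq]
  simp

namespace Gadget

open Classical in
/-- The entry `(i, c)` of the gadget matrix: `NG` left rows, `NG` right rows, one reference row, and
zero rows. The predicates say which clauses are violated on the left and on the right. -/
noncomputable def entry (B : ℤ) (J NG : ℕ) (uL uR : ℕ → ℕ → Prop) (i c : ℕ) : ℤ :=
  if c < J then
    if i < NG then if uL i c then 2 * B else 0
    else if i < 2 * NG then if uR (i - NG) c then -B else B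
    else 0
  else if c = J ∧ i = 2 * NG then 2 * B else 0

open Classical in
/-- The number of clauses that are violated by a pair of partial assignments. -/
noncomputable def viol (J : ℕ) (uL uR : ℕ → ℕ → Prop) (α β : ℕ) : ℕ :=
  ((Finset.range J).filter fun c => uL α c ∧ uR β c).card

variable {B : ℤ} {J NG n d dv : ℕ} {uL uR : ℕ → ℕ → Prop}

/-! ### Distances between rows of the gadget -/

theorem abs_entry_le (hB : 0 ≤ B) (i c : ℕ) : |entry B J NG uL uR i c| ≤ 2 * B := by
  rw [entry]
  split_ifs <;> rw [abs_le] <;> omega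

theorem viol_le (α β : ℕ) : viol J uL uR α β ≤ J := by
  classical
  rw [viol]
  exact (Finset.card_filter_le _ _).trans (by simp)

theorem viol_eq_zero {α β : ℕ} : viol J uL uR α β = 0 ↔ ∀ c < J, ¬ (uL α c ∧ uR β c) := by
  classical
  rw [viol, Finset.card_eq_zero, Finset.filter_eq_empty_iff]
  simp

/-- In a clause column the difference is `3 * B` in absolute value if both sides violate the clause.
In the other three cases it is `B` in absolute value, so a clause that one side satisfies is not
seen by the distance. -/
theorem sum_sq_left {α β : ℕ} (hd : J + 1 ≤ d) (hα : α < NG) (hβ : β < NG) :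
    ∑ c ∈ Finset.range d, (entry B J NG uL uR α c - entry B J NG uL uR (NG + β) c) ^ 2 =
      B ^ 2 * (J + 8 * viol J uL uR α β) := by
  classical
  rw [← Finset.sum_subset (Finset.range_mono (show J ≤ d by omega))]
  · have : ∀ c ∈ Finset.range J,
        (entry B J NG uL uR α c - entry B J NG uL uR (NG + β) c) ^ 2 =
          B ^ 2 * 1 + B ^ 2 * 8 * (if uL α c ∧ uR β c then 1 else 0) := by
      intro c hc
      rw [Finset.mem_range] at hc
      simp only [entry, hc, hα, if_true, show ¬ NG + β < NG by omega,
        show NG + β < 2 * NG by omega, if_false, Nat.add_sub_cancel_left]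
      by_cases h1 : uL α c <;> by_cases h2 : uR β c <;> simp [h1, h2] <;> ring
    rw [Finset.sum_congr rfl this, Finset.sum_add_distrib, ← Finset.mul_sum, ← Finset.mul_sum,
      Finset.sum_boole, viol]
    simp
    ring
  · intro c _ hc
    rw [Finset.mem_range] at hc
    simp [entry, hc, show α ≠ 2 * NG by omega, show NG + β ≠ 2 * NG by omega]

/-- The extra column contributes `4 * B ^ 2`, which places the reference row halfway between the
distances for no violation and for one. -/
theorem sum_sq_ref {β : ℕ} (hd : J + 1 ≤ d) (hβ : β < NG) :
    ∑ c ∈ Finset.range d, (entry B J NG uL uR (2 * NG) c - entry B J NG uL uR (NG + β) c) ^ 2 =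
      B ^ 2 * (J + 4) := by
  rw [← Finset.sum_subset (Finset.range_mono hd)]
  · rw [Finset.sum_range_succ]
    have : ∀ c ∈ Finset.range J,
        (entry B J NG uL uR (2 * NG) c - entry B J NG uL uR (NG + β) c) ^ 2 = B ^ 2 := by
      intro c hc
      rw [Finset.mem_range] at hc
      simp only [entry, hc, if_true, show ¬ NG + β < NG by omega, show ¬ 2 * NG < NG by omega,
        show NG + β < 2 * NG by omega, if_false, Nat.add_sub_cancel_left, lt_irrefl]
      split_ifs <;> ring
    rw [Finset.sum_congr rfl this]
    simp [entry, show NG + β ≠ 2 * NG by omega]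
    ring
  · intro c _ hc
    rw [Finset.mem_range] at hc
    simp [entry, show ¬ c < J by omega, show c ≠ J by omega]

/-- The gadget matrix. -/
noncomputable def matQ (B : ℤ) (J NG n d : ℕ) (uL uR : ℕ → ℕ → Prop) :
    Matrix (Fin n) (Fin d) ℤ := fun i c => entry B J NG uL uR i c

/-- The indicator of the right rows, in column `0`. -/
def matV (NG n dv : ℕ) : Matrix (Fin n) (Fin dv) ℤ := fun j l =>
  if (l : ℕ) = 0 ∧ NG ≤ (j : ℕ) ∧ (j : ℕ) < 2 * NG then 1 else 0

/-- The value matrix selects the right rows, so all other rows, including the zero rows that pad the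
matrix to `n` rows, drop out of the sum. -/
theorem attention_eq (C : ℝ) (i : Fin n) (hn : 2 * NG ≤ n) (hdv : 0 < dv) :
    rbfSelfAttention C ((matQ B J NG n d uL uR).map (Int.cast : ℤ → ℝ))
      ((matV NG n dv).map (Int.cast : ℤ → ℝ)) i ⟨0, hdv⟩ =
      ∑ β ∈ Finset.range NG, Real.exp (-C * ((∑ c ∈ Finset.range d,
        (entry B J NG uL uR i c - entry B J NG uL uR (NG + β) c) ^ 2 : ℤ) : ℝ)) := by
  rw [rbfSelfAttention_intCast]
  simp only [matQ, matV]
  have h1 : ∀ j : ℕ, (∑ c : Fin d, (entry B J NG uL uR i c - entry B J NG uL uR j c) ^ 2) =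
      ∑ c ∈ Finset.range d, (entry B J NG uL uR i c - entry B J NG uL uR j c) ^ 2 := fun j =>
    Fin.sum_univ_eq_sum_range
      (fun c => (entry B J NG uL uR i c - entry B J NG uL uR j c) ^ 2) d
  simp only [h1]
  rw [Fin.sum_univ_eq_sum_range (fun j => Real.exp (-C * ((∑ c ∈ Finset.range d,
    (entry B J NG uL uR i c - entry B J NG uL uR j c) ^ 2 : ℤ) : ℝ)) *
      (((if True ∧ NG ≤ j ∧ j < 2 * NG then 1 else 0 : ℤ)) : ℝ)) n]
  rw [← Finset.sum_subset (s₁ := (Finset.Ico NG (NG + NG)))]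
  · rw [Finset.sum_Ico_eq_sum_range, Nat.add_sub_cancel]
    refine Finset.sum_congr rfl fun β hβ => ?_
    rw [Finset.mem_range] at hβ
    simp [show NG + β < 2 * NG by omega]
  · intro j hj
    rw [Finset.mem_Ico] at hj
    rw [Finset.mem_range]
    omega
  · intro j _ hj
    rw [Finset.mem_Ico] at hj
    rw [if_neg (by omega)]
    simp

/-- With `B = B₀ * (g + 1)` the exponent `4 * C * B ^ 2` grows at least linearly in `g` with a slope
at one's disposal, while the left side grows like `2 ^ g`. Only the integer `B₀` enters the program,
so `C` may be any real number, computable or not. -/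
theorem exists_scale {C μ : ℝ} (hC : 0 < C) (hμ : μ < 1) : ∃ B₀ : ℕ, 1 ≤ B₀ ∧ ∀ g : ℕ,
    8 * (2 : ℝ) ^ g ≤ (1 - μ) / 2 * Real.exp (4 * C * ((B₀ * (g + 1) : ℕ) : ℝ) ^ 2) := by
  obtain ⟨B₁, hB₁⟩ := exists_nat_ge (((32 / (1 - μ)) + 2) / (4 * C))
  refine ⟨B₁ + 1, by omega, fun g => ?_⟩
  have h1 : 0 < 1 - μ := by linarith
  set x : ℝ := 32 / (1 - μ) with hx
  have hx0 : 0 < x := by positivity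
  have h2 : x + 2 ≤ 4 * C * (B₁ + 1) := by
    rw [div_le_iff₀ (by positivity)] at hB₁
    nlinarith
  have h3 : (x + 2) * (g + 1) ≤ 4 * C * (((B₁ + 1) * (g + 1) : ℕ) : ℝ) ^ 2 := by
    push_cast
    have hb : (1 : ℝ) ≤ B₁ + 1 := by linarith [Nat.cast_nonneg (α := ℝ) B₁]
    have hg : (1 : ℝ) ≤ g + 1 := by linarith [Nat.cast_nonneg (α := ℝ) g]
    have : ((B₁ : ℝ) + 1) * (g + 1) * 1 ≤ (B₁ + 1) * (g + 1) * ((B₁ + 1) * (g + 1)) :=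
      mul_le_mul_of_nonneg_left (one_le_mul_of_one_le_of_one_le hb hg) (by positivity)
    calc (x + 2) * (g + 1) ≤ 4 * C * (B₁ + 1) * (g + 1) :=
          mul_le_mul_of_nonneg_right h2 (by positivity)
      _ = 4 * C * (((B₁ : ℝ) + 1) * (g + 1) * 1) := by ring
      _ ≤ 4 * C * ((B₁ + 1) * (g + 1) * ((B₁ + 1) * (g + 1))) :=
          mul_le_mul_of_nonneg_left this (by positivity)
      _ = _ := by ring
  have h4 : x * 2 ^ g ≤ Real.exp ((x + 2) * (g + 1)) := by
    have h5 : (2 : ℝ) ^ g ≤ Real.exp g := by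
      rw [← mul_one (g : ℝ), Real.exp_nat_mul]
      exact pow_le_pow_left₀ (by norm_num) (by linarith [Real.add_one_le_exp (1 : ℝ)]) g
    have h6 : x ≤ Real.exp x := by linarith [Real.add_one_le_exp x]
    calc x * 2 ^ g ≤ Real.exp x * Real.exp g := mul_le_mul h6 h5 (by positivity) (by positivity)
      _ = Real.exp (x + g) := by rw [Real.exp_add]
      _ ≤ _ := by
        refine Real.exp_le_exp.2 ?_
        have := Nat.cast_nonneg (α := ℝ) g
        nlinarith
  have h7 := h4.trans (Real.exp_le_exp.2 h3)
  have h8 : (1 - μ) / 2 * (x * 2 ^ g) = 16 * 2 ^ g := by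
    rw [hx]; field_simp; norm_num
  have h9 := mul_le_mul_of_nonneg_left h7 (show 0 ≤ (1 - μ) / 2 by positivity)
  rw [h8] at h9
  have : (0 : ℝ) < 2 ^ g := by positivity
  linarith

/-- Outputs are at least `exp (-C * X)` for a polynomially bounded `X`. A number of bits linear in
`X` thus makes the absolute error a small fraction of every output. -/
theorem exists_precision {C μ : ℝ} (hC : 0 < C) (hμ : μ < 1) : ∃ c : ℕ, ∀ X : ℕ,
    (2 : ℝ) ^ (-((c * (X + 1) : ℕ) : ℤ)) ≤ (1 - μ) / 2 * Real.exp (-C * X) := by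
  have h1 : 0 < 1 - μ := by linarith
  obtain ⟨c, hc⟩ := exists_nat_ge (2 * (C + 2 / (1 - μ)))
  refine ⟨c, fun X => ?_⟩
  rw [zpow_neg, zpow_natCast, inv_le_iff_one_le_mul₀ (by positivity)]
  have hx : 0 < 2 / (1 - μ) := by positivity
  have h2 : Real.exp ((C + 2 / (1 - μ)) * (X + 1)) ≤ 2 ^ (c * (X + 1)) := by
    have hl : Real.exp (1 / 2) ≤ 2 := by
      have h3 : Real.exp (1 / 2) * Real.exp (1 / 2) = Real.exp 1 := by
        rw [← Real.exp_add]; norm_num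
      have := Real.exp_one_lt_d9
      nlinarith [Real.exp_pos (1 / 2)]
    calc Real.exp ((C + 2 / (1 - μ)) * (X + 1)) ≤ Real.exp (((c * (X + 1) : ℕ) : ℝ) * (1 / 2)) := by
          refine Real.exp_le_exp.2 ?_
          push_cast
          have := Nat.cast_nonneg (α := ℝ) X
          nlinarith
      _ = Real.exp (1 / 2) ^ (c * (X + 1)) := by rw [Real.exp_nat_mul]
      _ ≤ _ := pow_le_pow_left₀ (Real.exp_pos _).le hl _
  have h3 : 2 / (1 - μ) * Real.exp (C * X) ≤ Real.exp ((C + 2 / (1 - μ)) * (X + 1)) := by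
    have h6 : 2 / (1 - μ) ≤ Real.exp (2 / (1 - μ)) := by
      linarith [Real.add_one_le_exp (2 / (1 - μ))]
    calc _ ≤ Real.exp (2 / (1 - μ)) * Real.exp (C * X) :=
          mul_le_mul_of_nonneg_right h6 (Real.exp_pos _).le
      _ = Real.exp (2 / (1 - μ) + C * X) := by rw [Real.exp_add]
      _ ≤ _ := by
        refine Real.exp_le_exp.2 ?_
        have := Nat.cast_nonneg (α := ℝ) X
        nlinarith [mul_nonneg hx.le this]
  have h4 := h3.trans h2
  calc (1 : ℝ) = (1 - μ) / 2 * Real.exp (-C * X) * (2 / (1 - μ) * Real.exp (C * X)) := by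
        have : Real.exp (-C * X) * Real.exp (C * X) = 1 := by
          rw [← Real.exp_add]; simp
        calc (1 : ℝ) = ((1 - μ) / 2 * (2 / (1 - μ))) * (Real.exp (-C * X) * Real.exp (C * X)) := by
              rw [this]; field_simp
          _ = _ := by ring
    _ ≤ _ := mul_le_mul_of_nonneg_left h4 (by positivity)

/-- Rounding a floating-point number up to a power of two changes it by a factor of at most `2`, and
afterwards only its exponent and the bit length of its mantissa matter. -/
theorem two_zpow_size_bounds {a b : ℤ} (ha : 0 < a) :
    (a : ℝ) * 2 ^ b < 2 ^ ((bitLen a : ℤ) + b) ∧ (2 : ℝ) ^ ((bitLen a : ℤ) + b) ≤ 2 * (a * 2 ^ b) := by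
  have hb : (0 : ℝ) < 2 ^ b := by positivity
  obtain ⟨k, hk⟩ : ∃ k, bitLen a = k + 1 := by
    refine ⟨bitLen a - 1, ?_⟩
    have : bitLen a ≠ 0 := by
      intro h
      have := natAbs_lt_two_pow_bitLen a
      rw [h] at this; simp at this; omega
    omega
  have h1 : a.natAbs < 2 ^ bitLen a := natAbs_lt_two_pow_bitLen a
  have h2 : 2 ^ k ≤ a.natAbs := by
    by_contra h
    have := bitLen_le_iff.2 (not_le.1 h)
    omega
  have h3 : (a : ℝ) = (a.natAbs : ℝ) := by
    rw [Nat.cast_natAbs, abs_of_pos ha]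
  rw [zpow_add₀ (by norm_num), zpow_natCast, h3]
  constructor
  · refine mul_lt_mul_of_pos_right ?_ hb
    exact_mod_cast h1
  · rw [hk, pow_succ]
    have : ((2 : ℝ) ^ k) ≤ a.natAbs := by exact_mod_cast h2
    nlinarith

/-- From approximate outputs one can read off which left rows have a right row without violations. -/
theorem decides {C μ : ℝ} {g b p : ℕ} (hC : 0 < C) (hμ0 : 0 ≤ μ) (hμ : μ < 1)
    (hb : 8 * (2 : ℝ) ^ g ≤ (1 - μ) / 2 * Real.exp (4 * C * (b : ℝ) ^ 2))
    (hp : (2 : ℝ) ^ (-(p : ℤ)) ≤ (1 - μ) / 2 * Real.exp (-C * ((b ^ 2 * (9 * J + 4) : ℕ) : ℝ)))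
    (hNG : NG = 2 ^ g) (hn : 2 * NG + 1 ≤ n) (hd : J + 1 ≤ d) (hdv : 0 < dv) {s : RAMState}
    (hs : ∀ i : Fin n,
      |outputEntry s dv i 0 - rbfSelfAttention C ((matQ b J NG n d uL uR).map (Int.cast : ℤ → ℝ))
        ((matV NG n dv).map (Int.cast : ℤ → ℝ)) i ⟨0, hdv⟩| ≤
      μ * |rbfSelfAttention C ((matQ b J NG n d uL uR).map (Int.cast : ℤ → ℝ))
        ((matV NG n dv).map (Int.cast : ℤ → ℝ)) i ⟨0, hdv⟩| + 2 ^ (-(p : ℤ))) :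
    0 < s.mem 0 ((2 * NG : ℕ) * dv) ∧ ∀ α < NG, 0 < s.mem 0 ((α : ℤ) * dv) ∧
      ((2 : ℝ) ^ ((bitLen (s.mem 0 ((2 * NG : ℕ) * dv)) : ℤ) + s.mem 1 ((2 * NG : ℕ) * dv)) ≤
        (s.mem 0 ((α : ℤ) * dv) : ℝ) * 2 ^ (s.mem 1 ((α : ℤ) * dv)) ↔
        ∃ β < NG, ∀ c < J, ¬ (uL α c ∧ uR β c)) := by
  set δ := (1 - μ) / 2 with hδ
  have hδ0 : 0 < δ := by rw [hδ]; linarith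
  have hδ1 : δ ≤ 1 / 2 := by rw [hδ]; linarith
  set D : ℕ → ℝ := fun k => Real.exp (-C * ((b ^ 2 * k : ℕ) : ℝ)) with hD
  have hDpos : ∀ k, 0 < D k := fun k => Real.exp_pos _
  have hDanti : ∀ k l, k ≤ l → D l ≤ D k := fun k l hkl => by
    refine Real.exp_le_exp.2 ?_
    have : ((b ^ 2 * k : ℕ) : ℝ) ≤ ((b ^ 2 * l : ℕ) : ℝ) := by
      exact_mod_cast Nat.mul_le_mul_left _ hkl
    nlinarith
  have hNG0 : 0 < NG := by rw [hNG]; positivity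
  -- Four units of distance outweigh the number of right rows, the relative error and the rounding
  -- to powers of two.
  have hgap : ∀ k, 8 * (NG : ℝ) * D (k + 4) ≤ δ * D k := fun k => by
    have h1 : D k = Real.exp (4 * C * (b : ℝ) ^ 2) * D (k + 4) := by
      rw [hD]; simp only; rw [← Real.exp_add]; congr 1; push_cast; ring
    rw [h1, ← mul_assoc, hNG]
    push_cast
    exact mul_le_mul_of_nonneg_right hb (hDpos _).le
  -- The choice `δ = (1 - μ) / 2` gives `1 - μ - δ = δ` and `1 + μ + δ ≤ 2`.
  have approx : ∀ x y : ℝ, D (9 * J + 4) ≤ y → |x - y| ≤ μ * |y| + 2 ^ (-(p : ℤ)) →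
      δ * y ≤ x ∧ x ≤ 2 * y := by
    intro x y hy hxy
    have hy0 := (hDpos _).trans_le hy
    rw [abs_of_pos hy0, abs_le] at hxy
    have : (2 : ℝ) ^ (-(p : ℤ)) ≤ δ * y := hp.trans (mul_le_mul_of_nonneg_left hy hδ0.le)
    constructor <;> nlinarith
  have hleft : ∀ α (hα : α < NG), rbfSelfAttention C
      ((matQ b J NG n d uL uR).map (Int.cast : ℤ → ℝ)) ((matV NG n dv).map (Int.cast : ℤ → ℝ))
      ⟨α, by omega⟩ ⟨0, hdv⟩ = ∑ β ∈ Finset.range NG, D (J + 8 * viol J uL uR α β) := by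
    intro α hα
    rw [attention_eq C _ (by omega) hdv]
    refine Finset.sum_congr rfl fun β hβ => ?_
    rw [sum_sq_left hd hα (Finset.mem_range.1 hβ), hD]
    push_cast
    rfl
  have hrefY : rbfSelfAttention C
      ((matQ b J NG n d uL uR).map (Int.cast : ℤ → ℝ)) ((matV NG n dv).map (Int.cast : ℤ → ℝ))
      ⟨2 * NG, by omega⟩ ⟨0, hdv⟩ = NG * D (J + 4) := by
    rw [attention_eq C _ (by omega) hdv, Finset.sum_congr rfl fun β hβ => by
      rw [sum_sq_ref hd (Finset.mem_range.1 hβ)]]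
    rw [Finset.sum_const, Finset.card_range, nsmul_eq_mul, hD]
    push_cast
    rfl
  have hNG1 : (1 : ℝ) ≤ NG := by exact_mod_cast hNG0
  have hz := hs ⟨2 * NG, by omega⟩
  rw [hrefY] at hz
  have hz' := approx _ _ (by nlinarith [hDpos (J + 4), hDanti (J + 4) (9 * J + 4) (by omega)]) hz
  simp only [outputEntry, Nat.cast_zero, add_zero] at hz'
  set az := s.mem 0 ((2 * NG : ℕ) * dv) with haz
  set bz := s.mem 1 ((2 * NG : ℕ) * dv) with hbz
  have hpos : ∀ a b : ℤ, (0 : ℝ) < a * 2 ^ b → 0 < a := fun a b h => by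
    have := pos_of_mul_pos_left h (by positivity)
    exact_mod_cast this
  have hyz : 0 < NG * D (J + 4) := by have := hDpos (J + 4); positivity
  have haz0 : 0 < az := hpos az bz (lt_of_lt_of_le (by positivity) hz'.1)
  have hsz := two_zpow_size_bounds (b := bz) haz0
  refine ⟨haz0, fun α hα => ?_⟩
  have ha := hs ⟨α, by omega⟩
  rw [hleft α hα] at ha
  -- Every left output is at least its summand for `β = 0`, where at most `J` clauses are violated.
  -- This makes the absolute error relative.
  have hYlow : D (9 * J + 4) ≤ ∑ β ∈ Finset.range NG, D (J + 8 * viol J uL uR α β) := by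
    refine le_trans (hDanti (J + 8 * viol J uL uR α 0) _ ?_) (Finset.single_le_sum
      (f := fun β => D (J + 8 * viol J uL uR α β)) (fun β _ => (hDpos _).le)
      (Finset.mem_range.2 hNG0))
    have := viol_le (J := J) (uL := uL) (uR := uR) α 0
    omega
  have ha' := approx _ _ hYlow ha
  simp only [outputEntry, Nat.cast_zero, add_zero] at ha'
  have hY0 := (hDpos _).trans_le hYlow
  refine ⟨hpos _ _ (lt_of_lt_of_le (by positivity) ha'.1), fun h => ?_, ?_⟩
  · by_contra hno
    push Not at hno
    have hv : ∀ β ∈ Finset.range NG, D (J + 8 * viol J uL uR α β) ≤ D (J + 8) := fun β hβ => by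
      refine hDanti _ _ ?_
      have : viol J uL uR α β ≠ 0 := fun h0 => by
        obtain ⟨c, hc, h1⟩ := hno β (Finset.mem_range.1 hβ)
        exact viol_eq_zero.1 h0 c hc h1
      omega
    have hup := Finset.sum_le_card_nsmul _ _ _ hv
    rw [Finset.card_range, nsmul_eq_mul] at hup
    have h8 := hgap (J + 4)
    have h9 : 8 * (NG : ℝ) * D (J + 8) ≤ δ * (NG * D (J + 4)) := by
      have := hDpos (J + 8)
      have h10 : (J + 4 + 4) = J + 8 := by ring
      rw [h10] at h8
      have h11 := hDpos (J + 4)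
      nlinarith [mul_pos hδ0 h11]
    have h12 := hDpos (J + 8)
    have h13 : 0 < NG * D (J + 8) := by positivity
    -- Without a completing right row the output is at most `2 * NG * D (J + 8)`, whereas the
    -- threshold exceeds `δ * NG * D (J + 4) ≥ 8 * NG * D (J + 8)`.
    linarith [ha'.2, hz'.1, hsz.1]
  · rintro ⟨β, hβ, hv⟩
    have hv0 : viol J uL uR α β = 0 := viol_eq_zero.2 hv
    have h1 : D J ≤ ∑ β ∈ Finset.range NG, D (J + 8 * viol J uL uR α β) := by
      refine le_trans (by rw [hv0, mul_zero, add_zero]) (Finset.single_le_sum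
        (f := fun β => D (J + 8 * viol J uL uR α β)) (fun β _ => (hDpos _).le)
        (Finset.mem_range.2 hβ))
    have h2 := hgap J
    have h3 := mul_le_mul_of_nonneg_left h1 hδ0.le
    -- With a completing right row the output is at least `δ * D J ≥ 8 * NG * D (J + 4)`, whereas
    -- the threshold is at most `4 * NG * D (J + 4)`.
    linarith [ha'.1, hz'.2, hsz.2]

end Gadget

/-! ## The sparsification process on arrays of rows -/

namespace Sparsify

/-- Row `t` is minimal among the rows `0, …, T - 1`, and it is the first copy. -/
def Live (T : ℕ) (A : ℕ → Finset ℕ) (t : ℕ) : Prop := ∀ u < T, A u ⊆ A t → t ≤ u ∧ A t ⊆ A u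

/-- The family of the rows. -/
def rowFam (T : ℕ) (A : ℕ → Finset ℕ) : Finset (Finset ℕ) := (Finset.range T).image A

/-- The set size that the index `y` of a potential sunflower encodes. -/
def idxSize (k W y : ℕ) : ℕ := y / W ^ k / (k + 1)

/-- The petal size that the index `y` encodes. -/
def idxPetal (k W y : ℕ) : ℕ := y / W ^ k % (k + 1)

/-- The heart that the index `y` encodes: the first `k` digits of `y` in base `W`. -/
def idxHeart (k W y : ℕ) : Finset ℕ := (Finset.range W).filter fun l => ∃ j < k, y / W ^ j % W = l

/-- Row `t` belongs to the sunflower with index `y`. -/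
def Member (k W T : ℕ) (A : ℕ → Finset ℕ) (y t : ℕ) : Prop :=
  Live T A t ∧ (A t).card = idxSize k W y ∧ idxHeart k W y ⊆ A t

open Classical in
/-- The index `y` describes a sunflower with sufficiently many members. -/
def Found (k W T : ℕ) (θ : ℕ → ℕ) (A : ℕ → Finset ℕ) (y : ℕ) : Prop :=
  0 < idxPetal k W y ∧ idxPetal k W y < idxSize k W y ∧
    (idxHeart k W y).card + idxPetal k W y = idxSize k W y ∧
    ¬ ((Finset.range T).filter fun t => Member k W T A y t).card < θ (idxPetal k W y)

/-- The number of indices. -/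
def numIdx (k W : ℕ) : ℕ := (k + 1) * (k + 1) * W ^ k

open Classical in
/-- The first index of a sunflower, or the number of indices if there is none. -/
noncomputable def firstIdx (k W T : ℕ) (θ : ℕ → ℕ) (A : ℕ → Finset ℕ) : ℕ :=
  ((Finset.range (numIdx k W)).filter fun y =>
    ¬ ∃ y' < numIdx k W, y' ≤ y ∧ Found k W T θ A y').card

open Classical in
/-- The `j`-th petal of the sunflower with index `y`. -/
noncomputable def petalSet (k W T : ℕ) (A : ℕ → Finset ℕ) (y j : ℕ) : Finset ℕ :=
  (Finset.range W).filter fun l => ∃ t < T, Member k W T A y t ∧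
    ((Finset.range T).filter fun t' => t' < t ∧ Member k W T A y t').card = j ∧
      l ∈ A t ∧ l ∉ idxHeart k W y

/-- The `j`-th row that is added in a step with choice bit `b`. The set `{W - 1}` is used for
padding. -/
noncomputable def newRow (k W T : ℕ) (θ : ℕ → ℕ) (A : ℕ → Finset ℕ) (b : Bool) (j : ℕ) : Finset ℕ :=
  if firstIdx k W T θ A < numIdx k W then
    if b = true then
      if j < θ (idxPetal k W (firstIdx k W T θ A)) then petalSet k W T A (firstIdx k W T θ A) j
      else {W - 1}
    else if j = 0 then idxHeart k W (firstIdx k W T θ A) else {W - 1}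
  else {W - 1}

/-- Step number `s` writes the rows `m + s * Θ, …, m + s * Θ + Θ - 1`. -/
noncomputable def nextRows (k W T : ℕ) (θ : ℕ → ℕ) (m Θ s : ℕ) (A : ℕ → Finset ℕ) (b : Bool) :
    ℕ → Finset ℕ := fun t =>
  if m + s * Θ ≤ t ∧ t < m + s * Θ + Θ then newRow k W T θ A b (t - (m + s * Θ)) else A t

variable {k W T m Θ S : ℕ} {θ : ℕ → ℕ} {A : ℕ → Finset ℕ}

/-! ### Minimal sets as live rows, sunflowers as indices -/

theorem mem_rowFam {C : Finset ℕ} : C ∈ rowFam T A ↔ ∃ t < T, A t = C := by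
  simp [rowFam]

theorem Live.mem_minSets {t : ℕ} (ht : t < T) (h : Live T A t) : A t ∈ minSets (rowFam T A) := by
  refine Sparsify.mem_minSets.2 ⟨mem_rowFam.2 ⟨t, ht, rfl⟩, fun D hD hDt => ?_⟩
  obtain ⟨u, hu, rfl⟩ := mem_rowFam.1 hD
  exact hDt.antisymm (h u hu hDt).2

theorem exists_live {C : Finset ℕ} (hC : C ∈ minSets (rowFam T A)) : ∃ t < T, Live T A t ∧ A t = C := by
  classical
  rw [Sparsify.mem_minSets, mem_rowFam] at hC
  obtain ⟨hex, hmin⟩ := hC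
  have hspec := Nat.find_spec hex
  refine ⟨Nat.find hex, hspec.1, fun u hu hsub => ?_, hspec.2⟩
  rw [hspec.2] at hsub ⊢
  have := hmin (A u) (mem_rowFam.2 ⟨u, hu, rfl⟩) hsub
  exact ⟨Nat.find_min' hex ⟨hu, this⟩, this.ge⟩

theorem Live.inj {t u : ℕ} (ht : t < T) (hu : u < T) (h : Live T A t) (h' : Live T A u)
    (he : A t = A u) : t = u :=
  le_antisymm (h u hu he.ge).1 (h' t ht he.le).1

open Classical in
theorem card_live : ((Finset.range T).filter fun t => Live T A t).card =
    (minSets (rowFam T A)).card := by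
  refine Finset.card_bij (fun t _ => A t) ?_ ?_ ?_
  · intro t ht
    rw [Finset.mem_filter, Finset.mem_range] at ht
    exact ht.2.mem_minSets ht.1
  · intro t ht u hu h
    rw [Finset.mem_filter, Finset.mem_range] at ht hu
    exact ht.2.inj ht.1 hu.1 hu.2 h
  · intro C hC
    obtain ⟨t, ht, hl, rfl⟩ := exists_live hC
    exact ⟨t, by simp [ht, hl], rfl⟩

open Classical in
theorem card_member (y : ℕ) : ((Finset.range T).filter fun t => Member k W T A y t).card =
    (flower (rowFam T A) (idxSize k W y) (idxHeart k W y)).card := by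
  refine Finset.card_bij (fun t _ => A t) ?_ ?_ ?_
  · intro t ht
    rw [Finset.mem_filter, Finset.mem_range] at ht
    exact mem_flower.2 ⟨ht.2.1.mem_minSets ht.1, ht.2.2⟩
  · intro t ht u hu h
    rw [Finset.mem_filter, Finset.mem_range] at ht hu
    exact ht.2.1.inj ht.1 hu.1 hu.2.1 h
  · intro C hC
    obtain ⟨t, ht, hl, rfl⟩ := exists_live (mem_flower.1 hC).1
    exact ⟨t, Finset.mem_filter.2 ⟨Finset.mem_range.2 ht, hl, (mem_flower.1 hC).2⟩, rfl⟩

/-- The indices before which nothing was found form an initial segment, whose length is the first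
successful index. In this form a minimum can be computed by bounded sums. -/
theorem firstIdx_spec (h : ∃ y < numIdx k W, Found k W T θ A y) :
    firstIdx k W T θ A < numIdx k W ∧ Found k W T θ A (firstIdx k W T θ A) ∧
      ∀ y < firstIdx k W T θ A, ¬ Found k W T θ A y := by
  classical
  have hspec := Nat.find_spec h
  have hmin : ∀ y < Nat.find h, ¬ Found k W T θ A y := fun y hy hf =>
    Nat.find_min h hy ⟨hy.trans hspec.1, hf⟩
  have : firstIdx k W T θ A = Nat.find h := by
    have e : ((Finset.range (numIdx k W)).filter fun y =>
        ¬ ∃ y' < numIdx k W, y' ≤ y ∧ Found k W T θ A y') = Finset.range (Nat.find h) := by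
      ext y
      simp only [Finset.mem_filter, Finset.mem_range]
      constructor
      · rintro ⟨-, h2⟩
        by_contra hle
        exact h2 ⟨Nat.find h, hspec.1, not_lt.1 hle, hspec.2⟩
      · intro hy
        exact ⟨hy.trans hspec.1, fun ⟨y', _, h2, h3⟩ => hmin y' (h2.trans_lt hy) h3⟩
    rw [firstIdx]
    convert congrArg Finset.card e
    simp
  rw [this]
  exact ⟨hspec.1, hspec.2, hmin⟩

theorem firstIdx_eq (h : ¬ ∃ y < numIdx k W, Found k W T θ A y) :
    firstIdx k W T θ A = numIdx k W := by
  classical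
  rw [firstIdx, Finset.filter_true_of_mem, Finset.card_range]
  rintro y - ⟨y', h1, -, h2⟩
  exact h ⟨y', h1, h2⟩

/-- The elements of the heart are listed as `k` digits in base `W`. Unused digits repeat an element,
which is possible because the heart is nonempty. The higher part `e * W ^ k` does not affect these
digits. -/
theorem exists_idxHeart {H : Finset ℕ} (hH : H ⊆ Finset.range W) (hne : H.Nonempty)
    (hk : H.card ≤ k) (e : ℕ) : ∃ x < W ^ k, idxHeart k W (e * W ^ k + x) = H := by
  obtain ⟨f, hf⟩ : ∃ f : Fin k → Fin W, ∀ l : ℕ, l ∈ H ↔ ∃ j, (f j : ℕ) = l := by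
    obtain ⟨x₀, hx₀⟩ := hne
    let em := H.equivFin
    refine ⟨fun j => if h : (j : ℕ) < H.card then ⟨em.symm ⟨j, h⟩, Finset.mem_range.1
      (hH (em.symm ⟨j, h⟩).2)⟩ else ⟨x₀, Finset.mem_range.1 (hH hx₀)⟩, fun l => ⟨fun hl => ?_, ?_⟩⟩
    · refine ⟨⟨em ⟨l, hl⟩, (em ⟨l, hl⟩).2.trans_le hk⟩, ?_⟩
      simp
    · rintro ⟨j, rfl⟩
      dsimp only
      split_ifs
      · exact (em.symm _).2
      · exact hx₀
  refine ⟨finFunctionFinEquiv f, (finFunctionFinEquiv f).2, ?_⟩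
  ext l
  have hdig : ∀ j (hj : j < k), (e * W ^ k + (finFunctionFinEquiv f : ℕ)) / W ^ j % W = f ⟨j, hj⟩ := by
    intro j hj
    have hW : 0 < W := (f ⟨j, hj⟩).pos
    have h1 : ∀ F : ℕ, e * W ^ k + F = F + W ^ j * (W * (e * W ^ (k - j - 1))) := by
      intro F
      have : W ^ k = W ^ j * (W * W ^ (k - j - 1)) := by
        rw [← pow_succ', ← pow_add]; congr 1; omega
      rw [this]; ring
    rw [h1, Nat.add_mul_div_left _ _ (by positivity), Nat.add_mul_mod_self_left]
    have := congrArg (fun g => ((g ⟨j, hj⟩ : Fin W) : ℕ)) (finFunctionFinEquiv.symm_apply_apply f)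
    simpa [finFunctionFinEquiv] using this
  rw [hf, idxHeart, Finset.mem_filter, Finset.mem_range]
  constructor
  · rintro ⟨-, j, hj, h⟩
    exact ⟨⟨j, hj⟩, by rw [← h, hdig j hj]⟩
  · rintro ⟨j, rfl⟩
    exact ⟨(f j).2, j, j.2, hdig j j.2⟩

/-- The part of the index above `W ^ k` is `c * (k + 1) + i`, so the order of the indices refines
the lexicographic order of `(c, i)`, and the first successful index yields the minimality that the
sparsification needs. -/
theorem exists_idx {c i : ℕ} {H : Finset ℕ} (hH : H ⊆ Finset.range W) (hi : 1 ≤ i) (hic : i < c)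
    (hc : c ≤ k) (hcard : H.card + i = c) : ∃ x < W ^ k,
      (c * (k + 1) + i) * W ^ k + x < numIdx k W ∧
      idxSize k W ((c * (k + 1) + i) * W ^ k + x) = c ∧
      idxPetal k W ((c * (k + 1) + i) * W ^ k + x) = i ∧
      idxHeart k W ((c * (k + 1) + i) * W ^ k + x) = H := by
  obtain ⟨x, hx, he⟩ := exists_idxHeart hH (Finset.card_pos.1 (by omega)) (by omega : H.card ≤ k)
    (c * (k + 1) + i)
  have hpos : 0 < W ^ k := by omega
  have h1 : ((c * (k + 1) + i) * W ^ k + x) / W ^ k = c * (k + 1) + i := by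
    rw [mul_comm, Nat.mul_add_div hpos, Nat.div_eq_of_lt hx, add_zero]
  refine ⟨x, hx, ?_, ?_, ?_, he⟩
  · have h2 : c * (k + 1) + i + 1 ≤ (k + 1) * (k + 1) := by nlinarith
    have := Nat.mul_le_mul_right (W ^ k) h2
    rw [numIdx]
    nlinarith
  · rw [idxSize, h1, mul_comm, Nat.mul_add_div (by omega), Nat.div_eq_of_lt (by omega), add_zero]
  · rw [idxPetal, h1, mul_comm, Nat.mul_add_mod, Nat.mod_eq_of_lt (by omega)]

theorem idxSize_le {y : ℕ} (hy : y < numIdx k W) : idxSize k W y ≤ k := by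
  rw [idxSize, Nat.div_div_eq_div_mul]
  have : y / (W ^ k * (k + 1)) < k + 1 := by
    rw [Nat.div_lt_iff_lt_mul (Nat.pos_of_ne_zero fun h => ?_)]
    · rw [numIdx] at hy; nlinarith
    · have : W ^ k = 0 := by rcases Nat.mul_eq_zero.1 h with h | h <;> omega
      rw [numIdx, this] at hy
      simp at hy
  omega

theorem saturated_of_not_found (hrow : ∀ t < T, A t ⊆ Finset.range W)
    (h : ¬ ∃ y < numIdx k W, Found k W T θ A y) (hθ : ∀ i, 0 < θ i) :
    Saturated k θ (rowFam T A) := by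
  intro c i H hi hic hc hcard
  by_cases hH : H ⊆ Finset.range W
  · obtain ⟨x, -, hlt, h1, h2, h3⟩ := exists_idx hH hi hic hc hcard
    by_contra hge
    refine h ⟨_, hlt, ?_⟩
    rw [Found, h1, h2, h3]
    refine ⟨hi, hic, hcard, ?_⟩
    have := card_member (k := k) (W := W) (T := T) (A := A) ((c * (k + 1) + i) * W ^ k + x)
    rw [h1, h3] at this
    convert hge
  · rw [Finset.card_eq_zero.2]
    · exact hθ i
    · rw [Finset.eq_empty_iff_forall_notMem]
      intro C hC
      obtain ⟨h1, -, h2⟩ := mem_flower.1 hC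
      obtain ⟨t, ht, rfl⟩ := mem_rowFam.1 (Sparsify.mem_minSets.1 h1).1
      exact hH (h2.trans (hrow t ht))

theorem not_saturated_of_found {y : ℕ} (hy : y < numIdx k W) (h : Found k W T θ A y) :
    ¬ Saturated k θ (rowFam T A) := by
  intro hs
  have := hs _ _ _ h.1 h.2.1 (idxSize_le hy) h.2.2.1
  rw [← card_member] at this
  apply h.2.2.2
  convert this

-- The number of earlier members increases strictly along the members, so a member is determined by
-- its rank.
open Classical in
theorem petalSet_eq {y t : ℕ} (ht : t < T) (hrow : A t ⊆ Finset.range W)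
    (hm : Member k W T A y t) :
    petalSet k W T A y ((Finset.range T).filter fun t' => t' < t ∧ Member k W T A y t').card =
      A t \ idxHeart k W y := by
  ext l
  rw [petalSet, Finset.mem_filter, Finset.mem_sdiff]
  constructor
  · rintro ⟨-, u, hu, hmu, hcard, hl, hlH⟩
    have key : ∀ a b, a < T → Member k W T A y a → a < b →
        ((Finset.range T).filter fun t' => t' < a ∧ Member k W T A y t').card <
          ((Finset.range T).filter fun t' => t' < b ∧ Member k W T A y t').card := by
      intro a b ha hma hab
      refine Finset.card_lt_card (Finset.ssubset_iff_of_subset ?_ |>.2 ⟨a, ?_, ?_⟩)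
      · intro t'
        simp only [Finset.mem_filter, Finset.mem_range]
        exact fun h => ⟨h.1, h.2.1.trans hab, h.2.2⟩
      · simp [ha, hab, hma]
      · simp
    have : u = t := by
      rcases lt_trichotomy u t with h | h | h
      · exact absurd hcard (key u t hu hmu h).ne
      · exact h
      · exact absurd hcard (key t u ht hm h).ne'
    subst this
    exact ⟨hl, hlH⟩
  · rintro ⟨h1, h2⟩
    exact ⟨hrow h1, t, ht, hm, rfl, h1, h2⟩

open Classical in
/-- The members of small rank. -/
theorem exists_member_of_rank {y j : ℕ}
    (hj : j < ((Finset.range T).filter fun t => Member k W T A y t).card) :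
    ∃ t < T, Member k W T A y t ∧
      ((Finset.range T).filter fun t' => t' < t ∧ Member k W T A y t').card = j := by
  set s := (Finset.range T).filter fun t => Member k W T A y t with hs
  have hmem := Finset.orderEmbOfFin_mem s rfl ⟨j, hj⟩
  set t := s.orderEmbOfFin rfl ⟨j, hj⟩ with ht
  have hmem' := Finset.mem_filter.1 hmem
  refine ⟨t, Finset.mem_range.1 hmem'.1, hmem'.2, ?_⟩
  have e : ((Finset.range T).filter fun t' => t' < t ∧ Member k W T A y t') =
      (Finset.univ.filter fun i : Fin s.card => i < ⟨j, hj⟩).map (s.orderEmbOfFin rfl).toEmbedding := by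
    ext u
    simp only [Finset.mem_filter, Finset.mem_range, Finset.mem_map, Finset.mem_univ, true_and]
    constructor
    · rintro ⟨h1, h2, h3⟩
      have hu : u ∈ s := Finset.mem_filter.2 ⟨Finset.mem_range.2 h1, h3⟩
      obtain ⟨i, rfl⟩ : ∃ i, s.orderEmbOfFin rfl i = u := by
        have := Finset.range_orderEmbOfFin s rfl
        have hu' : u ∈ Set.range (s.orderEmbOfFin rfl) := by rw [this]; exact hu
        exact hu'
      exact ⟨i, by rwa [ht, OrderEmbedding.lt_iff_lt] at h2, rfl⟩
    · rintro ⟨i, hi, rfl⟩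
      have := Finset.mem_filter.1 (Finset.orderEmbOfFin_mem s rfl i)
      exact ⟨Finset.mem_range.1 this.1, by
        rw [ht]; exact (OrderEmbedding.lt_iff_lt _).2 hi, this.2⟩
  rw [e, Finset.card_map]
  have : (Finset.univ.filter fun i : Fin s.card => i < ⟨j, hj⟩) = Finset.Iio ⟨j, hj⟩ := by
    ext; simp
  rw [this, Fin.card_Iio]

/-- The rows from `m + s * Θ` on are still padding rows. -/
structure RowInv (W T m Θ s : ℕ) (A : ℕ → Finset ℕ) : Prop where
  sub : ∀ t < T, A t ⊆ Finset.range W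
  pad : ∀ t, m + s * Θ ≤ t → t < T → A t = {W - 1}

theorem newRow_subset (hW : 0 < W) (b : Bool) (j : ℕ) :
    newRow k W T θ A b j ⊆ Finset.range W := by
  have hpad : ({W - 1} : Finset ℕ) ⊆ Finset.range W := by
    intro l hl
    rw [Finset.mem_singleton] at hl
    rw [Finset.mem_range]
    omega
  classical
  rw [newRow]
  split_ifs
  · exact Finset.filter_subset _ _
  · exact hpad
  · exact Finset.filter_subset _ _
  · exact hpad
  · exact hpad

theorem RowInv.next {s : ℕ} (hW : 0 < W) (h : RowInv W T m Θ s A) (b : Bool) :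
    RowInv W T m Θ (s + 1) (nextRows k W T θ m Θ s A b) := by
  refine ⟨fun t ht => ?_, fun t h1 h2 => ?_⟩
  · rw [nextRows]
    split_ifs
    · exact newRow_subset hW _ _
    · exact h.sub t ht
  · rw [add_mul, one_mul] at h1
    rw [nextRows, if_neg (by omega)]
    exact h.pad t (by omega) h2

/-- The overwritten rows were padding, and the row right after them still is. So the padding set
does not disappear from the family. -/
theorem rowFam_next {s : ℕ} (h : RowInv W T m Θ s A) (b : Bool) (hT : m + s * Θ + Θ < T) :
    rowFam T (nextRows k W T θ m Θ s A b) =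
      rowFam T A ∪ (Finset.range Θ).image (newRow k W T θ A b) := by
  ext C
  rw [mem_rowFam, Finset.mem_union, mem_rowFam, Finset.mem_image]
  constructor
  · rintro ⟨t, ht, rfl⟩
    rw [nextRows]
    split_ifs with h1
    · exact Or.inr ⟨t - (m + s * Θ), Finset.mem_range.2 (by omega), rfl⟩
    · exact Or.inl ⟨t, ht, rfl⟩
  · rintro (⟨t, ht, rfl⟩ | ⟨j, hj, rfl⟩)
    · by_cases h1 : m + s * Θ ≤ t ∧ t < m + s * Θ + Θ
      · refine ⟨m + s * Θ + Θ, hT, ?_⟩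
        rw [nextRows, if_neg (by omega), h.pad _ (by omega) hT, h.pad _ h1.1 ht]
      · exact ⟨t, ht, by rw [nextRows, if_neg h1]⟩
    · rw [Finset.mem_range] at hj
      exact ⟨m + s * Θ + j, by omega, by
        rw [nextRows, if_pos (by omega), Nat.add_sub_cancel_left]⟩

theorem pad_mem_rowFam {s : ℕ} (h : RowInv W T m Θ s A) (hT : m + s * Θ < T) :
    {W - 1} ∈ rowFam T A :=
  mem_rowFam.2 ⟨m + s * Θ, hT, h.pad _ le_rfl hT⟩

theorem rowFam_next_of_saturated {s : ℕ} (h : RowInv W T m Θ s A) (b : Bool)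
    (hT : m + s * Θ + Θ < T) (hs : Saturated k θ (rowFam T A)) :
    rowFam T (nextRows k W T θ m Θ s A b) = rowFam T A := by
  rw [rowFam_next h b hT, Finset.union_eq_left]
  intro C hC
  obtain ⟨j, -, rfl⟩ := Finset.mem_image.1 hC
  have : ¬ ∃ y < numIdx k W, Found k W T θ A y := fun ⟨y, hy, hf⟩ =>
    not_saturated_of_found hy hf hs
  rw [newRow, if_neg (by rw [firstIdx_eq this]; exact lt_irrefl _)]
  exact pad_mem_rowFam h (by omega)

/-- If the family is not saturated, the index search succeeds, and the first index describes a
lexicographically minimal sunflower. The `Θ` rows of the step hold the heart or the petals, and the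
superfluous ones hold the padding set, which is in the family anyway. -/
theorem exists_sunflower {s : ℕ} (h : RowInv W T m Θ s A) (hT : m + s * Θ + Θ < T)
    (hθ : ∀ i, 0 < θ i) (hΘ : ∀ i ≤ k, θ i ≤ Θ) (hs : ¬ Saturated k θ (rowFam T A)) :
    ∃ c i H G, Sunflower k θ (rowFam T A) c i H G ∧
      rowFam T (nextRows k W T θ m Θ s A false) = insert H (rowFam T A) ∧
      rowFam T (nextRows k W T θ m Θ s A true) = rowFam T A ∪ G.image (· \ H) := by
  classical
  have hex : ∃ y < numIdx k W, Found k W T θ A y := by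
    by_contra hno
    exact hs (saturated_of_not_found h.sub hno hθ)
  obtain ⟨hlt, hf, hmin⟩ := firstIdx_spec hex
  rw [rowFam_next h _ hT, rowFam_next h _ hT]
  simp only [show newRow k W T θ A = fun b j => newRow k W T θ A b j from rfl, newRow, if_pos hlt]
  set y := firstIdx k W T θ A with hy
  have hpad := pad_mem_rowFam h (by omega : m + s * Θ < T)
  have hck := idxSize_le hlt
  have hΘi : θ (idxPetal k W y) ≤ Θ := hΘ _ (by have := hf.2.1; omega)
  set rank : ℕ → ℕ := fun t =>
    ((Finset.range T).filter fun t' => t' < t ∧ Member k W T A y t').card with hrank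
  -- Only the first `θ` members are used, since the degree bounds need a sunflower of exactly this
  -- size.
  set I := (Finset.range T).filter fun t => Member k W T A y t ∧ rank t < θ (idxPetal k W y) with hI
  have hImem : ∀ t ∈ I, t < T ∧ Member k W T A y t ∧ rank t < θ (idxPetal k W y) := fun t ht => by
    simpa [hI] using ht
  have hcount : θ (idxPetal k W y) ≤ ((Finset.range T).filter fun t => Member k W T A y t).card := by
    have := not_lt.1 hf.2.2.2
    convert this
  have hex2 : ∀ j < θ (idxPetal k W y), ∃ t ∈ I, rank t = j := fun j hj => by
    obtain ⟨t, h1, h2, h3⟩ := exists_member_of_rank (k := k) (W := W) (A := A) (hj.trans_le hcount)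
    exact ⟨t, by simp [hI, h1, h2, hrank, h3, hj], h3⟩
  have hrinj : Set.InjOn rank I := by
    intro t ht u hu htu
    have ht' := hImem t ht
    have hu' := hImem u hu
    by_contra hne
    have key : ∀ a b, a < T → Member k W T A y a → a < b → rank a < rank b := by
      intro a b ha hma hab
      refine Finset.card_lt_card (Finset.ssubset_iff_of_subset ?_ |>.2 ⟨a, ?_, ?_⟩)
      · intro t'
        simp only [Finset.mem_filter, Finset.mem_range]
        exact fun h => ⟨h.1, h.2.1.trans hab, h.2.2⟩
      · simp [ha, hab, hma]
      · simp
    rcases lt_or_gt_of_ne hne with h1 | h1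
    · exact (key t u ht'.1 ht'.2.1 h1).ne htu
    · exact (key u t hu'.1 hu'.2.1 h1).ne' htu
  have hIcard : I.card = θ (idxPetal k W y) := by
    rw [← Finset.card_range (θ (idxPetal k W y)), ← Finset.card_image_of_injOn hrinj]
    congr 1
    ext j
    simp only [Finset.mem_image, Finset.mem_range]
    exact ⟨fun ⟨t, ht, hj⟩ => hj ▸ (hImem t ht).2.2, fun hj => hex2 j hj⟩
  refine ⟨idxSize k W y, idxPetal k W y, idxHeart k W y, I.image A,
    ⟨hf.1, hf.2.1, hck, hf.2.2.1, ?_, ?_, ?_⟩, ?_, ?_⟩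
  · intro C hC
    obtain ⟨t, ht, rfl⟩ := Finset.mem_image.1 hC
    obtain ⟨h1, h2, -⟩ := hImem t ht
    exact mem_flower.2 ⟨h2.1.mem_minSets h1, h2.2⟩
  · rw [Finset.card_image_of_injOn, hIcard]
    intro t ht u hu htu
    have ht' := hImem t ht
    have hu' := hImem u hu
    exact ht'.2.1.1.inj ht'.1 hu'.1 hu'.2.1.1 htu
  · intro c' i' H' hi' hic' hcard' hlex
    by_cases hH' : H' ⊆ Finset.range W
    · have hc'k : c' ≤ k := by omega
      obtain ⟨x, hx, hlt', h1, h2, h3⟩ := exists_idx hH' hi' hic' hc'k hcard'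
      -- A lexicographically smaller pair has a smaller leading part of the index, whatever the
      -- digits of the heart are.
      have hylow : (c' * (k + 1) + i') * W ^ k + x < y := by
        have hdm := Nat.div_add_mod (y / W ^ k) (k + 1)
        have h4 : (c' * (k + 1) + i') + 1 ≤ y / W ^ k := by
          have h5 : y / W ^ k / (k + 1) = idxSize k W y := rfl
          have h6 : y / W ^ k % (k + 1) = idxPetal k W y := rfl
          rw [h5, h6] at hdm
          rcases hlex with h7 | ⟨h7, h8⟩
          · have := Nat.mul_le_mul_right (k + 1) h7
            rw [Nat.succ_mul] at this
            have h9 : (k + 1) * idxSize k W y = idxSize k W y * (k + 1) := mul_comm _ _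
            omega
          · rw [h7]
            have h9 : (k + 1) * idxSize k W y = idxSize k W y * (k + 1) := mul_comm _ _
            omega
        have h5 := Nat.mul_le_mul_right (W ^ k) h4
        have h6 := Nat.div_mul_le_self y (W ^ k)
        nlinarith
      have hnf := hmin _ hylow
      by_contra hge
      refine hnf ?_
      rw [Found, h1, h2, h3]
      refine ⟨hi', hic', hcard', ?_⟩
      have := card_member (k := k) (W := W) (T := T) (A := A) ((c' * (k + 1) + i') * W ^ k + x)
      rw [h1, h3] at this
      convert hge
    · rw [Finset.card_eq_zero.2]
      · exact hθ i'
      · rw [Finset.eq_empty_iff_forall_notMem]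
        intro C hC
        obtain ⟨h1, -, h2⟩ := mem_flower.1 hC
        obtain ⟨t, ht, rfl⟩ := mem_rowFam.1 (Sparsify.mem_minSets.1 h1).1
        exact hH' (h2.trans (h.sub t ht))
  · ext C
    simp only [Finset.mem_union, Finset.mem_image, Finset.mem_range, Finset.mem_insert]
    constructor
    · rintro (hC | ⟨j, hj, rfl⟩)
      · exact Or.inr hC
      · by_cases hj0 : j = 0
        · simp [hj0]
        · simp [hj0, hpad]
    · rintro (rfl | hC)
      · have := hθ (idxPetal k W y)
        exact Or.inr ⟨0, by omega, by simp⟩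
      · exact Or.inl hC
  · ext C
    simp only [Finset.mem_union, Finset.mem_image, Finset.mem_range]
    constructor
    · rintro (hC | ⟨j, hj, rfl⟩)
      · exact Or.inl hC
      · by_cases hjθ : j < θ (idxPetal k W y)
        · obtain ⟨t, ht, hr⟩ := hex2 j hjθ
          obtain ⟨h1, h2, -⟩ := hImem t ht
          refine Or.inr ⟨A t, ⟨t, ht, rfl⟩, ?_⟩
          rw [if_pos trivial, if_pos hjθ, ← hr]
          simp only [hrank]
          convert (petalSet_eq h1 (h.sub t h1) h2).symm
        · simp [hjθ, hpad]
    · rintro (hC | ⟨_, ⟨t, ht, rfl⟩, rfl⟩)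
      · exact Or.inl hC
      · obtain ⟨h1, h2, h3⟩ := hImem t ht
        refine Or.inr ⟨rank t, by omega, ?_⟩
        rw [if_pos trivial, if_pos h3]
        simp only [hrank]
        convert petalSet_eq h1 (h.sub t h1) h2

end Sparsify

/-! ## Hoare triples for families of inputs -/

/-- For every index `i`, started in a configuration that satisfies `Pre i`, the program `p` halts in
one that satisfies `Post i`, within time `w i` up to factors that are polynomial in `z i`. -/
def PHt {ι : Type} (z w : ι → ℕ) (p : Prog)
    (Pre Post : ι → (ℕ → ℤ) → (ℕ → ℤ → ℤ) → Prop) : Prop :=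
  ∃ c : ℕ, ∀ i ρ μ, Pre i ρ μ → Ht p ρ μ (c * (z i + 1) ^ c * w i) (Post i)

namespace PHt

variable {ι : Type} {z w : ι → ℕ} {p q : Prog}
  {P Q R : ι → (ℕ → ℤ) → (ℕ → ℤ → ℤ) → Prop}

theorem of_ht {f : ι → ℕ} (hf : PolyBdd z f)
    (h : ∀ i ρ μ, P i ρ μ → Ht p ρ μ (f i * w i) (Q i)) : PHt z w p P Q := by
  obtain ⟨c, hc⟩ := hf
  exact ⟨c, fun i ρ μ hP => (h i ρ μ hP).le (Nat.mul_le_mul_right _ (hc i))⟩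

theorem seq (hp : PHt z w p P Q) (hq : PHt z w q Q R) : PHt z w (.seq p q) P R := by
  obtain ⟨c, hc⟩ := hp
  obtain ⟨d, hd⟩ := hq
  refine of_ht ((PolyBdd.self.add (.const 1)).pow c |>.const_mul c |>.add
    ((PolyBdd.self.add (.const 1)).pow d |>.const_mul d)) fun i ρ μ hP => ?_
  rw [add_mul]
  exact (hc i ρ μ hP).seq (hd i)

theorem conseq {P' Q'} (h : PHt z w p P Q) (hP : ∀ i ρ μ, P' i ρ μ → P i ρ μ)
    (hQ : ∀ i ρ μ, Q i ρ μ → Q' i ρ μ) : PHt z w p P' Q' := by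
  obtain ⟨c, hc⟩ := h
  exact ⟨c, fun i ρ μ h => (hc i ρ μ (hP i ρ μ h)).mono le_rfl (hQ i)⟩

theorem weight {w' : ι → ℕ} (h : PHt z w p P Q) {f : ι → ℕ} (hf : PolyBdd z f)
    (hw : ∀ i, w i ≤ f i * w' i) : PHt z w' p P Q := by
  obtain ⟨c, hc⟩ := h
  refine of_ht (((PolyBdd.self.add (.const 1)).pow c |>.const_mul c).mul hf) fun i ρ μ hP => ?_
  refine (hc i ρ μ hP).le ?_
  rw [mul_assoc (c * (z i + 1) ^ c)]
  exact Nat.mul_le_mul_left _ (hw i)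

theorem assign {M B : ι → ℕ} (hM : PolyBdd z M) (hB : PolyBdd z B) (hw : ∀ i, 1 ≤ w i) {e : Expr}
    (x : ℕ) (he : e.WF) (h : ∀ i ρ μ, P i ρ μ → Expr.Small ρ μ (M i) (B i) ∧
      Q i (Function.update ρ x (e.eval ρ μ)) μ) : PHt z w (.assign x e) P Q :=
  of_ht (e.cost_polyBdd hM hB) fun i ρ μ hP =>
    (Ht.assign x (h i ρ μ hP).1 he (h i ρ μ hP).2).le (Nat.le_mul_of_pos_right _ (hw i))

theorem storeExpr {M B : ι → ℕ} (hM : PolyBdd z M) (hB : PolyBdd z B) (hw : ∀ i, 1 ≤ w i)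
    {e₁ e₂ : Expr} (a : ℕ) (he₁ : e₁.WF) (he₂ : e₂.WF)
    (h : ∀ i ρ μ, P i ρ μ → Expr.Small ρ μ (M i) (B i) ∧
      Q i ρ (Function.update μ a (Function.update (μ a) (e₁.eval ρ μ) (e₂.eval ρ μ)))) :
    PHt z w (.storeExpr a e₁ e₂) P Q :=
  of_ht ((e₁.cost_polyBdd hM hB).add (e₂.cost_polyBdd hM hB)) fun i ρ μ hP =>
    (Ht.storeExpr a (h i ρ μ hP).1 he₁ he₂ (h i ρ μ hP).2).le (Nat.le_mul_of_pos_right _ (hw i))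

/-- The body is specified for the family indexed by pairs of an input and a round, so one polynomial
bounds all rounds. -/
theorem forLoop {x b : ℕ} {body : Prog} (hx : x < 80) (hb : b < 80) (hxb : x ≠ b) {N M : ι → ℕ}
    (I : ι → ℕ → (ℕ → ℤ) → (ℕ → ℤ → ℤ) → Prop) (hM : PolyBdd z M)
    (hbody : PHt (fun i : ι × ℕ => z i.1) (fun i => w i.1) body
      (fun i ρ μ => i.2 < N i.1 ∧ I i.1 i.2 ρ μ) fun i ρ μ =>
        ρ x = i.2 ∧ ρ b = N i.1 ∧ I i.1 (i.2 + 1) (Function.update ρ x ((i.2 + 1 : ℕ) : ℤ)) μ)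
    (hw : ∀ i, 1 ≤ w i)
    (h : ∀ i ρ μ, P i ρ μ → bitLen (N i : ℤ) ≤ M i ∧ ρ b = N i ∧ I i 0 (Function.update ρ x 0) μ) :
    PHt z (fun i => (N i + 1) * w i) (.forLoop x b body) P fun i => I i (N i) := by
  obtain ⟨c, hc⟩ := hbody
  refine of_ht (((PolyBdd.self.add (.const 1)).pow c |>.const_mul c).add
    (((PolyBdd.const 5).mul hM).add (.const 10))) fun i ρ μ hP => ?_
  obtain ⟨h1, h2, h3⟩ := h i ρ μ hP
  refine (Ht.forLoop (T := c * (z i + 1) ^ c * w i) hx hb hxb (I i)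
    (fun j hj ρ' μ' hI => hc (i, j) ρ' μ' ⟨hj, hI⟩) h2 h3).le ?_
  have := hw i
  calc (N i + 1) * (c * (z i + 1) ^ c * w i + 5 * bitLen (N i : ℤ) + 10)
      ≤ (N i + 1) * (c * (z i + 1) ^ c * w i + (5 * M i + 10) * w i) := by
        refine Nat.mul_le_mul_left _ ?_
        nlinarith
    _ = _ := by ring

end PHt

/-- Nested loops that fill a two-dimensional array. -/
def Prog.fill₂ (x bx y b a : ℕ) (e₁ e₂ : Expr) : Prog := .forLoop x bx (.fill y b a e₁ e₂)

theorem Ht.fill₂ {ρ : ℕ → ℤ} {μ : ℕ → ℤ → ℤ} {M B x bx y b a N₁ N₂ : ℕ} {e₁ e₂ : Expr}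
    (hx : 16 ≤ x) (hx' : x < 64) (hbx : bx < 64) (hy : 16 ≤ y) (hy' : y < 64) (hb : b < 64)
    (hxbx : x ≠ bx) (hxb : x ≠ b) (hyb : y ≠ b) (hybx : y ≠ bx) (hxy : x ≠ y)
    (h : Expr.Small ρ μ M B) (he₁ : e₁.WF) (he₂ : e₂.WF) (hρ₁ : ρ bx = N₁) (hρ₂ : ρ b = N₂)
    (addr val : ℕ → ℕ → ℤ)
    (h₁ : ∀ i < N₁, ∀ j < N₂, ∀ ν, e₁.eval (Function.update (Function.update ρ x (i : ℤ)) y (j : ℤ))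
      (Function.update μ a ν) = addr i j)
    (h₂ : ∀ i < N₁, ∀ j < N₂, ∀ ν,
      Expr.Small (Function.update (Function.update ρ x (i : ℤ)) y (j : ℤ)) (Function.update μ a ν) M B →
      e₂.eval (Function.update (Function.update ρ x (i : ℤ)) y (j : ℤ))
      (Function.update μ a ν) = val i j)
    (hval : a < 8 → ∀ i < N₁, ∀ j < N₂, bitLen (val i j) ≤ M)
    (hinj : ∀ i < N₁, ∀ j < N₂, ∀ i' < N₁, ∀ j' < N₂, addr i j = addr i' j' → i = i' ∧ j = j') :
    Ht (.fill₂ x bx y b a e₁ e₂) ρ μ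
      ((N₁ + 1) * ((N₂ + 1) * (e₁.cost M B + e₂.cost M B + 5 * M + 10) + 5 * M + 10)) fun ρ' μ' =>
      (∀ u, u ≠ x → u ≠ y → ρ' u = ρ u) ∧ Expr.Small ρ' μ' M B ∧ ∃ ν, μ' = Function.update μ a ν ∧
        (∀ i < N₁, ∀ j < N₂, ν (addr i j) = val i j) ∧
          ∀ u, (∀ i < N₁, ∀ j < N₂, addr i j ≠ u) → ν u = μ a u := by
  have hNM : bitLen (N₁ : ℤ) ≤ M := by rw [← hρ₁]; exact h.reg bx hbx
  have hNM₂ : bitLen (N₂ : ℤ) ≤ M := by rw [← hρ₂]; exact h.reg b hb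
  have hsm : ∀ n ≤ N₁, ∀ ν, (∀ i < n, ∀ j < N₂, ν (addr i j) = val i j) →
      (∀ u, (∀ i < n, ∀ j < N₂, addr i j ≠ u) → ν u = μ a u) →
      ∀ ρ' : ℕ → ℤ, (∀ u, u ≠ x → u ≠ y → ρ' u = ρ u) → bitLen (ρ' x) ≤ M → bitLen (ρ' y) ≤ M →
      Expr.Small ρ' (Function.update μ a ν) M B := by
    intro n hn ν h3 h4 ρ' h5 h6 h7
    refine ⟨fun u hu => ?_, fun u hu => ?_, fun a' ha' u => ?_, h.bits⟩
    · by_cases hux : u = x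
      · rwa [hux]
      by_cases huy : u = y
      · rwa [huy]
      rw [h5 u hux huy]
      exact h.reg u hu
    · rw [h5 u (by omega) (by omega)]
      exact h.bound u hu
    · by_cases haa : a' = a
      · subst haa
        simp only [Function.update_self]
        by_cases hz : ∃ i < n, ∃ j < N₂, addr i j = u
        · obtain ⟨i, hi, j, hj, rfl⟩ := hz
          rw [h3 i hi j hj]
          exact hval ha' i (by omega) j hj
        · push Not at hz
          rw [h4 u hz]
          exact h.mem a' ha' u
      · simpa [haa] using h.mem a' ha' u
  let I : ℕ → (ℕ → ℤ) → (ℕ → ℤ → ℤ) → Prop := fun n ρ' μ' =>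
    (∀ u, u ≠ x → u ≠ y → ρ' u = ρ u) ∧ ρ' x = n ∧ bitLen (ρ' y) ≤ M ∧ n ≤ N₁ ∧
      ∃ ν, μ' = Function.update μ a ν ∧
        (∀ i < n, ∀ j < N₂, ν (addr i j) = val i j) ∧
          ∀ u, (∀ i < n, ∀ j < N₂, addr i j ≠ u) → ν u = μ a u
  refine (Ht.forLoop (T := (N₂ + 1) * (e₁.cost M B + e₂.cost M B + 5 * M + 10)) (by omega)
    (by omega) hxbx I ?_ hρ₁ ?_).mono (Nat.mul_le_mul_left _ (by omega)) ?_
  · rintro i hi ρ' μ' ⟨h3, h4, h5, -, ν, rfl, h6, h7⟩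
    have hup : ∀ j : ℕ, ∀ r < 64, Function.update ρ' y (j : ℤ) r =
        Function.update (Function.update ρ x (i : ℤ)) y (j : ℤ) r := by
      intro j r _
      by_cases hry : r = y
      · subst hry; simp
      by_cases hrx : r = x
      · subst hrx; simp [hry, h4]
      · simp [hry, hrx, h3 r hrx hry]
    have hxM : bitLen (ρ' x) ≤ M := by
      rw [h4]; exact (bitLen_natCast_mono hi.le).trans hNM
    refine (Ht.fill (M := M) (B := B) (N := N₂) hy hy' hb hyb
      (hsm i hi.le ν h6 h7 ρ' h3 hxM h5) he₁ he₂
      (by rw [h3 b hxb.symm hyb.symm, hρ₂]) (addr i) (val i) (fun j hj ν' => ?_) (fun j hj ν' hs => ?_)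
      (fun ha j hj => hval ha i hi j hj) (fun j hj j' hj' he => (hinj i hi j hj i hi j' hj' he).2)).mono
      le_rfl ?_
    · rw [Function.update_idem, e₁.eval_congr he₁ _ (hup j), h₁ i hi j hj]
    · rw [Function.update_idem] at hs ⊢
      rw [e₂.eval_congr he₂ _ (hup j), h₂ i hi j hj _ (hs.congr fun u hu => (hup j u hu).symm)]
    · rintro ρ'' μ'' ⟨rfl, ν', rfl, h8, h9⟩
      simp only [Function.update_self] at h9
      refine ⟨by simp [hxy, h4], by simp [hybx.symm, h3 bx hxbx.symm hybx.symm, hρ₁],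
        fun u hux huy => by simp [hux, huy, h3 u hux huy], by simp, by simp [hxy.symm, hNM₂], hi,
        ν', by simp, fun i' hi' j hj => ?_, fun u hu => ?_⟩
      · by_cases hii : i' = i
        · subst hii; exact h8 j hj
        · rw [h9 _ fun j' hj' he => hii (hinj i hi j' hj' i' (by omega) j hj he).1.symm]
          exact h6 i' (by omega) j hj
      · rw [h9 u fun j hj => hu i (by omega) j hj]
        exact h7 u fun i' hi' j hj => hu i' (by omega) j hj
  · exact ⟨fun u hux _ => by simp [hux], by simp, by simpa [hxy.symm] using h.reg y hy', by simp,
      μ a, by simp, by simp, by simp⟩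
  · rintro ρ' μ' ⟨h3, h4, h5, -, ν, rfl, h6, h7⟩
    exact ⟨h3, hsm N₁ le_rfl ν h6 h7 ρ' h3 (by rwa [h4]) h5, ν, rfl, h6, h7⟩

theorem PHt.fill₂ {ι : Type} {z w N₁ N₂ M B : ι → ℕ} {x bx y b a : ℕ} {e₁ e₂ : Expr}
    {P Q : ι → (ℕ → ℤ) → (ℕ → ℤ → ℤ) → Prop}
    (hx : 16 ≤ x) (hx' : x < 64) (hbx : bx < 64) (hy : 16 ≤ y) (hy' : y < 64) (hb : b < 64)
    (hxbx : x ≠ bx) (hxb : x ≠ b) (hyb : y ≠ b) (hybx : y ≠ bx) (hxy : x ≠ y)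
    (hM : PolyBdd z M) (hB : PolyBdd z B) (he₁ : e₁.WF) (he₂ : e₂.WF)
    (hN₂ : PolyBdd z N₂) (hw : ∀ i, N₁ i + 1 ≤ w i)
    (h : ∀ i ρ μ, P i ρ μ → Expr.Small ρ μ (M i) (B i) ∧ ρ bx = N₁ i ∧ ρ b = N₂ i ∧
      ∃ addr val : ℕ → ℕ → ℤ,
      (∀ s < N₁ i, ∀ t < N₂ i, ∀ ν, e₁.eval (Function.update (Function.update ρ x (s : ℤ)) y (t : ℤ))
        (Function.update μ a ν) = addr s t) ∧
      (∀ s < N₁ i, ∀ t < N₂ i, ∀ ν, Expr.Small (Function.update (Function.update ρ x (s : ℤ)) y (t : ℤ))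
        (Function.update μ a ν) (M i) (B i) →
        e₂.eval (Function.update (Function.update ρ x (s : ℤ)) y (t : ℤ))
        (Function.update μ a ν) = val s t) ∧
      (a < 8 → ∀ s < N₁ i, ∀ t < N₂ i, bitLen (val s t) ≤ M i) ∧
      (∀ s < N₁ i, ∀ t < N₂ i, ∀ s' < N₁ i, ∀ t' < N₂ i, addr s t = addr s' t' → s = s' ∧ t = t') ∧
      ∀ ρ' ν, (∀ u, u ≠ x → u ≠ y → ρ' u = ρ u) →
        Expr.Small ρ' (Function.update μ a ν) (M i) (B i) →
        (∀ s < N₁ i, ∀ t < N₂ i, ν (addr s t) = val s t) →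
        (∀ u, (∀ s < N₁ i, ∀ t < N₂ i, addr s t ≠ u) → ν u = μ a u) →
        Q i ρ' (Function.update μ a ν)) :
    PHt z w (.fill₂ x bx y b a e₁ e₂) P Q := by
  refine of_ht (f := fun i => (N₂ i + 1) * (e₁.cost (M i) (B i) + e₂.cost (M i) (B i) + 5 * M i + 10)
    + 5 * M i + 10) ((((hN₂.add (.const 1)).mul ((((e₁.cost_polyBdd hM hB).add
      (e₂.cost_polyBdd hM hB)).add ((PolyBdd.const 5).mul hM)).add (.const 10))).add
        ((PolyBdd.const 5).mul hM)).add (.const 10)) fun i ρ μ hP => ?_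
  obtain ⟨h1, h2, h3, addr, val, h4, h5, h6, h7, h8⟩ := h i ρ μ hP
  refine (Ht.fill₂ hx hx' hbx hy hy' hb hxbx hxb hyb hybx hxy h1 he₁ he₂ h2 h3 addr val h4 h5 h6
    h7).mono ?_ ?_
  · rw [mul_comm]
    exact Nat.mul_le_mul_left _ (hw i)
  · rintro ρ' μ' ⟨h9, h10, ν, rfl, h11, h12⟩
    exact h8 ρ' ν h9 h10 h11 h12

/-! ## Boolean expressions -/

namespace Expr

/-- The expression is true. -/
def Holds (e : Expr) (ρ : ℕ → ℤ) (μ : ℕ → ℤ → ℤ) : Prop := 0 < e.eval ρ μ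

def ind (e : Expr) : Expr := ite e (lit 1) (lit 0)
def lt (a b : Expr) : Expr := op .sub b a
def le (a b : Expr) : Expr := op .add (op .sub b a) (lit 1)
def conj (a b : Expr) : Expr := ite a b (lit 0)
def disj (a b : Expr) : Expr := ite a (lit 1) b
def neg (a : Expr) : Expr := ite a (lit 0) (lit 1)
def eq (a b : Expr) : Expr := conj (le a b) (le b a)
def count (x b : ℕ) (e : Expr) : Expr := sum x b (ind e)
def mod (a b : Expr) : Expr := op .sub a (op .mul b (op .div a b))

def anyOf (f : ℕ → Expr) : ℕ → Expr
  | 0 => lit 0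
  | n + 1 => disj (anyOf f n) (f n)

def sumOf (f : ℕ → Expr) : ℕ → Expr
  | 0 => lit 0
  | n + 1 => op .add (sumOf f n) (f n)

def pow (a : Expr) : ℕ → Expr
  | 0 => lit 1
  | n + 1 => op .mul (pow a n) a

variable {ρ : ℕ → ℤ} {μ : ℕ → ℤ → ℤ} {a b e c : Expr}

theorem holds_ite : (ite c a b).Holds ρ μ ↔
    (c.Holds ρ μ ∧ a.Holds ρ μ) ∨ (¬ c.Holds ρ μ ∧ b.Holds ρ μ) := by
  simp only [Holds, eval]; split_ifs with h <;> simp [h]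

theorem holds_lt : (lt a b).Holds ρ μ ↔ a.eval ρ μ < b.eval ρ μ := by
  simp [Holds, lt, eval, ArithOp.eval]

theorem holds_le : (le a b).Holds ρ μ ↔ a.eval ρ μ ≤ b.eval ρ μ := by
  simp [Holds, le, eval, ArithOp.eval]

theorem holds_conj : (conj a b).Holds ρ μ ↔ a.Holds ρ μ ∧ b.Holds ρ μ := by
  simp only [Holds, conj, eval]; split_ifs with h <;> simp [h]

theorem holds_disj : (disj a b).Holds ρ μ ↔ a.Holds ρ μ ∨ b.Holds ρ μ := by
  simp only [Holds, disj, eval]; split_ifs with h <;> simp [h]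

theorem holds_neg : (neg a).Holds ρ μ ↔ ¬ a.Holds ρ μ := by
  simp only [Holds, neg, eval]; split_ifs with h <;> simp [h]

theorem holds_eq : (eq a b).Holds ρ μ ↔ a.eval ρ μ = b.eval ρ μ := by
  rw [eq, holds_conj, holds_le, holds_le]; omega

open Classical in
theorem eval_ind : (ind e).eval ρ μ = if e.Holds ρ μ then 1 else 0 := by
  simp only [ind, eval, Holds]
  congr

open Classical in
theorem eval_count {x r N : ℕ} (h : ρ r = N) : (count x r e).eval ρ μ =
    (((Finset.range N).filter fun i : ℕ => e.Holds (Function.update ρ x (i : ℤ)) μ).card : ℤ) := by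
  simp only [count, eval, eval_ind, h, Int.toNat_natCast]
  rw [Finset.sum_boole]

theorem holds_count {x r N : ℕ} (h : ρ r = N) : (count x r e).Holds ρ μ ↔
    ∃ i < N, e.Holds (Function.update ρ x (i : ℤ)) μ := by
  classical
  rw [Holds, eval_count h, Nat.cast_pos, Finset.card_pos]
  simp [Finset.Nonempty]

theorem eval_mod : (mod a b).eval ρ μ = a.eval ρ μ % b.eval ρ μ := by
  simp [mod, eval, ArithOp.eval, Int.emod_def]

theorem holds_anyOf {f : ℕ → Expr} {n : ℕ} :
    (anyOf f n).Holds ρ μ ↔ ∃ i < n, (f i).Holds ρ μ := by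
  induction n with
  | zero => simp [anyOf, Holds, eval]
  | succ n ih => simp only [anyOf, holds_disj, ih, Nat.exists_lt_succ_right]

theorem eval_sumOf {f : ℕ → Expr} {n : ℕ} :
    (sumOf f n).eval ρ μ = ∑ i ∈ Finset.range n, (f i).eval ρ μ := by
  induction n with
  | zero => simp [sumOf, eval]
  | succ n ih => simp [sumOf, eval, ArithOp.eval, ih, Finset.sum_range_succ]

theorem eval_pow {n : ℕ} : (pow a n).eval ρ μ = a.eval ρ μ ^ n := by
  induction n with
  | zero => simp [pow, eval]
  | succ n ih => simp [pow, eval, ArithOp.eval, ih, pow_succ]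

theorem wf_anyOf {f : ℕ → Expr} {n : ℕ} (h : ∀ i, (f i).WF) : (anyOf f n).WF := by
  induction n with
  | zero => simp [anyOf, WF]
  | succ n ih => simp [anyOf, disj, WF, ih, h]

theorem wf_sumOf {f : ℕ → Expr} {n : ℕ} (h : ∀ i, (f i).WF) : (sumOf f n).WF := by
  induction n with
  | zero => simp [sumOf, WF]
  | succ n ih => simp [sumOf, WF, ih, h]

theorem wf_pow {x n : ℕ} (h : x < 64) : (pow (var x) n).WF := by
  induction n with
  | zero => simp [pow, WF]
  | succ n ih => simp [pow, WF, ih, h]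

/-- The value `f e` for `e < n`. -/
def table (f : ℕ → ℕ) (n : ℕ) (e : Expr) : Expr :=
  sumOf (fun i => ite (eq e (lit i)) (lit (f i)) (lit 0)) n

theorem eval_table {f : ℕ → ℕ} {n i : ℕ} (hi : i < n) (he : e.eval ρ μ = i) :
    (table f n e).eval ρ μ = f i := by
  rw [table, eval_sumOf, Finset.sum_eq_single i]
  · simp only [eval]
    rw [if_pos]
    exact holds_eq.2 he
  · intro j _ hj
    simp only [eval]
    rw [if_neg]
    intro h
    have := holds_eq.1 h
    simp only [eval, he] at this
    exact hj (by exact_mod_cast this.symm)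
  · simp [hi]

theorem wf_table {f : ℕ → ℕ} {n : ℕ} (he : e.WF) : (table f n e).WF :=
  wf_sumOf fun i => by simp [WF, eq, conj, le, he]

end Expr

/-! ## Expressions for the sparsification process -/

namespace Sparsify

open Expr

/-- Registers `0`, `1`, `2` hold the number of literals, of rows and of sunflower indices, and segment
`2` holds the rows. -/
structure RowCtx (k W T : ℕ) (A : ℕ → Finset ℕ) (ρ : ℕ → ℤ) (μ : ℕ → ℤ → ℤ) : Prop where
  width : ρ 0 = W
  rows : ρ 1 = T
  idx : ρ 2 = numIdx k W
  mem : ∀ t < T, ∀ l < W, 0 < μ 2 ((t : ℤ) * W + l) ↔ l ∈ A t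
  sub : ∀ t < T, A t ⊆ Finset.range W

/-- The bound variables 16 to 21 are allotted by nesting depth: an expression takes its free
variables above those that its own sums bind, so that nothing is captured. This is the origin of the
lower bounds on register numbers in the correctness lemmas. -/
def rowHas (t l : ℕ) : Expr := .get 2 (.op .add (.op .mul (.var t) (.var 0)) (.var l))
def subsetE (t u : ℕ) : Expr := neg (count 16 0 (conj (rowHas t 16) (neg (rowHas u 16))))
def liveE (t : ℕ) : Expr :=
  neg (count 17 1 (conj (subsetE 17 t) (neg (conj (le (var t) (var 17)) (subsetE t 17)))))
def heartE (k y l : ℕ) : Expr :=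
  anyOf (fun j => eq (mod (op .div (var y) (pow (var 0) j)) (var 0)) (var l)) k
def sizeE (k y : ℕ) : Expr := op .div (op .div (var y) (pow (var 0) k)) (lit (k + 1))
def petalE (k y : ℕ) : Expr := mod (op .div (var y) (pow (var 0) k)) (lit (k + 1))
def memberE (k y t : ℕ) : Expr :=
  conj (liveE t) (conj (eq (count 16 0 (rowHas t 16)) (sizeE k y))
    (neg (count 16 0 (conj (heartE k y 16) (neg (rowHas t 16))))))
def foundE (k : ℕ) (θ : ℕ → ℕ) (y : ℕ) : Expr :=
  conj (lt (lit 0) (petalE k y)) (conj (lt (petalE k y) (sizeE k y))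
    (conj (eq (op .add (count 16 0 (heartE k y 16)) (petalE k y)) (sizeE k y))
      (neg (lt (count 18 1 (memberE k y 18)) (table θ (k + 1) (petalE k y))))))
def firstE (k : ℕ) (θ : ℕ → ℕ) : Expr :=
  count 21 2 (neg (count 20 2 (conj (le (var 20) (var 21)) (foundE k θ 20))))
def petalSetE (k y l : ℕ) (j : Expr) : Expr :=
  count 18 1 (conj (memberE k y 18) (conj
    (eq (count 19 1 (conj (lt (var 19) (var 18)) (memberE k y 19))) j)
      (conj (rowHas 18 l) (neg (heartE k y l)))))
def padE (l : ℕ) : Expr := eq (var l) (op .sub (var 0) (lit 1))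
def newRowE (k : ℕ) (θ : ℕ → ℕ) (y bit l : ℕ) (j : Expr) : Expr :=
  ite (lt (var y) (var 2))
    (ite (var bit)
      (ite (lt j (table θ (k + 1) (petalE k y))) (petalSetE k y l j) (padE l))
      (ite (eq j (lit 0)) (heartE k y l) (padE l)))
    (padE l)

theorem rowHas_wf {t l : ℕ} (ht : t < 64) (hl : l < 64) : (rowHas t l).WF := by
  simp [rowHas, WF, ht, hl]

theorem liveE_wf {t : ℕ} (ht : t < 64) : (liveE t).WF := by
  simp [liveE, subsetE, rowHas, neg, conj, count, ind, le, WF, ht]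

theorem heartE_wf {k y l : ℕ} (hy : y < 64) (hl : l < 64) : (heartE k y l).WF :=
  wf_anyOf fun i => by simp [eq, le, conj, mod, WF, hy, hl, wf_pow]

theorem sizeE_wf {k y : ℕ} (hy : y < 64) : (sizeE k y).WF := by
  simp [sizeE, WF, hy, wf_pow]

theorem petalE_wf {k y : ℕ} (hy : y < 64) : (petalE k y).WF := by
  simp [petalE, mod, WF, hy, wf_pow]

theorem memberE_wf {k y t : ℕ} (hy : y < 64) (ht : t < 64) : (memberE k y t).WF := by
  simp [memberE, neg, conj, count, ind, le, eq, WF, liveE_wf, sizeE_wf, heartE_wf, rowHas_wf, hy, ht]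

theorem foundE_wf {k : ℕ} {θ : ℕ → ℕ} {y : ℕ} (hy : y < 64) : (foundE k θ y).WF := by
  simp [foundE, neg, conj, count, ind, le, lt, eq, WF, memberE_wf, sizeE_wf, petalE_wf, heartE_wf,
    wf_table, hy]

theorem firstE_wf {k : ℕ} {θ : ℕ → ℕ} : (firstE k θ).WF := by
  simp [firstE, neg, conj, count, ind, le, WF, foundE_wf]

theorem newRowE_wf {k : ℕ} {θ : ℕ → ℕ} {y bit l : ℕ} {j : Expr} (hy : y < 64) (hb : bit < 64)
    (hl : l < 64) (hj : j.WF) : (newRowE k θ y bit l j).WF := by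
  simp [newRowE, petalSetE, padE, neg, conj, count, ind, le, lt, eq, WF, memberE_wf, petalE_wf,
    heartE_wf, rowHas_wf, wf_table, hy, hb, hl, hj]

/-! ### Meaning of the expressions on an array of rows -/

namespace RowCtx

variable {k W T : ℕ} {θ : ℕ → ℕ} {A : ℕ → Finset ℕ} {ρ : ℕ → ℤ} {μ : ℕ → ℤ → ℤ}

theorem update (h : RowCtx k W T A ρ μ) {x : ℕ} (hx : 3 ≤ x) (v : ℤ) :
    RowCtx k W T A (Function.update ρ x v) μ :=
  ⟨by rw [Function.update_of_ne (by omega), h.width],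
    by rw [Function.update_of_ne (by omega), h.rows],
    by rw [Function.update_of_ne (by omega), h.idx], h.mem, h.sub⟩

theorem holds_rowHas (h : RowCtx k W T A ρ μ) {t l τ : ℕ} (ht : ρ t = τ) (hτ : τ < T) {v : ℕ}
    (hl : ρ l = v) (hv : v < W) : (rowHas t l).Holds ρ μ ↔ v ∈ A τ := by
  simp only [rowHas, Holds, eval, ArithOp.eval, ht, hl, h.width]
  exact h.mem τ hτ v hv

theorem holds_subset (h : RowCtx k W T A ρ μ) {t u τ υ : ℕ} (ht : ρ t = τ) (hτ : τ < T)
    (hu : ρ u = υ) (hυ : υ < T) (h16 : 17 ≤ t) (hu16 : 17 ≤ u) :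
    (subsetE t u).Holds ρ μ ↔ A τ ⊆ A υ := by
  rw [subsetE, holds_neg, holds_count h.width]
  push Not
  constructor
  · intro H l hl
    have hlW := Finset.mem_range.1 (h.sub τ hτ hl)
    have := H l hlW
    rw [holds_conj, holds_neg, (h.update (by norm_num) _).holds_rowHas (τ := τ) (v := l) (by
      rw [Function.update_of_ne (by omega), ht]) hτ (by simp) hlW,
      (h.update (by norm_num) _).holds_rowHas (τ := υ) (v := l) (by
      rw [Function.update_of_ne (by omega), hu]) hυ (by simp) hlW] at this
    tauto
  · intro H l hlW
    rw [holds_conj, holds_neg, (h.update (by norm_num) _).holds_rowHas (τ := τ) (v := l) (by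
      rw [Function.update_of_ne (by omega), ht]) hτ (by simp) hlW,
      (h.update (by norm_num) _).holds_rowHas (τ := υ) (v := l) (by
      rw [Function.update_of_ne (by omega), hu]) hυ (by simp) hlW]
    have := @H l
    tauto

theorem holds_live (h : RowCtx k W T A ρ μ) {t τ : ℕ} (ht : ρ t = τ) (hτ : τ < T) (h18 : 18 ≤ t) :
    (liveE t).Holds ρ μ ↔ Live T A τ := by
  rw [liveE, holds_neg, holds_count h.rows, Live]
  push Not
  refine forall₂_congr fun u hu => ?_
  have h' := h.update (x := 17) (by norm_num) (u : ℤ)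
  have e1 : Function.update ρ 17 (u : ℤ) t = τ := by rw [Function.update_of_ne (by omega), ht]
  rw [holds_conj, holds_neg, holds_conj, holds_le,
    h'.holds_subset (τ := u) (υ := τ) (by simp) hu e1 hτ le_rfl (by omega),
    h'.holds_subset (τ := τ) (υ := u) e1 hτ (by simp) hu (by omega) le_rfl]
  simp only [eval, e1, Function.update_self, Nat.cast_le]
  tauto

theorem holds_heart (h : RowCtx k W T A ρ μ) {y l v w : ℕ} (hy : ρ y = v) (hl : ρ l = w)
    (hw : w < W) : (heartE k y l).Holds ρ μ ↔ w ∈ idxHeart k W v := by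
  rw [heartE, holds_anyOf, idxHeart, Finset.mem_filter, Finset.mem_range]
  simp only [holds_eq, eval_mod, eval, ArithOp.eval, eval_pow, hy, hl, h.width, hw, true_and]
  norm_cast

theorem eval_size (h : RowCtx k W T A ρ μ) {y v : ℕ} (hy : ρ y = v) :
    (sizeE k y).eval ρ μ = idxSize k W v := by
  simp only [sizeE, eval, ArithOp.eval, eval_pow, hy, h.width, idxSize]
  push_cast
  rfl

theorem eval_petal (h : RowCtx k W T A ρ μ) {y v : ℕ} (hy : ρ y = v) :
    (petalE k y).eval ρ μ = idxPetal k W v := by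
  simp only [petalE, eval_mod, eval, ArithOp.eval, eval_pow, hy, h.width, idxPetal]
  push_cast
  rfl

theorem eval_card (h : RowCtx k W T A ρ μ) {t τ : ℕ} (ht : ρ t = τ) (hτ : τ < T) (h17 : 17 ≤ t) :
    (count 16 0 (rowHas t 16)).eval ρ μ = (A τ).card := by
  classical
  rw [eval_count h.width]
  congr 2
  ext l
  rw [Finset.mem_filter, Finset.mem_range]
  constructor
  · rintro ⟨h1, h2⟩
    rwa [(h.update (by norm_num) _).holds_rowHas (τ := τ) (v := l)
      (by rw [Function.update_of_ne (by omega), ht]) hτ (by simp) h1] at h2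
  · intro h1
    have hlW := Finset.mem_range.1 (h.sub τ hτ h1)
    refine ⟨hlW, ?_⟩
    rwa [(h.update (by norm_num) _).holds_rowHas (τ := τ) (v := l)
      (by rw [Function.update_of_ne (by omega), ht]) hτ (by simp) hlW]

theorem holds_member (h : RowCtx k W T A ρ μ) {y t v τ : ℕ} (hy : ρ y = v) (ht : ρ t = τ)
    (hτ : τ < T) (hy17 : 17 ≤ y) (h18 : 18 ≤ t) :
    (memberE k y t).Holds ρ μ ↔ Member k W T A v τ := by
  rw [memberE, holds_conj, holds_conj, h.holds_live ht hτ h18, holds_eq,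
    h.eval_card ht hτ (by omega), h.eval_size hy, holds_neg, holds_count h.width, Member]
  norm_cast
  refine and_congr_right fun _ => and_congr_right fun _ => ?_
  push Not
  have key : ∀ l < W, ((heartE k y 16).conj (rowHas t 16).neg).Holds
      (Function.update ρ 16 (l : ℤ)) μ ↔ l ∈ idxHeart k W v ∧ l ∉ A τ := by
    intro l hl
    rw [holds_conj, holds_neg, (h.update (by norm_num) _).holds_rowHas (τ := τ) (v := l)
      (by rw [Function.update_of_ne (by omega), ht]) hτ (by simp) hl,
      (h.update (by norm_num) _).holds_heart (v := v) (w := l)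
        (by rw [Function.update_of_ne (by omega), hy]) (by simp) hl]
  constructor
  · intro H l hl
    have hlW : l < W := Finset.mem_range.1 (Finset.filter_subset _ _ hl)
    have := H l hlW
    rw [key l hlW] at this
    tauto
  · intro H l hlW
    rw [key l hlW]
    have := @H l
    tauto

theorem holds_found (h : RowCtx k W T A ρ μ) {y v : ℕ} (hy : ρ y = v) (hy19 : 19 ≤ y) :
    (foundE k θ y).Holds ρ μ ↔ Found k W T θ A v := by
  classical
  have hheart : (count 16 0 (heartE k y 16)).eval ρ μ = (idxHeart k W v).card := by
    rw [eval_count h.width]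
    congr 2
    ext l
    rw [Finset.mem_filter, Finset.mem_range]
    constructor
    · rintro ⟨h1, h2⟩
      rwa [(h.update (by norm_num) _).holds_heart (v := v) (w := l)
        (by rw [Function.update_of_ne (by omega), hy]) (by simp) h1] at h2
    · intro h1
      have hlW : l < W := Finset.mem_range.1 (Finset.filter_subset _ _ h1)
      refine ⟨hlW, ?_⟩
      rwa [(h.update (by norm_num) _).holds_heart (v := v) (w := l)
        (by rw [Function.update_of_ne (by omega), hy]) (by simp) hlW]
  have hcount : (count 18 1 (memberE k y 18)).eval ρ μ =
      (((Finset.range T).filter fun t => Member k W T A v t).card : ℤ) := by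
    rw [eval_count h.rows]
    congr 2
    refine Finset.filter_congr fun t ht => ?_
    exact (h.update (by norm_num) _).holds_member (v := v) (τ := t)
      (by rw [Function.update_of_ne (by omega), hy]) (by simp) (Finset.mem_range.1 ht) (by omega)
      (by omega)
  rw [foundE, holds_conj, holds_conj, holds_conj, holds_lt, holds_lt, holds_eq, holds_neg, holds_lt,
    hcount, h.eval_size hy, h.eval_petal hy, Expr.eval_table (i := idxPetal k W v)
      (Nat.mod_lt _ (by omega)) (h.eval_petal hy), Found]
  simp only [eval, ArithOp.eval, hheart, h.eval_petal hy]
  norm_cast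

theorem eval_first (h : RowCtx k W T A ρ μ) :
    (firstE k θ).eval ρ μ = firstIdx k W T θ A := by
  classical
  rw [firstE, eval_count h.idx, firstIdx]
  congr 2
  refine Finset.filter_congr fun y hy => ?_
  have h' := h.update (x := 21) (by norm_num) (y : ℤ)
  rw [holds_neg, holds_count h'.idx, not_iff_not]
  refine exists_congr fun y' => and_congr_right fun hy' => ?_
  rw [holds_conj, holds_le, (h'.update (by norm_num) _).holds_found (v := y') (by simp)
    (by norm_num)]
  simp [eval]

theorem holds_petalSet (h : RowCtx k W T A ρ μ) {y l v w i : ℕ} {j : Expr} (hy : ρ y = v)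
    (hl : ρ l = w) (hw : w < W) (hy20 : 20 ≤ y) (hl20 : 20 ≤ l)
    (hj : ∀ t : ℕ, j.eval (Function.update ρ 18 (t : ℤ)) μ = i) :
    (petalSetE k y l j).Holds ρ μ ↔ w ∈ petalSet k W T A v i := by
  classical
  rw [petalSetE, holds_count h.rows, petalSet, Finset.mem_filter, Finset.mem_range]
  simp only [hw, true_and]
  refine exists_congr fun t => and_congr_right fun ht => ?_
  have h' := h.update (x := 18) (by norm_num) (t : ℤ)
  have ey : Function.update ρ 18 (t : ℤ) y = v := by rw [Function.update_of_ne (by omega), hy]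
  have el : Function.update ρ 18 (t : ℤ) l = w := by rw [Function.update_of_ne (by omega), hl]
  have et : Function.update ρ 18 (t : ℤ) 18 = t := by simp
  rw [holds_conj, holds_conj, holds_conj, holds_neg, holds_eq, h'.holds_member ey et ht (by omega)
    le_rfl, h'.holds_rowHas et ht el hw, h'.holds_heart ey el hw, hj t, eval_count h'.rows]
  norm_cast
  have : ((Finset.range T).filter fun i : ℕ => ((lt (var 19) (var 18)).conj (memberE k y 19)).Holds
      (Function.update (Function.update ρ 18 (t : ℤ)) 19 (i : ℤ)) μ) =
      (Finset.range T).filter fun t' => t' < t ∧ Member k W T A v t' := by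
    refine Finset.filter_congr fun t' ht' => ?_
    rw [holds_conj, holds_lt, (h'.update (by norm_num) _).holds_member (v := v) (τ := t')
      (by rw [Function.update_of_ne (by omega), ey]) (by simp) (Finset.mem_range.1 ht') (by omega)
      (by norm_num)]
    simp [eval]
  rw [this]

theorem holds_pad (h : RowCtx k W T A ρ μ) {l w : ℕ} (hl : ρ l = w) (hw : w < W) :
    (padE l).Holds ρ μ ↔ w ∈ ({W - 1} : Finset ℕ) := by
  rw [padE, holds_eq, Finset.mem_singleton]
  simp only [eval, ArithOp.eval, hl, h.width]
  omega

theorem holds_newRow (h : RowCtx k W T A ρ μ) {y bit l w i : ℕ} {b : Bool} {j : Expr}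
    (hy : ρ y = firstIdx k W T θ A) (hb : 0 < ρ bit ↔ b = true)
    (hl : ρ l = w) (hw : w < W) (hy20 : 20 ≤ y) (hl20 : 20 ≤ l) (hj₀ : j.eval ρ μ = i)
    (hj : ∀ t : ℕ, j.eval (Function.update ρ 18 (t : ℤ)) μ = i) :
    (newRowE k θ y bit l j).Holds ρ μ ↔ w ∈ newRow k W T θ A b i := by
  have h1 : (lt (var y) (var 2)).Holds ρ μ ↔ firstIdx k W T θ A < numIdx k W := by
    rw [holds_lt]; simp only [eval, hy, h.idx]; norm_cast
  have h2 : (var bit).Holds ρ μ ↔ b = true := hb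
  have h3 : (lt j (table θ (k + 1) (petalE k y))).Holds ρ μ ↔
      i < θ (idxPetal k W (firstIdx k W T θ A)) := by
    rw [holds_lt, hj₀, Expr.eval_table (i := idxPetal k W (firstIdx k W T θ A))
      (Nat.mod_lt _ (by omega)) (h.eval_petal hy)]
    norm_cast
  have h4 : (eq j (lit 0)).Holds ρ μ ↔ i = 0 := by
    rw [holds_eq, hj₀]; simp [eval]
  rw [newRowE, holds_ite, holds_ite, holds_ite, holds_ite, h1, h2, h3, h4, h.holds_pad hl hw,
    h.holds_petalSet hy hl hw hy20 hl20 hj, h.holds_heart hy hl hw, newRow]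
  split_ifs <;> simp_all

end RowCtx

end Sparsify

/-! ## From formulas to pairs of partial assignments -/

/-- The data of the reduction: `2 ^ (n / q)` is the number of partial assignments on each side. -/
structure Setup (k : ℕ) where
  q : ℕ
  q' : ℕ
  pr : Sparsify.Params k (q * q')
  c₀ : ℕ
  B₀ : ℕ
  cp : ℕ
  d : ℕ → ℕ
  dv : ℕ → ℕ
  K : ℕ
  k_pos : 1 ≤ k
  two_le_q : 2 ≤ q
  d_le : ∀ n, d n ≤ K * (n + 1) ^ K
  dv_le : ∀ n, dv n ≤ K * (n + 1) ^ K

/-- A `k`-CNF formula with its number of variables. -/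
abbrev Inst (k : ℕ) := Σ n, KCNF n k

/-- The literal `v` has the index `v`, and the literal `¬ v` has the index `n + v`. -/
def litIdx {n : ℕ} (x : Fin n × Bool) : ℕ := if x.2 then x.1 else n + x.1

/-- Truth of the literal with index `l`; the index `2 * n` stands for the constant `true`. -/
def TrueLit (n : ℕ) (a : ℕ → Bool) (l : ℕ) : Prop :=
  l = 2 * n ∨ (l < n ∧ a l = true) ∨ (n ≤ l ∧ l < 2 * n ∧ a (l - n) = false)

/-- The assignment whose values are the binary digits of three numbers. -/
def asgOf (g α β o : ℕ) (v : ℕ) : Bool :=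
  if v < g then α.testBit v else if v < 2 * g then β.testBit (v - g) else o.testBit (v - 2 * g)

theorem exists_asgOf (n g : ℕ) (a : ℕ → Bool) : ∃ α < 2 ^ g, ∃ β < 2 ^ g, ∃ o < 2 ^ (n - 2 * g),
    ∀ v < n, asgOf g α β o v = a v := by
  refine ⟨Nat.ofBits fun i : Fin g => a i, Nat.ofBits_lt_two_pow _,
    Nat.ofBits fun i : Fin g => a (g + i), Nat.ofBits_lt_two_pow _,
    Nat.ofBits fun i : Fin (n - 2 * g) => a (2 * g + i), Nat.ofBits_lt_two_pow _, fun v hv => ?_⟩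
  rw [asgOf]
  split_ifs with h1 h2
  · rw [Nat.testBit_ofBits_lt _ _ h1]
  · rw [Nat.testBit_ofBits_lt _ _ (by omega : v - g < g)]
    congr 1; dsimp only; omega
  · rw [Nat.testBit_ofBits_lt _ _ (by omega : v - 2 * g < n - 2 * g)]
    congr 1; dsimp only; omega

/-! ### Padding the sparse family to a fixed number of sets -/

namespace Sparsify

open Classical in
/-- The `j`-th of the sets that result from the rows `A`: the minimal ones and copies of `{W - 1}`, or
only empty sets if there are more than `J` minimal rows. -/
noncomputable def compress (W T J : ℕ) (A : ℕ → Finset ℕ) (j : ℕ) : Finset ℕ :=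
  (Finset.range W).filter fun l =>
    ¬ J < ((Finset.range T).filter fun t => Live T A t).card ∧
    ((∃ t < T, Live T A t ∧ ((Finset.range T).filter fun t' => t' < t ∧ Live T A t').card = j ∧
      l ∈ A t) ∨ (((Finset.range T).filter fun t => Live T A t).card ≤ j ∧ l ∈ ({W - 1} : Finset ℕ)))

theorem exists_live_subset {T : ℕ} {A : ℕ → Finset ℕ} {t : ℕ} (ht : t < T) :
    ∃ u < T, Live T A u ∧ A u ⊆ A t := by
  classical
  obtain ⟨C, hC, hmin⟩ := Finset.exists_min_image ((rowFam T A).filter (· ⊆ A t)) Finset.card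
    ⟨A t, Finset.mem_filter.2 ⟨mem_rowFam.2 ⟨t, ht, rfl⟩, subset_rfl⟩⟩
  rw [Finset.mem_filter] at hC
  obtain ⟨u, hu, hl, rfl⟩ := exists_live (T := T) (A := A) (C := C) (mem_minSets.2 ⟨hC.1,
    fun D hD hDC => Finset.eq_of_subset_of_card_le hDC
      (hmin D (Finset.mem_filter.2 ⟨hD, hDC.trans hC.2⟩))⟩)
  exact ⟨u, hu, hl, hC.2⟩

/-- A set that hits the minimal rows hits all rows, and the padding sets are hit because `W - 1`
stands for the constant true. If there are too many live rows, empty sets are produced, which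
nothing hits. This discards the codes whose path does not reach a sparse family. -/
theorem compress_hits {W T J : ℕ} {A : ℕ → Finset ℕ} (hsub : ∀ t < T, A t ⊆ Finset.range W)
    (hW : 0 < W) (hJ : 0 < J) {a : Set ℕ} (hpad : W - 1 ∈ a) :
    (∀ j < J, ∃ l ∈ compress W T J A j, l ∈ a) ↔
      (minSets (rowFam T A)).card ≤ J ∧ Hits a (rowFam T A) := by
  classical
  have hlive := card_live (T := T) (A := A)
  have hlive' : ((Finset.range T).filter fun t => Live T A t).card = (minSets (rowFam T A)).card := by
    convert hlive
  simp only [compress, Finset.mem_filter, Finset.mem_range]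
  constructor
  · intro h
    have hle : (minSets (rowFam T A)).card ≤ J := by
      obtain ⟨l, ⟨-, h1, -⟩, -⟩ := h 0 hJ
      rw [← hlive]
      convert not_lt.1 h1
    refine ⟨hle, fun C hC => ?_⟩
    obtain ⟨t, ht, rfl⟩ := mem_rowFam.1 hC
    obtain ⟨u, hu, hul, hut⟩ := exists_live_subset (A := A) ht
    set j := ((Finset.range T).filter fun t' => t' < u ∧ Live T A t').card with hj
    have hjlt : j < ((Finset.range T).filter fun t => Live T A t).card := by
      refine Finset.card_lt_card (Finset.ssubset_iff_of_subset ?_ |>.2 ⟨u, ?_, ?_⟩)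
      · intro t'
        simp only [Finset.mem_filter]
        exact fun h => ⟨h.1, h.2.2⟩
      · simp [hu, hul]
      · simp
    obtain ⟨l, ⟨-, -, h2⟩, hla⟩ := h j (by omega)
    rcases h2 with ⟨v, hv, hvl, hvj, hlv⟩ | ⟨h2, -⟩
    · have : v = u := by
        have key : ∀ a b, a < T → Live T A a → a < b →
            ((Finset.range T).filter fun t' => t' < a ∧ Live T A t').card <
              ((Finset.range T).filter fun t' => t' < b ∧ Live T A t').card := by
          intro a b ha hma hab
          refine Finset.card_lt_card (Finset.ssubset_iff_of_subset ?_ |>.2 ⟨a, ?_, ?_⟩)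
          · intro t'
            simp only [Finset.mem_filter, Finset.mem_range]
            exact fun h => ⟨h.1, h.2.1.trans hab, h.2.2⟩
          · simp [ha, hab, hma]
          · simp
        have hvj' : ((Finset.range T).filter fun t' => t' < v ∧ Live T A t').card = j := by
          convert hvj
        rcases lt_trichotomy v u with h3 | h3 | h3
        · have := key v u hv hvl h3; omega
        · exact h3
        · have := key u v hu hul h3; omega
      subst this
      exact ⟨l, hut hlv, hla⟩
    · refine absurd h2 (not_le.2 ?_)
      convert hjlt
  · rintro ⟨hle, hh⟩ j hj
    have hnot : ¬ J < ((Finset.range T).filter fun t => Live T A t).card := by omega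
    by_cases hjl : ((Finset.range T).filter fun t => Live T A t).card ≤ j
    · refine ⟨W - 1, ⟨by omega, ?_, Or.inr ⟨?_, by simp⟩⟩, hpad⟩
      · convert hnot
      · convert hjl
    · set s := (Finset.range T).filter fun t => Live T A t with hs
      have hjs : j < s.card := not_le.1 hjl
      have hmem := Finset.mem_filter.1 (Finset.orderEmbOfFin_mem s rfl ⟨j, hjs⟩)
      set t := s.orderEmbOfFin rfl ⟨j, hjs⟩ with ht
      obtain ⟨l, hl, hla⟩ := hh (A t) (mem_rowFam.2 ⟨t, Finset.mem_range.1 hmem.1, rfl⟩)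
      refine ⟨l, ⟨Finset.mem_range.1 (hsub t (Finset.mem_range.1 hmem.1) hl), ?_, Or.inl
        ⟨t, Finset.mem_range.1 hmem.1, hmem.2, ?_, hl⟩⟩, hla⟩
      · convert hnot
      have e : ((Finset.range T).filter fun t' => t' < t ∧ Live T A t') =
          (Finset.univ.filter fun i : Fin s.card => i < ⟨j, hjs⟩).map
            (s.orderEmbOfFin rfl).toEmbedding := by
        ext u
        simp only [Finset.mem_filter, Finset.mem_range, Finset.mem_map, Finset.mem_univ, true_and]
        constructor
        · rintro ⟨h1, h2, h3⟩
          have hu : u ∈ s := Finset.mem_filter.2 ⟨Finset.mem_range.2 h1, h3⟩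
          obtain ⟨i, rfl⟩ : ∃ i, s.orderEmbOfFin rfl i = u := by
            have := Finset.range_orderEmbOfFin s rfl
            have hu' : u ∈ Set.range (s.orderEmbOfFin rfl) := by rw [this]; exact hu
            exact hu'
          exact ⟨i, by rwa [ht, OrderEmbedding.lt_iff_lt] at h2, rfl⟩
        · rintro ⟨i, hi, rfl⟩
          have := Finset.mem_filter.1 (Finset.orderEmbOfFin_mem s rfl i)
          exact ⟨Finset.mem_range.1 this.1, by
            rw [ht]; exact (OrderEmbedding.lt_iff_lt _).2 hi, this.2⟩
      have e' := congrArg Finset.card e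
      rw [Finset.card_map] at e'
      have : (Finset.univ.filter fun i : Fin s.card => i < ⟨j, hjs⟩) = Finset.Iio ⟨j, hjs⟩ := by
        ext; simp
      rw [this, Fin.card_Iio] at e'
      convert e'

end Sparsify

/-- The rows of the clauses, followed by padding rows. -/
def initRows {n k : ℕ} (φ : KCNF n k) (t : ℕ) : Finset ℕ :=
  if t < φ.clauses.length then ((φ.clauses.getD t []).map litIdx).toFinset else {2 * n}

theorem litIdx_lt {n : ℕ} (x : Fin n × Bool) : litIdx x < 2 * n := by
  have := x.1.2
  rw [litIdx]
  split_ifs <;> omega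

theorem trueLit_litIdx {n : ℕ} {a : ℕ → Bool} (x : Fin n × Bool) :
    TrueLit n a (litIdx x) ↔ a x.1 = x.2 := by
  obtain ⟨v, b⟩ := x
  have := v.2
  rcases b with _ | _
  · simp [TrueLit, litIdx, show ¬ n + (v : ℕ) = 2 * n by omega, show n + (v : ℕ) < 2 * n by omega]
  · simp [TrueLit, litIdx, show ¬ (v : ℕ) = 2 * n by omega, show ¬ n ≤ (v : ℕ) by omega]

namespace Setup

open Sparsify

variable {k : ℕ} (St : Setup k) (I : Inst k)

def W : ℕ := 2 * I.1 + 1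
def m : ℕ := I.2.clauses.length
def S : ℕ := (∑ i ∈ Finset.Ico 1 k, St.pr.β i) * (2 * I.1 + 1) + 1
def Θ : ℕ := ∑ i ∈ Finset.range (k + 1), St.pr.θ i
-- Besides the clauses and `Θ` rows for every step there is one row that always remains padding.
def T : ℕ := m I + St.S I * St.Θ + 1
-- The bound for the number of minimal sets of a saturated family over `2 * n + 1` literals.
def J : ℕ := 1 + (2 * I.1 + 1) * (1 + ∑ i ∈ Finset.Ico 1 k, St.pr.θ i)
def g : ℕ := I.1 / St.q
def L : ℕ := I.1 / (St.q * St.q') + St.pr.κ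
-- The code of the choice bits occupies the low digits of an iteration number, the outer assignment
-- the high ones.
def R : ℕ := 2 ^ St.L I * 2 ^ (I.1 - 2 * St.g I)

/-- The sparsification step. -/
noncomputable def next : ℕ → (ℕ → Finset ℕ) → Bool → ℕ → Finset ℕ :=
  nextRows k (W I) (St.T I) St.pr.θ (m I) St.Θ

/-- The choice bits in iteration `r`. -/
def bits (r s : ℕ) : Bool :=
  codeBit St.pr.b ((codeNext St.pr.b)^[s] (r % 2 ^ St.L I, 2 ^ St.L I))

/-- The rows in iteration `r` after `s` steps. -/
noncomputable def rowsAt (r s : ℕ) : ℕ → Finset ℕ :=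
  runBits (St.next I) (initRows I.2) (St.bits I r) s

/-- The sparse formula in iteration `r`. -/
noncomputable def sparse (r c : ℕ) : Finset ℕ :=
  compress (W I) (St.T I) (St.J I) (St.rowsAt I r (St.S I)) c

/-- The left partial assignment `α` and the outer assignment of iteration `r` violate clause `c`. -/
def UnsatLeft (r α c : ℕ) : Prop := ∀ l ∈ St.sparse I r c, ¬ (l = 2 * I.1 ∨
  (l < 2 * I.1 ∧ (if l < I.1 then l else l - I.1) < St.g I ∧
    (α.testBit (if l < I.1 then l else l - I.1) = true ↔ l < I.1)) ∨
  (l < 2 * I.1 ∧ 2 * St.g I ≤ (if l < I.1 then l else l - I.1) ∧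
    ((r / 2 ^ St.L I).testBit ((if l < I.1 then l else l - I.1) - 2 * St.g I) = true ↔ l < I.1)))

/-- The right partial assignment `β` violates clause `c`. -/
def UnsatRight (r β c : ℕ) : Prop := ∀ l ∈ St.sparse I r c, ¬
  (l < 2 * I.1 ∧ St.g I ≤ (if l < I.1 then l else l - I.1) ∧
    (if l < I.1 then l else l - I.1) < 2 * St.g I ∧
    (β.testBit ((if l < I.1 then l else l - I.1) - St.g I) = true ↔ l < I.1))

/-- Some pair of partial assignments violates no clause. -/
def Good (r : ℕ) : Prop := ∃ α < 2 ^ St.g I, ∃ β < 2 ^ St.g I, ∀ c < St.J I,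
  ¬ (St.UnsatLeft I r α c ∧ St.UnsatRight I r β c)

/-- A satisfied literal is the constant, or it concerns a left or an outer variable, or a right
variable. The first kinds are credited to the left row, the last one to the right row. -/
theorem not_unsat_iff {r α β c : ℕ} : ¬ (St.UnsatLeft I r α c ∧ St.UnsatRight I r β c) ↔
    ∃ l ∈ St.sparse I r c, l ∈ {l | TrueLit I.1 (asgOf (St.g I) α β (r / 2 ^ St.L I)) l} := by
  have key : ∀ l : ℕ, TrueLit I.1 (asgOf (St.g I) α β (r / 2 ^ St.L I)) l ↔
      (l = 2 * I.1 ∨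
        (l < 2 * I.1 ∧ (if l < I.1 then l else l - I.1) < St.g I ∧
          (α.testBit (if l < I.1 then l else l - I.1) = true ↔ l < I.1)) ∨
        (l < 2 * I.1 ∧ 2 * St.g I ≤ (if l < I.1 then l else l - I.1) ∧
          ((r / 2 ^ St.L I).testBit ((if l < I.1 then l else l - I.1) - 2 * St.g I) = true ↔
            l < I.1))) ∨
        (l < 2 * I.1 ∧ St.g I ≤ (if l < I.1 then l else l - I.1) ∧
          (if l < I.1 then l else l - I.1) < 2 * St.g I ∧
          (β.testBit ((if l < I.1 then l else l - I.1) - St.g I) = true ↔ l < I.1)) := by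
    intro l
    rw [TrueLit, asgOf, asgOf]
    by_cases h0 : l = 2 * I.1
    · simp [h0]
    by_cases h1 : l < I.1
    · have h2 : l < 2 * I.1 := by omega
      simp only [h0, h1, h2, if_true, true_and, iff_true, false_or, not_le.2 h1, false_and, or_false]
      rcases lt_or_ge l (St.g I) with h3 | h3
      · simp [h3, show ¬ 2 * St.g I ≤ l by omega, show ¬ St.g I ≤ l by omega]
      rcases lt_or_ge l (2 * St.g I) with h4 | h4
      · simp [h3, h4, show ¬ 2 * St.g I ≤ l by omega, show ¬ l < St.g I by omega]
      · simp [h3, h4, show ¬ l < 2 * St.g I by omega, show ¬ l < St.g I by omega]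
    · by_cases h2 : l < 2 * I.1
      · simp only [h0, h1, h2, if_false, true_and, iff_false, false_or, not_lt.1 h1, false_and,
          Bool.not_eq_true]
        set v := l - I.1
        rcases lt_or_ge v (St.g I) with h3 | h3
        · simp [h3, show ¬ 2 * St.g I ≤ v by omega, show ¬ St.g I ≤ v by omega]
        rcases lt_or_ge v (2 * St.g I) with h4 | h4
        · simp [h3, h4, show ¬ 2 * St.g I ≤ v by omega, show ¬ v < St.g I by omega]
        · simp [h3, h4, show ¬ v < 2 * St.g I by omega, show ¬ v < St.g I by omega]
      · simp [h0, h1, h2]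
  simp only [Set.mem_ofPred_eq, key, UnsatLeft, UnsatRight]
  constructor
  · intro h
    by_contra hno
    exact h ⟨fun l hl h1 => hno ⟨l, hl, Or.inl h1⟩, fun l hl h1 => hno ⟨l, hl, Or.inr h1⟩⟩
  · rintro ⟨l, hl, h1 | h1⟩ ⟨h2, h3⟩
    exacts [h2 l hl h1, h3 l hl h1]

/-! ### Satisfiability as a search over iterations -/

theorem W_pos : 0 < W I := by rw [W]; omega

theorem pad_eq : W I - 1 = 2 * I.1 := by rw [W]; omega

theorem rowInv_init : RowInv (W I) (St.T I) (m I) St.Θ 0 (initRows I.2) := by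
  refine ⟨fun t _ l hl => ?_, fun t ht _ => ?_⟩
  · rw [initRows] at hl
    rw [Finset.mem_range, W]
    split_ifs at hl
    · rw [List.mem_toFinset, List.mem_map] at hl
      obtain ⟨x, -, rfl⟩ := hl
      have := litIdx_lt x
      omega
    · rw [Finset.mem_singleton] at hl; omega
  · rw [initRows, if_neg (by rw [m] at ht; omega), pad_eq]

theorem card_initRows_le {C : Finset ℕ} (hC : C ∈ rowFam (St.T I) (initRows I.2)) : C.card ≤ k := by
  obtain ⟨t, -, rfl⟩ := mem_rowFam.1 hC
  rw [initRows]
  split_ifs with h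
  · refine (List.toFinset_card_le _).trans ?_
    rw [List.length_map, List.getD_eq_getElem _ _ h]
    exact I.2.width_le _ (List.getElem_mem h)
  · simpa using St.k_pos

theorem lt_T {s : ℕ} (hs : s < St.S I) : m I + s * St.Θ + St.Θ < St.T I := by
  have := Nat.mul_le_mul_right St.Θ (Nat.succ_le_of_lt hs)
  rw [Nat.succ_mul] at this
  rw [T]
  omega

theorem θ_le_Θ {i : ℕ} (hi : i ≤ k) : St.pr.θ i ≤ St.Θ :=
  Finset.single_le_sum (f := St.pr.θ) (fun _ _ => Nat.zero_le _) (Finset.mem_range.2 (by omega))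

/-- The invariant of the sparsification process. -/
def StepInv (s : ℕ) (A : ℕ → Finset ℕ) : Prop :=
  RowInv (W I) (St.T I) (m I) St.Θ s A ∧ ∀ C ∈ rowFam (St.T I) A, C.card ≤ k

theorem stepInv_next {s : ℕ} (hs : s < St.S I) {A : ℕ → Finset ℕ} (b : Bool)
    (h : St.StepInv I s A) : St.StepInv I (s + 1) (St.next I s A b) := by
  refine ⟨h.1.next (W_pos I) b, ?_⟩
  by_cases hsat : Saturated k St.pr.θ (rowFam (St.T I) A)
  · rw [next, rowFam_next_of_saturated h.1 b (St.lt_T I hs) hsat]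
    exact h.2
  · obtain ⟨c, i, H, G, hsf, h0, h1⟩ := exists_sunflower h.1 (St.lt_T I hs) St.pr.θ_pos
      (fun i hi => St.θ_le_Θ hi) hsat
    have hH : H.card ≤ k := by have := hsf.le; have := hsf.card_heart; omega
    intro C hC
    cases b
    · rw [next, h0, Finset.mem_insert] at hC
      rcases hC with rfl | hC
      exacts [hH, h.2 C hC]
    · rw [next, h1, Finset.mem_union, Finset.mem_image] at hC
      rcases hC with hC | ⟨D, hD, rfl⟩
      · exact h.2 C hC
      · refine (Finset.card_le_card Finset.sdiff_subset).trans (h.2 D ?_)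
        exact (mem_minSets.1 (mem_flower.1 (hsf.sub hD)).1).1

theorem stepInv_runBits (w : ℕ → Bool) : ∀ s ≤ St.S I,
    St.StepInv I s (runBits (St.next I) (initRows I.2) w s)
  | 0, _ => ⟨St.rowInv_init I, fun _ => St.card_initRows_le I⟩
  | s + 1, hs => St.stepInv_next I (by omega) _ (stepInv_runBits w s (by omega))

/-- The clause rows are never overwritten, whatever the choice bits are. Therefore even a
meaningless code cannot lead to a false positive. -/
theorem rowsAt_of_lt {r s t : ℕ} (ht : t < m I) : St.rowsAt I r s t = initRows I.2 t := by
  rw [rowsAt]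
  induction s with
  | zero => rfl
  | succ s ih =>
    rw [runBits]
    nth_rw 1 [next]
    rw [nextRows, if_neg (by omega), ih]

theorem J_pos : 0 < St.J I := by rw [J]; omega

/-- If the formula is satisfiable, an assignment guides the process along a path with few ones. The
code of this path and the values of the outer variables make up the successful iteration.
Conversely, every iteration only adds sets to the clauses, so hitting the resulting family satisfies
the formula. -/
theorem satisfiable_iff : I.2.Satisfiable ↔ ∃ r < St.R I, St.Good I r := by
  constructor
  · rintro ⟨a, ha⟩
    set a' : ℕ → Bool := fun v => if h : v < I.1 then a ⟨v, h⟩ else false with ha'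
    have hhit : Hits {l | TrueLit I.1 a' l} (rowFam (St.T I) (initRows I.2)) := by
      intro C hC
      obtain ⟨t, -, rfl⟩ := mem_rowFam.1 hC
      rw [initRows]
      split_ifs with h
      · rw [List.getD_eq_getElem _ _ h]
        obtain ⟨x, hx, hax⟩ := ha _ (List.getElem_mem h)
        refine ⟨litIdx x, by rw [List.mem_toFinset]; exact List.mem_map_of_mem hx, ?_⟩
        rw [Set.mem_ofPred_eq, trueLit_litIdx, ha']
        simpa using hax
      · exact ⟨2 * I.1, by simp, Or.inl rfl⟩
    obtain ⟨w, hw1, hw2, hw3⟩ := exists_guided_path (U := Finset.range (W I)) (k := k)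
      (θ := St.pr.θ) (β := St.pr.β) (A := St.pr.A) (S := St.S I) (rowFam (St.T I)) (St.next I)
      (St.StepInv I) (fun s hs A b h => St.stepInv_next I hs b h)
      (fun s hs A b h hsat => rowFam_next_of_saturated h.1 b (St.lt_T I hs) hsat)
      (fun s hs A h hsat => exists_sunflower h.1 (St.lt_T I hs) St.pr.θ_pos
        (fun i hi => St.θ_le_Θ hi) hsat)
      (St.stepInv_runBits I (fun _ => false) 0 (by omega))
      (fun C hC => by
        obtain ⟨t, ht, rfl⟩ := mem_rowFam.1 hC
        exact (St.rowInv_init I).sub t ht) hhit St.pr.A_pos St.pr.θ_eq St.pr.β_pos St.pr.θ_pos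
      St.pr.β_rec (by rw [Finset.card_range, W, S]; omega)
    rw [Finset.card_range, W] at hw3
    obtain ⟨X, hX1, hX2⟩ := St.pr.code_le I.1 _ hw3
    -- The bound on the number of petal steps is what makes the choice bits compressible to `L`
    -- bits.
    obtain ⟨r₁, hr₁, hcode⟩ := exists_code (L := St.L I) (S := St.S I) St.pr.b_pos w hX1 hX2
    obtain ⟨α, hα, β, hβ, o, ho, hasg⟩ := exists_asgOf I.1 (St.g I) a'
    have hL : 0 < 2 ^ St.L I := by positivity
    have hmod : (2 ^ St.L I * o + r₁) % 2 ^ St.L I = r₁ := by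
      rw [Nat.mul_add_mod, Nat.mod_eq_of_lt hr₁]
    have hdiv : (2 ^ St.L I * o + r₁) / 2 ^ St.L I = o := by
      rw [Nat.mul_add_div hL, Nat.div_eq_of_lt hr₁, add_zero]
    have hrows : St.rowsAt I (2 ^ St.L I * o + r₁) (St.S I) =
        runBits (St.next I) (initRows I.2) w (St.S I) := by
      rw [rowsAt]
      refine runBits_congr _ _ fun s hs => ?_
      rw [bits, hmod]
      exact hcode s hs
    have hinv := St.stepInv_runBits I w (St.S I) le_rfl
    refine ⟨2 ^ St.L I * o + r₁, ?_, α, hα, β, hβ, fun c hc => (St.not_unsat_iff I).2 ?_⟩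
    · rw [R]
      calc 2 ^ St.L I * o + r₁ < 2 ^ St.L I * o + 2 ^ St.L I := by omega
        _ = 2 ^ St.L I * (o + 1) := by ring
        _ ≤ _ := Nat.mul_le_mul_left _ ho
    · refine (compress_hits (a := {l | TrueLit I.1 (asgOf (St.g I) α β _) l}) ?_ (W_pos I)
        (St.J_pos I) ?_).2 ⟨?_, ?_⟩ c hc
      · rw [hrows]; exact hinv.1.sub
      · exact Or.inl (pad_eq I)
      · rw [hrows]
        refine (hw2.card_minSets_le (U := Finset.range (W I)) (fun C hC => ?_) (fun C hC => ?_)).trans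
          ?_
        · obtain ⟨t, ht, rfl⟩ := mem_rowFam.1 hC
          exact hinv.1.sub t ht
        · exact hinv.2 C (mem_minSets.1 hC).1
        · rw [Finset.card_range, J, W]
      · rw [hrows, hdiv]
        intro C hC
        obtain ⟨l, hl, hla⟩ := hw1 C hC
        refine ⟨l, hl, ?_⟩
        rcases hla with h | ⟨h, h'⟩ | ⟨h, h', h''⟩
        · exact Or.inl h
        · exact Or.inr (Or.inl ⟨h, by rw [hasg l h, h']⟩)
        · exact Or.inr (Or.inr ⟨h, h', by rw [hasg _ (by omega), h'']⟩)
  · rintro ⟨r, -, α, -, β, -, h⟩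
    have hinv := St.stepInv_runBits I (St.bits I r) (St.S I) le_rfl
    have hh := ((compress_hits (a := {l | TrueLit I.1 (asgOf (St.g I) α β (r / 2 ^ St.L I)) l})
      hinv.1.sub (W_pos I) (St.J_pos I) (Or.inl (pad_eq I))).1
        fun c hc => (St.not_unsat_iff I).1 (h c hc)).2
    refine ⟨fun v => asgOf (St.g I) α β (r / 2 ^ St.L I) v, fun c hc => ?_⟩
    obtain ⟨t, ht, rfl⟩ := List.getElem_of_mem hc
    obtain ⟨l, hl, hla⟩ := hh (St.rowsAt I r (St.S I) t)
      (mem_rowFam.2 ⟨t, by rw [T, m]; omega, rfl⟩)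
    rw [St.rowsAt_of_lt I ht, initRows, if_pos ht, List.getD_eq_getElem _ _ ht, List.mem_toFinset,
      List.mem_map] at hl
    obtain ⟨x, hx, rfl⟩ := hl
    exact ⟨x, hx, (trueLit_litIdx x).1 hla⟩

end Setup

/-! ## Registers and memory in the reduction -/

/-- The number of variables plus the number of clauses. -/
def instSize {k : ℕ} (I : Inst k) : ℕ := I.1 + I.2.clauses.length

/-- The bit length of `f` is polynomially bounded. -/
def BitsBdd {ι : Type} (z f : ι → ℕ) : Prop := PolyBdd z fun i => bitLen (f i : ℤ)

namespace BitsBdd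

variable {ι : Type} {z f g : ι → ℕ}

theorem mono (hg : BitsBdd z g) (h : ∀ i, f i ≤ g i) : BitsBdd z f :=
  PolyBdd.mono hg fun i => bitLen_natCast_mono (h i)

theorem of_polyBdd (h : PolyBdd z f) : BitsBdd z f :=
  PolyBdd.mono h fun i => by simpa using bitLen_le_natAbs (f i : ℤ)

theorem const (c : ℕ) : BitsBdd z fun _ => c := .of_polyBdd (.const c)

theorem mul (hf : BitsBdd z f) (hg : BitsBdd z g) : BitsBdd z fun i => f i * g i :=
  (PolyBdd.add hf hg).mono fun i => by push_cast; exact bitLen_mul_le _ _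

theorem add (hf : BitsBdd z f) (hg : BitsBdd z g) : BitsBdd z fun i => f i + g i :=
  ((PolyBdd.add hf hg).add (.const 1)).mono fun i => by
    have := bitLen_add_le (f i) (g i)
    push_cast
    omega

theorem pow (hf : BitsBdd z f) (n : ℕ) : BitsBdd z fun i => f i ^ n := by
  induction n with
  | zero => simpa using const 1
  | succ n ih => simpa only [pow_succ] using ih.mul hf

theorem two_pow (hf : PolyBdd z f) : BitsBdd z fun i => 2 ^ f i :=
  (hf.add (.const 1)).mono fun i => by
    have := bitLen_two_pow (f i)
    push_cast
    omega

end BitsBdd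

theorem polyBdd_sum_bitLen {ι : Type} {z : ι → ℕ} {l : List (ℕ × (ι → ℕ))}
    (h : ∀ p ∈ l, BitsBdd z p.2) : PolyBdd z fun i => (l.map fun p => bitLen (p.2 i : ℤ)).sum := by
  induction l with
  | nil => exact .const 0
  | cons p l ih =>
    exact PolyBdd.add (h p (by simp)) (ih fun p' hp' => h p' (by simp [hp']))

namespace Setup

open Sparsify

variable {k : ℕ} (St : Setup k) (I : Inst k)

def NG : ℕ := 2 ^ St.g I
def Bs : ℕ := St.B₀ * (St.g I + 1)
-- All relevant squared distances are at most `Bs² * (9 * J + 4)`: between left and right rows at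
-- most `9 * J * Bs²`, and from the reference row `(J + 4) * Bs²`.
def prec : ℕ := St.cp * (St.Bs I ^ 2 * (9 * St.J I + 4) + 1)
-- The constant factor makes room for the `2 * 2 ^ g + 1` rows, makes the entries at most `N` in
-- absolute value, and moves `N` to where `d` dominates the logarithm.
def N : ℕ := St.c₀ * 2 ^ St.g I
-- The largest exponents needed are `n` and `L ≤ n + κ`.
def pows : ℕ := I.1 + St.pr.κ + 1

/-- The registers that hold constants, and their contents. -/
def consts : List (ℕ × (Inst k → ℕ)) :=
  [(32, fun I => I.1), (33, m), (34, St.g), (0, W), (6, St.S), (5, fun _ => St.Θ), (1, St.T),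
    (2, fun I => numIdx k (W I)), (4, St.J), (37, fun I => St.J I + 1), (39, St.Bs), (40, St.prec),
    (46, St.pows), (35, St.NG), (36, fun I => 2 ^ St.L I), (38, fun I => 2 * St.NG I + 1),
    (41, St.N), (44, St.R), (62, fun I => St.R I + 2), (42, fun I => St.d (St.N I)),
    (43, fun I => St.dv (St.N I))]

/-- A bound for the registers that bound sums. -/
def B : ℕ := I.1 + m I + W I + St.S I + St.Θ + St.T I + numIdx k (W I) + St.J I

/-- A bound for the bit lengths of the numbers in the reduction. -/
def M : ℕ := (St.consts.map fun p => bitLen (p.2 I : ℤ)).sum + St.pows I + bitLen (St.B I : ℤ) + 1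

variable {I}

theorem bitLen_const_le {p : ℕ × (Inst k → ℕ)} (hp : p ∈ St.consts) :
    bitLen (p.2 I : ℤ) ≤ St.M I := by
  have := List.le_sum_of_mem
    (List.mem_map_of_mem (f := fun p : ℕ × (Inst k → ℕ) => bitLen (p.2 I : ℤ)) hp)
  rw [M]
  omega

theorem bitLen_le_M_of_le_one {v : ℤ} (h0 : 0 ≤ v) (h1 : v ≤ 1) : bitLen v ≤ St.M I := by
  have h2 : v = 0 ∨ v = 1 := by omega
  have : bitLen v ≤ 1 := by rcases h2 with rfl | rfl <;> decide
  rw [M]; omega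

variable (I)

/-! ### Polynomial bounds for sizes and bit lengths -/

theorem polyBdd_n : PolyBdd instSize fun I : Inst k => I.1 :=
  PolyBdd.self.mono fun I => by rw [instSize]; omega

theorem polyBdd_m : PolyBdd instSize fun I : Inst k => m I :=
  PolyBdd.self.mono fun I => by rw [instSize, m]; omega

theorem polyBdd_W : PolyBdd instSize fun I : Inst k => W I :=
  (polyBdd_n.const_mul 2).add (.const 1)

theorem polyBdd_S : PolyBdd instSize St.S := (polyBdd_W.const_mul _).add (.const 1)

theorem polyBdd_T : PolyBdd instSize St.T :=
  (polyBdd_m.add (St.polyBdd_S.mul (.const _))).add (.const 1)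

theorem polyBdd_numIdx : PolyBdd instSize fun I : Inst k => numIdx k (W I) :=
  (polyBdd_W.pow k).const_mul _

theorem polyBdd_J : PolyBdd instSize St.J := (PolyBdd.const 1).add (polyBdd_W.mul (.const _))

theorem polyBdd_g : PolyBdd instSize St.g := polyBdd_n.mono fun _ => Nat.div_le_self _ _

theorem polyBdd_L : PolyBdd instSize St.L :=
  (polyBdd_n.add (.const St.pr.κ)).mono fun _ => Nat.add_le_add_right (Nat.div_le_self _ _) _

theorem polyBdd_Bs : PolyBdd instSize St.Bs := (St.polyBdd_g.add (.const 1)).const_mul _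

theorem polyBdd_prec : PolyBdd instSize St.prec :=
  (((St.polyBdd_Bs.pow 2).mul ((St.polyBdd_J.const_mul 9).add (.const 4))).add (.const 1)).const_mul _

theorem polyBdd_pows : PolyBdd instSize St.pows := (polyBdd_n.add (.const _)).add (.const 1)

theorem polyBdd_B : PolyBdd instSize St.B :=
  ((((((polyBdd_n.add polyBdd_m).add polyBdd_W).add St.polyBdd_S).add (.const _)).add
    St.polyBdd_T).add polyBdd_numIdx).add St.polyBdd_J

theorem bitsBdd_NG : BitsBdd instSize St.NG := .two_pow St.polyBdd_g

theorem bitsBdd_N : BitsBdd instSize St.N := (BitsBdd.const _).mul St.bitsBdd_NG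

theorem bitsBdd_R : BitsBdd instSize St.R :=
  (BitsBdd.two_pow St.polyBdd_L).mul (.two_pow (polyBdd_n.mono fun _ => Nat.sub_le _ _))

theorem bitsBdd_of_le {f : ℕ → ℕ} (h : ∀ n, f n ≤ St.K * (n + 1) ^ St.K) :
    BitsBdd instSize fun I => f (St.N I) :=
  ((BitsBdd.const St.K).mul ((St.bitsBdd_N.add (.const 1)).pow St.K)).mono fun _ => h _

theorem polyBdd_M : PolyBdd instSize St.M := by
  have h1 : BitsBdd instSize fun I : Inst k => I.1 := .of_polyBdd polyBdd_n
  have h2 : BitsBdd instSize fun I : Inst k => m I := .of_polyBdd polyBdd_m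
  have h3 : BitsBdd instSize fun I : Inst k => W I := .of_polyBdd polyBdd_W
  have h4 := BitsBdd.of_polyBdd St.polyBdd_g
  have h5 := BitsBdd.of_polyBdd St.polyBdd_S
  have h6 : BitsBdd instSize fun _ : Inst k => St.Θ := .const _
  have h7 := BitsBdd.of_polyBdd St.polyBdd_T
  have h8 : BitsBdd instSize fun I : Inst k => numIdx k (W I) := .of_polyBdd polyBdd_numIdx
  have h9 := BitsBdd.of_polyBdd St.polyBdd_J
  have h10 := h9.add (.const 1)
  have h11 := BitsBdd.of_polyBdd St.polyBdd_Bs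
  have h12 := BitsBdd.of_polyBdd St.polyBdd_prec
  have h13 := BitsBdd.of_polyBdd St.polyBdd_pows
  have h14 := St.bitsBdd_NG
  have h15 := BitsBdd.two_pow St.polyBdd_L
  have h16 := ((BitsBdd.const 2).mul h14).add (.const 1)
  have h17 := St.bitsBdd_N
  have h18 := St.bitsBdd_R
  have h19 := h18.add (.const 2)
  have h20 := St.bitsBdd_of_le St.d_le
  have h21 := St.bitsBdd_of_le St.dv_le
  refine (((polyBdd_sum_bitLen ?_).add St.polyBdd_pows).add
    (BitsBdd.of_polyBdd St.polyBdd_B)).add (.const 1)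
  simp only [consts, List.forall_mem_cons]
  exact ⟨h1, h2, h4, h3, h5, h6, h7, h8, h9, h10, h11, h12, h13, h14, h15, h16, h17, h18, h19, h20,
    h21, by simp⟩

end Setup

/-! ## The sparsification program -/

theorem PHt.fill₂_of_polyBdd {ι : Type} {z w N₁ N₂ M B : ι → ℕ} {x bx y b a : ℕ} {e₁ e₂ : Expr}
    {P Q : ι → (ℕ → ℤ) → (ℕ → ℤ → ℤ) → Prop}
    (hx : 16 ≤ x) (hx' : x < 64) (hbx : bx < 64) (hy : 16 ≤ y) (hy' : y < 64) (hb : b < 64)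
    (hxbx : x ≠ bx) (hxb : x ≠ b) (hyb : y ≠ b) (hybx : y ≠ bx) (hxy : x ≠ y)
    (hM : PolyBdd z M) (hB : PolyBdd z B) (he₁ : e₁.WF) (he₂ : e₂.WF)
    (hN₁ : PolyBdd z N₁) (hN₂ : PolyBdd z N₂) (hw : ∀ i, 1 ≤ w i)
    (h : ∀ i ρ μ, P i ρ μ → Expr.Small ρ μ (M i) (B i) ∧ ρ bx = N₁ i ∧ ρ b = N₂ i ∧
      ∃ addr val : ℕ → ℕ → ℤ,
      (∀ s < N₁ i, ∀ t < N₂ i, ∀ ν, e₁.eval (Function.update (Function.update ρ x (s : ℤ)) y (t : ℤ))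
        (Function.update μ a ν) = addr s t) ∧
      (∀ s < N₁ i, ∀ t < N₂ i, ∀ ν, Expr.Small (Function.update (Function.update ρ x (s : ℤ)) y (t : ℤ))
        (Function.update μ a ν) (M i) (B i) →
        e₂.eval (Function.update (Function.update ρ x (s : ℤ)) y (t : ℤ))
        (Function.update μ a ν) = val s t) ∧
      (a < 8 → ∀ s < N₁ i, ∀ t < N₂ i, bitLen (val s t) ≤ M i) ∧
      (∀ s < N₁ i, ∀ t < N₂ i, ∀ s' < N₁ i, ∀ t' < N₂ i, addr s t = addr s' t' → s = s' ∧ t = t') ∧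
      ∀ ρ' ν, (∀ u, u ≠ x → u ≠ y → ρ' u = ρ u) →
        Expr.Small ρ' (Function.update μ a ν) (M i) (B i) →
        (∀ s < N₁ i, ∀ t < N₂ i, ν (addr s t) = val s t) →
        (∀ u, (∀ s < N₁ i, ∀ t < N₂ i, addr s t ≠ u) → ν u = μ a u) →
        Q i ρ' (Function.update μ a ν)) :
    PHt z w (.fill₂ x bx y b a e₁ e₂) P Q :=
  (PHt.fill₂ (w := fun i => N₁ i + 1) hx hx' hbx hy hy' hb hxbx hxb hyb hybx hxy hM hB he₁ he₂ hN₂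
    (fun _ => le_rfl) h).weight (hN₁.add (.const 1)) fun i => Nat.le_mul_of_pos_right _ (hw i)

theorem rowMajor_injective {w s t s' t' : ℕ} (ht : t < w) (ht' : t' < w)
    (h : (s : ℤ) * w + t = s' * w + t') : s = s' ∧ t = t' := by
  have h' : s * w + t = s' * w + t' := by exact_mod_cast h
  have h1 : (s * w + t) / w = s := by
    rw [mul_comm, Nat.mul_add_div (by omega), Nat.div_eq_of_lt ht, add_zero]
  have h2 : (s' * w + t') / w = s' := by
    rw [mul_comm, Nat.mul_add_div (by omega), Nat.div_eq_of_lt ht', add_zero]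
  have : s = s' := by rw [← h1, ← h2, h']
  subst this
  exact ⟨rfl, by omega⟩

namespace Expr

theorem wf_conj {a b : Expr} : (conj a b).WF ↔ a.WF ∧ b.WF := by simp [conj, WF]
theorem wf_disj {a b : Expr} : (disj a b).WF ↔ a.WF ∧ b.WF := by simp [disj, WF]
theorem wf_neg {a : Expr} : (neg a).WF ↔ a.WF := by simp [neg, WF]
theorem wf_ind {a : Expr} : (ind a).WF ↔ a.WF := by simp [ind, WF]
theorem wf_lt {a b : Expr} : (lt a b).WF ↔ a.WF ∧ b.WF := by simp [lt, WF, and_comm]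
theorem wf_le {a b : Expr} : (le a b).WF ↔ a.WF ∧ b.WF := by simp [le, WF, and_comm]
theorem wf_eq {a b : Expr} : (eq a b).WF ↔ a.WF ∧ b.WF := by
  simp [eq, wf_conj, wf_le]; tauto
theorem wf_count {x b : ℕ} {e : Expr} : (count x b e).WF ↔ 16 ≤ x ∧ x < 64 ∧ b < 16 ∧ e.WF := by
  simp [count, wf_ind, WF]

end Expr

namespace Setup

open Sparsify Expr

variable {k : ℕ} (St : Setup k)

/-- The constants are in place. -/
structure Base (I : Inst k) (ρ : ℕ → ℤ) (μ : ℕ → ℤ → ℤ) : Prop where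
  const : ∀ p ∈ St.consts, ρ p.1 = (p.2 I : ℤ)
  small : Small ρ μ (St.M I) (St.B I)
  formula : μ 0 = I.2.input.mem 0
  powers : ∀ j < St.pows I, μ 1 (j : ℤ) = 2 ^ j

open Classical in
/-- The configuration before iteration `r` of the main loop, for `i = (I, r)`. -/
structure Main (i : Inst k × ℕ) (ρ : ℕ → ℤ) (μ : ℕ → ℤ → ℤ) : Prop extends Base St i.1 ρ μ where
  residue : ρ 63 = i.2
  flag : ρ 61 = if ∃ r < i.2, St.Good i.1 r then 1 else 0
  fresh : ∀ a ≥ 9, ∀ z : ℤ, i.2 ≤ z % (St.R i.1 + 2) → z % (St.R i.1 + 2) < St.R i.1 → μ a z = 0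

/-- The configuration within iteration `r` of the main loop. -/
structure Iter (i : Inst k × ℕ) (ρ : ℕ → ℤ) (μ : ℕ → ℤ → ℤ) : Prop extends Main St i ρ μ where
  lt : i.2 < St.R i.1

variable {St} {I : Inst k} {i : Inst k × ℕ} {ρ ρ' : ℕ → ℤ} {μ μ' : ℕ → ℤ → ℤ}

theorem const_range {p : ℕ × (Inst k → ℕ)} (hp : p ∈ St.consts) :
    p.1 < 16 ∨ 32 ≤ p.1 ∧ p.1 < 48 ∨ p.1 = 62 := by
  revert p
  simp [consts]

namespace Base

variable (h : Base St I ρ μ)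

include h

theorem n : ρ 32 = (I.1 : ℤ) := h.const (32, fun I => I.1) (by simp [consts])
theorem m : ρ 33 = (m I : ℤ) := h.const (33, Setup.m) (by simp [consts])
theorem g : ρ 34 = (St.g I : ℤ) := h.const (34, St.g) (by simp [consts])
theorem W : ρ 0 = (W I : ℤ) := h.const (0, Setup.W) (by simp [consts])
theorem S : ρ 6 = (St.S I : ℤ) := h.const (6, St.S) (by simp [consts])
theorem Θ : ρ 5 = (St.Θ : ℤ) := h.const (5, fun _ => St.Θ) (by simp [consts])
theorem T : ρ 1 = (St.T I : ℤ) := h.const (1, St.T) (by simp [consts])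
theorem idx : ρ 2 = (numIdx k (Setup.W I) : ℤ) :=
  h.const (2, fun I => numIdx k (Setup.W I)) (by simp [consts])
theorem J : ρ 4 = (St.J I : ℤ) := h.const (4, St.J) (by simp [consts])
theorem J_succ : ρ 37 = (St.J I + 1 : ℕ) := h.const (37, fun I => St.J I + 1) (by simp [consts])
theorem Bs : ρ 39 = (St.Bs I : ℤ) := h.const (39, St.Bs) (by simp [consts])
theorem prec : ρ 40 = (St.prec I : ℤ) := h.const (40, St.prec) (by simp [consts])
theorem NG : ρ 35 = (St.NG I : ℤ) := h.const (35, St.NG) (by simp [consts])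
theorem two_pow_L : ρ 36 = (2 ^ St.L I : ℕ) := h.const (36, fun I => 2 ^ St.L I) (by simp [consts])
theorem two_NG_succ : ρ 38 = (2 * St.NG I + 1 : ℕ) :=
  h.const (38, fun I => 2 * St.NG I + 1) (by simp [consts])
theorem N : ρ 41 = (St.N I : ℤ) := h.const (41, St.N) (by simp [consts])
theorem R : ρ 44 = (St.R I : ℤ) := h.const (44, St.R) (by simp [consts])
theorem modulus : ρ 62 = (St.R I + 2 : ℕ) := h.const (62, fun I => St.R I + 2) (by simp [consts])
theorem d : ρ 42 = (St.d (St.N I) : ℤ) := h.const (42, fun I => St.d (St.N I)) (by simp [consts])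
theorem dv : ρ 43 = (St.dv (St.N I) : ℤ) :=
  h.const (43, fun I => St.dv (St.N I)) (by simp [consts])

end Base

theorem Base.bitLen_le {v : ℕ} (f : ℕ × (Inst k → ℕ)) (hf : f ∈ St.consts) (hv : v ≤ f.2 I) :
    bitLen (v : ℤ) ≤ St.M I :=
  (bitLen_natCast_mono hv).trans (St.bitLen_const_le hf)

theorem Main.frame (h : Main St i ρ μ)
    (hρ : ∀ z, (z < 16 ∨ 32 ≤ z ∧ z < 48 ∨ 61 ≤ z ∧ z < 64) → ρ' z = ρ z)
    (hs : Small ρ' μ' (St.M i.1) (St.B i.1)) (hμ : ∀ a, a = 0 ∨ a = 1 ∨ 9 ≤ a → μ' a = μ a) :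
    Main St i ρ' μ' where
  const p hp := by
    rw [hρ _ (by have := const_range hp; omega)]
    exact h.const p hp
  small := hs
  formula := by rw [hμ 0 (by simp), h.formula]
  powers j hj := by rw [hμ 1 (by simp), h.powers j hj]
  residue := by rw [hρ 63 (by norm_num), h.residue]
  flag := by rw [hρ 61 (by norm_num), h.flag]
  fresh a ha z := by rw [hμ a (by omega)]; exact h.fresh a ha z

theorem Iter.frame (h : Iter St i ρ μ)
    (hρ : ∀ z, (z < 16 ∨ 32 ≤ z ∧ z < 48 ∨ 61 ≤ z ∧ z < 64) → ρ' z = ρ z)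
    (hs : Small ρ' μ' (St.M i.1) (St.B i.1)) (hμ : ∀ a, a = 0 ∨ a = 1 ∨ 9 ≤ a → μ' a = μ a) :
    Iter St i ρ' μ' := ⟨h.toMain.frame hρ hs hμ, h.lt⟩

theorem Iter.update (h : Iter St i ρ μ) {x : ℕ} (hx : 16 ≤ x ∧ x < 32 ∨ 48 ≤ x ∧ x < 61) {v : ℤ}
    (hv : bitLen v ≤ St.M i.1) : Iter St i (Function.update ρ x v) μ :=
  h.frame (fun z hz => by rw [Function.update_of_ne (by omega)]) (h.small.update (by omega) hv)
    fun _ _ => rfl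

/-! ### Reading the formula -/

/-- The code of the literal with index `l`. -/
def litVal (n l : ℕ) : ℤ := if l < n then l + 1 else n - (l + 1)

theorem litVal_eq_litCode {n l : ℕ} (_ : l < 2 * n) (x : Fin n × Bool) :
    litCode x = litVal n l ↔ litIdx x = l := by
  obtain ⟨v, b⟩ := x
  have := v.2
  rw [litCode, litVal, litIdx]
  cases b <;> simp <;> split_ifs <;> omega

theorem mem_initRows {n k : ℕ} (φ : KCNF n k) {t l : ℕ} (hl : l < 2 * n + 1) :
    ((t < φ.clauses.length ∧ l < 2 * n ∧ ∃ j < k, φ.input.mem 0 ((k : ℤ) * t + j) = litVal n l) ∨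
      (φ.clauses.length ≤ t ∧ l = 2 * n)) ↔ l ∈ initRows φ t := by
  rw [initRows]
  split_ifs with ht
  · simp only [ht, true_and, not_le.2 ht, false_and, or_false]
    rw [List.getD_eq_getElem _ _ ht, List.mem_toFinset, List.mem_map]
    set c := φ.clauses[t] with hc
    have hcw : c.length ≤ k := φ.width_le c (List.getElem_mem ht)
    have hin : ∀ j < k, φ.input.mem 0 ((k : ℤ) * t + j) = (c.map litCode).getD j 0 := by
      intro j hj
      have h1 : ((k : ℤ) * t + j).toNat = k * t + j := by
        rw [← Int.toNat_natCast (k * t + j)]; push_cast; rfl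
      have h2 : (0 : ℤ) ≤ (k : ℤ) * t + j := by positivity
      simp only [KCNF.input, h2, and_self, if_true, h1]
      rw [Nat.mul_add_div (by omega), Nat.div_eq_of_lt hj, add_zero, Nat.mul_add_mod,
        Nat.mod_eq_of_lt hj, List.getD_eq_getElem _ _ ht]
    constructor
    · rintro ⟨hln, j, hj, hv⟩
      rw [hin j hj] at hv
      -- A cell beyond the end of the clause holds `0`, which is the code of no literal.
      have hjl : j < c.length := by
        by_contra hge
        rw [List.getD_eq_default _ _ (by simpa using hge), litVal] at hv
        split_ifs at hv <;> omega
      rw [List.getD_eq_getElem _ _ (by simpa using hjl), List.getElem_map,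
        litVal_eq_litCode hln] at hv
      exact ⟨_, List.getElem_mem hjl, hv⟩
    · rintro ⟨x, hx, rfl⟩
      obtain ⟨j, hj, rfl⟩ := List.getElem_of_mem hx
      refine ⟨litIdx_lt _, j, by omega, ?_⟩
      rw [hin j (by omega), List.getD_eq_getElem _ _ (by simpa using hj), List.getElem_map,
        litVal_eq_litCode (litIdx_lt _)]
  · simp [ht, not_lt.1 ht]

def codeE : Expr :=
  ite (lt (var 23) (var 32)) (op .add (var 23) (lit 1)) (op .sub (var 32) (op .add (var 23) (lit 1)))

def initE (k : ℕ) : Expr :=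
  disj (conj (lt (var 22) (var 33)) (conj (lt (var 23) (op .add (var 32) (var 32)))
      (anyOf (fun j => eq (get 0 (op .add (op .mul (lit k) (var 22)) (lit j))) codeE) k)))
    (conj (le (var 33) (var 22)) (eq (var 23) (op .add (var 32) (var 32))))

theorem initE_wf (k : ℕ) : (initE k).WF := by
  have : (anyOf (fun j => eq (get 0 (op .add (op .mul (lit k) (var 22)) (lit (j : ℤ)))) codeE) k).WF :=
    wf_anyOf fun j => by simp [wf_eq, wf_lt, codeE, WF]
  simp [initE, this, wf_eq, wf_le, wf_conj, wf_disj, wf_lt, WF]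

theorem Base.holds_init (h : Base St I ρ μ) {t l : ℕ} (ht : ρ 22 = t) (hl : ρ 23 = l)
    (hlW : l < Setup.W I) : (initE k).Holds ρ μ ↔ l ∈ initRows I.2 t := by
  rw [← mem_initRows I.2 hlW]
  have hcode : codeE.eval ρ μ = litVal I.1 l := by
    have : 0 < (lt (var 23) (var 32)).eval ρ μ ↔ l < I.1 := by
      rw [← Holds, holds_lt]; simp [eval, hl, h.n]
    simp only [codeE, eval, ArithOp.eval, hl, h.n, litVal]
    simp only [this]
  simp only [initE, holds_disj, holds_conj, holds_lt, holds_le, holds_eq, holds_anyOf, hcode]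
  simp only [eval, ArithOp.eval, ht, hl, h.n, h.m, h.formula, Setup.m]
  norm_cast
  rw [← two_mul]

/-! ### Steps -/

variable (St)

/-- The state of the decoder of the choice bits. -/
def code (I : Inst k) (r s : ℕ) : ℕ × ℕ :=
  (codeNext St.pr.b)^[s] (r % 2 ^ St.L I, 2 ^ St.L I)

variable {St}

theorem code_le (I : Inst k) (r s : ℕ) :
    (St.code I r s).1 ≤ 2 ^ St.L I ∧ (St.code I r s).2 ≤ 2 ^ St.L I := by
  induction s with
  | zero => exact ⟨(Nat.mod_lt _ (by positivity)).le, le_rfl⟩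
  | succ s ih =>
    rw [code, Function.iterate_succ_apply', ← code, codeNext]
    have := Nat.div_le_self (St.code I r s).2 (2 ^ St.pr.b)
    split_ifs
    · exact ⟨ih.1, this.trans ih.2⟩
    · exact ⟨(Nat.sub_le _ _).trans ih.1, (Nat.sub_le _ _).trans ih.2⟩

variable (St) in
/-- The configuration after `s` sparsification steps, with decoder state `c`. -/
structure Rows (i : Inst k × ℕ) (s : ℕ) (c : ℕ × ℕ) (ρ : ℕ → ℤ) (μ : ℕ → ℤ → ℤ) : Prop
    extends Iter St i ρ μ where
  code_fst : ρ 51 = c.1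
  code_snd : ρ 52 = c.2
  outer : ρ 53 = (i.2 / 2 ^ St.L i.1 : ℕ)
  step : ρ 48 = s
  mem : ∀ t < St.T i.1, ∀ l < Setup.W i.1,
    0 < μ 2 ((t : ℤ) * Setup.W i.1 + l) ↔ l ∈ St.rowsAt i.1 i.2 s t
  le_S : s ≤ St.S i.1

theorem Rows.ctx {s : ℕ} {c : ℕ × ℕ} (h : Rows St i s c ρ μ) :
    RowCtx k (Setup.W i.1) (St.T i.1) (St.rowsAt i.1 i.2 s) ρ μ :=
  ⟨h.W, h.T, h.idx, h.mem, (St.stepInv_runBits i.1 (St.bits i.1 i.2) s h.le_S).1.sub⟩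

theorem Rows.frame {s : ℕ} {c : ℕ × ℕ} (h : Rows St i s c ρ μ)
    (hρ : ∀ z, (z < 16 ∨ 32 ≤ z ∧ z < 54 ∨ 61 ≤ z ∧ z < 64) → ρ' z = ρ z)
    (hs : Small ρ' μ' (St.M i.1) (St.B i.1))
    (hμ : ∀ a, a = 0 ∨ a = 1 ∨ a = 2 ∨ 9 ≤ a → μ' a = μ a) : Rows St i s c ρ' μ' where
  toIter := h.toIter.frame (fun z hz => hρ z (by omega)) hs fun a ha => hμ a (by omega)
  code_fst := by rw [hρ _ (by norm_num), h.code_fst]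
  code_snd := by rw [hρ _ (by norm_num), h.code_snd]
  outer := by rw [hρ _ (by norm_num), h.outer]
  step := by rw [hρ _ (by norm_num), h.step]
  mem := by rw [hμ 2 (by norm_num)]; exact h.mem
  le_S := h.le_S

theorem Rows.update {s : ℕ} {c : ℕ × ℕ} (h : Rows St i s c ρ μ) {x : ℕ}
    (hx : 16 ≤ x ∧ x < 32 ∨ 54 ≤ x ∧ x < 61) {v : ℤ}
    (hv : bitLen v ≤ St.M i.1) : Rows St i s c (Function.update ρ x v) μ :=
  h.frame (fun z hz => by rw [Function.update_of_ne (by omega)]) (h.small.update (by omega) hv)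
    fun _ _ => rfl

def addrE : Expr := op .add (op .mul (var 22) (var 0)) (var 23)

def startE : Expr := op .add (var 33) (op .mul (var 48) (var 5))

def nextE (k : ℕ) (θ : ℕ → ℕ) : Expr :=
  ite (conj (le startE (var 22)) (lt (var 22) (op .add startE (var 5))))
    (newRowE k θ 54 55 23 (op .sub (var 22) startE)) (rowHas 22 23)

theorem addrE_wf : addrE.WF := by simp [addrE, WF]

theorem nextE_wf (k : ℕ) (θ : ℕ → ℕ) : (nextE k θ).WF := by
  have : (newRowE k θ 54 55 23 (op .sub (var 22) startE)).WF :=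
    newRowE_wf (by norm_num) (by norm_num) (by norm_num) (by simp [startE, WF])
  have hs : startE.WF := by simp [startE, WF]
  simp [nextE, this, hs, rowHas_wf, wf_conj, wf_le, wf_lt, WF]

theorem Rows.holds_next {s t l : ℕ} {c : ℕ × ℕ} {b : Bool} (h : Rows St i s c ρ μ)
    (ht : ρ 22 = t) (htT : t < St.T i.1) (hl : ρ 23 = l) (hlW : l < Setup.W i.1)
    (hy : ρ 54 = firstIdx k (Setup.W i.1) (St.T i.1) St.pr.θ (St.rowsAt i.1 i.2 s))
    (hb : 0 < ρ 55 ↔ b = true) :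
    (nextE k St.pr.θ).Holds ρ μ ↔ l ∈ St.next i.1 s (St.rowsAt i.1 i.2 s) b t := by
  have hst : startE.eval ρ μ = (Setup.m i.1 + s * St.Θ : ℕ) := by
    simp [startE, eval, ArithOp.eval, h.m, h.step, h.Θ]
  rw [nextE, holds_ite, holds_conj, holds_le, holds_lt, next, nextRows]
  have e1 : (var 22).eval ρ μ = t := ht
  have e2 : (op .add startE (var 5)).eval ρ μ = (Setup.m i.1 + s * St.Θ + St.Θ : ℕ) := by
    rw [eval, hst]; simp [eval, ArithOp.eval, h.Θ]
  rw [hst, e1, e2, Nat.cast_le, Nat.cast_lt]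
  split_ifs with hc
  · simp only [hc, and_self, true_and, not_true_eq_false, false_and, or_false]
    refine h.ctx.holds_newRow hy hb hl hlW (by norm_num) (by norm_num) ?_ fun u => ?_
    · rw [eval, e1, hst, ArithOp.eval]; omega
    · have : startE.eval (Function.update ρ 18 (u : ℤ)) μ = startE.eval ρ μ := by
        simp [startE, eval, ArithOp.eval]
      rw [eval, this, hst]
      simp [eval, ArithOp.eval, ht]
      omega
  · simp only [hc, false_and, not_false_eq_true, true_and, false_or]
    exact h.ctx.holds_rowHas ht htT hl hlW

/-- The choice bit is stored first, because updating the decoder state destroys the data it is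
computed from. Every new row depends on all old rows, so the new array is built in segment 3 and
then copied back to segment 2. -/
def stepProg (k : ℕ) (θ : ℕ → ℕ) (b : ℕ) : Prog :=
  .seq (.assign 55 (ind (lt (var 51) (op .div (var 52) (lit (2 ^ b)))))) <|
  .seq (.assign 51 (ite (var 55) (var 51) (op .sub (var 51) (op .div (var 52) (lit (2 ^ b)))))) <|
  .seq (.assign 52 (ite (var 55) (op .div (var 52) (lit (2 ^ b)))
    (op .sub (var 52) (op .div (var 52) (lit (2 ^ b)))))) <|
  .seq (.assign 54 (firstE k θ)) <|
  .seq (.fill₂ 22 1 23 0 3 addrE (ind (nextE k θ))) (.fill₂ 22 1 23 0 2 addrE (get 3 addrE))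

theorem eval_addrE {s t : ℕ} (h : ρ 0 = (Setup.W I : ℤ)) :
    addrE.eval (Function.update (Function.update ρ 22 (s : ℤ)) 23 (t : ℤ)) μ =
      (s : ℤ) * Setup.W I + t := by
  simp [addrE, eval, ArithOp.eval, h]

open Classical in
/-- The two fills of a step. -/
theorem phtStepFills (St : Setup k) : PHt (fun i : (Inst k × ℕ) × ℕ => instSize i.1.1) (fun _ => 1)
    (.seq (.fill₂ 22 1 23 0 3 addrE (ind (nextE k St.pr.θ))) (.fill₂ 22 1 23 0 2 addrE (get 3 addrE)))
    (fun i ρ μ => Rows St i.1 i.2 (St.code i.1.1 i.1.2 (i.2 + 1)) ρ μ ∧ i.2 < St.S i.1.1 ∧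
      (ρ 54 = firstIdx k (Setup.W i.1.1) (St.T i.1.1) St.pr.θ (St.rowsAt i.1.1 i.1.2 i.2)) ∧
        (0 < ρ 55 ↔ St.bits i.1.1 i.1.2 i.2 = true))
    (fun i ρ μ => Rows St i.1 (i.2 + 1) (St.code i.1.1 i.1.2 (i.2 + 1))
      (Function.update ρ 48 ((i.2 + 1 : ℕ) : ℤ)) μ ∧ ρ 48 = i.2) := by
  have hM := St.polyBdd_M.comp fun i : (Inst k × ℕ) × ℕ => i.1.1
  have hB := St.polyBdd_B.comp fun i : (Inst k × ℕ) × ℕ => i.1.1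
  have hT := St.polyBdd_T.comp fun i : (Inst k × ℕ) × ℕ => i.1.1
  have hW := (polyBdd_W (k := k)).comp fun i : (Inst k × ℕ) × ℕ => i.1.1
  refine .seq (Q := fun i ρ μ => Rows St i.1 i.2 (St.code i.1.1 i.1.2 (i.2 + 1)) ρ μ ∧
      i.2 < St.S i.1.1 ∧
      ∀ t < St.T i.1.1, ∀ l < Setup.W i.1.1, μ 3 ((t : ℤ) * Setup.W i.1.1 + l) =
        if l ∈ St.rowsAt i.1.1 i.1.2 (i.2 + 1) t then 1 else 0) ?_ ?_
  · refine PHt.fill₂_of_polyBdd (by norm_num) (by norm_num) (by norm_num) (by norm_num)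
      (by norm_num) (by norm_num) (by norm_num) (by norm_num) (by norm_num) (by norm_num)
      (by norm_num) hM hB addrE_wf (wf_ind.2 (nextE_wf _ _)) hT hW (fun _ => le_rfl) ?_
    rintro i ρ μ ⟨h, hS, hy, hb⟩
    refine ⟨h.small, h.T, h.W, fun s t => (s : ℤ) * Setup.W i.1.1 + t,
      fun s t => if t ∈ St.rowsAt i.1.1 i.1.2 (i.2 + 1) s then 1 else 0,
      fun s _ t _ ν => eval_addrE h.W, fun s hs t ht ν hsm => ?_, fun _ s _ t _ => ?_,
      fun s _ t ht s' _ t' ht' => rowMajor_injective ht ht', ?_⟩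
    · rw [eval_ind]
      refine if_congr ?_ rfl rfl
      have h' : Rows St i.1 i.2 (St.code i.1.1 i.1.2 (i.2 + 1)) (Function.update
          (Function.update ρ 22 (s : ℤ)) 23 (t : ℤ)) (Function.update μ 3 ν) :=
        h.frame (fun z hz => by
          rw [Function.update_of_ne (by omega), Function.update_of_ne (by omega)]) hsm
          fun a ha => by rw [Function.update_of_ne (by omega)]
      rw [rowsAt, runBits]
      exact h'.holds_next (by simp) hs (by simp) ht (by simpa using hy) (by simpa using hb)
    · dsimp only
      split_ifs
      · exact St.bitLen_le_M_of_le_one (by norm_num) le_rfl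
      · exact St.bitLen_le_M_of_le_one le_rfl (by norm_num)
    · intro ρ' ν hρ' hsm hν _
      refine ⟨h.frame (fun z hz => hρ' z (by omega) (by omega)) hsm fun a ha => by
        rw [Function.update_of_ne (by omega)], hS, ?_⟩
      intro t ht l hl
      rw [Function.update_self]
      exact hν t ht l hl
  · refine PHt.fill₂_of_polyBdd (by norm_num) (by norm_num) (by norm_num) (by norm_num)
      (by norm_num) (by norm_num) (by norm_num) (by norm_num) (by norm_num) (by norm_num)
      (by norm_num) hM hB addrE_wf ⟨by norm_num, addrE_wf⟩ hT hW (fun _ => le_rfl) ?_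
    rintro i ρ μ ⟨h, hS, hmem⟩
    refine ⟨h.small, h.T, h.W, fun s t => (s : ℤ) * Setup.W i.1.1 + t,
      fun s t => if t ∈ St.rowsAt i.1.1 i.1.2 (i.2 + 1) s then 1 else 0,
      fun s _ t _ ν => eval_addrE h.W, fun s hs t ht ν hsm => ?_, fun _ s _ t _ => ?_,
      fun s _ t ht s' _ t' ht' => rowMajor_injective ht ht', ?_⟩
    · rw [eval, eval_addrE h.W, Function.update_of_ne (by norm_num)]
      exact hmem s hs t ht
    · dsimp only
      split_ifs
      · exact St.bitLen_le_M_of_le_one (by norm_num) le_rfl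
      · exact St.bitLen_le_M_of_le_one le_rfl (by norm_num)
    · intro ρ' ν hρ' hsm hν _
      have hsb : bitLen ((i.2 + 1 : ℕ) : ℤ) ≤ St.M i.1.1 :=
        Base.bitLen_le (6, St.S) (by simp [consts]) hS
      refine ⟨⟨(h.toIter.frame (fun z hz => hρ' z (by omega) (by omega)) hsm fun a ha => by
        rw [Function.update_of_ne (by omega)]).update (by norm_num) hsb, ?_, ?_, ?_, ?_, ?_, hS⟩, ?_⟩
      · rw [Function.update_of_ne (by norm_num), hρ' _ (by norm_num) (by norm_num), h.code_fst]
      · rw [Function.update_of_ne (by norm_num), hρ' _ (by norm_num) (by norm_num), h.code_snd]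
      · rw [Function.update_of_ne (by norm_num), hρ' _ (by norm_num) (by norm_num), h.outer]
      · simp
      · intro t ht l hl
        rw [Function.update_self, hν t ht l hl]
        dsimp only
        split_ifs with h1 <;> simp [h1]
      · rw [hρ' _ (by norm_num) (by norm_num), h.step]

end Setup

namespace Setup

open Sparsify Expr

variable {k : ℕ} {St : Setup k} {I : Inst k} {i : Inst k × ℕ} {ρ ρ' : ℕ → ℤ} {μ μ' : ℕ → ℤ → ℤ}

theorem Rows.update_fst {s : ℕ} {c : ℕ × ℕ} (h : Rows St i s c ρ μ) {v : ℕ}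
    (hv : v ≤ 2 ^ St.L i.1) : Rows St i s (v, c.2) (Function.update ρ 51 (v : ℤ)) μ where
  toIter := h.toIter.update (by norm_num) (Base.bitLen_le (36, fun I => 2 ^ St.L I)
    (by simp [consts]) hv)
  code_fst := by simp
  code_snd := by simpa using h.code_snd
  outer := by simpa using h.outer
  step := by simpa using h.step
  mem := h.mem
  le_S := h.le_S

theorem Rows.update_snd {s : ℕ} {c : ℕ × ℕ} (h : Rows St i s c ρ μ) {v : ℕ}
    (hv : v ≤ 2 ^ St.L i.1) : Rows St i s (c.1, v) (Function.update ρ 52 (v : ℤ)) μ where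
  toIter := h.toIter.update (by norm_num) (Base.bitLen_le (36, fun I => 2 ^ St.L I)
    (by simp [consts]) hv)
  code_fst := by simpa using h.code_fst
  code_snd := by simp
  outer := by simpa using h.outer
  step := by simpa using h.step
  mem := h.mem
  le_S := h.le_S

theorem bits_eq (I : Inst k) (r s : ℕ) : St.bits I r s =
    decide ((St.code I r s).1 < (St.code I r s).2 / 2 ^ St.pr.b) := rfl

theorem code_succ (I : Inst k) (r s : ℕ) : St.code I r (s + 1) =
    (if St.bits I r s = true then (St.code I r s).1
      else (St.code I r s).1 - (St.code I r s).2 / 2 ^ St.pr.b,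
    if St.bits I r s = true then (St.code I r s).2 / 2 ^ St.pr.b
      else (St.code I r s).2 - (St.code I r s).2 / 2 ^ St.pr.b) := by
  rw [code, Function.iterate_succ_apply', ← code, codeNext, bits_eq]
  simp only [decide_eq_true_eq]
  split_ifs <;> rfl

theorem phtStep (St : Setup k) : PHt (fun i : (Inst k × ℕ) × ℕ => instSize i.1.1) (fun _ => 1)
    (stepProg k St.pr.θ St.pr.b)
    (fun i ρ μ => i.2 < St.S i.1.1 ∧ Rows St i.1 i.2 (St.code i.1.1 i.1.2 i.2) ρ μ)
    (fun i ρ μ => ρ 48 = i.2 ∧ ρ 6 = St.S i.1.1 ∧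
      Rows St i.1 (i.2 + 1) (St.code i.1.1 i.1.2 (i.2 + 1))
        (Function.update ρ 48 ((i.2 + 1 : ℕ) : ℤ)) μ) := by
  have hM := St.polyBdd_M.comp fun i : (Inst k × ℕ) × ℕ => i.1.1
  have hB := St.polyBdd_B.comp fun i : (Inst k × ℕ) × ℕ => i.1.1
  have hq : ∀ i : (Inst k × ℕ) × ℕ, ∀ ρ μ c, c.2 = (St.code i.1.1 i.1.2 i.2).2 →
      Rows St i.1 i.2 c ρ μ → (op .div (var 52) (lit (2 ^ St.pr.b))).eval ρ μ =
        ((St.code i.1.1 i.1.2 i.2).2 / 2 ^ St.pr.b : ℕ) := by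
    intro i ρ μ c hc h
    simp [eval, ArithOp.eval, h.code_snd, hc]
  refine .seq (Q := fun i ρ μ => i.2 < St.S i.1.1 ∧ Rows St i.1 i.2 (St.code i.1.1 i.1.2 i.2) ρ μ ∧
    ρ 55 = if St.bits i.1.1 i.1.2 i.2 = true then 1 else 0) ?_ <|
    .seq (Q := fun i ρ μ => i.2 < St.S i.1.1 ∧ Rows St i.1 i.2 ((St.code i.1.1 i.1.2 (i.2 + 1)).1,
      (St.code i.1.1 i.1.2 i.2).2) ρ μ ∧
      ρ 55 = if St.bits i.1.1 i.1.2 i.2 = true then 1 else 0) ?_ <|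
    .seq (Q := fun i ρ μ => i.2 < St.S i.1.1 ∧ Rows St i.1 i.2 (St.code i.1.1 i.1.2 (i.2 + 1)) ρ μ ∧
      ρ 55 = if St.bits i.1.1 i.1.2 i.2 = true then 1 else 0) ?_ <|
    .seq (Q := fun i ρ μ => Rows St i.1 i.2 (St.code i.1.1 i.1.2 (i.2 + 1)) ρ μ ∧ i.2 < St.S i.1.1 ∧
      (ρ 54 = firstIdx k (Setup.W i.1.1) (St.T i.1.1) St.pr.θ (St.rowsAt i.1.1 i.1.2 i.2)) ∧
        (0 < ρ 55 ↔ St.bits i.1.1 i.1.2 i.2 = true)) ?_ ?_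
  · refine .assign hM hB (fun _ => le_rfl) 55 (by simp [wf_ind, wf_lt, WF]) ?_
    rintro i ρ μ ⟨hS, h⟩
    have hev : (ind (lt (var 51) (op .div (var 52) (lit (2 ^ St.pr.b))))).eval ρ μ =
        if St.bits i.1.1 i.1.2 i.2 = true then 1 else 0 := by
      rw [eval_ind, holds_lt, hq i ρ μ _ rfl h]
      simp only [eval, h.code_fst, bits_eq, decide_eq_true_eq, Nat.cast_lt]
    refine ⟨h.small, hS, h.update (by norm_num) ?_, by rw [Function.update_self, hev]⟩
    rw [hev]
    split_ifs
    · exact St.bitLen_le_M_of_le_one (by norm_num) le_rfl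
    · exact St.bitLen_le_M_of_le_one le_rfl (by norm_num)
  · refine .assign hM hB (fun _ => le_rfl) 51 (by simp [WF]) ?_
    rintro i ρ μ ⟨hS, h, hb⟩
    have hle : (St.code i.1.1 i.1.2 i.2).2 / 2 ^ St.pr.b ≤ (St.code i.1.1 i.1.2 i.2).1 ∨
        St.bits i.1.1 i.1.2 i.2 = true := by
      rw [bits_eq, decide_eq_true_eq]; omega
    have hev : (ite (var 55) (var 51) (op .sub (var 51) (op .div (var 52) (lit (2 ^ St.pr.b))))).eval
        ρ μ = ((St.code i.1.1 i.1.2 (i.2 + 1)).1 : ℕ) := by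
      have e : (op .sub (var 51) (op .div (var 52) (lit (2 ^ St.pr.b)))).eval ρ μ =
          ((St.code i.1.1 i.1.2 i.2).1 : ℤ) -
            ((St.code i.1.1 i.1.2 i.2).2 / 2 ^ St.pr.b : ℕ) := by
        rw [eval, hq i ρ μ _ rfl h, eval, h.code_fst, ArithOp.eval]
      rw [eval, e, eval, eval, hb, h.code_fst, code_succ]
      dsimp only
      by_cases hbit : St.bits i.1.1 i.1.2 i.2 = true
      · simp [hbit]
      · have := hle.resolve_right hbit
        simp only [hbit, Bool.false_eq_true, if_false, lt_irrefl]
        omega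
    refine ⟨h.small, hS, ?_, by simpa using hb⟩
    rw [hev]
    exact h.update_fst (code_le i.1.1 i.1.2 (i.2 + 1)).1
  · refine .assign hM hB (fun _ => le_rfl) 52 (by simp [WF]) ?_
    rintro i ρ μ ⟨hS, h, hb⟩
    have hev : (ite (var 55) (op .div (var 52) (lit (2 ^ St.pr.b)))
        (op .sub (var 52) (op .div (var 52) (lit (2 ^ St.pr.b))))).eval
        ρ μ = ((St.code i.1.1 i.1.2 (i.2 + 1)).2 : ℕ) := by
      have h52 := h.code_snd
      dsimp only at h52
      have hle := Nat.div_le_self (St.code i.1.1 i.1.2 i.2).2 (2 ^ St.pr.b)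
      have e : (op .sub (var 52) (op .div (var 52) (lit (2 ^ St.pr.b)))).eval ρ μ =
          ((St.code i.1.1 i.1.2 i.2).2 - (St.code i.1.1 i.1.2 i.2).2 / 2 ^ St.pr.b : ℕ) := by
        rw [eval, hq i ρ μ ((St.code i.1.1 i.1.2 (i.2 + 1)).1, (St.code i.1.1 i.1.2 i.2).2) rfl h, eval, h52, ArithOp.eval]
        omega
      rw [eval, e, hq i ρ μ ((St.code i.1.1 i.1.2 (i.2 + 1)).1, (St.code i.1.1 i.1.2 i.2).2) rfl h, eval, hb, code_succ]
      by_cases hbit : St.bits i.1.1 i.1.2 i.2 = true <;> simp [hbit]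
    refine ⟨h.small, hS, ?_, by simpa using hb⟩
    rw [hev]
    exact h.update_snd (code_le i.1.1 i.1.2 (i.2 + 1)).2
  · refine .assign hM hB (fun _ => le_rfl) 54 firstE_wf ?_
    rintro i ρ μ ⟨hS, h, hb⟩
    have hev := h.ctx.eval_first (θ := St.pr.θ)
    refine ⟨h.small, h.update (by norm_num) ?_, hS, by rw [Function.update_self, hev], ?_⟩
    · rw [hev]
      refine Base.bitLen_le (2, fun I => numIdx k (Setup.W I)) (by simp [consts]) ?_
      classical
      exact (Finset.card_filter_le _ _).trans (by simp)
    · rw [Function.update_of_ne (by norm_num), hb]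
      split_ifs with h1 <;> simp [h1]
  · refine (phtStepFills St).conseq (fun _ _ _ h => h) fun i ρ μ h => ⟨h.2, ?_, h.1⟩
    have := h.1.S
    rwa [Function.update_of_ne (by norm_num)] at this

theorem phtSteps (St : Setup k) : PHt (fun i : Inst k × ℕ => instSize i.1) (fun _ => 1)
    (.forLoop 48 6 (stepProg k St.pr.θ St.pr.b))
    (fun i ρ μ => Rows St i 0 (St.code i.1 i.2 0) (Function.update ρ 48 0) μ)
    (fun i ρ μ => Rows St i (St.S i.1) (St.code i.1 i.2 (St.S i.1)) ρ μ) := by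
  refine (PHt.forLoop (w := fun _ => 1) (N := fun i : Inst k × ℕ => St.S i.1)
    (M := fun i => St.M i.1) (by norm_num) (by norm_num) (by norm_num)
    (fun i s ρ μ => Rows St i s (St.code i.1 i.2 s) ρ μ) (St.polyBdd_M.comp Prod.fst)
    (phtStep St) (fun _ => le_rfl) fun i ρ μ h => ⟨?_, ?_, h⟩).weight
    (((St.polyBdd_S.comp Prod.fst).add (.const 1))) fun i => le_rfl
  · exact Base.bitLen_le (6, St.S) (by simp [consts]) le_rfl
  · have := h.S
    rwa [Function.update_of_ne (by norm_num)] at this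

/-! ### Initialization -/

/-- The iteration number is split into the outer assignment (quotient by `2 ^ L`) and the code of
the choice bits (remainder). -/
def initProg (k : ℕ) : Prog :=
  .seq (.assign 53 (op .div (var 63) (var 36))) <| .seq (.assign 51 (mod (var 63) (var 36))) <|
    .seq (.assign 52 (var 36)) (.fill₂ 22 1 23 0 2 addrE (ind (initE k)))

open Classical in
theorem phtInit (St : Setup k) : PHt (fun i : Inst k × ℕ => instSize i.1) (fun _ => 1)
    (initProg k) (fun i ρ μ => Iter St i ρ μ)
    (fun i ρ μ => Rows St i 0 (St.code i.1 i.2 0) (Function.update ρ 48 0) μ) := by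
  have hM := St.polyBdd_M.comp fun i : Inst k × ℕ => i.1
  have hB := St.polyBdd_B.comp fun i : Inst k × ℕ => i.1
  have hT := St.polyBdd_T.comp fun i : Inst k × ℕ => i.1
  have hW := (polyBdd_W (k := k)).comp fun i : Inst k × ℕ => i.1
  refine .seq (Q := fun i ρ μ => Iter St i ρ μ ∧ ρ 53 = (i.2 / 2 ^ St.L i.1 : ℕ)) ?_ <|
    .seq (Q := fun i ρ μ => Iter St i ρ μ ∧ ρ 53 = (i.2 / 2 ^ St.L i.1 : ℕ) ∧
      ρ 51 = (i.2 % 2 ^ St.L i.1 : ℕ)) ?_ <|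
    .seq (Q := fun i ρ μ => Iter St i ρ μ ∧ ρ 53 = (i.2 / 2 ^ St.L i.1 : ℕ) ∧
      ρ 51 = (i.2 % 2 ^ St.L i.1 : ℕ) ∧ ρ 52 = (2 ^ St.L i.1 : ℕ)) ?_ ?_
  · refine .assign hM hB (fun _ => le_rfl) 53 (by simp [WF]) fun i ρ μ h => ?_
    have e : (op .div (var 63) (var 36)).eval ρ μ = (i.2 / 2 ^ St.L i.1 : ℕ) := by
      simp [eval, ArithOp.eval, h.residue, h.two_pow_L]
    rw [e]
    refine ⟨h.small, h.update (by norm_num) ?_, by simp⟩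
    exact Base.bitLen_le (44, St.R) (by simp [consts]) ((Nat.div_le_self _ _).trans h.lt.le)
  · refine .assign hM hB (fun _ => le_rfl) 51 (by simp [WF, mod]) fun i ρ μ ⟨h, h1⟩ => ?_
    have e : (mod (var 63) (var 36)).eval ρ μ = (i.2 % 2 ^ St.L i.1 : ℕ) := by
      simp [eval_mod, eval, h.residue, h.two_pow_L]
    rw [e]
    refine ⟨h.small, h.update (by norm_num) ?_, by simpa using h1, by simp⟩
    exact Base.bitLen_le (44, St.R) (by simp [consts]) ((Nat.mod_le _ _).trans h.lt.le)
  · refine .assign hM hB (fun _ => le_rfl) 52 (by simp [WF]) fun i ρ μ ⟨h, h1, h2⟩ => ?_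
    have e : (var 36).eval ρ μ = (2 ^ St.L i.1 : ℕ) := h.two_pow_L
    rw [e]
    refine ⟨h.small, h.update (by norm_num) ?_, by simpa using h1, by simpa using h2, by simp⟩
    exact Base.bitLen_le (36, fun I => 2 ^ St.L I) (by simp [consts]) le_rfl
  · refine PHt.fill₂_of_polyBdd (by norm_num) (by norm_num) (by norm_num) (by norm_num)
      (by norm_num) (by norm_num) (by norm_num) (by norm_num) (by norm_num) (by norm_num)
      (by norm_num) hM hB addrE_wf (wf_ind.2 (initE_wf k)) hT hW (fun _ => le_rfl) ?_
    rintro i ρ μ ⟨h, h1, h2, h3⟩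
    refine ⟨h.small, h.T, h.W, fun s t => (s : ℤ) * Setup.W i.1 + t,
      fun s t => if t ∈ initRows i.1.2 s then 1 else 0,
      fun s _ t _ ν => eval_addrE h.W, fun s hs t ht ν hsm => ?_, fun _ s _ t _ => ?_,
      fun s _ t ht s' _ t' ht' => rowMajor_injective ht ht', ?_⟩
    · rw [eval_ind]
      refine if_congr ?_ rfl rfl
      have h' : Iter St i (Function.update
          (Function.update ρ 22 (s : ℤ)) 23 (t : ℤ)) (Function.update μ 2 ν) :=
        h.frame (fun z hz => by
          rw [Function.update_of_ne (by omega), Function.update_of_ne (by omega)]) hsm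
          fun a ha => by rw [Function.update_of_ne (by omega)]
      exact h'.holds_init (by simp) (by simp) ht
    · dsimp only
      split_ifs
      · exact St.bitLen_le_M_of_le_one (by norm_num) le_rfl
      · exact St.bitLen_le_M_of_le_one le_rfl (by norm_num)
    · intro ρ' ν hρ' hsm hν _
      refine ⟨(h.frame (fun z hz => hρ' z (by omega) (by omega)) hsm fun a ha => by
        rw [Function.update_of_ne (by omega)]).update (by norm_num) (by simp), ?_, ?_, ?_, ?_, ?_,
        Nat.zero_le _⟩
      · rw [Function.update_of_ne (by norm_num), hρ' _ (by norm_num) (by norm_num), h2]; rfl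
      · rw [Function.update_of_ne (by norm_num), hρ' _ (by norm_num) (by norm_num), h3]; rfl
      · rw [Function.update_of_ne (by norm_num), hρ' _ (by norm_num) (by norm_num), h1]
      · simp
      · intro t ht l hl
        rw [Function.update_self, hν t ht l hl]
        dsimp only
        rw [rowsAt, runBits]
        split_ifs with h1 <;> simp [h1]

/-! ### Compression -/

def liveCountE : Expr := count 18 1 (liveE 18)

def compressE : Expr :=
  conj (neg (lt (var 4) liveCountE)) (disj (count 18 1 (conj (liveE 18) (conj
    (eq (count 19 1 (conj (lt (var 19) (var 18)) (liveE 19))) (var 22)) (rowHas 18 23))))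
      (conj (le liveCountE (var 22)) (padE 23)))

theorem compressE_wf : compressE.WF := by
  simp [compressE, liveCountE, padE, wf_conj, wf_neg, wf_lt, wf_count, wf_disj, wf_eq, wf_le, WF,
    liveE_wf, rowHas_wf]

theorem holds_compress {W T J j l : ℕ} {A : ℕ → Finset ℕ} (h : RowCtx k W T A ρ μ) (hJ : ρ 4 = J)
    (hj : ρ 22 = j) (hl : ρ 23 = l) (hlW : l < W) :
    compressE.Holds ρ μ ↔ l ∈ compress W T J A j := by
  classical
  have hlive : ∀ t < T, (liveE 18).Holds (Function.update ρ 18 (t : ℤ)) μ ↔ Live T A t := fun t ht =>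
    (h.update (by norm_num) _).holds_live (by simp) ht (by norm_num)
  have hcnt : liveCountE.eval ρ μ = (((Finset.range T).filter fun t => Live T A t).card : ℤ) := by
    rw [liveCountE, eval_count h.rows]
    congr 2
    exact Finset.filter_congr fun t ht => hlive t (Finset.mem_range.1 ht)
  rw [compressE, holds_conj, holds_neg, holds_lt, holds_disj, holds_conj, holds_le, hcnt,
    h.holds_pad hl hlW, holds_count h.rows, compress, Finset.mem_filter, Finset.mem_range]
  simp only [eval, hJ, hj, hlW, true_and, Nat.cast_lt, Nat.cast_le]
  refine and_congr (not_congr ?_) (or_congr (exists_congr fun t => and_congr_right fun ht => ?_)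
    (and_congr_left fun _ => ?_))
  · exact Iff.rfl
  · have h' := h.update (x := 18) (by norm_num) (t : ℤ)
    rw [holds_conj, holds_conj, hlive t ht, holds_eq, eval_count h'.rows,
      h'.holds_rowHas (τ := t) (v := l) (by simp) ht (by simpa using hl) hlW]
    have : ((Finset.range T).filter fun i : ℕ => ((lt (var 19) (var 18)).conj (liveE 19)).Holds
        (Function.update (Function.update ρ 18 (t : ℤ)) 19 (i : ℤ)) μ) =
        (Finset.range T).filter fun t' => t' < t ∧ Live T A t' := by
      refine Finset.filter_congr fun t' ht' => ?_
      rw [holds_conj, holds_lt, (h'.update (by norm_num) _).holds_live (τ := t') (by simp)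
        (Finset.mem_range.1 ht') (by norm_num)]
      simp [eval]
    rw [this]
    simp [eval, hj]
  · exact Iff.rfl

variable (St) in
/-- The configuration after the sparsification. -/
structure Sparse (i : Inst k × ℕ) (ρ : ℕ → ℤ) (μ : ℕ → ℤ → ℤ) : Prop extends Iter St i ρ μ where
  outer : ρ 53 = (i.2 / 2 ^ St.L i.1 : ℕ)
  clauses : ∀ c < St.J i.1, ∀ l < Setup.W i.1,
    0 < μ 4 ((c : ℤ) * Setup.W i.1 + l) ↔ l ∈ St.sparse i.1 i.2 c

open Classical in
theorem phtCompress (St : Setup k) : PHt (fun i : Inst k × ℕ => instSize i.1) (fun _ => 1)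
    (.fill₂ 22 4 23 0 4 addrE (ind compressE))
    (fun i ρ μ => Rows St i (St.S i.1) (St.code i.1 i.2 (St.S i.1)) ρ μ)
    (fun i ρ μ => Sparse St i ρ μ) := by
  have hM := St.polyBdd_M.comp fun i : Inst k × ℕ => i.1
  have hB := St.polyBdd_B.comp fun i : Inst k × ℕ => i.1
  have hJ := St.polyBdd_J.comp fun i : Inst k × ℕ => i.1
  have hW := (polyBdd_W (k := k)).comp fun i : Inst k × ℕ => i.1
  refine PHt.fill₂_of_polyBdd (by norm_num) (by norm_num) (by norm_num) (by norm_num)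
      (by norm_num) (by norm_num) (by norm_num) (by norm_num) (by norm_num) (by norm_num)
      (by norm_num) hM hB addrE_wf (wf_ind.2 compressE_wf) hJ hW (fun _ => le_rfl) ?_
  rintro i ρ μ h
  refine ⟨h.small, h.J, h.W, fun s t => (s : ℤ) * Setup.W i.1 + t,
      fun s t => if t ∈ St.sparse i.1 i.2 s then 1 else 0,
      fun s _ t _ ν => eval_addrE h.W, fun s hs t ht ν hsm => ?_, fun _ s _ t _ => ?_,
      fun s _ t ht s' _ t' ht' => rowMajor_injective ht ht', ?_⟩
  · rw [eval_ind]
    refine if_congr ?_ rfl rfl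
    have h' : Rows St i (St.S i.1) (St.code i.1 i.2 (St.S i.1)) (Function.update
          (Function.update ρ 22 (s : ℤ)) 23 (t : ℤ)) (Function.update μ 4 ν) :=
        h.frame (fun z hz => by
          rw [Function.update_of_ne (by omega), Function.update_of_ne (by omega)]) hsm
          fun a ha => by rw [Function.update_of_ne (by omega)]
    exact holds_compress h'.ctx h'.J (by simp) (by simp) ht
  · dsimp only
    split_ifs
    · exact St.bitLen_le_M_of_le_one (by norm_num) le_rfl
    · exact St.bitLen_le_M_of_le_one le_rfl (by norm_num)
  · intro ρ' ν hρ' hsm hν _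
    refine ⟨h.toIter.frame (fun z hz => hρ' z (by omega) (by omega)) hsm fun a ha => by
        rw [Function.update_of_ne (by omega)], ?_, ?_⟩
    · rw [hρ' _ (by norm_num) (by norm_num), h.outer]
    · intro t ht l hl
      rw [Function.update_self, hν t ht l hl]
      dsimp only
      split_ifs with h1 <;> simp [h1]

def sparsifyProg (k : ℕ) (θ : ℕ → ℕ) (b : ℕ) : Prog :=
  .seq (initProg k) (.seq (.forLoop 48 6 (stepProg k θ b))
    (.fill₂ 22 4 23 0 4 addrE (ind compressE)))

theorem phtSparsify (St : Setup k) : PHt (fun i : Inst k × ℕ => instSize i.1) (fun _ => 1)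
    (sparsifyProg k St.pr.θ St.pr.b) (fun i ρ μ => Iter St i ρ μ) (fun i ρ μ => Sparse St i ρ μ) :=
  (phtInit St).seq ((phtSteps St).seq (phtCompress St))

end Setup

/-! ## Loading and calling the attention program -/

theorem PHt.fill {ι : Type} {z w N M B : ι → ℕ} {x b a : ℕ} {e₁ e₂ : Expr}
    {P Q : ι → (ℕ → ℤ) → (ℕ → ℤ → ℤ) → Prop}
    (hx : 16 ≤ x) (hx' : x < 64) (hb : b < 64) (hxb : x ≠ b)
    (hM : PolyBdd z M) (hB : PolyBdd z B) (he₁ : e₁.WF) (he₂ : e₂.WF) (hw : ∀ i, N i + 1 ≤ w i)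
    (h : ∀ i ρ μ, P i ρ μ → Expr.Small ρ μ (M i) (B i) ∧ ρ b = N i ∧
      ∃ addr val : ℕ → ℤ,
      (∀ s < N i, ∀ ν, e₁.eval (Function.update ρ x (s : ℤ)) (Function.update μ a ν) = addr s) ∧
      (∀ s < N i, ∀ ν, Expr.Small (Function.update ρ x (s : ℤ)) (Function.update μ a ν) (M i) (B i) →
        e₂.eval (Function.update ρ x (s : ℤ)) (Function.update μ a ν) = val s) ∧
      (a < 8 → ∀ s < N i, bitLen (val s) ≤ M i) ∧
      (∀ s < N i, ∀ s' < N i, addr s = addr s' → s = s') ∧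
      ∀ ν, (∀ s < N i, ν (addr s) = val s) → (∀ u, (∀ s < N i, addr s ≠ u) → ν u = μ a u) →
        Q i (Function.update ρ x (N i : ℤ)) (Function.update μ a ν)) :
    PHt z w (.fill x b a e₁ e₂) P Q := by
  refine of_ht (f := fun i => e₁.cost (M i) (B i) + e₂.cost (M i) (B i) + 5 * M i + 10)
    ((((e₁.cost_polyBdd hM hB).add (e₂.cost_polyBdd hM hB)).add (hM.const_mul 5)).add (.const 10))
    fun i ρ μ hP => ?_
  obtain ⟨h1, h2, addr, val, h4, h5, h6, h7, h8⟩ := h i ρ μ hP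
  refine (Ht.fill hx hx' hb hxb h1 he₁ he₂ h2 addr val h4 h5 h6 h7).mono ?_ ?_
  · rw [mul_comm]
    exact Nat.mul_le_mul_left _ (hw i)
  · rintro ρ' μ' ⟨rfl, ν, rfl, h11, h12⟩
    exact h8 ν h11 h12

theorem rowMajor_apply {n d s c : ℕ} (M : Matrix (Fin n) (Fin d) ℤ) (hs : s < n) (hc : c < d) :
    rowMajor M ((s : ℤ) * d + c) = M ⟨s, hs⟩ ⟨c, hc⟩ := by
  rw [rowMajor, Finset.sum_eq_single ⟨s, hs⟩, Finset.sum_eq_single ⟨c, hc⟩]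
  · simp
  · intro c' _ hne
    rw [if_neg]
    intro h
    exact hne (Fin.ext (rowMajor_injective c'.2 hc h.symm).2)
  · simp
  · intro s' _ hne
    refine Finset.sum_eq_zero fun c' _ => if_neg fun h => hne (Fin.ext ?_)
    exact (rowMajor_injective c'.2 hc h.symm).1
  · simp

theorem rowMajor_eq_zero {n d : ℕ} (M : Matrix (Fin n) (Fin d) ℤ) {z : ℤ}
    (h : ∀ s < n, ∀ c < d, z ≠ (s : ℤ) * d + c) : rowMajor M z = 0 := by
  rw [rowMajor]
  exact Finset.sum_eq_zero fun s _ => Finset.sum_eq_zero fun c _ => if_neg (h s s.2 c c.2)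

/-- An array that holds the entries of a matrix in its upper left corner, all other entries of which
are zero. -/
theorem eq_rowMajor {n d N₁ N₂ : ℕ} {ν : ℤ → ℤ} (M : Matrix (Fin n) (Fin d) ℤ) (hN₁ : N₁ ≤ n)
    (hN₂ : N₂ ≤ d)
    (h : ∀ s (hs : s < N₁), ∀ c (hc : c < N₂),
      ν ((s : ℤ) * d + c) = M ⟨s, hs.trans_le hN₁⟩ ⟨c, hc.trans_le hN₂⟩)
    (h0 : ∀ z : ℤ, (∀ s < N₁, ∀ c < N₂, (s : ℤ) * d + c ≠ z) → ν z = 0)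
    (hM : ∀ (s : Fin n) (c : Fin d), (N₁ ≤ (s : ℕ) ∨ N₂ ≤ (c : ℕ)) → M s c = 0) (z : ℤ) : ν z = rowMajor M z := by
  by_cases hz : ∃ s < n, ∃ c < d, z = (s : ℤ) * d + c
  · obtain ⟨s, hs, c, hc, rfl⟩ := hz
    rw [rowMajor_apply M hs hc]
    by_cases hlt : s < N₁ ∧ c < N₂
    · exact h s hlt.1 c hlt.2
    · rw [hM _ _ (by dsimp only; omega)]
      refine h0 _ fun s' hs' c' hc' he => ?_
      obtain ⟨rfl, rfl⟩ := rowMajor_injective (hc'.trans_le hN₂) hc he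
      exact hlt ⟨hs', hc'⟩
  · push Not at hz
    rw [rowMajor_eq_zero M fun s hs c hc => hz s hs c hc]
    exact h0 z fun s hs c hc he => hz s (hs.trans_le hN₁) c (hc.trans_le hN₂) he.symm

namespace Setup

open Sparsify Expr

variable {k : ℕ} {St : Setup k} {I : Inst k} {i : Inst k × ℕ} {ρ ρ' : ℕ → ℤ} {μ μ' : ℕ → ℤ → ℤ}

/-- Requirements on the sizes of the attention inputs. -/
structure Valid (St : Setup k) : Prop where
  J_lt : ∀ I, St.J I + 1 ≤ St.d (St.N I)
  NG_lt : ∀ I, 2 * St.NG I + 1 ≤ St.N I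
  Bs_le : ∀ I, 2 * St.Bs I ≤ St.N I
  dv_pos : ∀ n, 1 ≤ St.dv n

variable (St) in
/-- The constants and the number of the iteration are in place. -/
structure Loc (i : Inst k × ℕ) (ρ : ℕ → ℤ) (μ : ℕ → ℤ → ℤ) : Prop extends Base St i.1 ρ μ where
  residue : ρ 63 = i.2
  lt : i.2 < St.R i.1

variable (St) in
/-- The constants and the sparse formula are in place. -/
structure Core (i : Inst k × ℕ) (ρ : ℕ → ℤ) (μ : ℕ → ℤ → ℤ) : Prop extends Loc St i ρ μ where
  outer : ρ 53 = (i.2 / 2 ^ St.L i.1 : ℕ)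
  clauses : ∀ c < St.J i.1, ∀ l < Setup.W i.1,
    0 < μ 4 ((c : ℤ) * Setup.W i.1 + l) ↔ l ∈ St.sparse i.1 i.2 c

variable (St) in
open Classical in
/-- The flag says whether one of the iterations before `r` was successful. -/
def Flag (i : Inst k × ℕ) (ρ : ℕ → ℤ) : Prop := ρ 61 = if ∃ r < i.2, St.Good i.1 r then 1 else 0

/-- Memory of the iterations from `r` on is unused. -/
def Fresh (R r : ℕ) (μ : ℕ → ℤ → ℤ) : Prop :=
  ∀ a ≥ 9, ∀ z : ℤ, r ≤ z % (R + 2) → z % (R + 2) < R → μ a z = 0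

theorem Loc.frame (h : Loc St i ρ μ)
    (hρ : ∀ z, (z < 16 ∨ 32 ≤ z ∧ z < 48 ∨ 62 ≤ z ∧ z < 64) → ρ' z = ρ z)
    (hs : Small ρ' μ' (St.M i.1) (St.B i.1)) (hμ : ∀ a, a = 0 ∨ a = 1 → μ' a = μ a) :
    Loc St i ρ' μ' where
  const p hp := by
    rw [hρ _ (by have := const_range hp; omega)]
    exact h.const p hp
  small := hs
  formula := by rw [hμ 0 (by simp), h.formula]
  powers j hj := by rw [hμ 1 (by simp), h.powers j hj]
  residue := by rw [hρ 63 (by norm_num), h.residue]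
  lt := h.lt

theorem Core.frame (h : Core St i ρ μ)
    (hρ : ∀ z, (z < 16 ∨ 32 ≤ z ∧ z < 48 ∨ z = 53 ∨ 62 ≤ z ∧ z < 64) → ρ' z = ρ z)
    (hs : Small ρ' μ' (St.M i.1) (St.B i.1)) (hμ : ∀ a, a = 0 ∨ a = 1 ∨ a = 4 → μ' a = μ a) :
    Core St i ρ' μ' where
  toLoc := h.toLoc.frame (fun z hz => hρ z (by omega)) hs fun a ha => hμ a (by omega)
  outer := by rw [hρ _ (by norm_num), h.outer]
  clauses := by rw [hμ 4 (by norm_num)]; exact h.clauses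

theorem Sparse.core (h : Sparse St i ρ μ) : Core St i ρ μ ∧ Flag St i ρ ∧ Fresh (St.R i.1) i.2 μ :=
  ⟨⟨⟨h.toBase, h.residue, h.lt⟩, h.outer, h.clauses⟩, h.flag, h.fresh⟩

/-! ### Evaluation of partial assignments -/

def iffE (a b : Expr) : Expr := disj (conj a b) (conj (neg a) (neg b))

theorem holds_iffE {a b : Expr} : (iffE a b).Holds ρ μ ↔ (a.Holds ρ μ ↔ b.Holds ρ μ) := by
  rw [iffE, holds_disj, holds_conj, holds_conj, holds_neg, holds_neg]; tauto

def bitE (x j : Expr) : Expr := eq (mod (op .div x (get 1 j)) (lit 2)) (lit 1)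

theorem Base.holds_bit (h : Base St I ρ μ) {x j : Expr} {v u : ℕ} (hx : x.eval ρ μ = v)
    (hj : j.eval ρ μ = u) (hu : u < St.pows I) : (bitE x j).Holds ρ μ ↔ v.testBit u = true := by
  rw [bitE, holds_eq, eval_mod, Nat.testBit_eq_decide_div_mod_eq, decide_eq_true_eq]
  simp only [eval, ArithOp.eval, hx, hj, h.powers u hu]
  norm_cast

def varE : Expr := ite (lt (var 16) (var 32)) (var 16) (op .sub (var 16) (var 32))
def hasE : Expr := get 4 (op .add (op .mul (var 23) (var 0)) (var 16))
def twoE (x : ℕ) : Expr := op .add (var x) (var x)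

def unsatLeftE : Expr :=
  neg (count 16 0 (conj hasE (disj (eq (var 16) (twoE 32)) (disj
    (conj (lt (var 16) (twoE 32)) (conj (lt varE (var 34))
      (iffE (bitE (var 22) varE) (lt (var 16) (var 32)))))
    (conj (lt (var 16) (twoE 32)) (conj (le (twoE 34) varE)
      (iffE (bitE (var 53) (op .sub varE (twoE 34))) (lt (var 16) (var 32)))))))))

def unsatRightE : Expr :=
  neg (count 16 0 (conj hasE (conj (lt (var 16) (twoE 32)) (conj (le (var 34) varE)
    (conj (lt varE (twoE 34))
      (iffE (bitE (op .sub (var 22) (var 35)) (op .sub varE (var 34))) (lt (var 16) (var 32))))))))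

theorem unsatLeftE_wf : unsatLeftE.WF := by
  simp [unsatLeftE, hasE, twoE, varE, bitE, iffE, mod, wf_conj, wf_neg, wf_lt, wf_count, wf_disj,
    wf_eq, wf_le, WF]

theorem unsatRightE_wf : unsatRightE.WF := by
  simp [unsatRightE, hasE, twoE, varE, bitE, iffE, mod, wf_conj, wf_neg, wf_lt, wf_count, wf_disj,
    wf_eq, wf_le, WF]

section

variable {c l : ℕ}

theorem Core.holds_has (h : Core St i ρ μ) (hc : ρ 23 = c) (hcJ : c < St.J i.1) (hl : ρ 16 = l)
    (hlW : l < Setup.W i.1) : hasE.Holds ρ μ ↔ l ∈ St.sparse i.1 i.2 c := by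
  simp only [hasE, Holds, eval, ArithOp.eval, hc, hl, h.W]
  exact h.clauses c hcJ l hlW

theorem Core.eval_var (h : Core St i ρ μ) (hl : ρ 16 = l) :
    varE.eval ρ μ = (if l < i.1.1 then l else l - i.1.1 : ℕ) := by
  have : 0 < (lt (var 16) (var 32)).eval ρ μ ↔ l < i.1.1 := by
    rw [← Holds, holds_lt]; simp [eval, hl, h.n]
  simp only [varE, eval, ArithOp.eval, hl, h.n]
  simp only [this]
  split_ifs <;> omega

theorem Core.update (h : Core St i ρ μ) {x : ℕ} (hx : 16 ≤ x ∧ x < 32) {v : ℤ}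
    (hv : bitLen v ≤ St.M i.1) : Core St i (Function.update ρ x v) μ :=
  h.frame (fun z hz => by rw [Function.update_of_ne (by omega)]) (h.small.update (by omega) hv)
    fun _ _ => rfl

theorem lt_of_mem_sparse {r c l : ℕ} (hl : l ∈ St.sparse I r c) : l < Setup.W I := by
  classical exact Finset.mem_range.1 (Finset.filter_subset _ _ hl)

theorem lt_pows {u : ℕ} (h : u ≤ I.1) : u < St.pows I := by rw [pows]; omega

theorem Core.holds_unsatLeft (h : Core St i ρ μ) {α : ℕ} (hα : ρ 22 = α) (hc : ρ 23 = c)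
    (hcJ : c < St.J i.1) : unsatLeftE.Holds ρ μ ↔ St.UnsatLeft i.1 i.2 α c := by
  rw [unsatLeftE, holds_neg, holds_count h.W, UnsatLeft, not_exists]
  have hsub : ∀ l ∈ St.sparse i.1 i.2 c, l < Setup.W i.1 := fun l hl => lt_of_mem_sparse hl
  have key : ∀ l < Setup.W i.1, _ := fun l hlW => by
    have hlM : bitLen (l : ℤ) ≤ St.M i.1 := Base.bitLen_le (0, Setup.W) (by simp [consts]) hlW.le
    have h' := h.update (x := 16) (by norm_num) hlM
    have hl : Function.update ρ 16 (l : ℤ) 16 = l := by simp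
    have hα' : Function.update ρ 16 (l : ℤ) 22 = α := by simpa using hα
    have hc' : Function.update ρ 16 (l : ℤ) 23 = c := by simpa using hc
    have hv := h'.eval_var hl
    have hvle : (if l < i.1.1 then l else l - i.1.1) ≤ i.1.1 := by
      rw [Setup.W] at hlW; split_ifs <;> omega
    have hg2 : (twoE 34).eval (Function.update ρ 16 (l : ℤ)) μ = (2 * St.g i.1 : ℕ) := by
      simp only [twoE, eval, ArithOp.eval, h'.g]; push_cast; ring
    have hn2 : (twoE 32).eval (Function.update ρ 16 (l : ℤ)) μ = (2 * i.1.1 : ℕ) := by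
      simp only [twoE, eval, ArithOp.eval, h'.n]; push_cast; ring
    have e16 : (var 16).eval (Function.update ρ 16 (l : ℤ)) μ = l := hl
    have e34 : (var 34).eval (Function.update ρ 16 (l : ℤ)) μ = St.g i.1 := h'.g
    have e32 : (var 32).eval (Function.update ρ 16 (l : ℤ)) μ = i.1.1 := h'.n
    have hb1 := h'.holds_bit (x := var 22) (v := α) hα' hv (lt_pows hvle)
    have hb2 : 2 * St.g i.1 ≤ (if l < i.1.1 then l else l - i.1.1) →
        ((bitE (var 53) (op .sub varE (twoE 34))).Holds (Function.update ρ 16 (l : ℤ)) μ ↔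
        (i.2 / 2 ^ St.L i.1).testBit ((if l < i.1.1 then l else l - i.1.1) - 2 * St.g i.1) = true) :=
      fun hle => h'.holds_bit (by simpa [eval] using h.outer) (by
        rw [eval, hv, hg2, ArithOp.eval]; omega) (lt_pows (by omega))
    have : (conj hasE (disj (eq (var 16) (twoE 32)) (disj
        (conj (lt (var 16) (twoE 32)) (conj (lt varE (var 34))
          (iffE (bitE (var 22) varE) (lt (var 16) (var 32)))))
        (conj (lt (var 16) (twoE 32)) (conj (le (twoE 34) varE)
          (iffE (bitE (var 53) (op .sub varE (twoE 34))) (lt (var 16) (var 32)))))))).Holds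
        (Function.update ρ 16 (l : ℤ)) μ ↔ l ∈ St.sparse i.1 i.2 c ∧ (l = 2 * i.1.1 ∨
      (l < 2 * i.1.1 ∧ (if l < i.1.1 then l else l - i.1.1) < St.g i.1 ∧
        (α.testBit (if l < i.1.1 then l else l - i.1.1) = true ↔ l < i.1.1)) ∨
      (l < 2 * i.1.1 ∧ 2 * St.g i.1 ≤ (if l < i.1.1 then l else l - i.1.1) ∧
        ((i.2 / 2 ^ St.L i.1).testBit ((if l < i.1.1 then l else l - i.1.1) - 2 * St.g i.1) = true ↔
          l < i.1.1))) := by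
      rw [holds_conj, h'.holds_has hc' hcJ hl hlW, holds_disj, holds_eq, holds_disj, holds_conj,
        holds_lt, holds_conj, holds_lt, holds_iffE, hb1, holds_lt, holds_conj, holds_lt, holds_conj,
        holds_le, holds_iffE, holds_lt, e16, hn2, hv, e34, hg2, e32, Nat.cast_lt, Nat.cast_lt,
        Nat.cast_lt, Nat.cast_le, Nat.cast_inj]
      refine and_congr_right fun _ => or_congr_right (or_congr_right (and_congr_right fun _ =>
        and_congr_right fun hle => ?_))
      rw [hb2 hle]
    exact this
  constructor
  · intro H l hl ht
    exact H l ⟨hsub l hl, (key l (hsub l hl)).2 ⟨hl, ht⟩⟩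
  · rintro H l ⟨hlW, hh⟩
    obtain ⟨h1, h2⟩ := (key l hlW).1 hh
    exact H l h1 h2

theorem Core.holds_unsatRight (h : Core St i ρ μ) {β : ℕ} (hβ : ρ 22 = (St.NG i.1 + β : ℕ))
    (hc : ρ 23 = c) (hcJ : c < St.J i.1) :
    unsatRightE.Holds ρ μ ↔ St.UnsatRight i.1 i.2 β c := by
  rw [unsatRightE, holds_neg, holds_count h.W, UnsatRight, not_exists]
  have hsub : ∀ l ∈ St.sparse i.1 i.2 c, l < Setup.W i.1 := fun l hl => lt_of_mem_sparse hl
  have key : ∀ l < Setup.W i.1, _ := fun l hlW => by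
    have hlM : bitLen (l : ℤ) ≤ St.M i.1 := Base.bitLen_le (0, Setup.W) (by simp [consts]) hlW.le
    have h' := h.update (x := 16) (by norm_num) hlM
    have hl : Function.update ρ 16 (l : ℤ) 16 = l := by simp
    have hβ' : Function.update ρ 16 (l : ℤ) 22 = (St.NG i.1 + β : ℕ) := by simpa using hβ
    have hc' : Function.update ρ 16 (l : ℤ) 23 = c := by simpa using hc
    have hv := h'.eval_var hl
    have hvle : (if l < i.1.1 then l else l - i.1.1) ≤ i.1.1 := by
      rw [Setup.W] at hlW; split_ifs <;> omega
    have hg2 : (twoE 34).eval (Function.update ρ 16 (l : ℤ)) μ = (2 * St.g i.1 : ℕ) := by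
      simp only [twoE, eval, ArithOp.eval, h'.g]; push_cast; ring
    have hn2 : (twoE 32).eval (Function.update ρ 16 (l : ℤ)) μ = (2 * i.1.1 : ℕ) := by
      simp only [twoE, eval, ArithOp.eval, h'.n]; push_cast; ring
    have e16 : (var 16).eval (Function.update ρ 16 (l : ℤ)) μ = l := hl
    have e34 : (var 34).eval (Function.update ρ 16 (l : ℤ)) μ = St.g i.1 := h'.g
    have e32 : (var 32).eval (Function.update ρ 16 (l : ℤ)) μ = i.1.1 := h'.n
    have eβ : (op .sub (var 22) (var 35)).eval (Function.update ρ 16 (l : ℤ)) μ = β := by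
      simp only [eval, ArithOp.eval, hβ', h'.NG]; push_cast; ring
    have hb2 : St.g i.1 ≤ (if l < i.1.1 then l else l - i.1.1) →
        ((bitE (op .sub (var 22) (var 35)) (op .sub varE (var 34))).Holds
          (Function.update ρ 16 (l : ℤ)) μ ↔
        β.testBit ((if l < i.1.1 then l else l - i.1.1) - St.g i.1) = true) :=
      fun hle => h'.holds_bit eβ (by
        rw [eval, hv, e34, ArithOp.eval]; omega) (lt_pows (by omega))
    have : (conj hasE (conj (lt (var 16) (twoE 32)) (conj (le (var 34) varE)
        (conj (lt varE (twoE 34))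
        (iffE (bitE (op .sub (var 22) (var 35)) (op .sub varE (var 34))) (lt (var 16) (var 32))))))).Holds
        (Function.update ρ 16 (l : ℤ)) μ ↔ l ∈ St.sparse i.1 i.2 c ∧
      (l < 2 * i.1.1 ∧ St.g i.1 ≤ (if l < i.1.1 then l else l - i.1.1) ∧
        (if l < i.1.1 then l else l - i.1.1) < 2 * St.g i.1 ∧
        (β.testBit ((if l < i.1.1 then l else l - i.1.1) - St.g i.1) = true ↔ l < i.1.1)) := by
      rw [holds_conj, h'.holds_has hc' hcJ hl hlW, holds_conj, holds_lt, holds_conj, holds_le,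
        holds_conj, holds_lt, holds_iffE, holds_lt, e16, hn2, hv, e34, hg2, e32, Nat.cast_lt,
        Nat.cast_lt, Nat.cast_lt, Nat.cast_le]
      refine and_congr_right fun _ => and_congr_right fun _ => and_congr_right fun hle =>
        and_congr_right fun _ => ?_
      rw [hb2 hle]
    exact this
  constructor
  · intro H l hl ht
    exact H l ⟨hsub l hl, (key l (hsub l hl)).2 ⟨hl, ht⟩⟩
  · rintro H l ⟨hlW, hh⟩
    obtain ⟨h1, h2⟩ := (key l hlW).1 hh
    exact H l h1 h2

end

end Setup

namespace Setup

open Sparsify Expr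

variable {k : ℕ} {St : Setup k} {I : Inst k} {i : Inst k × ℕ} {ρ ρ' : ℕ → ℤ} {μ μ' : ℕ → ℤ → ℤ}

/-! ### The attention input -/

variable (St) in
/-- The query matrix of iteration `r`. -/
noncomputable def qMat (I : Inst k) (uL uR : ℕ → ℕ → Prop) :
    Matrix (Fin (St.N I)) (Fin (St.d (St.N I))) ℤ :=
  Gadget.matQ (St.Bs I) (St.J I) (St.NG I) (St.N I) (St.d (St.N I)) uL uR

variable (St) in
def vMat (I : Inst k) : Matrix (Fin (St.N I)) (Fin (St.dv (St.N I))) ℤ :=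
  Gadget.matV (St.NG I) (St.N I) (St.dv (St.N I))

/-- The address of the number in register `z` for relocated programs. -/
def cellE (e : Expr) : Expr := op .add (op .mul e (var 62)) (var 63)

def qE : Expr :=
  ite (lt (var 23) (var 4))
    (ite (lt (var 22) (var 35)) (ite unsatLeftE (twoE 39) (lit 0))
      (ite (lt (var 22) (twoE 35)) (ite unsatRightE (op .sub (lit 0) (var 39)) (var 39)) (lit 0)))
    (ite (eq (var 22) (twoE 35)) (twoE 39) (lit 0))

theorem qE_wf : qE.WF := by
  simp [qE, WF, wf_lt, wf_eq, twoE, unsatLeftE_wf, unsatRightE_wf]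

theorem eval_ite_holds {c a b : Expr} : (ite c a b).eval ρ μ =
    open Classical in if c.Holds ρ μ then a.eval ρ μ else b.eval ρ μ := by
  simp only [eval, Holds]
  congr

theorem Base.eval_twoE_Bs (h : Base St I ρ μ) : (twoE 39).eval ρ μ = 2 * (St.Bs I : ℤ) := by
  simp only [twoE, eval, ArithOp.eval, h.Bs]; ring

theorem Base.eval_twoE_NG (h : Base St I ρ μ) : (twoE 35).eval ρ μ = (2 * St.NG I : ℕ) := by
  simp only [twoE, eval, ArithOp.eval, h.NG]; push_cast; ring

theorem Core.eval_q (h : Core St i ρ μ) {s c : ℕ} (hs : ρ 22 = s) (hc : ρ 23 = c)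
    (hcJ : c < St.J i.1 + 1) : qE.eval ρ μ = Gadget.entry (St.Bs i.1) (St.J i.1) (St.NG i.1)
      (St.UnsatLeft i.1 i.2) (St.UnsatRight i.1 i.2) s c := by
  classical
  have e22 : (var 22).eval ρ μ = s := hs
  have e23 : (var 23).eval ρ μ = c := hc
  have e4 : (var 4).eval ρ μ = St.J i.1 := h.J
  have e35 : (var 35).eval ρ μ = St.NG i.1 := h.NG
  have e39 : (var 39).eval ρ μ = St.Bs i.1 := h.Bs
  have h0 : (lit 0).eval ρ μ = 0 := rfl
  have hneg : (op .sub (lit 0) (var 39)).eval ρ μ = -(St.Bs i.1 : ℤ) := by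
    rw [eval, h0, e39, ArithOp.eval]; ring
  rw [qE, eval_ite_holds, eval_ite_holds, eval_ite_holds, eval_ite_holds, eval_ite_holds,
    eval_ite_holds, holds_lt, holds_lt, holds_lt, holds_eq, h.eval_twoE_Bs, h.eval_twoE_NG, e22, e23,
    e4, e35, e39, h0, hneg, Nat.cast_lt, Nat.cast_lt, Nat.cast_lt, Nat.cast_inj, Gadget.entry]
  by_cases h1 : c < St.J i.1
  · rw [if_pos h1, if_pos h1]
    by_cases h2 : s < St.NG i.1
    · rw [if_pos h2, if_pos h2]
      exact if_congr (h.holds_unsatLeft hs hc h1) rfl rfl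
    · rw [if_neg h2, if_neg h2]
      by_cases h3 : s < 2 * St.NG i.1
      · rw [if_pos h3, if_pos h3]
        refine if_congr (h.holds_unsatRight ?_ hc h1) rfl rfl
        rw [hs]; push_cast; omega
      · rw [if_neg h3, if_neg h3]
  · rw [if_neg h1, if_neg h1]
    by_cases h2 : s = 2 * St.NG i.1
    · rw [if_pos h2, if_pos ⟨by omega, h2⟩]
    · rw [if_neg h2, if_neg fun h => h2 h.2]

theorem cell_emod {z : ℤ} {R r : ℕ} (h : r < R) : (z * (R + 2) + r) % ((R : ℤ) + 2) = r := by
  rw [Int.add_comm, Int.add_mul_emod_self_right]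
  exact Int.emod_eq_of_lt (by omega) (by omega)

theorem cell_injective {z z' : ℤ} {R r : ℕ} (h : z * ((R : ℤ) + 2) + r = z' * (R + 2) + r) :
    z = z' := by
  have h1 : z * ((R : ℤ) + 2) = z' * (R + 2) := by linarith
  exact mul_right_cancel₀ (by positivity) h1

theorem qMat_eq_zero {uL uR : ℕ → ℕ → Prop} (s : Fin (St.N I)) (c : Fin (St.d (St.N I)))
    (h : 2 * St.NG I + 1 ≤ (s : ℕ) ∨ St.J I + 1 ≤ (c : ℕ)) : St.qMat I uL uR s c = 0 := by
  rw [qMat, Gadget.matQ, Gadget.entry]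
  by_cases h1 : (c : ℕ) < St.J I
  · rw [if_pos h1, if_neg (by omega), if_neg (by omega)]
  · rw [if_neg h1, if_neg (by omega)]

variable (St) in
/-- The query matrix is in place. -/
structure HasQ (i : Inst k × ℕ) (ρ : ℕ → ℤ) (μ : ℕ → ℤ → ℤ) : Prop extends Loc St i ρ μ where
  flag : Flag St i ρ
  fresh : Fresh (St.R i.1) (i.2 + 1) μ
  query : ∀ z : ℤ, μ 9 (z * (St.R i.1 + 2) + i.2) =
    rowMajor (St.qMat i.1 (St.UnsatLeft i.1 i.2) (St.UnsatRight i.1 i.2)) z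
  rest : ∀ a ≥ 10, ∀ z : ℤ, μ a (z * (St.R i.1 + 2) + i.2) = 0

variable (St) in
/-- The attention input is in place. -/
structure HasInput (i : Inst k × ℕ) (ρ : ℕ → ℤ) (μ : ℕ → ℤ → ℤ) : Prop extends Loc St i ρ μ where
  flag : Flag St i ρ
  fresh : Fresh (St.R i.1) (i.2 + 1) μ
  input : ∀ a, ∀ z : ℤ, μ (9 + a) (z * (St.R i.1 + 2 : ℕ) + (i.2 : ℕ)) =
    (attentionInput (St.qMat i.1 (St.UnsatLeft i.1 i.2) (St.UnsatRight i.1 i.2)) (St.vMat i.1)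
      (St.prec i.1)).mem a z

theorem Fresh.succ {R r : ℕ} (h : Fresh R r μ) : Fresh R (r + 1) μ :=
  fun a ha z h1 h2 => h a ha z (by push_cast at h1; omega) h2

theorem Fresh.update {R r a : ℕ} {ν : ℤ → ℤ} (h : Fresh R (r + 1) μ) 
    (hν : ∀ z : ℤ, z % (R + 2) ≠ r → ν z = μ a z) :
    Fresh R (r + 1) (Function.update μ a ν) := by
  intro a' ha' z h1 h2
  by_cases haa : a' = a
  · subst haa
    rw [Function.update_self, hν z (by push_cast at h1; omega)]
    exact h a' ha' z h1 h2
  · rw [Function.update_of_ne haa]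
    exact h a' ha' z h1 h2

end Setup

namespace Setup

open Sparsify Expr

variable {k : ℕ} {St : Setup k} {I : Inst k} {i : Inst k × ℕ} {ρ ρ' : ℕ → ℤ} {μ μ' : ℕ → ℤ → ℤ}

/-- Only the upper left corner with `2 * NG + 1` rows and `J + 1` columns is written. The remaining
entries are zero because the residue class of this iteration is still unused, so the cost does not
depend on `d (N)`. -/
def loadQ : Prog :=
  .fill₂ 22 38 23 37 9 (cellE (op .add (op .mul (var 22) (var 42)) (var 23))) qE

theorem phtLoadQ (St : Setup k) (hv : St.Valid) :
    PHt (fun i : Inst k × ℕ => instSize i.1) (fun i => St.NG i.1 + 1) loadQ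
      (fun i ρ μ => Sparse St i ρ μ) (fun i ρ μ => HasQ St i ρ μ) := by
  have hM := St.polyBdd_M.comp fun i : Inst k × ℕ => i.1
  have hB := St.polyBdd_B.comp fun i : Inst k × ℕ => i.1
  have hJ := (St.polyBdd_J.comp fun i : Inst k × ℕ => i.1).add (.const 1)
  refine PHt.weight (w := fun i => 2 * St.NG i.1 + 1 + 1) (f := fun _ => 2)
    (PHt.fill₂ (N₁ := fun i => 2 * St.NG i.1 + 1)
      (by norm_num) (by norm_num) (by norm_num) (by norm_num)
      (by norm_num) (by norm_num) (by norm_num) (by norm_num) (by norm_num) (by norm_num)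
      (by norm_num) hM hB (by simp [cellE, WF]) qE_wf hJ (fun _ => le_rfl) ?_) (.const 2)
      fun i => by omega
  rintro i ρ μ hsp
  obtain ⟨h, hflag, hfresh⟩ := hsp.core
  have hd : St.J i.1 + 1 ≤ St.d (St.N i.1) := hv.J_lt i.1
  refine ⟨h.small, h.two_NG_succ, h.J_succ,
    fun s c => ((s : ℤ) * St.d (St.N i.1) + c) * (St.R i.1 + 2) + i.2,
    fun s c => Gadget.entry (St.Bs i.1) (St.J i.1) (St.NG i.1)
      (St.UnsatLeft i.1 i.2) (St.UnsatRight i.1 i.2) s c,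
    fun s _ c _ ν => ?_, fun s hs c hc ν hsm => ?_, fun h => absurd h (by norm_num),
    fun s _ c hc s' _ c' hc' he => rowMajor_injective (hc.trans_le hd) (hc'.trans_le hd)
      (cell_injective he), ?_⟩
  · simp [cellE, eval, ArithOp.eval, h.d, h.modulus, h.residue]
  · have h' : Core St i (Function.update (Function.update ρ 22 (s : ℤ)) 23 (c : ℤ))
        (Function.update μ 9 ν) := h.frame (fun z hz => by
          rw [Function.update_of_ne (by omega), Function.update_of_ne (by omega)]) hsm
          fun a ha => by rw [Function.update_of_ne (by omega)]
    exact h'.eval_q (by simp) (by simp) hc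
  · intro ρ' ν hρ' hsm hν hν0
    -- All addresses written lie in the residue class of the iteration, so the memory of later
    -- iterations stays fresh.
    have hz : ∀ z : ℤ, z % (St.R i.1 + 2) ≠ i.2 → ν z = μ 9 z := fun z hz =>
      hν0 z fun s _ c _ he => hz (by rw [← he]; exact cell_emod h.lt)
    have hcell : ∀ a ≥ 9, ∀ z : ℤ, μ a (z * (St.R i.1 + 2) + i.2) = 0 := fun a ha z =>
      hfresh a ha _ (by rw [cell_emod h.lt]) (by rw [cell_emod h.lt]; exact_mod_cast h.lt)
    refine ⟨h.toLoc.frame (fun z hz => hρ' z (by omega) (by omega)) hsm fun a ha => by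
        rw [Function.update_of_ne (by omega)], ?_, hfresh.succ.update hz, fun z => ?_, fun a ha z => ?_⟩
    · rw [Flag, hρ' _ (by norm_num) (by norm_num)]; exact hflag
    · rw [Function.update_self]
      refine eq_rowMajor (N₁ := 2 * St.NG i.1 + 1) (N₂ := St.J i.1 + 1)
        (ν := fun z => ν (z * (St.R i.1 + 2) + i.2)) _ (hv.NG_lt i.1) hd
        (fun s hs c hc => hν s hs c hc) (fun z hz => ?_) (qMat_eq_zero (St := St)) z
      rw [hν0 _ fun s hs c hc he => hz s hs c hc (cell_injective he)]
      exact hcell 9 le_rfl z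
    · rw [Function.update_of_ne (by omega)]
      exact hcell a (by omega) z

/-- Column `0` of the value matrix is enough; all other columns stay zero, and their outputs are
never read. -/
def loadV : Prog :=
  .fill 22 38 10 (cellE (op .mul (var 22) (var 43)))
    (ind (conj (le (var 35) (var 22)) (lt (var 22) (twoE 35))))

theorem phtLoadV (St : Setup k) (hv : St.Valid) :
    PHt (fun i : Inst k × ℕ => instSize i.1) (fun i => St.NG i.1 + 1) loadV
      (fun i ρ μ => HasQ St i ρ μ) (fun i ρ μ => HasInput St i ρ μ) := by
  have hM := St.polyBdd_M.comp fun i : Inst k × ℕ => i.1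
  have hB := St.polyBdd_B.comp fun i : Inst k × ℕ => i.1
  refine PHt.weight (w := fun i => 2 * St.NG i.1 + 1 + 1) (f := fun _ => 2)
    (PHt.fill (N := fun i => 2 * St.NG i.1 + 1)
      (by norm_num) (by norm_num) (by norm_num) (by norm_num) hM hB (by simp [cellE, WF])
      (by simp [wf_ind, wf_conj, wf_le, wf_lt, WF, twoE]) (fun _ => le_rfl) ?_) (.const 2)
      fun i => by omega
  rintro i ρ μ h
  have hdv := hv.dv_pos (St.N i.1)
  refine ⟨h.small, h.two_NG_succ, fun s => ((s : ℤ) * St.dv (St.N i.1)) * (St.R i.1 + 2) + i.2,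
    fun s => if St.NG i.1 ≤ s ∧ s < 2 * St.NG i.1 then 1 else 0,
    fun s _ ν => ?_, fun s hs ν hsm => ?_, fun h => absurd h (by norm_num),
    fun s _ s' _ he => ?_, ?_⟩
  · simp [cellE, eval, ArithOp.eval, h.dv, h.modulus, h.residue]
  · have h' : Loc St i (Function.update ρ 22 (s : ℤ)) (Function.update μ 10 ν) :=
      h.toLoc.frame (fun z hz => by rw [Function.update_of_ne (by omega)]) hsm
          fun a ha => by rw [Function.update_of_ne (by omega)]
    classical
    rw [eval_ind]
    refine if_congr ?_ rfl rfl
    rw [holds_conj, holds_le, holds_lt, h'.eval_twoE_NG]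
    simp only [eval, h'.NG, Function.update_self, Nat.cast_le, Nat.cast_lt]
  · have := cell_injective he
    have h0 : (St.dv (St.N i.1) : ℤ) ≠ 0 := by omega
    exact_mod_cast mul_right_cancel₀ h0 this
  · intro ν hν hν0
    have hz : ∀ z : ℤ, z % (St.R i.1 + 2) ≠ i.2 → ν z = μ 10 z := fun z hz =>
      hν0 z fun s _ he => hz (by rw [← he]; exact cell_emod h.lt)
    have hsm : Small (Function.update ρ 22 ((2 * St.NG i.1 + 1 : ℕ) : ℤ)) (Function.update μ 10 ν)
        (St.M i.1) (St.B i.1) := by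
      have := h.small.update (x := 22) (by norm_num)
        (Base.bitLen_le (St := St) (38, fun I => 2 * St.NG I + 1) (by simp [consts]) le_rfl)
      refine ⟨this.reg, this.bound, fun a ha z => ?_, this.bits⟩
      rw [Function.update_of_ne (by omega)]
      exact this.mem a ha z
    refine ⟨h.toLoc.frame (fun z hz => by rw [Function.update_of_ne (by omega)]) hsm fun a ha => by
        rw [Function.update_of_ne (by omega)], ?_, h.fresh.update hz, fun a z => ?_⟩
    · rw [Flag, Function.update_of_ne (by norm_num)]; exact h.flag
    · push_cast
      rw [attentionInput]
      dsimp only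
      split_ifs with h0 h1
      · subst h0
        rw [Function.update_of_ne (by norm_num)]
        exact h.query z
      · subst h1
        rw [Function.update_self]
        refine eq_rowMajor (N₁ := 2 * St.NG i.1 + 1) (N₂ := 1)
          (ν := fun z => ν (z * (St.R i.1 + 2) + i.2)) _ (hv.NG_lt i.1) hdv
          (fun s hs c hc => ?_) (fun z hz => ?_) (fun s c hsc => ?_) z
        · obtain rfl : c = 0 := by omega
          have := hν s hs
          simp only [Nat.cast_zero, add_zero]
          rw [this, vMat, Gadget.matV]
          simp
        · rw [hν0 _ fun s hs he => hz s hs 0 (by norm_num) (by simpa using cell_injective he)]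
          exact h.rest 10 le_rfl z
        · rw [vMat, Gadget.matV, if_neg (by omega)]
      · rw [Function.update_of_ne (by omega)]
        exact h.rest (9 + a) (by omega) z


/-! ### The call -/

variable (St) in
/-- The program `P` decides, in time `τ` and with numbers of at most `bb` bits, which left rows of the
gadget have a right row without violations. -/
def Oracle (P : Prog) (τ bb : Inst k → ℕ) : Prop := ∀ I, ∀ uL uR : ℕ → ℕ → Prop,
  ∃ (t : ℕ) (s : RAMState), P.Exec (attentionInput (St.qMat I uL uR) (St.vMat I) (St.prec I)) t s ∧
    t ≤ τ I ∧ s.BitsLE (bb I) ∧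
    0 < s.mem 0 ((2 * St.NG I : ℕ) * St.dv (St.N I)) ∧
    ∀ α < St.NG I, 0 < s.mem 0 ((α : ℤ) * St.dv (St.N I)) ∧
      ((2 : ℝ) ^ ((bitLen (s.mem 0 ((2 * St.NG I : ℕ) * St.dv (St.N I))) : ℤ) +
          s.mem 1 ((2 * St.NG I : ℕ) * St.dv (St.N I))) ≤
        (s.mem 0 ((α : ℤ) * St.dv (St.N I)) : ℝ) * 2 ^ (s.mem 1 ((α : ℤ) * St.dv (St.N I))) ↔
        ∃ β < St.NG I, ∀ c < St.J I, ¬ (uL α c ∧ uR β c))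

variable (St) in
/-- Mantissas `a` and exponents `b` from which one can read off whether iteration `r` is successful. -/
structure Witness (i : Inst k × ℕ) (bb : Inst k → ℕ) (a b : ℕ → ℤ) : Prop where
  bits : ∀ j, bitLen (a j) ≤ bb i.1 ∧ bitLen (b j) ≤ bb i.1
  ref_pos : 0 < a (2 * St.NG i.1)
  pos : ∀ α < St.NG i.1, 0 < a α
  good : St.Good i.1 i.2 ↔ ∃ α < St.NG i.1,
    (2 : ℝ) ^ ((bitLen (a (2 * St.NG i.1)) : ℤ) + b (2 * St.NG i.1)) ≤ (a α : ℝ) * 2 ^ b α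

variable (St) in
/-- The output of the attention program is in place. -/
structure HasOutput (i : Inst k × ℕ) (a b : ℕ → ℤ) (ρ : ℕ → ℤ) (μ : ℕ → ℤ → ℤ) :
    Prop extends Loc St i ρ μ where
  fresh : Fresh (St.R i.1) (i.2 + 1) μ
  mantissa : ∀ j : ℕ, μ 9 ((j : ℤ) * St.dv (St.N i.1) * (St.R i.1 + 2) + i.2) = a j
  exponent : ∀ j : ℕ, μ 10 ((j : ℤ) * St.dv (St.N i.1) * (St.R i.1 + 2) + i.2) = b j

theorem phtCall (St : Setup k) {P : Prog} {τ bb : Inst k → ℕ} (hP : St.Oracle P τ bb) :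
    PHt (fun i : Inst k × ℕ => instSize i.1) (fun i => τ i.1 + 1) (.call 9 P [41, 42, 43, 40])
      (fun i ρ μ => HasInput St i ρ μ)
      (fun i ρ μ => ∃ a b, Witness St i bb a b ∧ HasOutput St i a b ρ μ ∧ Flag St i ρ) := by
  have hM := St.polyBdd_M.comp fun i : Inst k × ℕ => i.1
  refine .of_ht (f := fun i => P.callRegs [41, 42, 43, 40] * (St.M i.1 + 2) + 2 + (4 * St.M i.1 + 6))
    ((((hM.add (.const 2)).const_mul _).add (.const 2)).add ((hM.const_mul 4).add (.const 6)))
    fun i ρ μ h => ?_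
  obtain ⟨t, s, hex, ht, hbits, href, hα⟩ := hP i.1 (St.UnsatLeft i.1 i.2) (St.UnsatRight i.1 i.2)
  have hlt := h.lt
  refine (Ht.call (σ := 9) (c := St.M i.1) (t := t) (R := (St.R i.1 + 2 : ℕ)) (r := (i.2 : ℕ))
    (s' := s) (by simp) ?_ (by positivity) (by exact_mod_cast (by omega : i.2 < St.R i.1 + 2))
    h.modulus h.residue h.input ?_).mono ?_ ?_
  · intro x hx
    exact h.small.reg x (by simp at hx; omega)
  · simp only [List.map_cons, List.map_nil, h.N, h.d, h.dv, h.prec]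
    exact hex
  · have hb : bitLen ((St.R i.1 + 2 : ℕ) : ℤ) ≤ St.M i.1 :=
      Base.bitLen_le (62, fun I => St.R I + 2) (by simp [consts]) le_rfl
    have h1 : t * (4 * bitLen ((St.R i.1 + 2 : ℕ) : ℤ) + 6) ≤ (4 * St.M i.1 + 6) * τ i.1 := by
      rw [mul_comm]
      exact Nat.mul_le_mul (by omega) ht
    have h2 : t * (4 * bitLen ((St.R i.1 + 2 : ℕ) : ℤ) + 6) ≤
        (P.callRegs [41, 42, 43, 40] * (St.M i.1 + 2) + 2 + (4 * St.M i.1 + 6)) * τ i.1 :=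
      h1.trans (Nat.mul_le_mul_right _ (by omega))
    rw [mul_add_one]
    omega
  · rintro ρ' μ' ⟨hρ, hm, hframe⟩
    have hμ : ∀ a < 9, μ' a = μ a := fun a ha => funext fun z => hframe a z (Or.inl ha)
    refine ⟨fun j => s.mem 0 ((j : ℤ) * St.dv (St.N i.1)),
      fun j => s.mem 1 ((j : ℤ) * St.dv (St.N i.1)),
      ⟨fun j => ⟨hbits.2 _ _, hbits.2 _ _⟩, by simpa using href, fun α h => (hα α h).1, ?_⟩,
      ⟨h.toLoc.frame (fun z hz => hρ z (by omega)) ?_ fun a ha => hμ a (by omega), ?_, ?_, ?_⟩, ?_⟩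
    · rw [Good]
      refine exists_congr fun α => and_congr_right fun h => ?_
      rw [(hα α h).2]
      rfl
    · exact ⟨fun x hx => by rw [hρ x (by omega)]; exact h.small.reg x hx,
        fun x hx => by rw [hρ x (by omega)]; exact h.small.bound x hx,
        fun a ha z => by rw [hμ a (by omega)]; exact h.small.mem a ha z, h.small.bits⟩
    · intro a ha z h1 h2
      rw [hframe a z (Or.inr (by push_cast at h1 ⊢; omega))]
      exact h.fresh a ha z h1 h2
    · intro j
      have := hm 0 ((j : ℤ) * St.dv (St.N i.1))
      push_cast at this
      exact this
    · intro j
      have := hm 1 ((j : ℤ) * St.dv (St.N i.1))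
      push_cast at this
      exact this
    · rw [Flag, hρ _ (by norm_num)]; exact h.flag

end Setup

/-! ## Straight-line programs with big numbers -/

namespace Ht

variable {q : Prog} {ρ : ℕ → ℤ} {μ : ℕ → ℤ → ℤ} {T D : ℕ} {R : (ℕ → ℤ) → (ℕ → ℤ → ℤ) → Prop}

theorem seq_const {x : ℕ} {c : ℤ} (hD : 1 + bitLen c ≤ D) (h : Ht q (Function.update ρ x c) μ T R) :
    Ht (.seq (.const x c) q) ρ μ (D + T) R :=
  ((Ht.const x c (Q := fun ρ' μ' => ρ' = Function.update ρ x c ∧ μ' = μ) ⟨rfl, rfl⟩).le hD).seq <| by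
    rintro _ _ ⟨rfl, rfl⟩; exact h

theorem seq_arith {o : ArithOp} {x y z : ℕ} (hy : y < 80) (hz : z < 80)
    (hD : o.cost (ρ y) (ρ z) ≤ D) (h : Ht q (Function.update ρ x (o.eval (ρ y) (ρ z))) μ T R) :
    Ht (.seq (.arith o x y z) q) ρ μ (D + T) R :=
  ((Ht.arith o hy hz (Q := fun ρ' μ' => ρ' = Function.update ρ x (o.eval (ρ y) (ρ z)) ∧ μ' = μ)
    ⟨rfl, rfl⟩).le hD).seq <| by rintro _ _ ⟨rfl, rfl⟩; exact h

theorem seq_load {x a z : ℕ} (hz : z < 80) (hD : 1 + bitLen (ρ z) + bitLen (μ a (ρ z)) ≤ D)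
    (h : Ht q (Function.update ρ x (μ a (ρ z))) μ T R) : Ht (.seq (.load x a z) q) ρ μ (D + T) R :=
  ((Ht.load hz (Q := fun ρ' μ' => ρ' = Function.update ρ x (μ a (ρ z)) ∧ μ' = μ)
    ⟨rfl, rfl⟩).le hD).seq <| by rintro _ _ ⟨rfl, rfl⟩; exact h

theorem seq_store {x a z : ℕ} (hz : z < 80) (hx : x < 80) (hD : 1 + bitLen (ρ z) + bitLen (ρ x) ≤ D)
    (h : Ht q ρ (Function.update μ a (Function.update (μ a) (ρ z) (ρ x))) T R) :
    Ht (.seq (.store a z x) q) ρ μ (D + T) R :=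
  ((Ht.store hz hx (Q := fun ρ' μ' => ρ' = ρ ∧
    μ' = Function.update μ a (Function.update (μ a) (ρ z) (ρ x))) ⟨rfl, rfl⟩).le hD).seq <| by
      rintro _ _ ⟨rfl, rfl⟩; exact h

theorem seq_assign {M B x : ℕ} {e : Expr} (hs : Expr.Small ρ μ M B) (he : e.WF)
    (h : Ht q (Function.update ρ x (e.eval ρ μ)) μ T R) :
    Ht (.seq (.assign x e) q) ρ μ (e.cost M B + T) R :=
  (Ht.assign x hs he (Q := fun ρ' μ' => ρ' = Function.update ρ x (e.eval ρ μ) ∧ μ' = μ)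
    ⟨rfl, rfl⟩).seq <| by rintro _ _ ⟨rfl, rfl⟩; exact h

theorem const' {x : ℕ} {c : ℤ} (hD : 1 + bitLen c ≤ D) (h : R (Function.update ρ x c) μ) :
    Ht (.const x c) ρ μ D R := (Ht.const x c h).le hD

theorem arith' {o : ArithOp} {x y z : ℕ} (hy : y < 80) (hz : z < 80)
    (hD : o.cost (ρ y) (ρ z) ≤ D) (h : R (Function.update ρ x (o.eval (ρ y) (ρ z))) μ) :
    Ht (.arith o x y z) ρ μ D R := (Ht.arith o hy hz h).le hD

theorem ifPos' {p : Prog} {x : ℕ} (hx : x < 80) (hD : 1 + bitLen (ρ x) ≤ D)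
    (hp : 0 < ρ x → Ht p ρ μ T R) (hq : ¬ 0 < ρ x → Ht q ρ μ T R) :
    Ht (.ifPos x p q) ρ μ (D + T) R := (Ht.ifPos hx hp hq).le (by omega)

end Ht

theorem two_pow_le_iff_lt_bitLen {a : ℤ} (ha : 0 ≤ a) (e : ℕ) : 2 ^ e ≤ a ↔ e < bitLen a := by
  rw [bitLen, Nat.lt_size]
  zify
  rw [abs_of_nonneg ha]

theorem two_zpow_le_iff_lt_bitLen {a b c : ℤ} (ha : 0 < a) :
    (2 : ℝ) ^ c ≤ (a : ℝ) * 2 ^ b ↔ c - b < bitLen a := by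
  obtain ⟨h1, h2⟩ := Gadget.two_zpow_size_bounds (b := b) ha
  constructor
  · intro h
    have := (zpow_lt_zpow_iff_right₀ (by norm_num : (1 : ℝ) < 2)).1 (h.trans_lt h1)
    omega
  · intro h
    have h3 : (2 : ℝ) ^ (c + 1) ≤ 2 ^ ((bitLen a : ℤ) + b) :=
      (zpow_le_zpow_iff_right₀ (by norm_num : (1 : ℝ) < 2)).2 (by omega)
    rw [zpow_add_one₀ (by norm_num)] at h3
    linarith

theorem bitLen_natCast_le (n : ℕ) : bitLen (n : ℤ) ≤ n := by simpa using bitLen_le_natAbs (n : ℤ)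

/-- Mantissas and exponents of the output are known only existentially. Making them part of the
index keeps the polynomial factor uniform in them. -/
theorem PHt.exists {ι κ : Type} {z w : ι → ℕ} {p : Prog}
    {P : ι → κ → (ℕ → ℤ) → (ℕ → ℤ → ℤ) → Prop} {Q : ι → (ℕ → ℤ) → (ℕ → ℤ → ℤ) → Prop}
    (h : PHt (fun j : ι × κ => z j.1) (fun j => w j.1) p (fun j => P j.1 j.2) fun j => Q j.1) :
    PHt z w p (fun i ρ μ => ∃ y, P i y ρ μ) Q := by
  obtain ⟨c, hc⟩ := h
  exact ⟨c, fun i ρ μ ⟨y, hy⟩ => hc (i, y) ρ μ hy⟩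

/-! ## Reading off the result of an iteration -/

namespace Setup

open Expr

variable {k : ℕ} {St : Setup k} {I : Inst k} {i : Inst k × ℕ} {ρ ρ' : ℕ → ℤ} {μ μ' : ℕ → ℤ → ℤ}
  {bb : Inst k → ℕ} {a b : ℕ → ℤ}

theorem HasOutput.frame (h : HasOutput St i a b ρ μ)
    (hρ : ∀ z < 64, z ≠ 22 → z ≠ 61 → ρ' z = ρ z) (h22 : bitLen (ρ' 22) ≤ St.M i.1)
    (h61 : bitLen (ρ' 61) ≤ St.M i.1) (hμ : ∀ c ≠ 8, μ' c = μ c) : HasOutput St i a b ρ' μ' where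
  toLoc := h.toLoc.frame (fun z hz => hρ z (by omega) (by omega) (by omega))
    ⟨fun z hz => by
      by_cases hz22 : z = 22
      · subst hz22; exact h22
      by_cases hz61 : z = 61
      · subst hz61; exact h61
      rw [hρ z hz hz22 hz61]; exact h.small.reg z hz,
    fun z hz => by rw [hρ z (by omega) (by omega) (by omega)]; exact h.small.bound z hz,
    fun c hc z => by rw [hμ c (by omega)]; exact h.small.mem c hc z, h.small.bits⟩
    fun c hc => hμ c (by omega)
  fresh c hc z h1 h2 := by rw [hμ c (by omega)]; exact h.fresh c hc z h1 h2
  mantissa j := by rw [hμ 9 (by norm_num)]; exact h.mantissa j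
  exponent j := by rw [hμ 10 (by norm_num)]; exact h.exponent j

theorem HasOutput.bitLen_reg (h : HasOutput St i a b ρ μ) {z : ℕ} (hz : z < 64) :
    bitLen (ρ z) ≤ St.M i.1 := h.small.reg z hz

/-- The address of the output in row `e` and column `0`. -/
def outE (e : Expr) : Expr := cellE (op .mul e (var 43))

theorem HasOutput.eval_outE (h : HasOutput St i a b ρ μ) {e : Expr} {j : ℕ} (he : e.eval ρ μ = j) :
    (outE e).eval ρ μ = (j : ℤ) * St.dv (St.N i.1) * (St.R i.1 + 2) + i.2 := by
  simp [outE, cellE, eval, ArithOp.eval, he, h.dv, h.modulus, h.residue]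

theorem HasOutput.load_mantissa (h : HasOutput St i a b ρ μ) {e : Expr} {j : ℕ}
    (he : e.eval ρ μ = j) : μ 9 ((outE e).eval ρ μ) = a j := by rw [h.eval_outE he, h.mantissa]

theorem HasOutput.load_exponent (h : HasOutput St i a b ρ μ) {e : Expr} {j : ℕ}
    (he : e.eval ρ μ = j) : μ 10 ((outE e).eval ρ μ) = b j := by rw [h.eval_outE he, h.exponent]

theorem HasOutput.bitLen_outE (h : HasOutput St i a b ρ μ) {e : Expr} {j : ℕ}
    (he : e.eval ρ μ = j) (hj : bitLen (j : ℤ) ≤ St.M i.1) :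
    bitLen ((outE e).eval ρ μ) ≤ 3 * St.M i.1 + 1 := by
  rw [h.eval_outE he]
  have h1 := bitLen_address_le (i := (j : ℤ) * St.dv (St.N i.1)) (R := (St.R i.1 + 2 : ℕ))
    (r := i.2) (by positivity) (by have := h.lt; push_cast; omega)
  have h2 := bitLen_mul_le (j : ℤ) (St.dv (St.N i.1))
  have h3 : bitLen (St.dv (St.N i.1) : ℤ) ≤ St.M i.1 :=
    Base.bitLen_le (43, fun I => St.dv (St.N I)) (by simp [consts]) le_rfl
  have h4 : bitLen ((St.R i.1 + 2 : ℕ) : ℤ) ≤ St.M i.1 :=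
    Base.bitLen_le (62, fun I => St.R I + 2) (by simp [consts]) le_rfl
  push_cast at h1 h4
  omega

theorem outE_wf {e : Expr} : (outE e).WF ↔ e.WF := by simp [outE, cellE, WF]

theorem bitLen_NG_le {j : ℕ} (hj : j ≤ 2 * St.NG I) : bitLen (j : ℤ) ≤ St.M I :=
  Base.bitLen_le (38, fun I => 2 * St.NG I + 1) (by simp [consts]) (by dsimp only; omega)

variable (St) in
/-- The reference output and the number `1` are in registers. -/
structure Ref (i : Inst k × ℕ) (a b : ℕ → ℤ) (ρ : ℕ → ℤ) (μ : ℕ → ℤ → ℤ) :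
    Prop extends HasOutput St i a b ρ μ where
  flag : Flag St i ρ
  mant : ρ 65 = a (2 * St.NG i.1)
  expo : ρ 66 = b (2 * St.NG i.1)
  one : ρ 72 = 1

theorem Ref.frame (h : Ref St i a b ρ μ)
    (hρ : ∀ z < 64, z ≠ 22 → ρ' z = ρ z) (h22 : bitLen (ρ' 22) ≤ St.M i.1)
    (hbig : ∀ z, z = 65 ∨ z = 66 ∨ z = 72 → ρ' z = ρ z) : Ref St i a b ρ' μ where
  toHasOutput := h.toHasOutput.frame (fun z hz h1 _ => hρ z hz h1) h22
    (by rw [hρ 61 (by norm_num) (by norm_num)]; exact h.bitLen_reg (by norm_num)) fun _ _ => rfl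
  flag := by rw [Flag, hρ 61 (by norm_num) (by norm_num)]; exact h.flag
  mant := by rw [hbig 65 (by norm_num), h.mant]
  expo := by rw [hbig 66 (by norm_num), h.expo]
  one := by rw [hbig 72 (by norm_num), h.one]

/-- Inputs of the comparison: an iteration and the outputs. -/
abbrev Cmp (k : ℕ) := (Inst k × ℕ) × (ℕ → ℤ) × (ℕ → ℤ)

theorem le_mul_succ {u v w t : ℕ} (h : t ≤ u + v * w) : t ≤ (u + v) * (w + 1) :=
  h.trans (by nlinarith [Nat.zero_le (u * w)])

/-- Outputs may be far longer than the bound `M` for the values of expressions. They are kept in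
registers from 64 on, which expressions cannot access, and are processed by single instructions. -/
def refProg : Prog :=
  .seq (.assign 64 (outE (twoE 35))) <| .seq (.load 65 9 64) <| .seq (.load 66 10 64) <|
  .seq (.const 72 1) <| .seq (.const 67 0) (.arith .add 67 65 67)

theorem phtRef (St : Setup k) (bb : Inst k → ℕ) :
    PHt (fun i : Cmp k => instSize i.1.1) (fun i => bb i.1.1 + 1) refProg
      (fun i ρ μ => Witness St i.1 bb i.2.1 i.2.2 ∧ HasOutput St i.1 i.2.1 i.2.2 ρ μ ∧ Flag St i.1 ρ)
      (fun i ρ μ => Witness St i.1 bb i.2.1 i.2.2 ∧ Ref St i.1 i.2.1 i.2.2 ρ μ ∧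
        ρ 67 = i.2.1 (2 * St.NG i.1.1)) := by
  have hM := St.polyBdd_M.comp fun i : Cmp k => i.1.1
  have hB := St.polyBdd_B.comp fun i : Cmp k => i.1.1
  refine .of_ht (f := fun i => (outE (twoE 35)).cost (St.M i.1.1) (St.B i.1.1) +
    5 * (3 * St.M i.1.1 + 5) + 5) ((((outE (twoE 35)).cost_polyBdd hM hB).add
      (((hM.const_mul 3).add (.const 5)).const_mul 5)).add (.const 5)) ?_
  rintro i ρ μ ⟨hw, h, hf⟩
  have he := h.eval_twoE_NG
  have ha := (hw.bits (2 * St.NG i.1.1)).1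
  have hb := (hw.bits (2 * St.NG i.1.1)).2
  have hout := h.bitLen_outE he (bitLen_NG_le le_rfl)
  have hm := h.load_mantissa he
  have hx := h.load_exponent he
  refine Ht.le (Ht.seq_assign h.small (by simp [outE_wf, twoE, WF]) <|
    Ht.seq_load (D := 3 * St.M i.1.1 + 2 + bb i.1.1) (by norm_num) ?_ <|
    Ht.seq_load (D := 3 * St.M i.1.1 + 2 + bb i.1.1) (by norm_num) ?_ <|
    Ht.seq_const (D := 2) (by simp) <| Ht.seq_const (D := 1) (by simp) <|
    Ht.arith' (D := 1 + bb i.1.1) (by norm_num) (by norm_num) ?_ ?_)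
    (le_mul_succ (v := 5) (u := _) ?_)
  · simp [hm]
    omega
  · simp [hx]
    omega
  · simp [ArithOp.cost, hm]
    omega
  · refine ⟨hw, ⟨h.frame (fun z hz _ _ => ?_) ?_ ?_ fun _ _ => rfl, ?_, ?_, ?_, ?_⟩, ?_⟩
    · simp [show z ≠ 64 by omega, show z ≠ 65 by omega, show z ≠ 66 by omega, show z ≠ 67 by omega,
        show z ≠ 72 by omega]
    · simpa using h.bitLen_reg (by norm_num)
    · simpa using h.bitLen_reg (by norm_num)
    · simpa [Flag] using hf
    · simp [hm]
    · simp [hx]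
    · simp
    · simp [ArithOp.eval, hm]
  · omega

/-- The maximal mantissa determines how many powers of two are needed, so that one table serves all
rows. The maximum is updated by adding a positive difference. -/
def maxProg : Prog :=
  .seq (.assign 64 (outE (var 22))) <| .seq (.load 68 9 64) <| .seq (.arith .sub 73 68 67) <|
  .ifPos 73 (.arith .add 67 67 73) (.const 73 0)

variable (St) in
/-- Register `67` holds the maximum of the reference output and the first `j` outputs. -/
structure MaxInv (i : Inst k × ℕ) (a b : ℕ → ℤ) (bb : Inst k → ℕ) (j : ℕ) (ρ : ℕ → ℤ)
    (μ : ℕ → ℤ → ℤ) : Prop extends Ref St i a b ρ μ where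
  wit : Witness St i bb a b
  idx : ρ 22 = j
  bits : bitLen (ρ 67) ≤ bb i.1
  ref_le : a (2 * St.NG i.1) ≤ ρ 67
  le_max : ∀ α < j, a α ≤ ρ 67

theorem phtMaxBody (St : Setup k) (bb : Inst k → ℕ) :
    PHt (fun i : Cmp k × ℕ => instSize i.1.1.1) (fun i => bb i.1.1.1 + 1) maxProg
      (fun i ρ μ => i.2 < St.NG i.1.1.1 ∧ MaxInv St i.1.1 i.1.2.1 i.1.2.2 bb i.2 ρ μ)
      (fun i ρ μ => ρ 22 = i.2 ∧ ρ 35 = St.NG i.1.1.1 ∧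
        MaxInv St i.1.1 i.1.2.1 i.1.2.2 bb (i.2 + 1) (Function.update ρ 22 ((i.2 + 1 : ℕ) : ℤ)) μ) := by
  have hM := St.polyBdd_M.comp fun i : Cmp k × ℕ => i.1.1.1
  have hB := St.polyBdd_B.comp fun i : Cmp k × ℕ => i.1.1.1
  refine .of_ht (f := fun i => (outE (var 22)).cost (St.M i.1.1.1) (St.B i.1.1.1) +
    5 * (3 * St.M i.1.1.1 + 5) + 10) ((((outE (var 22)).cost_polyBdd hM hB).add
      (((hM.const_mul 3).add (.const 5)).const_mul 5)).add (.const 10)) ?_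
  rintro ⟨⟨i, a, b⟩, j⟩ ρ μ ⟨hj, h⟩
  dsimp only at hj h ⊢
  have he : (var 22).eval ρ μ = j := h.idx
  have ha := (h.wit.bits j).1
  have hout := h.bitLen_outE he (bitLen_NG_le (by omega))
  have hm := h.load_mantissa he
  have hX := h.bits
  have hd := bitLen_sub_le (a j) (ρ 67)
  have key : ∀ (ρ' : ℕ → ℤ), (∀ z < 64, ρ' z = ρ z) →
      (∀ z, z = 65 ∨ z = 66 ∨ z = 72 → ρ' z = ρ z) → a j ≤ ρ' 67 → ρ 67 ≤ ρ' 67 →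
      bitLen (ρ' 67) ≤ bb i.1 → ρ' 22 = j ∧ ρ' 35 = St.NG i.1 ∧
        MaxInv St i a b bb (j + 1) (Function.update ρ' 22 ((j + 1 : ℕ) : ℤ)) μ := by
    intro ρ' h1 h2 h4 h5 h6
    refine ⟨by rw [h1 22 (by norm_num), h.idx], by rw [h1 35 (by norm_num), h.NG],
      ⟨h.toRef.frame (fun z hz hz' => ?_) ?_ fun z hz => ?_, h.wit, by simp, ?_, ?_, ?_⟩⟩
    · rw [Function.update_of_ne hz', h1 z hz]
    · rw [Function.update_self]; exact bitLen_NG_le (by omega)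
    · rw [Function.update_of_ne (by omega), h2 z hz]
    · simpa using h6
    · simpa using h.ref_le.trans h5
    · intro α hα
      rw [Function.update_of_ne (by norm_num)]
      rcases Nat.lt_succ_iff_lt_or_eq.1 hα with h7 | rfl
      exacts [(h.le_max α h7).trans h5, h4]
  refine Ht.le (Ht.seq_assign h.small (by simp [outE_wf, WF]) <|
    Ht.seq_load (D := 3 * St.M i.1 + 2 + bb i.1) (by norm_num) ?_ <|
    Ht.seq_arith (D := 1 + 2 * bb i.1) (by norm_num) (by norm_num) ?_ <|
    Ht.ifPos' (D := 2 + bb i.1) (T := 2 + 2 * bb i.1) (by norm_num) ?_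
      (fun hpos => Ht.arith' (by norm_num) (by norm_num) ?_ (key _ (fun z hz => ?_) (fun z hz => ?_)
        ?_ ?_ ?_))
      fun hpos => Ht.const' (by simp; omega) (key _ (fun z hz => ?_) (fun z hz => ?_) ?_ ?_ ?_))
    (le_mul_succ (v := 6) (u := _) ?_)
  · simp [hm]; omega
  · simp [ArithOp.cost, hm]; omega
  · simp [ArithOp.eval, hm]; omega
  · simp [ArithOp.cost, ArithOp.eval, hm]; omega
  · simp [show z ≠ 64 by omega, show z ≠ 67 by omega, show z ≠ 68 by omega, show z ≠ 73 by omega]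
  · rcases hz with rfl | rfl | rfl <;> simp
  · simp [ArithOp.eval, hm]
  · simp [ArithOp.eval, hm] at hpos ⊢; omega
  · simpa [ArithOp.eval, hm] using ha
  · simp [show z ≠ 64 by omega, show z ≠ 68 by omega, show z ≠ 73 by omega]
  · rcases hz with rfl | rfl | rfl <;> simp
  · simp [ArithOp.eval, hm] at hpos ⊢; omega
  · simp
  · simpa using hX
  · omega

theorem phtMax (St : Setup k) (bb : Inst k → ℕ) :
    PHt (fun i : Cmp k => instSize i.1.1) (fun i => (St.NG i.1.1 + 1) * (bb i.1.1 + 1))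
      (.forLoop 22 35 maxProg)
      (fun i ρ μ => Witness St i.1 bb i.2.1 i.2.2 ∧ Ref St i.1 i.2.1 i.2.2 ρ μ ∧
        ρ 67 = i.2.1 (2 * St.NG i.1.1))
      (fun i ρ μ => MaxInv St i.1 i.2.1 i.2.2 bb (St.NG i.1.1) ρ μ) := by
  refine PHt.forLoop (x := 22) (b := 35) (w := fun i : Cmp k => bb i.1.1 + 1)
    (N := fun i => St.NG i.1.1) (by norm_num) (by norm_num) (by norm_num)
    (fun i j ρ μ => MaxInv St i.1 i.2.1 i.2.2 bb j ρ μ)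
    (St.polyBdd_M.comp fun i : Cmp k => i.1.1) (phtMaxBody St bb) (fun i => Nat.le_add_left 1 _) ?_
  rintro i ρ μ ⟨hw, h, h67⟩
  refine ⟨bitLen_NG_le (by omega), h.NG, ⟨h.frame (fun z hz hz' => ?_) (by simp) fun z hz => ?_,
    hw, by simp, ?_, ?_, by simp⟩⟩
  · rw [Function.update_of_ne hz']
  · rw [Function.update_of_ne (by omega)]
  · simpa [h67] using (hw.bits _).1
  · simp [h67]

/-! ### Powers of two and the bit length of the reference output -/

/-- Powers are produced by doubling until they exceed the maximal mantissa. On the way, every power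
that is at most the reference mantissa increments register 66, which finally exceeds the reference
exponent by the bit length of the mantissa. There are at most `bb` rounds with numbers of `O(bb)`
bits, hence a quadratic cost in `bb`. -/
def tabBody : Prog :=
  .seq (.store 8 70 69) <| .seq (.arith .sub 74 65 69) <| .seq (.arith .add 74 74 72) <|
  .seq (.arith .add 69 69 69) <| .seq (.arith .add 70 70 72) <| .seq (.arith .sub 71 67 69) <|
  .seq (.arith .add 71 71 72) <| .ifPos 74 (.arith .add 66 66 72) (.const 74 0)

def tabProg : Prog :=
  .seq (.const 69 1) <| .seq (.const 70 0) <| .seq (.arith .add 71 67 70) (.whilePos 71 tabBody)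

variable (St) in
/-- The table of powers of two holds `2 ^ e` for `e < j`, and register `66` holds the exponent of the
reference output plus the number of them that are at most the mantissa. -/
structure TabInv (i : Inst k × ℕ) (a b : ℕ → ℤ) (bb : Inst k → ℕ) (X : ℤ) (j : ℕ) (ρ : ℕ → ℤ)
    (μ : ℕ → ℤ → ℤ) : Prop extends HasOutput St i a b ρ μ where
  flag : Flag St i ρ
  wit : Witness St i bb a b
  one : ρ 72 = 1
  mant : ρ 65 = a (2 * St.NG i.1)
  max : ρ 67 = X
  pow : ρ 69 = 2 ^ j
  idx : ρ 70 = j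
  test : 0 < ρ 71 ↔ j < bitLen X
  test_bits : bitLen (ρ 71) ≤ bb i.1 + 3
  table : ∀ e < j, μ 8 (e : ℤ) = 2 ^ e
  threshold : ρ 66 = b (2 * St.NG i.1) + (min j (bitLen (a (2 * St.NG i.1))) : ℕ)
  bits : bitLen X ≤ bb i.1
  ref_le : a (2 * St.NG i.1) ≤ X
  le_max : ∀ α < St.NG i.1, a α ≤ X

theorem TabInv.body {X : ℤ} {j : ℕ} (h : TabInv St i a b bb X j ρ μ) (hj : j < bitLen X) :
    Ht tabBody ρ μ (25 * (bb i.1 + 5)) (TabInv St i a b bb X (j + 1)) := by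
  have ha := (h.wit.bits (2 * St.NG i.1)).1
  have hb := (h.wit.bits (2 * St.NG i.1)).2
  have hbits := h.bits
  have h1 := bitLen_natCast_le j
  have h2 := bitLen_two_pow j
  have h2' := bitLen_two_pow (j + 1)
  have h3 := bitLen_sub_le (a (2 * St.NG i.1)) (2 ^ j)
  have h4 := bitLen_add_le (a (2 * St.NG i.1) - 2 ^ j) 1
  have h5 := bitLen_sub_le X (2 ^ (j + 1))
  have h6 := bitLen_add_le (X - 2 ^ (j + 1)) 1
  have h7 := bitLen_natCast_le (min j (bitLen (a (2 * St.NG i.1))))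
  have h8 := bitLen_add_le (b (2 * St.NG i.1)) (min j (bitLen (a (2 * St.NG i.1))) : ℕ)
  have hthr : bitLen (ρ 66) ≤ bb i.1 + 1 := by rw [h.threshold]; omega
  have hone : bitLen 1 = 1 := bitLen_one
  have hpow : (2 : ℤ) ^ j + 2 ^ j = 2 ^ (j + 1) := by ring
  have hX0 : 0 ≤ X := h.wit.ref_pos.le.trans h.ref_le
  have key : ∀ (ρ' : ℕ → ℤ), (∀ z < 64, ρ' z = ρ z) →
      (∀ z, z = 65 ∨ z = 67 ∨ z = 72 → ρ' z = ρ z) → ρ' 69 = 2 ^ (j + 1) → ρ' 70 = j + 1 →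
      ρ' 71 = X - 2 ^ (j + 1) + 1 →
      ρ' 66 = ρ 66 + (if 2 ^ j ≤ a (2 * St.NG i.1) then 1 else 0) →
      TabInv St i a b bb X (j + 1) ρ'
        (Function.update μ 8 (Function.update (μ 8) (ρ 70) (ρ 69))) := by
    intro ρ' h1 h2 h3 h4 h5 h6'
    refine ⟨h.frame (fun z hz _ _ => h1 z hz) ?_ ?_ fun c hc => ?_, ?_, h.wit, ?_, ?_, ?_, h3, ?_,
      ?_, ?_, fun e he => ?_, ?_, hbits, h.ref_le, h.le_max⟩
    · rw [h1 _ (by norm_num)]; exact h.bitLen_reg (by norm_num)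
    · rw [h1 _ (by norm_num)]; exact h.bitLen_reg (by norm_num)
    · rw [Function.update_of_ne hc]
    · rw [Flag, h1 _ (by norm_num)]; exact h.flag
    · rw [h2 _ (by norm_num), h.one]
    · rw [h2 _ (by norm_num), h.mant]
    · rw [h2 _ (by norm_num), h.max]
    · rw [h4]; push_cast; rfl
    · rw [h5, ← two_pow_le_iff_lt_bitLen hX0]; omega
    · rw [h5]; omega
    · rw [Function.update_self, h.idx, h.pow]
      by_cases hej : e = j
      · subst hej; rw [Function.update_self]
      · rw [Function.update_of_ne (by exact_mod_cast hej)]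
        exact h.table e (by omega)
    · rw [h6', h.threshold]
      by_cases hc : 2 ^ j ≤ a (2 * St.NG i.1)
      · rw [if_pos hc]
        rw [two_pow_le_iff_lt_bitLen h.wit.ref_pos.le] at hc
        push_cast
        omega
      · rw [if_neg hc]
        rw [two_pow_le_iff_lt_bitLen h.wit.ref_pos.le] at hc
        push_cast
        omega
  have hmant := h.mant
  have hpw := h.pow
  have hidx := h.idx
  have hmx := h.max
  have ho := h.one
  refine Ht.le (Ht.seq_store (D := 2 * bb i.1 + 3) (by norm_num) (by norm_num) ?_ <|
    Ht.seq_arith (D := 2 * bb i.1 + 3) (by norm_num) (by norm_num) ?_ <|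
    Ht.seq_arith (D := 2 * bb i.1 + 3) (by norm_num) (by norm_num) ?_ <|
    Ht.seq_arith (D := 2 * bb i.1 + 3) (by norm_num) (by norm_num) ?_ <|
    Ht.seq_arith (D := 2 * bb i.1 + 3) (by norm_num) (by norm_num) ?_ <|
    Ht.seq_arith (D := 2 * bb i.1 + 5) (by norm_num) (by norm_num) ?_ <|
    Ht.seq_arith (D := 2 * bb i.1 + 5) (by norm_num) (by norm_num) ?_ <|
    Ht.ifPos' (D := bb i.1 + 5) (T := 2 * bb i.1 + 5) (by norm_num) ?_
      (fun hpos => Ht.arith' (by norm_num) (by norm_num) ?_ (key _ (fun z hz => ?_) (fun z hz => ?_)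
        ?_ ?_ ?_ ?_))
      fun hpos => Ht.const' (by simp) (key _ (fun z hz => ?_) (fun z hz => ?_) ?_ ?_ ?_ ?_)) ?_
  · simp [hpw, hidx]; omega
  · simp [ArithOp.cost, hmant, hpw]; omega
  · simp [ArithOp.cost, ArithOp.eval, hmant, hpw, ho]; omega
  · simp [ArithOp.cost, hpw]; omega
  · simp [ArithOp.cost, hidx, ho]; omega
  · simp [ArithOp.cost, ArithOp.eval, hmx, hpw, hpow]; omega
  · simp [ArithOp.cost, ArithOp.eval, hmx, hpw, hpow, ho]; omega
  · simp [ArithOp.eval, hmant, hpw, ho]; omega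
  · simp [ArithOp.cost, ho]; omega
  · simp [show z ≠ 66 by omega, show z ≠ 69 by omega, show z ≠ 70 by omega, show z ≠ 71 by omega,
      show z ≠ 74 by omega]
  · rcases hz with rfl | rfl | rfl <;> simp
  · simp [ArithOp.eval, hpw, hpow]
  · simp [ArithOp.eval, hidx, ho]
  · simp [ArithOp.eval, hmx, hpw, hpow, ho]
  · simp [ArithOp.eval, hmant, hpw, ho] at hpos ⊢; omega
  · simp [show z ≠ 69 by omega, show z ≠ 70 by omega, show z ≠ 71 by omega,
      show z ≠ 74 by omega]
  · rcases hz with rfl | rfl | rfl <;> simp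
  · simp [ArithOp.eval, hpw, hpow]
  · simp [ArithOp.eval, hidx, ho]
  · simp [ArithOp.eval, hmx, hpw, hpow, ho]
  · simp [ArithOp.eval, hmant, hpw, ho] at hpos ⊢; omega
  · omega

variable (St) in
/-- The table and the threshold are in place. -/
structure HasTab (i : Inst k × ℕ) (a b : ℕ → ℤ) (bb : Inst k → ℕ) (N : ℕ) (ρ : ℕ → ℤ)
    (μ : ℕ → ℤ → ℤ) : Prop extends HasOutput St i a b ρ μ where
  wit : Witness St i bb a b
  one : ρ 72 = 1
  idx : ρ 70 = N
  table : ∀ e < N, μ 8 (e : ℤ) = 2 ^ e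
  threshold : ρ 66 = b (2 * St.NG i.1) + (bitLen (a (2 * St.NG i.1)) : ℕ)
  bits : N ≤ bb i.1
  le_size : ∀ α < St.NG i.1, bitLen (a α) ≤ N

theorem phtTab (St : Setup k) (bb : Inst k → ℕ) :
    PHt (fun i : Cmp k => instSize i.1.1) (fun i => (bb i.1.1 + 1) ^ 2) tabProg
      (fun i ρ μ => MaxInv St i.1 i.2.1 i.2.2 bb (St.NG i.1.1) ρ μ)
      (fun i ρ μ => ∃ N, HasTab St i.1 i.2.1 i.2.2 bb N ρ μ ∧ Flag St i.1 ρ) := by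
  refine .of_ht (f := fun _ => 200) (.const _) ?_
  rintro ⟨i, a, b⟩ ρ μ h
  dsimp only at h ⊢
  have hX0 : 0 ≤ ρ 67 := h.wit.ref_pos.le.trans h.ref_le
  have hbits := h.bits
  have hone : bitLen 1 = 1 := bitLen_one
  refine Ht.le (Ht.seq_const (D := 2) (by simp) <| Ht.seq_const (D := 1) (by simp) <|
    Ht.seq_arith (D := 1 + bb i.1) (by norm_num) (by norm_num) (by simp [ArithOp.cost]; omega) <|
    (Ht.whilePos (N := bitLen (ρ 67)) (c := bb i.1 + 3) (T := 25 * (bb i.1 + 5)) (by norm_num)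
      (fun j => TabInv St i a b bb (ρ 67) j) (fun j hj ρ' μ' h' => ⟨h'.test.2 hj, h'.test_bits⟩)
      (fun j hj ρ' μ' h' => h'.body hj)
      (fun ρ' μ' h' => ⟨fun hpos => lt_irrefl _ (h'.test.1 hpos), h'.test_bits⟩) ?_).mono le_rfl
      fun ρ' μ' h' => ⟨bitLen (ρ 67), ⟨h'.toHasOutput, h'.wit, h'.one, h'.idx, h'.table, ?_, hbits,
        fun α hα => ?_⟩, h'.flag⟩) ?_
  · refine ⟨h.toHasOutput.frame (fun z hz _ _ => ?_) ?_ ?_ fun _ _ => rfl, ?_, h.wit, ?_, ?_, ?_, ?_, ?_, ?_, ?_,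
      by simp, ?_, hbits, h.ref_le, h.le_max⟩
    · simp [show z ≠ 69 by omega, show z ≠ 70 by omega, show z ≠ 71 by omega]
    · simpa using h.bitLen_reg (by norm_num)
    · simpa using h.bitLen_reg (by norm_num)
    · simpa [Flag] using h.flag
    · simp [h.one]
    · simp [h.mant]
    · simp
    · simp
    · simp
    · have := two_pow_le_iff_lt_bitLen hX0 0
      simp [ArithOp.eval]
      omega
    · simp [ArithOp.eval]; omega
    · simp [h.expo]
  · rw [h'.threshold, min_eq_right]
    exact bitLen_mono (by have := h.wit.ref_pos; have := h.ref_le; omega)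
  · exact bitLen_mono (by have := h.wit.pos α hα; have := h.le_max α hα; omega)
  · have : bitLen (ρ 67) * (25 * (bb i.1 + 5) + (bb i.1 + 3) + 1) ≤
        bb i.1 * (25 * (bb i.1 + 5) + (bb i.1 + 3) + 1) := Nat.mul_le_mul_right _ hbits
    nlinarith

end Setup

namespace Setup

open Expr

variable {k : ℕ} {St : Setup k} {I : Inst k} {i : Inst k × ℕ} {ρ ρ' : ℕ → ℤ} {μ μ' : ℕ → ℤ → ℤ}
  {bb : Inst k → ℕ} {a b : ℕ → ℤ}

/-! ### Comparing the outputs with the reference output -/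

theorem HasTab.frame {N : ℕ} (h : HasTab St i a b bb N ρ μ)
    (hρ : ∀ z < 64, z ≠ 22 → z ≠ 61 → ρ' z = ρ z) (h22 : bitLen (ρ' 22) ≤ St.M i.1)
    (h61 : bitLen (ρ' 61) ≤ St.M i.1) (hbig : ∀ z, z = 66 ∨ z = 70 ∨ z = 72 → ρ' z = ρ z) :
    HasTab St i a b bb N ρ' μ where
  toHasOutput := h.toHasOutput.frame hρ h22 h61 fun _ _ => rfl
  wit := h.wit
  one := by rw [hbig 72 (by norm_num), h.one]
  idx := by rw [hbig 70 (by norm_num), h.idx]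
  table := h.table
  threshold := by rw [hbig 66 (by norm_num), h.threshold]
  bits := h.bits
  le_size := h.le_size

variable (St) in
/-- The output of row `α` exceeds the threshold. -/
def Exceeds (I : Inst k) (a b : ℕ → ℤ) (α : ℕ) : Prop :=
  b (2 * St.NG I) + (bitLen (a (2 * St.NG I)) : ℕ) - b α < bitLen (a α)

/-- The comparison of real numbers turns into one of integers: only a difference of exponents is
compared with a bit length, so no power with a huge exponent is ever formed. -/
theorem Witness.good_iff (h : Witness St i bb a b) :
    St.Good i.1 i.2 ↔ ∃ α < St.NG i.1, St.Exceeds i.1 a b α := by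
  rw [h.good]
  refine exists_congr fun α => and_congr_right fun hα => ?_
  rw [two_zpow_le_iff_lt_bitLen (h.pos α hα), Exceeds, add_comm]

variable (St) in
open Classical in
/-- The first `j` outputs have been compared with the threshold. -/
structure CheckInv (i : Inst k × ℕ) (a b : ℕ → ℤ) (bb : Inst k → ℕ) (N j : ℕ) (ρ : ℕ → ℤ)
    (μ : ℕ → ℤ → ℤ) : Prop extends HasTab St i a b bb N ρ μ where
  row : ρ 22 = j
  flag : ρ 61 = if (∃ r < i.2, St.Good i.1 r) ∨ ∃ α < j, St.Exceeds i.1 a b α then 1 else 0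

/-- Let `e` be the threshold exponent minus the exponent of the row. If `e ≤ 0`, the row exceeds the
threshold because its mantissa is positive. If `e` is at least the size of the table, no mantissa is
long enough. Otherwise `2 ^ e` is in the table and is compared with the mantissa. -/
def checkBody : Prog :=
  .seq (.assign 64 (outE (var 22))) <| .seq (.load 68 9 64) <| .seq (.load 75 10 64) <|
  .seq (.arith .sub 75 66 75) <| .ifPos 75 (.seq (.arith .sub 76 70 75) <|
    .ifPos 76 (.seq (.load 76 8 75) <| .seq (.arith .sub 76 68 76) <| .seq (.arith .add 76 76 72) <|
      .ifPos 76 (.const 61 1) (.const 76 0)) (.const 76 0)) (.const 61 1)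

theorem phtCheckBody (St : Setup k) (bb : Inst k → ℕ) :
    PHt (fun i : (Cmp k × ℕ) × ℕ => instSize i.1.1.1.1) (fun i => bb i.1.1.1.1 + 1) checkBody
      (fun i ρ μ => i.2 < St.NG i.1.1.1.1 ∧
        CheckInv St i.1.1.1 i.1.1.2.1 i.1.1.2.2 bb i.1.2 i.2 ρ μ)
      (fun i ρ μ => ρ 22 = i.2 ∧ ρ 35 = St.NG i.1.1.1.1 ∧ CheckInv St i.1.1.1 i.1.1.2.1 i.1.1.2.2 bb
        i.1.2 (i.2 + 1) (Function.update ρ 22 ((i.2 + 1 : ℕ) : ℤ)) μ) := by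
  classical
  have hM := St.polyBdd_M.comp fun i : (Cmp k × ℕ) × ℕ => i.1.1.1.1
  have hB := St.polyBdd_B.comp fun i : (Cmp k × ℕ) × ℕ => i.1.1.1.1
  refine .of_ht (f := fun i => (outE (var 22)).cost (St.M i.1.1.1.1) (St.B i.1.1.1.1) +
    6 * (3 * St.M i.1.1.1.1 + 5) + 80) ((((outE (var 22)).cost_polyBdd hM hB).add
      (((hM.const_mul 3).add (.const 5)).const_mul 6)).add (.const 80)) ?_
  rintro ⟨⟨⟨i, a, b⟩, N⟩, j⟩ ρ μ ⟨hj, h⟩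
  dsimp only at hj h ⊢
  have he : (var 22).eval ρ μ = j := h.row
  have ha := (h.wit.bits j).1
  have hb := (h.wit.bits j).2
  have ha' := (h.wit.bits (2 * St.NG i.1)).1
  have hb' := (h.wit.bits (2 * St.NG i.1)).2
  have hN := h.bits
  have hout := h.bitLen_outE he (bitLen_NG_le (by omega))
  have hm := h.load_mantissa he
  have hx := h.load_exponent he
  have ho := h.one
  have hidx := h.idx
  have hpos := h.wit.pos j hj
  obtain ⟨e, hedef⟩ : ∃ e, ρ 66 - b j = e := ⟨_, rfl⟩
  have hex : St.Exceeds i.1 a b j ↔ e < bitLen (a j) := by rw [Exceeds, ← hedef, h.threshold]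
  have h1 : bitLen (ρ 66) ≤ bb i.1 + 1 := by
    have h2 := bitLen_add_le (b (2 * St.NG i.1)) (bitLen (a (2 * St.NG i.1)) : ℕ)
    have h3 := bitLen_natCast_le (bitLen (a (2 * St.NG i.1)))
    rw [h.threshold]; omega
  have h2 : bitLen e ≤ bb i.1 + 2 := by
    have := bitLen_sub_le (ρ 66) (b j)
    rw [← hedef]
    omega
  have h3 := bitLen_natCast_le N
  have h4 := bitLen_sub_le N e
  have hone : bitLen 1 = 1 := bitLen_one
  have key : ∀ (ρ' : ℕ → ℤ), (∀ z < 64, z ≠ 61 → ρ' z = ρ z) →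
      (∀ z, z = 66 ∨ z = 70 ∨ z = 72 → ρ' z = ρ z) →
      (St.Exceeds i.1 a b j ∧ ρ' 61 = 1 ∨ ¬ St.Exceeds i.1 a b j ∧ ρ' 61 = ρ 61) →
      ρ' 22 = j ∧ ρ' 35 = St.NG i.1 ∧
        CheckInv St i a b bb N (j + 1) (Function.update ρ' 22 ((j + 1 : ℕ) : ℤ)) μ := by
    intro ρ' h1 h2 h3
    refine ⟨by rw [h1 22 (by norm_num) (by norm_num), h.row],
      by rw [h1 35 (by norm_num) (by norm_num), h.NG],
      ⟨h.toHasTab.frame (fun z hz hz' h61 => ?_) ?_ ?_ fun z hz => ?_, by simp, ?_⟩⟩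
    · rw [Function.update_of_ne hz', h1 z hz h61]
    · rw [Function.update_self]; exact bitLen_NG_le (by omega)
    · rw [Function.update_of_ne (by norm_num)]
      rcases h3 with ⟨-, h3⟩ | ⟨-, h3⟩
      · rw [h3]; exact St.bitLen_le_M_of_le_one (by norm_num) le_rfl
      · rw [h3]; exact h.bitLen_reg (by norm_num)
    · rw [Function.update_of_ne (by omega), h2 z hz]
    · rw [Function.update_of_ne (by norm_num)]
      rcases h3 with ⟨h4, h3⟩ | ⟨h4, h3⟩
      · rw [h3, if_pos (Or.inr ⟨j, by omega, h4⟩)]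
      · rw [h3, h.flag]
        refine if_congr (or_congr_right (exists_congr fun α => and_congr_left fun h5 => ?_)) rfl rfl
        have : α ≠ j := fun h6 => h4 (h6 ▸ h5)
        omega
  have small_case : ∀ n : ℕ, n < N → e = n → (μ 8 e = 2 ^ n ∧ bitLen (μ 8 e) ≤ bb i.1 + 1) := by
    intro n hn hen
    rw [hen, h.table n hn]
    exact ⟨rfl, by rw [bitLen_two_pow]; omega⟩
  refine Ht.le (Ht.seq_assign h.small (by simp [outE_wf, WF]) <|
    Ht.seq_load (D := 3 * St.M i.1 + 2 + bb i.1) (by norm_num) ?_ <|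
    Ht.seq_load (D := 3 * St.M i.1 + 2 + bb i.1) (by norm_num) ?_ <|
    Ht.seq_arith (D := 2 * bb i.1 + 2) (by norm_num) (by norm_num) ?_ <|
    Ht.ifPos' (D := bb i.1 + 3) (T := 20 * (bb i.1 + 3)) (by norm_num) ?_
      (fun hp1 => Ht.le (Ht.seq_arith (D := 2 * bb i.1 + 3) (by norm_num) (by norm_num) ?_ <|
        Ht.ifPos' (D := bb i.1 + 4) (T := 15 * (bb i.1 + 3)) (by norm_num) ?_
        (fun hp2 => Ht.le (Ht.seq_load (D := 2 * bb i.1 + 4) (by norm_num) ?_ <|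
          Ht.seq_arith (D := 2 * bb i.1 + 4) (by norm_num) (by norm_num) ?_ <|
          Ht.seq_arith (D := 2 * bb i.1 + 4) (by norm_num) (by norm_num) ?_ <|
          Ht.ifPos' (D := bb i.1 + 4) (T := 2) (by norm_num) ?_
          (fun hp3 => Ht.const' (by simp) (key _ (fun z hz hz' => ?_) (fun z hz => ?_) ?_))
          fun hp3 => Ht.const' (by simp) (key _ (fun z hz hz' => ?_) (fun z hz => ?_) ?_)) (by omega))
        fun hp2 => Ht.const' (by simp; omega) (key _ (fun z hz hz' => ?_) (fun z hz => ?_) ?_))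
        (by omega))
      fun hp1 => Ht.const' (by simp; omega) (key _ (fun z hz hz' => ?_) (fun z hz => ?_) ?_))
    (le_mul_succ (v := 28) (u := _) ?_)
  · simp [hm]; omega
  · simp [hx]; omega
  · simp [ArithOp.cost, hx]; omega
  · simp [ArithOp.eval, hx, hedef]; omega
  · simp [ArithOp.cost, ArithOp.eval, hx, hedef, hidx]; omega
  · simp [ArithOp.eval, hx, hedef, hidx]; omega
  · simp [ArithOp.eval, hx, hedef, hidx] at hp1 hp2 ⊢
    obtain ⟨n, hn⟩ : ∃ n : ℕ, e = n := ⟨e.toNat, by omega⟩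
    have := small_case n (by omega) hn
    omega
  · simp [ArithOp.cost, ArithOp.eval, hm, hx, hedef, hidx] at hp1 hp2 ⊢
    obtain ⟨n, hn⟩ : ∃ n : ℕ, e = n := ⟨e.toNat, by omega⟩
    have := small_case n (by omega) hn
    omega
  · simp [ArithOp.cost, ArithOp.eval, hm, hx, hedef, hidx, ho] at hp1 hp2 ⊢
    obtain ⟨n, hn⟩ : ∃ n : ℕ, e = n := ⟨e.toNat, by omega⟩
    have := small_case n (by omega) hn
    have := bitLen_sub_le (a j) (μ 8 e)
    omega
  · simp [ArithOp.eval, hm, hx, hedef, hidx, ho] at hp1 hp2 ⊢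
    obtain ⟨n, hn⟩ : ∃ n : ℕ, e = n := ⟨e.toNat, by omega⟩
    have := small_case n (by omega) hn
    have := bitLen_sub_le (a j) (μ 8 e)
    have := bitLen_add_le (a j - μ 8 e) 1
    omega
  · simp [show z ≠ 64 by omega, show z ≠ 68 by omega, show z ≠ 75 by omega, show z ≠ 76 by omega, hz']
  · rcases hz with rfl | rfl | rfl <;> simp
  · simp [ArithOp.eval, hm, hx, hedef, hidx, ho] at hp1 hp2 hp3 ⊢
    obtain ⟨n, hn⟩ : ∃ n : ℕ, e = n := ⟨e.toNat, by omega⟩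
    have h5 := (small_case n (by omega) hn).1
    have h6 := two_pow_le_iff_lt_bitLen hpos.le n
    rw [hex]
    omega
  · simp [show z ≠ 64 by omega, show z ≠ 68 by omega, show z ≠ 75 by omega, show z ≠ 76 by omega]
  · rcases hz with rfl | rfl | rfl <;> simp
  · simp [ArithOp.eval, hm, hx, hedef, hidx, ho] at hp1 hp2 hp3 ⊢
    obtain ⟨n, hn⟩ : ∃ n : ℕ, e = n := ⟨e.toNat, by omega⟩
    have h5 := (small_case n (by omega) hn).1
    have h6 := two_pow_le_iff_lt_bitLen hpos.le n
    rw [hex]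
    omega
  · simp [show z ≠ 64 by omega, show z ≠ 68 by omega, show z ≠ 75 by omega, show z ≠ 76 by omega]
  · rcases hz with rfl | rfl | rfl <;> simp
  · simp [ArithOp.eval, hx, hedef, hidx] at hp1 hp2 ⊢
    have := h.le_size j hj
    rw [hex]
    omega
  · simp [show z ≠ 64 by omega, show z ≠ 68 by omega, show z ≠ 75 by omega, hz']
  · rcases hz with rfl | rfl | rfl <;> simp
  · simp [ArithOp.eval, hx, hedef] at hp1 ⊢
    have := (two_pow_le_iff_lt_bitLen hpos.le 0).1 (by rw [pow_zero]; omega)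
    rw [hex]
    omega
  · omega

theorem phtCheck (St : Setup k) (bb : Inst k → ℕ) :
    PHt (fun i : Cmp k => instSize i.1.1) (fun i => (St.NG i.1.1 + 1) * (bb i.1.1 + 1))
      (.forLoop 22 35 checkBody)
      (fun i ρ μ => ∃ N, HasTab St i.1 i.2.1 i.2.2 bb N ρ μ ∧ Flag St i.1 ρ)
      (fun i ρ μ => ∃ N, CheckInv St i.1 i.2.1 i.2.2 bb N (St.NG i.1.1) ρ μ) := by
  classical
  refine PHt.exists (PHt.conseq (PHt.forLoop (x := 22) (b := 35)
    (w := fun i : Cmp k × ℕ => bb i.1.1.1 + 1)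
    (N := fun i => St.NG i.1.1.1) (P := fun i ρ μ => HasTab St i.1.1 i.1.2.1 i.1.2.2 bb i.2 ρ μ ∧
      Flag St i.1.1 ρ) (by norm_num) (by norm_num) (by norm_num)
    (fun i j ρ μ => CheckInv St i.1.1 i.1.2.1 i.1.2.2 bb i.2 j ρ μ)
    (St.polyBdd_M.comp fun i : Cmp k × ℕ => i.1.1.1) (phtCheckBody St bb)
      (fun i => Nat.le_add_left 1 _) ?_) (fun _ _ _ h => h) fun i ρ μ h => ⟨_, h⟩)
  rintro i ρ μ ⟨h, hf⟩
  refine ⟨bitLen_NG_le (by omega), h.NG, ⟨h.frame (fun z hz hz' _ => ?_) (by simp) ?_ fun z hz => ?_,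
    by simp, ?_⟩⟩
  · rw [Function.update_of_ne hz']
  · simpa using h.bitLen_reg (by norm_num)
  · rw [Function.update_of_ne (by omega)]
  · rw [Function.update_of_ne (by norm_num), hf]
    exact if_congr (by simp) rfl rfl

/-! ### One iteration -/

def iterProg (k : ℕ) (θ : ℕ → ℕ) (b : ℕ) (P : Prog) : Prog :=
  .seq (sparsifyProg k θ b) <| .seq loadQ <| .seq loadV <| .seq (.call 9 P [41, 42, 43, 40]) <|
  .seq refProg <| .seq (.forLoop 22 35 maxProg) <| .seq tabProg (.forLoop 22 35 checkBody)

theorem CheckInv.next {N : ℕ} (h : CheckInv St i a b bb N (St.NG i.1) ρ μ) :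
    Main St (i.1, i.2 + 1) (Function.update ρ 63 ((i.2 + 1 : ℕ) : ℤ)) μ where
  const p hp := by
    rw [Function.update_of_ne (by have := const_range hp; omega)]
    exact h.const p hp
  small := h.small.update (by norm_num) (Base.bitLen_le (62, fun I => St.R I + 2) (by simp [consts])
    (by have := h.lt; dsimp only; omega))
  formula := h.formula
  powers := h.powers
  residue := by simp
  flag := by
    classical
    rw [Function.update_of_ne (by norm_num), h.flag]
    refine if_congr ?_ rfl rfl
    rw [← h.wit.good_iff]
    constructor
    · rintro (⟨r, hr, hg⟩ | hg)
      exacts [⟨r, by dsimp only; omega, hg⟩, ⟨i.2, by dsimp only; omega, hg⟩]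
    · rintro ⟨r, hr, hg⟩
      rcases Nat.lt_succ_iff_lt_or_eq.1 hr with hr | rfl
      exacts [Or.inl ⟨r, hr, hg⟩, Or.inr hg]
  fresh a ha z h1 h2 := h.fresh a ha z (by exact_mod_cast h1) h2

theorem phtIter (St : Setup k) (hv : St.Valid) {P : Prog} {τ bb : Inst k → ℕ}
    (hP : St.Oracle P τ bb) :
    PHt (fun i : Inst k × ℕ => instSize i.1)
      (fun i => (St.NG i.1 + 1) * (bb i.1 + 1) + (bb i.1 + 1) ^ 2 + (τ i.1 + 1))
      (iterProg k St.pr.θ St.pr.b P) (fun i ρ μ => Iter St i ρ μ)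
      (fun i ρ μ => ρ 63 = i.2 ∧ ρ 44 = St.R i.1 ∧
        Main St (i.1, i.2 + 1) (Function.update ρ 63 ((i.2 + 1 : ℕ) : ℤ)) μ) := by
  have h1 := PolyBdd.const (z := fun i : Inst k × ℕ => instSize i.1) 1
  have h1' := PolyBdd.const (z := fun i : Cmp k => instSize i.1.1) 1
  have hcmp : PHt (fun i : Cmp k => instSize i.1.1)
      (fun i => (St.NG i.1.1 + 1) * (bb i.1.1 + 1) + (bb i.1.1 + 1) ^ 2 + (τ i.1.1 + 1))
      (.seq refProg <| .seq (.forLoop 22 35 maxProg) <| .seq tabProg (.forLoop 22 35 checkBody))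
      (fun i ρ μ => Witness St i.1 bb i.2.1 i.2.2 ∧ HasOutput St i.1 i.2.1 i.2.2 ρ μ ∧ Flag St i.1 ρ)
      (fun i ρ μ => ρ 63 = i.1.2 ∧ ρ 44 = St.R i.1.1 ∧
        Main St (i.1.1, i.1.2 + 1) (Function.update ρ 63 ((i.1.2 + 1 : ℕ) : ℤ)) μ) := by
    refine ((phtRef St bb).weight h1' fun i => ?_).seq <| ((phtMax St bb).weight h1' fun i => ?_).seq <|
      ((phtTab St bb).weight h1' fun i => ?_).seq <| ((phtCheck St bb).weight h1' fun i => ?_).conseq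
        (fun _ _ _ h => h) ?_
    · nlinarith [Nat.zero_le (St.NG i.1.1 * (bb i.1.1 + 1))]
    · omega
    · omega
    · omega
    · rintro i ρ μ ⟨N, h⟩
      exact ⟨h.residue, h.R, h.next⟩
  refine ((phtSparsify St).weight h1 fun i => by omega).seq <|
    ((phtLoadQ St hv).weight h1 fun i => ?_).seq <| ((phtLoadV St hv).weight h1 fun i => ?_).seq <|
    ((phtCall St hP).weight h1 fun i => by omega).seq <| (PHt.exists (κ := (ℕ → ℤ) × (ℕ → ℤ))
      (P := fun i y ρ μ => Witness St i bb y.1 y.2 ∧ HasOutput St i y.1 y.2 ρ μ ∧ Flag St i ρ) hcmp).conseq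
      ?_ fun _ _ _ h => h
  · nlinarith [Nat.zero_le ((St.NG i.1 + 1) * bb i.1)]
  · nlinarith [Nat.zero_le ((St.NG i.1 + 1) * bb i.1)]
  · rintro i ρ μ ⟨a, b, h⟩
    exact ⟨(a, b), h⟩

end Setup

/-! ## The program for satisfiability -/

namespace Setup

open Expr Sparsify

variable {k : ℕ} {St : Setup k} {I : Inst k} {ρ ρ' : ℕ → ℤ} {μ μ' : ℕ → ℤ → ℤ}
  {E E' : Inst k → (ℕ → ℤ → ℤ) → Prop} {j : ℕ}

/-! ### Computing the constants -/

variable (St) in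
/-- The first `j` constants are in place. -/
structure Known (j : ℕ) (E : Inst k → (ℕ → ℤ → ℤ) → Prop) (I : Inst k) (ρ : ℕ → ℤ)
    (μ : ℕ → ℤ → ℤ) : Prop where
  const : ∀ p ∈ St.consts.take j, ρ p.1 = (p.2 I : ℤ)
  small : Small ρ μ (St.M I) (St.B I)
  extra : E I μ

theorem Known.update (h : Known St j E I ρ μ) {x : ℕ} {f : Inst k → ℕ}
    (hx : St.consts[j]? = some (x, f)) (hfresh : ∀ p ∈ St.consts.take j, p.1 ≠ x)
    (hB : x < 16 → f I ≤ St.B I) : Known St (j + 1) E I (Function.update ρ x (f I)) μ where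
  const p hp := by
    rw [List.take_add_one, hx, Option.toList_some, List.mem_append, List.mem_singleton] at hp
    rcases hp with hp | rfl
    · rw [Function.update_of_ne (hfresh p hp), h.const p hp]
    · simp
  small := by
    refine ⟨fun z hz => ?_, fun z hz => ?_, h.small.mem, h.small.bits⟩
    · by_cases hzx : z = x
      · subst hzx
        rw [Function.update_self]
        exact St.bitLen_const_le (p := (z, f)) (List.mem_of_getElem? hx)
      · rw [Function.update_of_ne hzx]; exact h.small.reg z hz
    · by_cases hzx : z = x
      · subst hzx
        rw [Function.update_self]
        exact_mod_cast hB hz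
      · rw [Function.update_of_ne hzx]; exact h.small.bound z hz
  extra := h.extra

theorem Known.update_of_le (h : Known St j E I ρ μ) {x : ℕ} (hx : 16 ≤ x)
    (hfresh : ∀ p ∈ St.consts.take j, p.1 ≠ x) {v : ℤ} (hv : bitLen v ≤ St.M I) :
    Known St j E I (Function.update ρ x v) μ where
  const p hp := by rw [Function.update_of_ne (hfresh p hp), h.const p hp]
  small := h.small.update hx hv
  extra := h.extra

theorem phtConst (j x : ℕ) (f : Inst k → ℕ) (e : Expr) (hx : St.consts[j]? = some (x, f))
    (hfresh : ∀ p ∈ St.consts.take j, p.1 ≠ x) (hB : ∀ I, x < 16 → f I ≤ St.B I) (he : e.WF)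
    (heval : ∀ I ρ μ, Known St j E I ρ μ → e.eval ρ μ = f I) :
    PHt instSize (fun _ => 1) (.assign x e) (Known St j E) (Known St (j + 1) E) :=
  .assign St.polyBdd_M St.polyBdd_B (fun _ => le_rfl) x he fun I ρ μ h =>
    ⟨h.small, by rw [heval I ρ μ h]; exact h.update hx hfresh (hB I)⟩

/-- Before the computation of the powers of two. -/
def Start (I : Inst k) (μ : ℕ → ℤ → ℤ) : Prop :=
  μ 0 = I.2.input.mem 0 ∧ ∀ a ≥ 9, ∀ z, μ a z = 0

variable (St) in
/-- The powers of two are in place, and the memory with residues less than `c` is unused. -/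
def Unused (c : Inst k → ℕ) (I : Inst k) (μ : ℕ → ℤ → ℤ) : Prop :=
  μ 0 = I.2.input.mem 0 ∧ (∀ j < St.pows I, μ 1 (j : ℤ) = 2 ^ j) ∧
    ∀ a ≥ 9, ∀ z : ℤ, z % (St.R I + 2) < c I → μ a z = 0

theorem bitLen_litCode_le {n : ℕ} (x : Fin n × Bool) : bitLen (litCode x) ≤ bitLen (n : ℤ) := by
  refine bitLen_mono ?_
  have := x.1.2
  rw [litCode]
  split_ifs <;> omega

theorem small_input (I : Inst k) :
    Small (initRegs [(I.1 : ℤ), (I.2.clauses.length : ℤ)]) I.2.input.mem (St.M I) (St.B I) := by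
  have hn : bitLen (I.1 : ℤ) ≤ St.M I := St.bitLen_const_le (p := (32, fun I => I.1)) (by simp [consts])
  have hm : bitLen (I.2.clauses.length : ℤ) ≤ St.M I :=
    St.bitLen_const_le (p := (33, Setup.m)) (by simp [consts])
  have hB : I.1 + m I ≤ St.B I := by rw [B]; omega
  rw [m] at hB
  refine ⟨fun z _ => ?_, fun z _ => ?_, fun a _ z => ?_, by rw [M]; omega⟩
  · rcases z with _ | _ | z <;> simp [initRegs, hn, hm]
  · rcases z with _ | _ | z <;> simp [initRegs] <;> omega
  · simp only [KCNF.input]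
    split_ifs
    · by_cases h : z.toNat % k < ((I.2.clauses.getD (z.toNat / k) []).map litCode).length
      · rw [List.getD_eq_getElem _ _ h, List.getElem_map]
        exact (bitLen_litCode_le _).trans hn
      · rw [List.getD_eq_default _ _ (not_lt.1 h)]; simp
    · simp

def readProg : Prog := .seq (.assign 32 (var 0)) (.assign 33 (var 1))

theorem phtRead (St : Setup k) : PHt instSize (fun _ => 1) readProg
    (fun I ρ μ => ρ = initRegs [(I.1 : ℤ), (I.2.clauses.length : ℤ)] ∧ μ = I.2.input.mem)
    (Known St 2 Start) := by
  refine .seq (Q := fun I ρ μ => Known St 1 Start I ρ μ ∧ ρ 1 = (m I : ℤ)) ?_ ?_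
  · refine .assign St.polyBdd_M St.polyBdd_B (fun _ => le_rfl) 32 (by simp [WF]) ?_
    rintro I _ _ ⟨rfl, rfl⟩
    have h0 : Known St 0 Start I (initRegs [(I.1 : ℤ), (I.2.clauses.length : ℤ)]) I.2.input.mem :=
      ⟨by simp, small_input I, rfl, fun a ha z => by simp [KCNF.input, show a ≠ 0 by omega]⟩
    exact ⟨h0.small, h0.update (x := 32) (f := fun I => I.1) rfl (by simp) (by norm_num), rfl⟩
  · refine .assign St.polyBdd_M St.polyBdd_B (fun _ => le_rfl) 33 (by simp [WF]) ?_
    rintro I ρ μ ⟨h, h1⟩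
    refine ⟨h.small, ?_⟩
    rw [eval, h1]
    exact h.update (x := 33) rfl (by simp [consts]) (by norm_num)

def sizesProg (q a b : ℕ) (k : ℕ) (s B₀ cp κ : ℕ) : Prog :=
  .seq (.assign 34 (op .div (var 32) (lit q))) <|
  .seq (.assign 0 (op .add (op .mul (lit 2) (var 32)) (lit 1))) <|
  .seq (.assign 6 (op .add (op .mul (lit a) (var 0)) (lit 1))) <|
  .seq (.assign 5 (lit b)) <|
  .seq (.assign 1 (op .add (op .add (var 33) (op .mul (var 6) (var 5))) (lit 1))) <|
  .seq (.assign 2 (op .mul (lit ((k + 1) * (k + 1))) (pow (var 0) k))) <|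
  .seq (.assign 4 (op .add (lit 1) (op .mul (var 0) (lit (1 + s))))) <|
  .seq (.assign 37 (op .add (var 4) (lit 1))) <|
  .seq (.assign 39 (op .mul (lit B₀) (op .add (var 34) (lit 1)))) <|
  .seq (.assign 40 (op .mul (lit cp) (op .add (op .mul (op .mul (var 39) (var 39))
    (op .add (op .mul (lit 9) (var 4)) (lit 4))) (lit 1)))) <|
  .assign 46 (op .add (op .add (var 32) (lit κ)) (lit 1))

theorem phtSizes (St : Setup k) : PHt instSize (fun _ => 1)
    (sizesProg St.q (∑ i ∈ Finset.Ico 1 k, St.pr.β i) St.Θ k (∑ i ∈ Finset.Ico 1 k, St.pr.θ i) St.B₀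
      St.cp St.pr.κ) (Known St 2 E) (Known St 13 E) := by
  refine (phtConst 2 34 St.g _ rfl (by simp [consts]) (by norm_num) (by simp [WF])
    fun I ρ μ h => ?_).seq <|
    (phtConst 3 0 Setup.W _ rfl (by simp [consts]) (fun I _ => by rw [B]; omega) (by simp [WF])
    fun I ρ μ h => ?_).seq <|
    (phtConst 4 6 St.S _ rfl (by simp [consts]) (fun I _ => by rw [B]; omega) (by simp [WF])
    fun I ρ μ h => ?_).seq <|
    (phtConst 5 5 (fun _ => St.Θ) _ rfl (by simp [consts]) (fun I _ => by rw [B]; omega) (by simp [WF])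
    fun I ρ μ h => ?_).seq <|
    (phtConst 6 1 St.T _ rfl (by simp [consts]) (fun I _ => by rw [B]; omega) (by simp [WF])
    fun I ρ μ h => ?_).seq <|
    (phtConst 7 2 (fun I => numIdx k (Setup.W I)) _ rfl (by simp [consts])
      (fun I _ => by rw [B]; omega) (by simp [WF, wf_pow]) fun I ρ μ h => ?_).seq <|
    (phtConst 8 4 St.J _ rfl (by simp [consts]) (fun I _ => by rw [B]; omega) (by simp [WF])
    fun I ρ μ h => ?_).seq <|
    (phtConst 9 37 (fun I => St.J I + 1) _ rfl (by simp [consts]) (by norm_num) (by simp [WF])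
    fun I ρ μ h => ?_).seq <|
    (phtConst 10 39 St.Bs _ rfl (by simp [consts]) (by norm_num) (by simp [WF])
    fun I ρ μ h => ?_).seq <|
    (phtConst 11 40 St.prec _ rfl (by simp [consts]) (by norm_num) (by simp [WF])
    fun I ρ μ h => ?_).seq <|
    phtConst 12 46 St.pows _ rfl (by simp [consts]) (by norm_num) (by simp [WF]) fun I ρ μ h => ?_
  all_goals
    have hc := h.const
    simp only [consts, List.take_succ_cons, List.take_zero, List.forall_mem_cons] at hc
    simp only [eval, ArithOp.eval, eval_pow, hc]
  · rfl
  · rw [W]; push_cast; rfl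
  · rw [W, S]; push_cast; rfl
  · rw [T]; push_cast; rfl
  · rw [numIdx]; push_cast; rfl
  · rw [J, W]; push_cast; rfl
  · push_cast; rfl
  · rw [Bs]; push_cast; rfl
  · rw [prec]; push_cast; ring
  · rw [pows]; push_cast; rfl

end Setup

namespace Setup

open Expr Sparsify

variable {k : ℕ} {St : Setup k} {I : Inst k} {ρ ρ' : ℕ → ℤ} {μ μ' : ℕ → ℤ → ℤ}
  {E E' : Inst k → (ℕ → ℤ → ℤ) → Prop} {j : ℕ}

/-! ### Powers of two -/

/-- The machine has no shifts. This table of powers is used for extracting the bits of partial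
assignments and for the numbers `2 ^ g`, `2 ^ L` and `2 ^ (n - 2 * g)`. -/
def powersProg : Prog :=
  .seq (.assign 56 (lit 1)) (.forLoop 22 46 (.seq (.storeExpr 1 (var 22) (var 56))
    (.assign 56 (op .add (var 56) (var 56)))))

variable (St) in
structure PowInv (I : Inst k) (j : ℕ) (ρ : ℕ → ℤ) (μ : ℕ → ℤ → ℤ) : Prop extends
    Known St 13 Start I ρ μ where
  idx : ρ 22 = j
  pow : ρ 56 = 2 ^ j
  powers : ∀ i < j, μ 1 (i : ℤ) = 2 ^ i

theorem bitLen_two_pow_le {j : ℕ} (hj : j ≤ St.pows I) : bitLen (2 ^ j) ≤ St.M I := by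
  rw [bitLen_two_pow, M]; omega

theorem bitLen_pows_le {j : ℕ} (hj : j ≤ St.pows I) : bitLen (j : ℤ) ≤ St.M I :=
  (bitLen_natCast_mono hj).trans (St.bitLen_const_le (p := (46, St.pows)) (by simp [consts]))

theorem phtPowers (St : Setup k) : PHt instSize (fun _ => 1) powersProg (Known St 13 Start)
    (Known St 13 (St.Unused fun I => St.R I + 2)) := by
  have hM := St.polyBdd_M
  have hB := St.polyBdd_B
  refine .seq (Q := fun I ρ μ => Known St 13 Start I ρ μ ∧ ρ 56 = 1) ?_ ?_
  · refine .assign hM hB (fun _ => le_rfl) 56 (by simp [WF]) fun I ρ μ h => ⟨h.small, ?_, by simp [eval]⟩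
    exact h.update_of_le (by norm_num) (by simp [consts])
      (St.bitLen_le_M_of_le_one (by simp [eval]) (by simp [eval]))
  refine PHt.conseq (PHt.weight (w' := fun _ => 1) (PHt.forLoop (x := 22) (b := 46)
    (w := fun _ : Inst k => 1) (N := St.pows)
    (P := fun I ρ μ => Known St 13 Start I ρ μ ∧ ρ 56 = 1)
    (by norm_num) (by norm_num) (by norm_num) (PowInv St) hM ?_
    (fun _ => le_rfl) ?_) (St.polyBdd_pows.add (.const 1)) fun I => le_rfl) (fun _ _ _ h => h) ?_
  · have hM' := hM.comp fun i : Inst k × ℕ => i.1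
    have hB' := hB.comp fun i : Inst k × ℕ => i.1
    refine .seq (Q := fun i ρ μ => i.2 < St.pows i.1 ∧ Known St 13 Start i.1 ρ μ ∧ ρ 22 = i.2 ∧
      ρ 56 = 2 ^ i.2 ∧ ∀ j : ℕ, j < i.2 + 1 → μ 1 (j : ℤ) = 2 ^ j) ?_ ?_
    · refine .storeExpr hM' hB' (fun _ => le_rfl) 1 (by simp [WF]) (by simp [WF]) ?_
      rintro ⟨I, j⟩ ρ μ ⟨hj, h⟩
      refine ⟨h.small, hj, ⟨h.const, ⟨h.small.reg, h.small.bound, fun a ha z => ?_, h.small.bits⟩,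
        ?_, fun a ha z => ?_⟩, h.idx, h.pow, fun i hi => ?_⟩
      · by_cases ha1 : a = 1
        · subst ha1
          rw [Function.update_self, Function.update_apply]
          split_ifs
          · rw [eval, h.pow]; exact bitLen_two_pow_le hj.le
          · exact h.small.mem 1 ha z
        · rw [Function.update_of_ne ha1]; exact h.small.mem a ha z
      · rw [Function.update_of_ne (by norm_num)]; exact h.extra.1
      · rw [Function.update_of_ne (by omega)]; exact h.extra.2 a ha z
      · simp only [eval, h.idx, h.pow, Function.update_self]
        by_cases hij : i = j
        · subst hij; rw [Function.update_self]
        · rw [Function.update_of_ne (by exact_mod_cast hij)]; exact h.powers i (by dsimp only at hi; omega)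
    · refine .assign hM' hB' (fun _ => le_rfl) 56 (by simp [WF]) ?_
      rintro ⟨I, j⟩ ρ μ ⟨hj, h, hidx, hpow, hp⟩
      dsimp only at hj h hidx hpow hp ⊢
      have hv : (op .add (var 56) (var 56)).eval ρ μ = 2 ^ (j + 1) := by
        simp only [eval, ArithOp.eval, hpow]; ring
      rw [hv]
      have h46 : ρ 46 = St.pows I := h.const (46, St.pows) (by simp [consts])
      refine ⟨h.small, by simpa using hidx, by simpa using h46, ⟨?_, by simp, by simp, hp⟩⟩
      exact (h.update_of_le (by norm_num) (by simp [consts]) (bitLen_two_pow_le hj)).update_of_le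
        (by norm_num) (by simp [consts]) (bitLen_pows_le hj)
  · rintro I ρ μ ⟨h, h56⟩
    exact ⟨bitLen_pows_le le_rfl, h.const (46, St.pows) (by simp [consts]),
      ⟨h.update_of_le (by norm_num) (by simp [consts]) (by simp), by simp, by simpa using h56,
        by simp⟩⟩
  · exact fun I ρ μ h => ⟨h.const, h.small, h.extra.1, h.powers, fun a ha z _ => h.extra.2 a ha z⟩

def countsProg (q q' κ c₀ : ℕ) : Prog :=
  .seq (.assign 35 (get 1 (var 34))) <|
  .seq (.assign 36 (get 1 (op .add (op .div (var 32) (lit (q * q'))) (lit κ)))) <|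
  .seq (.assign 38 (op .add (op .mul (lit 2) (var 35)) (lit 1))) <|
  .seq (.assign 41 (op .mul (lit c₀) (var 35))) <|
  .seq (.assign 44 (op .mul (var 36) (get 1 (op .sub (var 32) (op .mul (lit 2) (var 34)))))) <|
  .assign 62 (op .add (var 44) (lit 2))

theorem phtCounts (St : Setup k) {c : Inst k → ℕ} : PHt instSize (fun _ => 1)
    (countsProg St.q St.q' St.pr.κ St.c₀) (Known St 13 (St.Unused c)) (Known St 19 (St.Unused c)) := by
  refine (phtConst 13 35 St.NG _ rfl (by simp [consts]) (by norm_num) (by simp [WF])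
    fun I ρ μ h => ?_).seq <|
    (phtConst 14 36 (fun I => 2 ^ St.L I) _ rfl (by simp [consts]) (by norm_num) (by simp [WF])
    fun I ρ μ h => ?_).seq <|
    (phtConst 15 38 (fun I => 2 * St.NG I + 1) _ rfl (by simp [consts]) (by norm_num) (by simp [WF])
    fun I ρ μ h => ?_).seq <|
    (phtConst 16 41 St.N _ rfl (by simp [consts]) (by norm_num) (by simp [WF])
    fun I ρ μ h => ?_).seq <|
    (phtConst 17 44 St.R _ rfl (by simp [consts]) (by norm_num) (by simp [WF])
    fun I ρ μ h => ?_).seq <|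
    phtConst 18 62 (fun I => St.R I + 2) _ rfl (by simp [consts]) (by norm_num) (by simp [WF])
    fun I ρ μ h => ?_
  all_goals
    have hc := h.const
    have hp := h.extra.2.1
    have hg : St.g I ≤ I.1 := Nat.div_le_self _ _
    have hL : I.1 / (St.q * St.q') ≤ I.1 := Nat.div_le_self _ _
    simp only [consts, List.take_succ_cons, List.take_zero, List.forall_mem_cons] at hc
    simp only [eval, ArithOp.eval, hc]
  · rw [hp _ (by rw [pows]; omega), NG]; push_cast; rfl
  · have := hp (St.L I) (by rw [pows, L]; omega)
    rw [L] at this ⊢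
    push_cast at this ⊢
    exact this
  · push_cast; rfl
  · rw [N, NG]; push_cast; rfl
  · have h2 : 2 * St.g I ≤ I.1 := by
      have := Nat.div_mul_le_self I.1 St.q
      have h3 := Nat.mul_le_mul_left (I.1 / St.q) St.two_le_q
      rw [g]; omega
    have := hp (I.1 - 2 * St.g I) (by rw [pows]; omega)
    rw [Nat.cast_sub h2] at this
    push_cast at this
    rw [this, R]
    push_cast
    rfl
  · push_cast; rfl

/-! ### Dimensions -/

variable (St) in
/-- The program `P` computes `f` at the size of the gadget, in time `τ`. -/
def Dim (P : Prog) (f : ℕ → ℕ) (τ : Inst k → ℕ) : Prop := ∀ I : Inst k, ∃ (t : ℕ) (s : RAMState),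
  P.Exec ⟨initRegs [(St.N I : ℤ)], fun _ _ => 0⟩ t s ∧ t ≤ τ I ∧ s.reg 0 = (f (St.N I) : ℤ)

/-- The modulus is `R + 2` because the two programs for the dimensions run in the residue classes `R
+ 1` and `R`, which no iteration uses. -/
def dimProg (x : ℕ) (c : ℤ) (P : Prog) : Prog :=
  .seq (.assign 63 (op .add (var 44) (lit c))) (P.callResult 9 [41] x)

theorem phtDim (St : Setup k) {P : Prog} {f : ℕ → ℕ} {τ : Inst k → ℕ} (hP : St.Dim P f τ) (j x c : ℕ)
    (hc : c < 2) (hx : St.consts[j]? = some (x, fun I => f (St.N I))) (h16 : 16 ≤ x) (h64 : x < 64)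
    (hfresh : ∀ p ∈ St.consts.take j, p.1 ≠ x) (hj : 19 ≤ j)
    (hfresh' : ∀ p ∈ St.consts.take j, p.1 ≠ 63 ∧ p.1 ≠ 79) :
    PHt instSize (fun I => τ I + 1) (dimProg x c P)
      (Known St j (St.Unused fun I => St.R I + c + 1))
      (Known St (j + 1) (St.Unused fun I => St.R I + c)) := by
  have hM := St.polyBdd_M
  have hmem : ∀ p ∈ St.consts.take 19, p ∈ St.consts.take j := fun p hp =>
    (List.take_subset_take_left _ hj) hp
  refine .seq (Q := fun I ρ μ => Known St j (St.Unused fun I => St.R I + c + 1) I ρ μ ∧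
    ρ 63 = (St.R I + c : ℕ)) ?_ ?_
  · refine .assign hM St.polyBdd_B (fun _ => Nat.le_add_left 1 _) 63 (by simp [WF]) fun I ρ μ h => ?_
    have h44 : ρ 44 = St.R I := h.const (44, St.R) (hmem _ (by simp [consts]))
    have hv : (op .add (var 44) (lit c)).eval ρ μ = (St.R I + c : ℕ) := by
      simp [eval, ArithOp.eval, h44]
    rw [hv]
    exact ⟨h.small, h.update_of_le (by norm_num) (fun p hp => (hfresh' p hp).1)
      ((bitLen_natCast_mono (by omega : St.R I + c ≤ St.R I + 2)).trans
        (St.bitLen_const_le (p := (62, fun I => St.R I + 2)) (by simp [consts]))), by simp⟩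
  refine .of_ht (f := fun I => P.callRegs [41] * (St.M I + 2) + 4 + (4 * St.M I + 6) + St.M I)
    (((((hM.add (.const 2)).const_mul _).add (.const 4)).add ((hM.const_mul 4).add (.const 6))).add hM)
    fun I ρ μ ⟨h, h63⟩ => ?_
  obtain ⟨t, s, hex, ht, hs⟩ := hP I
  have h62 : ρ 62 = (St.R I + 2 : ℕ) := h.const (62, fun I => St.R I + 2) (hmem _ (by simp [consts]))
  have h41 : ρ 41 = (St.N I : ℕ) := h.const (41, St.N) (hmem _ (by simp [consts]))
  have hmod : ∀ z : ℤ, 0 ≤ z % (St.R I + 2) ∧ z % (St.R I + 2) < St.R I + 2 := fun z =>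
    ⟨Int.emod_nonneg _ (by omega), Int.emod_lt_of_pos _ (by omega)⟩
  refine (Ht.callResult (σ := 9) (c := St.M I) (t := t) (R := (St.R I + 2 : ℕ)) (r := (St.R I + c : ℕ))
    (m := fun _ _ => 0) (s' := s) (by simp) ?_ (by positivity) (by omega)
    h62 h63 ?_ ?_).mono ?_ ?_
  · intro y hy
    exact h.small.reg y (by simp at hy; omega)
  · intro a z
    refine h.extra.2.2 (9 + a) (by omega) _ ?_
    push_cast
    rw [Int.mul_add_emod_self_right, Int.emod_eq_of_lt (by omega) (by omega)]
    omega
  · simpa [h41] using hex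
  · have hb : bitLen ((St.R I + 2 : ℕ) : ℤ) ≤ St.M I :=
      St.bitLen_const_le (p := (62, fun I => St.R I + 2)) (by simp [consts])
    have h1 : t * (4 * bitLen ((St.R I + 2 : ℕ) : ℤ) + 6) ≤ (4 * St.M I + 6) * τ I := by
      rw [mul_comm]
      exact Nat.mul_le_mul (by omega) ht
    have h2 : t * (4 * bitLen ((St.R I + 2 : ℕ) : ℤ) + 6) ≤
        (P.callRegs [41] * (St.M I + 2) + 4 + (4 * St.M I + 6) + St.M I) * τ I :=
      h1.trans (Nat.mul_le_mul_right _ (by omega))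
    have h3 : bitLen (s.reg 0) ≤ St.M I := by
      rw [hs]
      exact St.bitLen_const_le (p := (x, fun I => f (St.N I))) (List.mem_of_getElem? hx)
    rw [mul_add_one]
    omega
  · rintro ρ' μ' ⟨rfl, hframe⟩
    have hμ : ∀ a < 9, μ' a = μ a := fun a ha => funext fun z => hframe a z (Or.inl ha)
    have h' : Known St j (St.Unused fun I => St.R I + c) I (Function.update ρ 79 0) μ' := by
      refine ⟨fun p hp => ?_, ⟨fun z hz => ?_, fun z hz => ?_, fun a ha z => ?_, h.small.bits⟩, ?_, ?_,
        fun a ha z hz => ?_⟩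
      · rw [Function.update_of_ne (hfresh' p hp).2, h.const p hp]
      · rw [Function.update_of_ne (by omega)]; exact h.small.reg z hz
      · rw [Function.update_of_ne (by omega)]; exact h.small.bound z hz
      · rw [hμ a (by omega)]; exact h.small.mem a ha z
      · rw [hμ 0 (by norm_num)]; exact h.extra.1
      · intro i hi
        rw [hμ 1 (by norm_num)]; exact h.extra.2.1 i hi
      · rw [hframe a z (Or.inr (by push_cast at hz ⊢; omega))]
        exact h.extra.2.2 a ha z (by push_cast at hz ⊢; omega)
    rw [hs]
    exact h'.update hx hfresh (by omega)

/-! ### The main loop -/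

variable (St) in
def satProg (P Pd Pv : Prog) : Prog :=
  .seq readProg <| .seq (sizesProg St.q (∑ i ∈ Finset.Ico 1 k, St.pr.β i) St.Θ k
    (∑ i ∈ Finset.Ico 1 k, St.pr.θ i) St.B₀ St.cp St.pr.κ) <|
  .seq powersProg <| .seq (countsProg St.q St.q' St.pr.κ St.c₀) <|
  .seq (dimProg 42 1 Pd) <| .seq (dimProg 43 0 Pv) <| .seq (.assign 61 (lit 0)) <|
  .seq (.forLoop 63 44 (iterProg k St.pr.θ St.pr.b P)) (.assign 0 (var 61))

theorem phtSat (St : Setup k) (hv : St.Valid) {P Pd Pv : Prog} {τ bb τd : Inst k → ℕ}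
    (hP : St.Oracle P τ bb) (hd : St.Dim Pd St.d τd) (hdv : St.Dim Pv St.dv τd) :
    PHt instSize (fun I => τd I + 1 +
        (St.R I + 1) * ((St.NG I + 1) * (bb I + 1) + (bb I + 1) ^ 2 + (τ I + 1))) (satProg St P Pd Pv)
      (fun I ρ μ => ρ = initRegs [(I.1 : ℤ), (I.2.clauses.length : ℤ)] ∧ μ = I.2.input.mem)
      (fun I ρ _ => (I.2.Satisfiable → ρ 0 = 1) ∧ (¬ I.2.Satisfiable → ρ 0 = 0)) := by
  classical
  have h1 := PolyBdd.const (z := instSize (k := k)) 1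
  have hw : ∀ I : Inst k, 1 ≤ τd I + 1 +
      (St.R I + 1) * ((St.NG I + 1) * (bb I + 1) + (bb I + 1) ^ 2 + (τ I + 1)) := fun I => by omega
  refine ((phtRead St).weight h1 fun I => by omega).seq <|
    ((phtSizes St).weight h1 fun I => by omega).seq <|
    ((phtPowers St).weight h1 fun I => by omega).seq <|
    ((phtCounts St).weight h1 fun I => by omega).seq <|
    ((phtDim St hd 19 42 1 (by norm_num) rfl (by norm_num) (by norm_num) (by simp [consts]) le_rfl
      (by simp [consts])).weight h1 fun I => by omega).seq <|
    ((phtDim St hdv 20 43 0 (by norm_num) rfl (by norm_num) (by norm_num) (by simp [consts])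
      (by norm_num) (by simp [consts])).weight h1 fun I => by omega).seq <|
    .seq (Q := fun I ρ μ => Known St 21 (St.Unused St.R) I ρ μ ∧ ρ 61 = 0) ?_ <|
    .seq (Q := fun I ρ μ => Main St (I, St.R I) ρ μ) ?_ ?_
  · refine .assign St.polyBdd_M St.polyBdd_B hw 61 (by simp [WF]) fun I ρ μ h => ?_
    exact ⟨h.small, h.update_of_le (by norm_num) (by simp [consts]) (by simp [eval]), by simp [eval]⟩
  · refine PHt.weight (w := fun I => (St.R I + 1) *
        ((St.NG I + 1) * (bb I + 1) + (bb I + 1) ^ 2 + (τ I + 1))) ?_ h1 fun I => by omega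
    refine PHt.forLoop (x := 63) (b := 44)
      (w := fun I => (St.NG I + 1) * (bb I + 1) + (bb I + 1) ^ 2 + (τ I + 1)) (N := St.R)
      (by norm_num) (by norm_num) (by norm_num) (fun I j ρ μ => Main St (I, j) ρ μ) St.polyBdd_M
      ((phtIter St hv hP).conseq (fun i ρ μ h => ⟨h.2, h.1⟩) fun _ _ _ h => h) (fun I => by omega) ?_
    rintro I ρ μ ⟨h, h61⟩
    have h' := h.update_of_le (x := 63) (v := 0) (by norm_num) (by simp [consts]) (by simp)
    refine ⟨St.bitLen_const_le (p := (44, St.R)) (by simp [consts]),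
      h.const (44, St.R) (by simp [consts]), ⟨⟨fun p hp => h'.const p ?_, h'.small, h.extra.1,
        h.extra.2.1⟩, by simp, by simpa using h61, fun a ha z _ hz => h.extra.2.2 a ha z hz⟩⟩
    rwa [List.take_of_length_le (by simp [consts])]
  · refine .assign St.polyBdd_M St.polyBdd_B hw 0 (by simp [WF]) fun I ρ μ h => ⟨h.small, ?_⟩
    have := h.flag
    rw [St.satisfiable_iff]
    simp only [Function.update_self, eval, this]
    exact ⟨fun h => if_pos h, fun h => if_neg h⟩

end Setup

/-! ## The attention program as an oracle -/

theorem rowMajor_eq_or {n d : ℕ} (A : Matrix (Fin n) (Fin d) ℤ) (z : ℤ) :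
    rowMajor A z = 0 ∨ ∃ i j, rowMajor A z = A i j := by
  rw [rowMajor]
  by_cases h : ∃ (i : Fin n) (j : Fin d), z = (i : ℤ) * d + j
  · obtain ⟨i, j, rfl⟩ := h
    exact Or.inr ⟨i, j, rowMajor_apply A i.2 j.2⟩
  · push Not at h
    exact Or.inl (Finset.sum_eq_zero fun i _ => Finset.sum_eq_zero fun j _ => if_neg (h i j))

theorem bitLen_rowMajor_le {n d b : ℕ} {A : Matrix (Fin n) (Fin d) ℤ} (h : ∀ i j, bitLen (A i j) ≤ b)
    (z : ℤ) : bitLen (rowMajor A z) ≤ b := by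
  rcases rowMajor_eq_or A z with h' | ⟨i, j, h'⟩ <;> rw [h']
  exacts [by simp, h i j]

theorem attentionInput_bitsLE {n d dv p b : ℕ} {Q : Matrix (Fin n) (Fin d) ℤ}
    {V : Matrix (Fin n) (Fin dv) ℤ} (hn : bitLen (n : ℤ) ≤ b) (hd : bitLen (d : ℤ) ≤ b)
    (hdv : bitLen (dv : ℤ) ≤ b) (hp : bitLen (p : ℤ) ≤ b) (hQ : ∀ i j, bitLen (Q i j) ≤ b)
    (hV : ∀ i j, bitLen (V i j) ≤ b) : (attentionInput Q V p).BitsLE b := by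
  refine ⟨fun x => ?_, fun a z => ?_⟩
  · rcases x with _ | _ | _ | _ | x <;> simp [attentionInput, initRegs, *]
  · rw [attentionInput]
    dsimp only
    split_ifs
    exacts [bitLen_rowMajor_le hQ z, bitLen_rowMajor_le hV z, by simp]

namespace Setup

variable {k : ℕ}

/-- The gadget inputs obey the restrictions on entries, so the program must answer on them. The
bound on the output bits comes from the potential argument, started with `M` plus the constants of
the program. -/
theorem oracle_of_solves (St : Setup k) (hv : St.Valid) {P : Prog} {C μ : ℝ} {T : ℕ → ℕ → ℝ}
    (hC : 0 < C) (hμ0 : 0 ≤ μ) (hμ : μ < 1)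
    (hB : ∀ g : ℕ, 8 * (2 : ℝ) ^ g ≤
      (1 - μ) / 2 * Real.exp (4 * C * ((St.B₀ * (g + 1) : ℕ) : ℝ) ^ 2))
    (hp : ∀ X : ℕ, (2 : ℝ) ^ (-((St.cp * (X + 1) : ℕ) : ℤ)) ≤ (1 - μ) / 2 * Real.exp (-C * X))
    (hP : ∀ p, SolvesAttention P C St.d St.dv p (T p)
      fun y y' => |y' - y| ≤ μ * |y| + (2 : ℝ) ^ (-(p : ℤ))) :
    St.Oracle P (fun I => ⌊T (St.prec I) (St.N I)⌋₊)
      fun I => Nat.sqrt ((P.constBits + St.M I + 2) ^ 2 + 9 * ⌊T (St.prec I) (St.N I)⌋₊) := by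
  intro I uL uR
  have hdv := hv.dv_pos (St.N I)
  have hNG := hv.NG_lt I
  have hBs := hv.Bs_le I
  have hent := fun i c => Gadget.abs_entry_le (J := St.J I) (NG := St.NG I) (uL := uL) (uR := uR)
    (Int.natCast_nonneg (St.Bs I)) i c
  obtain ⟨t, s, hex, ht, hs⟩ := hP (St.prec I) (St.N I) (by omega) (St.qMat I uL uR) (St.vMat I)
    (fun i j => (hent i j).trans (by exact_mod_cast hBs)) (fun i l => by
      rw [vMat, Gadget.matV]; split_ifs <;> simp)
  have ht' : t ≤ ⌊T (St.prec I) (St.N I)⌋₊ := Nat.le_floor ht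
  have hMB : bitLen (St.Bs I : ℤ) ≤ St.M I := St.bitLen_const_le (p := (39, St.Bs)) (by simp [consts])
  have hin : (attentionInput (St.qMat I uL uR) (St.vMat I) (St.prec I)).BitsLE
      (P.constBits + St.M I + 2) := by
    refine attentionInput_bitsLE ?_ ?_ ?_ ?_ (fun i j => ?_) fun i j => ?_
    · have := St.bitLen_const_le (I := I) (p := (41, St.N)) (by simp [consts])
      dsimp only at this; omega
    · have := St.bitLen_const_le (I := I) (p := (42, fun I => St.d (St.N I))) (by simp [consts])
      dsimp only at this; omega
    · have := St.bitLen_const_le (I := I) (p := (43, fun I => St.dv (St.N I))) (by simp [consts])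
      dsimp only at this; omega
    · have := St.bitLen_const_le (I := I) (p := (40, St.prec)) (by simp [consts])
      dsimp only at this; omega
    · have h1 : bitLen (St.qMat I uL uR i j) ≤ bitLen ((St.Bs I : ℤ) + St.Bs I) := by
        refine bitLen_mono ?_
        have := abs_le.1 (hent i j)
        rw [qMat, Gadget.matQ]
        omega
      have := bitLen_add_le (St.Bs I) (St.Bs I)
      omega
    · have : bitLen (St.vMat I i j) ≤ 1 := by
        rw [vMat, Gadget.matV]; split_ifs <;> simp
      omega
  obtain ⟨b', hb', -, hsq⟩ := hex.bitsLE (by omega) hin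
  refine ⟨t, s, hex, ht', hb'.mono ?_, ?_⟩
  · rw [Nat.le_sqrt']
    omega
  · exact Gadget.decides (C := C) (μ := μ) (g := St.g I) (b := St.Bs I) (p := St.prec I) hC hμ0 hμ
      (hB _) (hp _) rfl hNG (hv.J_lt I) hdv fun i => hs i ⟨0, hdv⟩

theorem dim_of_computes (St : Setup k) {P : Prog} {f : ℕ → ℕ} {K : ℕ}
    (h : ∀ n : ℕ, f n ≤ K * (n + 1) ^ K ∧ ∃ (t : ℕ) (s : RAMState),
      P.Exec ⟨initRegs [(n : ℤ)], fun _ _ => 0⟩ t s ∧ t ≤ K * (n + 1) ^ K ∧ s.reg 0 = (f n : ℤ)) :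
    St.Dim P f fun I => K * (St.N I + 1) ^ K := fun I => (h (St.N I)).2

/-! ## Choice of the parameters -/

/-- From `n + 1 ≤ q * (g + 1)` it follows that `J + 1 ≤ A * (g + 1)` for a constant `A`. Since `log
N ≥ (g + 1) / 2`, it suffices that `log N ≤ d N / (2 * A)`, which holds from some `n₀` on; the
constant `c₀` is chosen above `n₀`. -/
theorem exists_setup {k q q' : ℕ} (hk : 1 ≤ k) (hq : 2 ≤ q) (hq' : 0 < q') (B₀ cp : ℕ) {d dv : ℕ → ℕ}
    {K : ℕ} (hd : ∀ n, d n ≤ K * (n + 1) ^ K) (hdv : ∀ n, dv n ≤ K * (n + 1) ^ K)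
    (hdv_pos : ∀ n, 1 ≤ dv n)
    (hlog : (fun n : ℕ => Real.log (n : ℝ)) =o[atTop] (fun n : ℕ => (d n : ℝ))) :
    ∃ St : Setup k, St.q = q ∧ St.q' = q' ∧ St.B₀ = B₀ ∧ St.cp = cp ∧ St.d = d ∧ St.dv = dv ∧
      St.Valid := by
  obtain ⟨pr⟩ := Sparsify.exists_params k (q * q') (by positivity)
  set s := ∑ i ∈ Finset.Ico 1 k, pr.θ i with hs
  set A := 2 + 2 * q * (1 + s) with hA
  have hA0 : (0 : ℝ) < A := by positivity
  have hev := hlog.bound (c := 1 / (2 * A)) (by positivity)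
  obtain ⟨n₀, hn₀⟩ := eventually_atTop.1 hev
  refine ⟨⟨q, q', pr, n₀ + 2 * B₀ + 3, B₀, cp, d, dv, K, hk, hq, hd, hdv⟩, rfl, rfl, rfl, rfl, rfl,
    rfl, fun I => ?_, fun I => ?_, fun I => ?_, hdv_pos⟩
  · simp only [J, N, g]
    rw [← hs]
    set g := I.1 / q with hg
    have hn : I.1 + 1 ≤ q * (g + 1) := by
      have := Nat.lt_mul_div_succ I.1 (show 0 < q by omega)
      exact this
    set M := (n₀ + 2 * B₀ + 3) * 2 ^ g with hM
    have hM0 : n₀ + 2 * B₀ + 3 ≤ M := Nat.le_mul_of_pos_right _ (by positivity)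
    have h1 := hn₀ M (by omega)
    have h2 : ((g : ℝ) + 1) / 2 ≤ Real.log M := by
      have h3 : (2 : ℝ) ^ (g + 1) ≤ M := by
        rw [hM, pow_succ]
        push_cast
        have : (0 : ℝ) < 2 ^ g := by positivity
        nlinarith [Nat.cast_nonneg (α := ℝ) n₀, Nat.cast_nonneg (α := ℝ) B₀]
      have h4 := Real.log_le_log (by positivity) h3
      rw [Real.log_pow] at h4
      have := Real.log_two_gt_d9
      push_cast at h4
      nlinarith [Nat.cast_nonneg (α := ℝ) g]
    have h5 : Real.log M ≤ 1 / (2 * A) * d M := by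
      have := (le_abs_self _).trans h1
      simpa using this
    have h6 : (A : ℝ) * (g + 1) ≤ d M := by
      rw [one_div_mul_eq_div, le_div_iff₀ (by positivity)] at h5
      nlinarith
    have h7 : A * (g + 1) ≤ d M := by exact_mod_cast h6
    refine le_trans ?_ h7
    have h8 : (2 * I.1 + 1) * (1 + s) ≤ 2 * (q * (g + 1)) * (1 + s) :=
      Nat.mul_le_mul_right _ (by omega)
    rw [hA]
    nlinarith
  · simp only [NG, N, g]
    have : 1 ≤ 2 ^ (I.1 / q) := Nat.one_le_two_pow
    nlinarith [Nat.zero_le (n₀ * 2 ^ (I.1 / q)), Nat.zero_le (B₀ * 2 ^ (I.1 / q))]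
  · simp only [Bs, N, g]
    have : I.1 / q + 1 ≤ 2 ^ (I.1 / q) := Nat.lt_two_pow_self
    calc 2 * (B₀ * (I.1 / q + 1)) ≤ 2 * (B₀ * 2 ^ (I.1 / q)) := by gcongr
      _ = 2 * B₀ * 2 ^ (I.1 / q) := by ring
      _ ≤ _ := Nat.mul_le_mul_right _ (by omega)

end Setup

/-! ## The running time -/

namespace Setup

variable {k : ℕ} {St : Setup k} {ε : ℝ}

/-- The exponent on the left is `n + L - g * ε / 2`. Here `g ≥ n / q - 1`, while `q' ≥ 4 / ε` gives
`L ≤ n * ε / (4 * q) + κ`. So half of the gain from the attention algorithm is spent on the codes,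
and the other half remains. -/
theorem rounds_mul_le (hε : 0 < ε) (hε1 : ε ≤ 1) (hq' : 4 ≤ ε * St.q') (I : Inst k) :
    (St.R I : ℝ) * (St.NG I * (2 : ℝ) ^ ((St.g I : ℝ) * (1 - ε / 2))) ≤
      2 ^ (St.pr.κ + 1) * (2 : ℝ) ^ ((1 - ε / (4 * St.q)) * (I.1 : ℝ)) := by
  have hq : (2 : ℝ) ≤ St.q := by exact_mod_cast St.two_le_q
  have hq0 : (0 : ℝ) < St.q' := by
    by_contra h
    nlinarith
  have hg2 : 2 * St.g I ≤ I.1 := by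
    have := Nat.div_mul_le_self I.1 St.q
    have h3 := Nat.mul_le_mul_left (I.1 / St.q) St.two_le_q
    rw [g]; omega
  have hL : (St.L I : ℝ) ≤ I.1 / St.q / St.q' + St.pr.κ := by
    rw [L]
    push_cast
    have := Nat.cast_div_le (m := I.1) (n := St.q * St.q') (α := ℝ)
    rw [div_div]
    push_cast at this
    linarith
  have hg : (I.1 : ℝ) / St.q ≤ St.g I + 1 := by
    rw [div_le_iff₀ (by linarith), g]
    have := (Nat.lt_mul_div_succ I.1 (show 0 < St.q by have := St.two_le_q; omega)).le
    have h2 : (I.1 : ℝ) ≤ ((St.q * (I.1 / St.q + 1) : ℕ) : ℝ) := by exact_mod_cast this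
    push_cast at h2
    linarith
  set u : ℝ := I.1 / St.q with hu
  have hu0 : 0 ≤ u := by positivity
  have h1 : u / St.q' ≤ u * ε / 4 := by
    rw [div_le_iff₀ hq0]
    nlinarith
  have h2 : ε / (4 * St.q) * (I.1 : ℝ) = u * ε / 4 := by rw [hu]; field_simp
  have hR : (St.R I : ℝ) * St.NG I = (2 : ℝ) ^ ((St.L I : ℝ) + (I.1 - St.g I)) := by
    rw [R, NG, ← pow_add, ← Nat.cast_mul, ← pow_add, show St.L I + (I.1 - 2 * St.g I) + St.g I =
      St.L I + (I.1 - St.g I) by omega]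
    have h3 : (I.1 : ℝ) - St.g I = ((I.1 - St.g I : ℕ) : ℝ) := by
      rw [Nat.cast_sub (by omega)]
    rw [h3, ← Nat.cast_add, Real.rpow_natCast]
    push_cast
    rfl
  rw [← mul_assoc, hR, ← Real.rpow_natCast, ← Real.rpow_add (by norm_num), ← Real.rpow_add (by norm_num)]
  refine Real.rpow_le_rpow_of_exponent_le (by norm_num) ?_
  push_cast
  nlinarith

/-- As `q ≥ 2 * K`, a polynomial of degree `K` in `2 ^ g` is only of order `2 ^ (n / 2)`. -/
theorem dims_le {K : ℕ} (hε1 : ε ≤ 1) (hK : 2 * K ≤ St.q) (I : Inst k) :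
    ((K * (St.N I + 1) ^ K : ℕ) : ℝ) ≤
      (K * (St.c₀ + 1) ^ K : ℕ) * (2 : ℝ) ^ ((1 - ε / (4 * St.q)) * (I.1 : ℝ)) := by
  have hq : (2 : ℝ) ≤ St.q := by exact_mod_cast St.two_le_q
  have h1 : K * (St.N I + 1) ^ K ≤ K * (St.c₀ + 1) ^ K * 2 ^ (St.g I * K) := by
    rw [mul_assoc, pow_mul, ← mul_pow, N]
    have : 1 ≤ 2 ^ St.g I := Nat.one_le_two_pow
    gcongr
    nlinarith
  have h2 : 2 * (St.g I * K) ≤ I.1 := by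
    have := Nat.div_mul_le_self I.1 St.q
    rw [g]
    nlinarith [Nat.mul_le_mul_left (I.1 / St.q) hK]
  have h3 : ((2 * (St.g I * K) : ℕ) : ℝ) ≤ I.1 := by exact_mod_cast h2
  have h4 : ε / (4 * St.q) ≤ 1 / 2 := by
    rw [div_le_iff₀ (by positivity)]
    nlinarith
  calc ((K * (St.N I + 1) ^ K : ℕ) : ℝ) ≤ (K * (St.c₀ + 1) ^ K * 2 ^ (St.g I * K) : ℕ) := by
        exact_mod_cast h1
    _ = (K * (St.c₀ + 1) ^ K : ℕ) * (2 : ℝ) ^ ((St.g I * K : ℕ) : ℝ) := by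
        rw [Real.rpow_natCast]; push_cast; ring
    _ ≤ _ := by
        refine mul_le_mul_of_nonneg_left (Real.rpow_le_rpow_of_exponent_le (by norm_num) ?_)
          (by positivity)
        push_cast at h3 ⊢
        nlinarith [Nat.cast_nonneg (α := ℝ) I.1]

theorem polyBdd_factor (St : Setup k) (K : ℕ) :
    PolyBdd instSize fun I : Inst k => K * (St.prec I + 1) ^ K * (St.c₀ + 1) ^ 2 :=
  (((St.polyBdd_prec.add (.const 1)).pow K).const_mul K).mul (.const _)

/-- Here `Y ^ 2` is the time of a call up to polynomial factors, so the outputs have about `Y` bits.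
Scanning them costs `NG * Y`, while the table and the call cost `Y ^ 2 ≤ NG * Y`. The total per
iteration is therefore of order `NG * Y`. -/
theorem cost_le {NG Y R X f b : ℝ} {τ bb : ℕ} (hf : 0 ≤ f) (hf2 : f ≤ f ^ 2) (hb : 0 ≤ b) (hY : 1 ≤ Y)
    (hYN : Y ≤ NG) (hR : 1 ≤ R) (hX : R * (NG * Y) ≤ X) (hτ : (τ : ℝ) ≤ f * Y ^ 2)
    (hbb : (bb : ℝ) ^ 2 ≤ b ^ 2 + 9 * τ) :
    (R + 1) * ((NG + 1) * (bb + 1) + (bb + 1) ^ 2 + (τ + 1)) ≤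
      2 * (2 * (b + 3 * f + 1) + (b + 3 * f + 1) ^ 2 + (f + 1)) * X := by
  have h1 : (bb : ℝ) ≤ (b + 3 * f) * Y := by
    -- The right side squared is at least `b² + 9 * f² * Y²`, and `f ≤ f²` for natural numbers.
    refine abs_le_of_sq_le_sq' ?_ (by positivity) |>.2
    have : 1 ≤ Y ^ 2 := one_le_pow₀ hY
    nlinarith [mul_nonneg hb hf, sq_nonneg b, mul_nonneg (sq_nonneg b) (sub_nonneg.2 this),
      mul_nonneg (mul_nonneg hb hf) (sq_nonneg Y), mul_nonneg (sub_nonneg.2 hf2) (sq_nonneg Y)]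
  have h2 : (bb : ℝ) + 1 ≤ (b + 3 * f + 1) * Y := by linarith
  have hNG : 1 ≤ NG := hY.trans hYN
  set e := b + 3 * f + 1 with he
  have he0 : 0 ≤ e := by positivity
  have hYY : Y ^ 2 ≤ NG * Y := by nlinarith
  have h3 : (NG + 1) * ((bb : ℝ) + 1) ≤ 2 * e * (NG * Y) := by
    calc (NG + 1) * ((bb : ℝ) + 1) ≤ (2 * NG) * (e * Y) := by
          refine mul_le_mul (by linarith) h2 (by positivity) (by linarith)
      _ = _ := by ring
  have h4 : ((bb : ℝ) + 1) ^ 2 ≤ e ^ 2 * (NG * Y) := by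
    calc ((bb : ℝ) + 1) ^ 2 ≤ (e * Y) ^ 2 := by gcongr
      _ = e ^ 2 * Y ^ 2 := by ring
      _ ≤ _ := by gcongr
  have h5 : (τ : ℝ) + 1 ≤ (f + 1) * (NG * Y) := by
    have : 1 ≤ Y ^ 2 := one_le_pow₀ hY
    calc (τ : ℝ) + 1 ≤ (f + 1) * Y ^ 2 := by linarith
      _ ≤ _ := by gcongr
  have hNGY : 0 ≤ NG * Y := by positivity
  calc (R + 1) * ((NG + 1) * (bb + 1) + (bb + 1) ^ 2 + (τ + 1))
      ≤ (2 * R) * (2 * e * (NG * Y) + e ^ 2 * (NG * Y) + (f + 1) * (NG * Y)) := by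
        exact mul_le_mul (by linarith) (by linarith) (by positivity) (by linarith)
    _ = 2 * (2 * e + e ^ 2 + (f + 1)) * (R * (NG * Y)) := by ring
    _ ≤ _ := by gcongr

theorem weight_le (St : Setup k) (P : Prog) (K Kd : ℕ) (hε : 0 < ε) (hε1 : ε ≤ 1) (hq : 2 * Kd ≤ St.q)
    (hq' : 4 ≤ ε * St.q') {τ : Inst k → ℕ}
    (hτ : ∀ I, τ I = ⌊(K : ℝ) * ((St.prec I : ℝ) + 1) ^ K * (St.N I : ℝ) ^ (2 - ε)⌋₊) :
    ∃ F : Inst k → ℕ, PolyBdd instSize F ∧ ∀ I,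
      ((Kd * (St.N I + 1) ^ Kd + 1 + (St.R I + 1) * ((St.NG I + 1) *
        (Nat.sqrt ((P.constBits + St.M I + 2) ^ 2 + 9 * τ I) + 1) +
        (Nat.sqrt ((P.constBits + St.M I + 2) ^ 2 + 9 * τ I) + 1) ^ 2 + (τ I + 1)) : ℕ) : ℝ) ≤
      F I * (2 : ℝ) ^ ((1 - ε / (4 * St.q)) * (I.1 : ℝ)) := by
  set f : Inst k → ℕ := fun I => K * (St.prec I + 1) ^ K * (St.c₀ + 1) ^ 2 with hf
  set b : Inst k → ℕ := fun I => P.constBits + St.M I + 2 with hb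
  have hfp : PolyBdd instSize f := St.polyBdd_factor K
  have hbp : PolyBdd instSize b := ((PolyBdd.const _).add St.polyBdd_M).add (.const 2)
  have hep : PolyBdd instSize fun I => b I + 3 * f I + 1 := (hbp.add (hfp.const_mul 3)).add (.const 1)
  refine ⟨fun I => Kd * (St.c₀ + 1) ^ Kd + 1 + 2 ^ (St.pr.κ + 1) *
    (2 * (2 * (b I + 3 * f I + 1) + (b I + 3 * f I + 1) ^ 2 + (f I + 1))),
    (PolyBdd.const _).add (((((hep.const_mul 2).add (hep.pow 2)).add
      (hfp.add (.const 1))).const_mul 2).const_mul _), fun I => ?_⟩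
  have hq2 : (2 : ℝ) ≤ St.q := by exact_mod_cast St.two_le_q
  have hX1 : 1 ≤ (2 : ℝ) ^ ((1 - ε / (4 * St.q)) * (I.1 : ℝ)) := by
    refine Real.one_le_rpow (by norm_num) (mul_nonneg ?_ (Nat.cast_nonneg _))
    rw [sub_nonneg, div_le_one (by positivity)]
    linarith
  have h1 := rounds_mul_le hε hε1 hq' I
  have h2 := dims_le hε1 hq I
  set X := (2 : ℝ) ^ ((1 - ε / (4 * St.q)) * (I.1 : ℝ)) with hX
  set Y := (2 : ℝ) ^ ((St.g I : ℝ) * (1 - ε / 2)) with hY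
  have hYsq : Y ^ 2 = (2 : ℝ) ^ ((St.g I : ℝ) * (2 - ε)) := by
    rw [hY, ← Real.rpow_natCast, ← Real.rpow_mul (by norm_num)]
    congr 1; push_cast; ring
  have hτ' : (τ I : ℝ) ≤ f I * Y ^ 2 := by
    rw [hτ]
    refine (Nat.floor_le (by positivity)).trans ?_
    have h3 : (St.N I : ℝ) ^ (2 - ε) ≤ ((St.c₀ + 1 : ℕ) : ℝ) ^ 2 * Y ^ 2 := by
      calc (St.N I : ℝ) ^ (2 - ε) = (St.c₀ : ℝ) ^ (2 - ε) * ((2 : ℝ) ^ (St.g I : ℝ)) ^ (2 - ε) := by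
            rw [N, ← Real.mul_rpow (by positivity) (by positivity), Real.rpow_natCast]
            push_cast; rfl
        _ = (St.c₀ : ℝ) ^ (2 - ε) * Y ^ 2 := by rw [← Real.rpow_mul (by norm_num), hYsq]
        _ ≤ ((St.c₀ + 1 : ℕ) : ℝ) ^ (2 - ε) * Y ^ 2 := by
            gcongr
            · linarith
            · linarith
        _ ≤ ((St.c₀ + 1 : ℕ) : ℝ) ^ (2 : ℝ) * Y ^ 2 := by
            gcongr
            · push_cast; linarith [Nat.cast_nonneg (α := ℝ) St.c₀]
            · linarith
        _ = _ := by norm_cast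
    calc _ ≤ (K : ℝ) * ((St.prec I : ℝ) + 1) ^ K * (((St.c₀ + 1 : ℕ) : ℝ) ^ 2 * Y ^ 2) := by gcongr
      _ = _ := by rw [hf]; push_cast; ring
  have hcost := cost_le (NG := St.NG I) (Y := Y) (R := St.R I) (f := f I) (b := b I) (τ := τ I)
    (bb := Nat.sqrt (b I ^ 2 + 9 * τ I)) (Nat.cast_nonneg _)
    (by exact_mod_cast Nat.le_self_pow (by norm_num) _) (Nat.cast_nonneg _)
    (Real.one_le_rpow (by norm_num) (mul_nonneg (Nat.cast_nonneg _) (by linarith))) ?_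
    (by exact_mod_cast (by rw [R]; positivity : 0 < St.R I)) h1 hτ'
    (by exact_mod_cast Nat.sqrt_le' _)
  · push_cast at hcost h2 ⊢
    nlinarith
  · rw [hY, NG]
    push_cast
    rw [← Real.rpow_natCast]
    refine Real.rpow_le_rpow_of_exponent_le (by norm_num) ?_
    nlinarith [Nat.cast_nonneg (α := ℝ) (St.g I)]

end Setup

/-! ## The lower bound -/

/-- The sparsification presupposes `k ≥ 1`. For `k = 0` all clauses are empty, so a formula is
satisfiable exactly if it has no clause. -/
theorem solvesKSAT_zero (δ : ℝ) (hδ : δ ≤ 1) : SolvesKSAT (.ifPos 1 (.const 0 0) (.const 0 1)) 0 δ := by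
  refine ⟨3, fun n φ => ?_⟩
  have hsat : φ.Satisfiable ↔ ¬ 0 < (φ.clauses.length : ℤ) := by
    constructor
    · rintro ⟨a, ha⟩ h
      obtain ⟨c, hc⟩ := List.exists_mem_of_length_pos (by exact_mod_cast h : 0 < φ.clauses.length)
      obtain ⟨l, hl, -⟩ := ha c hc
      have := φ.width_le c hc
      rw [List.length_eq_zero_iff.1 (by omega : c.length = 0)] at hl
      simp at hl
    · intro h
      have : φ.clauses = [] := List.length_eq_zero_iff.1 (by omega)
      exact ⟨fun _ => true, by simp [this]⟩
  have hX : 1 ≤ (2 : ℝ) ^ ((1 - δ) * (n : ℝ)) :=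
    Real.one_le_rpow (by norm_num) (mul_nonneg (by linarith) (Nat.cast_nonneg _))
  have htime : ∀ t : ℕ, t ≤ 1 + bitLen (φ.clauses.length : ℤ) + 2 → (t : ℝ) ≤
      (3 : ℕ) * ((n : ℝ) + φ.clauses.length + 1) ^ 3 * (2 : ℝ) ^ ((1 - δ) * (n : ℝ)) := by
    intro t ht
    have h1 := bitLen_natCast_le φ.clauses.length
    have h2 : (t : ℝ) ≤ 3 + φ.clauses.length := by exact_mod_cast (by omega)
    have h3 : (1 : ℝ) ≤ (n : ℝ) + φ.clauses.length + 1 := by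
      linarith [Nat.cast_nonneg (α := ℝ) n, Nat.cast_nonneg (α := ℝ) φ.clauses.length]
    calc (t : ℝ) ≤ 3 * ((n : ℝ) + φ.clauses.length + 1) := by
          linarith [Nat.cast_nonneg (α := ℝ) n, Nat.cast_nonneg (α := ℝ) φ.clauses.length]
      _ ≤ 3 * ((n : ℝ) + φ.clauses.length + 1) ^ 3 := by
          gcongr; exact le_self_pow₀ h3 (by norm_num)
      _ ≤ _ := by push_cast; exact le_mul_of_one_le_right (by positivity) hX
  by_cases h : 0 < (φ.clauses.length : ℤ)
  · refine ⟨_, _, .if_true h (.const _ _ _), htime _ ?_, fun h' => absurd h (hsat.1 h'),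
      fun _ => by simp⟩
    simp [KCNF.input, initRegs]
  · refine ⟨_, _, .if_false h (.const _ _ _), htime _ ?_, fun _ => by simp,
      fun h' => absurd (hsat.2 h) h'⟩
    simp [KCNF.input, initRegs]

/-- Self-attention cannot be approximated in subquadratic time up to a relative error and an absolute
error that is part of the input. -/
theorem not_solvesAttention (hSETH : SETH) {C : ℝ} (hC : 0 < C) {d dv : ℕ → ℕ} (hd : PolyTimeFun d)
    (hdv : PolyTimeFun dv) (hdv_pos : ∀ n, 1 ≤ dv n)
    (hlog : (fun n : ℕ => Real.log (n : ℝ)) =o[atTop] (fun n : ℕ => (d n : ℝ)))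
    {ε : ℝ} (hε : 0 < ε) {μ : ℝ} (hμ0 : 0 ≤ μ) (hμ : μ < 1) {P : Prog} {K : ℕ}
    (hP : ∀ p : ℕ, SolvesAttention P C d dv p
      (fun n => (K : ℝ) * ((p : ℝ) + 1) ^ K * (n : ℝ) ^ (2 - ε))
      fun y y' => |y' - y| ≤ μ * |y| + (2 : ℝ) ^ (-(p : ℤ))) : False := by
  -- A smaller `ε` only weakens the assumed time bound, because `n ≥ 1`.
  wlog hε1 : ε ≤ 1 generalizing ε
  · refine this one_pos (fun p n hn Q V hQ hV => ?_) le_rfl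
    obtain ⟨t, s, hex, ht, hs⟩ := hP p n hn Q V hQ hV
    refine ⟨t, s, hex, ht.trans ?_, hs⟩
    have : (1 : ℝ) ≤ n := by exact_mod_cast hn
    dsimp only
    gcongr
    exact (not_le.1 hε1).le
  obtain ⟨Pd, Kd, hd⟩ := hd
  obtain ⟨Pv, Kv, hdv⟩ := hdv
  set L := max Kd Kv with hL
  have hmono : ∀ n {c : ℕ}, c ≤ L → c * (n + 1) ^ c ≤ L * (n + 1) ^ L := fun n c hc =>
    PolyBdd.const_mul_pow_mono n hc
  obtain ⟨q', hq'⟩ := exists_nat_ge (4 / ε)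
  rw [div_le_iff₀ hε] at hq'
  have hq0 : 0 < q' := by
    rcases Nat.eq_zero_or_pos q' with rfl | h
    · norm_num at hq'
    · exact h
  -- The bound `2 * L ≤ q` makes the computation of the dimensions cheap, with `L` the degree of
  -- their polynomial bounds.
  obtain ⟨q, hq2, hqL⟩ : ∃ q : ℕ, 2 ≤ q ∧ 2 * L ≤ q := ⟨2 * L + 2, by omega, by omega⟩
  obtain ⟨B₀, -, hB₀⟩ := Gadget.exists_scale hC hμ
  obtain ⟨cp, hcp⟩ := Gadget.exists_precision hC hμ
  have hq2' : (2 : ℝ) ≤ q := by exact_mod_cast hq2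
  have hδ : 0 < ε / (4 * q) := by positivity
  -- The saving `ε / (4 * q)` is fixed before `k` is obtained. Everything that depends on `k`, in
  -- particular the sparsification constants, is absorbed by `c₀` and `κ`.
  obtain ⟨k, hk⟩ := hSETH _ hδ
  refine hk ?_
  rcases Nat.eq_zero_or_pos k with rfl | hk0
  · refine ⟨_, solvesKSAT_zero _ ?_⟩
    rw [div_le_one (by positivity)]
    linarith
  obtain ⟨St, rfl, rfl, rfl, rfl, rfl, rfl, hv⟩ := Setup.exists_setup (K := L) hk0 hq2 hq0 B₀ cp
    (fun n => (hd n).1.trans (hmono n (le_max_left _ _)))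
    (fun n => (hdv n).1.trans (hmono n (le_max_right _ _))) hdv_pos hlog
  have hor := St.oracle_of_solves hv hC hμ0 hμ hB₀ hcp hP
  have hdim : ∀ {Q : Prog} {f : ℕ → ℕ} {c : ℕ}, c ≤ L → St.Dim Q f (fun I => c * (St.N I + 1) ^ c) →
      St.Dim Q f fun I => L * (St.N I + 1) ^ L := fun hc h I => by
    obtain ⟨t, s, h1, h2, h3⟩ := h I
    exact ⟨t, s, h1, h2.trans (hmono _ hc), h3⟩
  obtain ⟨c, hc⟩ := St.phtSat hv hor (hdim (le_max_left _ _) (St.dim_of_computes hd))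
    (hdim (le_max_right _ _) (St.dim_of_computes hdv))
  obtain ⟨F, hF, hw⟩ := St.weight_le P K L hε hε1 hqL (by linarith) (fun _ => rfl)
  obtain ⟨D, hD⟩ := ((((PolyBdd.self (z := instSize (k := k))).add (.const 1)).pow c).const_mul c).mul hF
  refine ⟨Setup.satProg St P Pd Pv, D, fun n φ => ?_⟩
  obtain ⟨t, s, hex, ht, ρ, hρ, h1, h2⟩ := hc ⟨n, φ⟩ _ _ ⟨rfl, rfl⟩ φ.input (fun _ _ => rfl) rfl
  refine ⟨t, s, hex, ?_, fun h => (hρ 0 (by norm_num)).trans (h1 h),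
    fun h => (hρ 0 (by norm_num)).trans (h2 h)⟩
  have h3 := hw ⟨n, φ⟩
  have h4 := hD ⟨n, φ⟩
  refine (Nat.cast_le.2 ht).trans ?_
  rw [Nat.cast_mul]
  refine (mul_le_mul_of_nonneg_left h3 (Nat.cast_nonneg _)).trans ?_
  rw [← mul_assoc, ← Nat.cast_mul]
  refine mul_le_mul_of_nonneg_right ((Nat.cast_le.2 h4).trans (le_of_eq ?_)) (by positivity)
  simp [instSize]

/-! ### Reduction of the three claims to one lower bound -/

theorem SolvesAttention.mono {P : Prog} {C : ℝ} {d dv : ℕ → ℕ} {p : ℕ} {T T' : ℕ → ℝ}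
    {ok ok' : ℝ → ℝ → Prop} (h : SolvesAttention P C d dv p T ok) (hT : ∀ n, T n ≤ T' n)
    (hok : ∀ y y', ok y y' → ok' y y') : SolvesAttention P C d dv p T' ok' := fun n hn Q V hQ hV => by
  obtain ⟨t, s, hex, ht, hs⟩ := h n hn Q V hQ hV
  exact ⟨t, s, hex, ht.trans (hT n), fun i l => hok _ _ (hs i l)⟩

theorem setReg_attentionInput {n d dv : ℕ} (Q : Matrix (Fin n) (Fin d) ℤ)
    (V : Matrix (Fin n) (Fin dv) ℤ) (p : ℕ) :
    (attentionInput Q V p).setReg 3 0 = attentionInput Q V 0 := by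
  simp only [RAMState.setReg, attentionInput]
  congr 1
  funext x
  rcases x with _ | _ | _ | _ | x <;> simp [initRegs]

/-- A program that ignores the precision parameter. -/
theorem SolvesAttention.ignorePrecision {P : Prog} {C K ε : ℝ} {d dv : ℕ → ℕ} {ok : ℝ → ℝ → Prop}
    (h : SolvesAttention P C d dv 0 (fun n => K * (n : ℝ) ^ (2 - ε)) ok) (hε : ε ≤ 2) :
    ∃ K' : ℕ, ∀ p : ℕ, SolvesAttention (.seq (.const 3 0) P) C d dv p
      (fun n => (K' : ℝ) * ((p : ℝ) + 1) ^ K' * (n : ℝ) ^ (2 - ε)) ok := by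
  obtain ⟨K', hK'⟩ := exists_nat_ge (K + 1)
  refine ⟨K', fun p n hn Q V hQ hV => ?_⟩
  obtain ⟨t, s, hex, ht, hs⟩ := h n hn Q V hQ hV
  refine ⟨_, s, .seq (.const _ _ _) (by rwa [setReg_attentionInput]), ?_, hs⟩
  have hn1 : (1 : ℝ) ≤ n := by exact_mod_cast hn
  have h1 : (1 : ℝ) ≤ (n : ℝ) ^ (2 - ε) := Real.one_le_rpow hn1 (by linarith)
  have h2 : (1 : ℝ) ≤ ((p : ℝ) + 1) ^ K' := one_le_pow₀ (by linarith [Nat.cast_nonneg (α := ℝ) p])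
  dsimp only at ht ⊢
  simp only [bitLen_zero, add_zero, Nat.cast_add, Nat.cast_one]
  calc (1 : ℝ) + t ≤ (K + 1) * (n : ℝ) ^ (2 - ε) := by nlinarith
    _ ≤ K' * (n : ℝ) ^ (2 - ε) := by gcongr
    _ ≤ K' * ((p : ℝ) + 1) ^ K' * (n : ℝ) ^ (2 - ε) := by
        gcongr
        exact le_mul_of_one_le_right (Nat.cast_nonneg _) h2

/-- Quadratic hardness of `ℓ₂`-self-attention under SETH, for every fixed RBF constant `C > 0`:
(1) exact computation, both as literal equality of the output matrix and as computation to any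
precision `2 ^ (-p)` that is requested as part of the input, in time `O(n ^ (2 - ε) · poly(p))`;
(2) entrywise multiplicative approximation with error `0 ≤ μ < 1`. -/
theorem mainTheorem4 (hSETH : SETH) (C : ℝ) (hC : 0 < C)
    (d dv : ℕ → ℕ) (hd : PolyTimeFun d) (hdv : PolyTimeFun dv) (hdv_pos : ∀ n, 1 ≤ dv n)
    (hlog : (fun n : ℕ => Real.log (n : ℝ)) =o[atTop] (fun n : ℕ => (d n : ℝ)))
    (ε : ℝ) (hε : 0 < ε) :
    ((¬ ∃ (P : Prog) (K : ℝ), SolvesAttention P C d dv 0 (fun n => K * (n : ℝ) ^ (2 - ε))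
        (fun y y' => y' = y)) ∧
      (¬ ∃ (P : Prog) (K : ℕ), ∀ p : ℕ,
        SolvesAttention P C d dv p
          (fun n => (K : ℝ) * ((p : ℝ) + 1) ^ K * (n : ℝ) ^ (2 - ε))
          (fun y y' => |y' - y| ≤ (2 : ℝ) ^ (-(p : ℤ))))) ∧
    (∀ μ : ℝ, 0 ≤ μ → μ < 1 →
      ¬ ∃ (P : Prog) (K : ℝ), SolvesAttention P C d dv 0 (fun n => K * (n : ℝ) ^ (2 - ε))
        (fun y y' => |y' - y| ≤ μ * |y|)) := by
  have hmul : ∀ μ : ℝ, 0 ≤ μ → μ < 1 →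
      ¬ ∃ (P : Prog) (K : ℝ), SolvesAttention P C d dv 0 (fun n => K * (n : ℝ) ^ (2 - ε))
        (fun y y' => |y' - y| ≤ μ * |y|) := by
    rintro μ hμ0 hμ ⟨P, K, h⟩
    -- The exponent `2 - min ε 1` is at least `1`, so the time bound absorbs the extra instruction
    -- that clears the precision register. The absolute value makes the constant nonnegative, as the
    -- comparison of the bounds requires.
    have h' : SolvesAttention P C d dv 0 (fun n => |K| * (n : ℝ) ^ (2 - min ε 1))
        fun y y' => |y' - y| ≤ μ * |y| := by
      intro n hn Q V hQ hV
      obtain ⟨t, s, hex, ht, hs⟩ := h n hn Q V hQ hV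
      have hn1 : (1 : ℝ) ≤ n := by exact_mod_cast hn
      refine ⟨t, s, hex, ht.trans ?_, hs⟩
      dsimp only
      gcongr
      · exact le_abs_self K
      · exact min_le_left _ _
    obtain ⟨K', hK'⟩ := h'.ignorePrecision (by linarith [min_le_right ε 1])
    exact not_solvesAttention hSETH hC hd hdv hdv_pos hlog (lt_min hε one_pos) hμ0 hμ fun p =>
      (hK' p).mono (fun _ => le_rfl) fun y y' hy => hy.trans (by linarith [zpow_pos (two_pos (α := ℝ)) (-(p : ℤ))])
  refine ⟨⟨?_, ?_⟩, hmul⟩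
  · rintro ⟨P, K, h⟩
    exact hmul 0 le_rfl one_pos ⟨P, K, h.mono (fun _ => le_rfl) fun y y' hy => by simp [hy]⟩
  · rintro ⟨P, K, h⟩
    exact not_solvesAttention hSETH hC hd hdv hdv_pos hlog hε le_rfl one_pos fun p =>
      (h p).mono (fun _ => le_rfl) fun y y' hy => by simpa using hy
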